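/- Let $m\ge 3$. **The algebra.** Let $Q$ be the quiver with vertices $[1],\dots,[m-1]$, edges $L_i\colon[i]\to[i-1]$ and $R_i\colon[i-1]\to[i]$ for $2\le i\le m-1$, and loops $U_1$ at $[1]$ and $U_m$ at $[m-1]$. Let $C=\mathcal C(m,1)$ be its path algebra over $\mathbb Z$ (paths are written from left to right) modulo the relations $L_iL_{i-1}=0$, $R_{i-1}R_i=0$ ($3\le i\le m-1$), $L_2U_1=U_1R_2=R_{m-1}U_m=U_mL_{m-1}=0$. Let $I_x$ be the constant path at $[x]$, $I=\bigoplus_x\mathbb Z I_x$, $1=\sum_x I_x$, let $C_+$ be the span of the non-constant paths, and put $U_i=R_iL_i+L_iR_i$ for $1<i<m$. Grade $C[t]$ by $\mathrm{gr}(C)=0$, $\mathrm{gr}(t)=2m-4$. **Tiling graphs.** A centered tiling graph $\Gamma$ is a connected planar graph in a disk, with at least one internal vertex, that meets the boundary circle exactly in its leaves, one of which is the root. Its edges are oriented and labeled by $1,\dots,m-1$ so that around each internal vertex there are $m-1$ consecutive incoming edges, labeled $1,\dots,m-1$ counterclockwise, and $m-1$ consecutive outgoing edges, labeled $1,\dots,m-1$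 clockwise. The sector between the outgoing edges $i-1,i$ is labeled $L_i$, the one between the incoming edges $i-1,i$ is labeled $R_i$, the one between the two edges labeled $1$ is labeled $U_1$, and the one between the two edges labeled $m-1$ is labeled $U_m$. It is required that every oriented cycle through distinct vertices has length one, and that every region of the complement that does not meet the boundary circle is a monogon containing $U_1$ (type $1$), a monogon containing $U_m$ (type $m$), or a bigon containing $L_i$ and $R_i$ (type $i$, $1<i<m$). Graphs are considered up to isotopy. Let $w(\Gamma)\in\mathbb N^m$ count the regions of each type that do not meet the boundary circle, let $d(\Gamma)$ be the number of internal vertices, and let $\iota(\Gamma)=I_k$ where $k$ is the label of the root edge. The leaves cut the boundary circle into intervals, ordered counterclockwise from the root; let $\vec a(\Gamma)=(a_1,\dots,a_n)$, where $a_j$ is the product of the labels of the sectors in the region at the $j$-th interval, in the order in which they are met counterclockwise. **Operations.** For $w\in\mathbb N^m$ and non-constant paths $a_1,\dots,a_n$ ($n\ge1$) put $c^w_n(a_1,\dots,a_n)=\sum_\Gamma \iota(\Gamma)\,t^{d(\Gamma)}$, the sum over all $\Gamma$ with $w(\Gamma)=w$ and $\vec a(\Gamma)=(a_1,\dots,a_n)$,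 and, for $(n,w)\ne(2,0)$, $$\mu^w_n(a_1,\dots,a_n)=c^w_n(a_1,\dots,a_n)+\sum_{a_1=a\cdot a_1'}a\cdot c^w_n(a_1',a_2,\dots,a_n)+\sum_{a_n=a_n'\cdot a}c^w_n(a_1,\dots,a_{n-1},a_n')\cdot a,$$ where $a,a_1',a_n'$ are non-constant paths. Put $\mu^w_n=0$ if $n\ge1$, $(n,w)\neq(2,0)$ and some input is a constant path; let $\mu^0_2$ be the product of $C$; let $\mu^{e_i}_0=U_i$ for the standard basis vectors $e_i$ ($1\le i\le m$), and $\mu^w_0=0$ for all other $w$. Extend these operations $\mathbb Z[t]$-multilinearly to $C[t]$. **Theorem.** The operations $\mu^w_n$, $w\in\mathbb N^m$, $n\ge0$, make $C[t]$ a unital weighted $A_\infty$ algebra over $\mathbb Z$. That is: $C[t]$ is a graded $I$-bimodule; each $\mu^w_n$ is $\mathbb Z[t]$-multilinear, is defined on the $n$-fold tensor product over $I$, is a map of $I$-bimodules, and has degree $n-2+2\sum_i w_i$; $\mu^0_0=0$; for all $n\ge0$ and $w\in\mathbb N^m$, $$\sum_{\substack{n=r+s+t\\ w=u+v}}(-1)^{r+st}\,\mu^u_{r+1+t}\circ(\mathrm{Id}^{\otimes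 r}\otimes\mu^v_s\otimes\mathrm{Id}^{\otimes t})=0;$$ and $\mu^0_2(a,1)=\mu^0_2(1,a)=a$ for all $a$, while $\mu^w_n(a_1,\dots,a_n)=0$ whenever $(n,w)\ne(2,0)$ and some $a_i=1$. -/

import Mathlib

open scoped Polynomial

/-! ## Weighted A-infinity algebras

Weight vectors are elements of `Fin N → ℕ`; inputs of an operation are handled as sequences
`a : ℕ → A`, of which an operation of arity `n` sees the first `n` terms. -/

namespace WeightedAInfty

/-- The sequence `a 0, …, a (r-1), y, a (r+s), a (r+s+1), …`: the `s` consecutive terms of `a`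
starting at position `r` are replaced by the single element `y`. -/
def splice {A : Type*} (a : ℕ → A) (r s : ℕ) (y : A) : ℕ → A := fun j =>
  if j < r then a j else if j = r then y else a (j - 1 + s)

/-- The operations `μ w n : Aⁿ → A` make the graded bimodule `A` (with homogeneous parts `𝒜 g`)
into a weighted A-infinity algebra, with signs. The tensor products are over the ground ring
generated by the commuting rings `R` (acting centrally) and `k` (acting on both sides). The
algebra is concentrated in even degrees in the application, so that no further (Koszul) signs
occur in the structure relation. -/
structure IsWeightedAInfty (R k : Type*) [CommRing R] [Ring k] {A : Type*} [AddCommGroup A]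
    [Module R A] [Module k A] [Module kᵐᵒᵖ A] [SMulCommClass k kᵐᵒᵖ A] {N : ℕ}
    (𝒜 : ℤ → AddSubgroup A) (μ : (Fin N → ℕ) → (n : ℕ) → (Fin n → A) → A) : Prop where
  /-- `A` is a graded bimodule. -/
  isInternal : DirectSum.IsInternal 𝒜
  left_smul_mem : ∀ (c : k) (g : ℤ), ∀ a ∈ 𝒜 g, c • a ∈ 𝒜 g
  right_smul_mem : ∀ (c : k) (g : ℤ), ∀ a ∈ 𝒜 g, MulOpposite.op c • a ∈ 𝒜 g
  /-- The operations are multilinear over `R`. -/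
  map_update_add : ∀ w n (a : Fin n → A) (i : Fin n) (x y : A),
    μ w n (Function.update a i (x + y)) =
      μ w n (Function.update a i x) + μ w n (Function.update a i y)
  map_update_smul : ∀ w n (a : Fin n → A) (i : Fin n) (c : R) (x : A),
    μ w n (Function.update a i (c • x)) = c • μ w n (Function.update a i x)
  /-- The operations are defined on the tensor product over `k`. -/
  balanced : ∀ w n (a : Fin n → A) (i j : Fin n), i.val + 1 = j.val → ∀ c : k,
    μ w n (Function.update a i (MulOpposite.op c • a i)) = μ w n (Function.update a j (c • a j))
  /-- The operations are maps of `k`-bimodules. -/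
  map_left_smul : ∀ w n (a : Fin (n + 1) → A) (c : k),
    μ w (n + 1) (Function.update a 0 (c • a 0)) = c • μ w (n + 1) a
  map_right_smul : ∀ w n (a : Fin (n + 1) → A) (c : k),
    μ w (n + 1) (Function.update a (Fin.last n) (MulOpposite.op c • a (Fin.last n))) =
      MulOpposite.op c • μ w (n + 1) a
  smul_zero_ary : ∀ w (a : Fin 0 → A) (c : k), c • μ w 0 a = MulOpposite.op c • μ w 0 a
  /-- `μ w n` has degree `n - 2 + 2 ∑ w i`. -/
  degree : ∀ w n (a : Fin n → A) (g : Fin n → ℤ), (∀ i, a i ∈ 𝒜 (g i)) →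
    μ w n a ∈ 𝒜 ((∑ i, g i) + n - 2 + 2 * ∑ i, (w i : ℤ))
  /-- There is no curvature in weight zero. -/
  zero_weight_zero_ary : ∀ a : Fin 0 → A, μ 0 0 a = 0
  /-- The structure relation
  `∑ (-1)^(r+st) μ^u_{r+1+t} ∘ (Id^r ⊗ μ^v_s ⊗ Id^t) = 0`, the sum over `r + s + t = n` and
  `u + v = w`. -/
  relation : ∀ (w : Fin N → ℕ) (n : ℕ) (a : ℕ → A),
    ∑ p ∈ Finset.HasAntidiagonal.antidiagonal n, ∑ q ∈ Finset.HasAntidiagonal.antidiagonal p.2,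
      ∑ v ∈ Finset.Icc 0 w,
      (-1 : ℤ) ^ (p.1 + q.1 * q.2) •
        μ (w - v) (p.1 + 1 + q.2)
          (fun j => splice a p.1 q.1 (μ v q.1 (fun i => a (p.1 + i))) j) = 0

/-- `e` is a (strict) unit for the operations `μ`. -/
structure IsStrictUnit {A : Type*} [AddCommGroup A] {N : ℕ}
    (μ : (Fin N → ℕ) → (n : ℕ) → (Fin n → A) → A) (e : A) : Prop where
  mul_unit : ∀ a, μ 0 2 ![a, e] = a
  unit_mul : ∀ a, μ 0 2 ![e, a] = a
  vanish : ∀ w n (a : Fin n → A), (n, w) ≠ (2, 0) → (∃ i, a i = e) → μ w n a = 0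

end WeightedAInfty

namespace Bordered

/-! ## The algebra `C(m,1)[t]` over `ℤ` -/

/-- The vertices `[1], …, [m-1]` of the quiver; also the labels `1, …, m-1` of edges of graphs. -/
abbrev Node (m : ℕ) := {x : ℕ // 1 ≤ x ∧ x < m}

instance (m : ℕ) : Fintype (Node m) := Fintype.subtype (Finset.Ico 1 m) (by simp)

/-- The edges of the quiver: `L i : [i] → [i-1]` and `R i : [i-1] → [i]` for `2 ≤ i ≤ m-1`,
and the loops `U₁` at `[1]` and `Uₘ` at `[m-1]`. -/
inductive Letter (m : ℕ)
  | L (i : ℕ) (h : 2 ≤ i ∧ i < m)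
  | R (i : ℕ) (h : 2 ≤ i ∧ i < m)
  | U₁ (h : 1 < m)
  | Uₘ (h : 1 < m)

namespace Letter

def src {m : ℕ} : Letter m → Node m
  | L i h => ⟨i, by omega⟩
  | R i h => ⟨i - 1, by omega⟩
  | U₁ h => ⟨1, by omega⟩
  | Uₘ h => ⟨m - 1, by omega⟩

def tgt {m : ℕ} : Letter m → Node m
  | L i h => ⟨i - 1, by omega⟩
  | R i h => ⟨i, by omega⟩
  | U₁ h => ⟨1, by omega⟩
  | Uₘ h => ⟨m - 1, by omega⟩

/-- The index `i` in `L i`, `R i`, `U₁`, `Uₘ`. -/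
def index {m : ℕ} : Letter m → ℕ
  | L i _ => i
  | R i _ => i
  | U₁ _ => 1
  | Uₘ _ => m

/-- The products of two composable letters that are set to zero (paths are written from left to
right). -/
inductive IsRelation {m : ℕ} : Letter m → Letter m → Prop
  | LL (i : ℕ) (h h') : IsRelation (L (i + 1) h) (L i h')
  | RR (i : ℕ) (h h') : IsRelation (R i h) (R (i + 1) h')
  | LU (h h') : IsRelation (L 2 h) (U₁ h')
  | UR (h h') : IsRelation (U₁ h) (R 2 h')
  | RU (h h') : IsRelation (R (m - 1) h) (Uₘ h')
  | UL (h h') : IsRelation (Uₘ h) (L (m - 1) h')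

/-- The product `a b` is a nonzero path. -/
def Follows {m : ℕ} (a b : Letter m) : Prop := a.tgt = b.src ∧ ¬ IsRelation a b

end Letter

/-- Paths in the quiver that contain none of the relations. The relations being monomial, these
paths form a basis of the path algebra modulo the relations. An empty list of letters gives the
constant path at `start`. -/
@[ext]
structure Path (m : ℕ) where
  start : Node m
  letters : List (Letter m)
  start_eq : ∀ a ∈ letters.head?, a.src = start
  chain : letters.IsChain Letter.Follows

/-- The endpoint of a path. -/
def Path.finish {m : ℕ} (p : Path m) : Node m :=
  (p.letters.getLast?.map Letter.tgt).getD p.start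

/-- The constant path at `x`. -/
def Path.const {m : ℕ} (x : Node m) : Path m := ⟨x, [], by simp, by simp⟩

/-- `C(m,1)[t]` over `ℤ`, as the free `ℤ[t]`-module on paths. -/
abbrev Alg (m : ℕ) := Path m →₀ ℤ[X]

/-- The ring `I(m,1)` of idempotents, over `ℤ`. -/
abbrev Idem (m : ℕ) := Node m → ℤ

/-- The left action of the ring of idempotents. -/
noncomputable instance (m : ℕ) : Module (Idem m) (Alg m) where
  smul c a := Finsupp.onFinset a.support (fun p => c p.start • a p)
    (fun p h => by
      rw [Finsupp.mem_support_iff]; intro h0; exact h (by rw [h0, smul_zero]))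
  one_smul a := Finsupp.ext fun p => one_smul ℤ (a p)
  mul_smul c d a := Finsupp.ext fun p => mul_smul (c p.start) (d p.start) (a p)
  smul_zero c := Finsupp.ext fun p => smul_zero (c p.start)
  smul_add c a b := Finsupp.ext fun p => smul_add (c p.start) (a p) (b p)
  add_smul c d a := Finsupp.ext fun p => add_smul (c p.start) (d p.start) (a p)
  zero_smul a := Finsupp.ext fun p => zero_smul ℤ (a p)

/-- The right action of the ring of idempotents. -/
noncomputable instance (m : ℕ) : Module (Idem m)ᵐᵒᵖ (Alg m) where
  smul c a := Finsupp.onFinset a.support (fun p => c.unop p.finish • a p)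
    (fun p h => by
      rw [Finsupp.mem_support_iff]; intro h0; exact h (by rw [h0, smul_zero]))
  one_smul a := Finsupp.ext fun p => one_smul ℤ (a p)
  mul_smul c d a := Finsupp.ext fun p =>
    (congrArg (fun z : ℤ => z • a p) (mul_comm (d.unop p.finish) (c.unop p.finish))).trans
      (mul_smul (c.unop p.finish) (d.unop p.finish) (a p))
  smul_zero c := Finsupp.ext fun p => smul_zero (c.unop p.finish)
  smul_add c a b := Finsupp.ext fun p => smul_add (c.unop p.finish) (a p) (b p)
  add_smul c d a := Finsupp.ext fun p => add_smul (c.unop p.finish) (d.unop p.finish) (a p)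
  zero_smul a := Finsupp.ext fun p => zero_smul ℤ (a p)

instance (m : ℕ) : SMulCommClass (Idem m) (Idem m)ᵐᵒᵖ (Alg m) where
  smul_comm c d a := Finsupp.ext fun p => smul_comm (c p.start) (d.unop p.finish) (a p)

/-- The idempotent `I_x`. -/
noncomputable def idem {m : ℕ} (x : Node m) : Alg m := Finsupp.single (Path.const x) 1

/-- The unit, the sum of all the idempotents `I_x`. -/
noncomputable def unit (m : ℕ) : Alg m := ∑ x : Node m, idem x

open Classical in
/-- The element given by a nonempty word in the letters: the path with these letters, or zero if
the word contains a relation or is not composable. -/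
noncomputable def ofWord {m : ℕ} : List (Letter m) → Alg m
  | [] => 0
  | a :: l =>
    if h : (a :: l).IsChain Letter.Follows then
      Finsupp.single ⟨a.src, a :: l, by simp, h⟩ 1
    else 0

open Classical in
/-- The product of two paths: their concatenation if this is again one of the basis paths, and
zero otherwise. -/
noncomputable def mulPath {m : ℕ} (p q : Path m) : Alg m :=
  if p.finish = q.start then
    if p.letters = [] then Finsupp.single q 1
    else if q.letters = [] then Finsupp.single p 1
    else ofWord (p.letters ++ q.letters)
  else 0

/-- The product of `C(m,1)[t]`. -/
noncomputable def mul {m : ℕ} (a b : Alg m) : Alg m :=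
  a.sum fun p x => b.sum fun q y => (x * y) • mulPath p q

/-- The element `U_i`: the loops `U₁` and `Uₘ` for `i = 1` and `i = m`, and `R_i L_i + L_i R_i`
for `1 < i < m`. -/
noncomputable def U (m i : ℕ) : Alg m :=
  if h : 1 < m then
    if i = 1 then ofWord [.U₁ h]
    else if i = m then ofWord [.Uₘ h]
    else if h' : 2 ≤ i ∧ i < m then ofWord [.R i h', .L i h'] + ofWord [.L i h', .R i h']
    else 0
  else 0

/-- The homogeneous elements of degree `g`, where `C(m,1)` has degree `0` and `t` has degree
`2m - 4`. -/
def grading (m : ℕ) (g : ℤ) : AddSubgroup (Alg m) where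
  carrier := {a | ∀ p j, (a p).coeff j ≠ 0 → (2 * (m : ℤ) - 4) * j = g}
  zero_mem' := by intro p j h; simp at h
  add_mem' := by
    intro a b ha hb p j h
    by_cases h0 : (a p).coeff j = 0
    · exact hb p j (by simpa [h0] using h)
    · exact ha p j h0
  neg_mem' := by intro a ha p j h; exact ha p j (by simpa using h)

/-! ## Tiling graphs -/

/-- The ends of edges at an internal vertex: `m - 1` incoming edges and `m - 1` outgoing edges,
each labeled by `1, …, m-1`. -/
inductive Port (m : ℕ)
  | into (k : Node m)
  | outOf (k : Node m)
deriving DecidableEq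

namespace Port

def label {m : ℕ} : Port m → Node m
  | into k => k
  | outOf k => k

/-- The two ends of an edge joining two internal vertices: the edge goes out of one of them and
into the other one, with the same label. -/
def flip {m : ℕ} : Port m → Port m
  | into k => outOf k
  | outOf k => into k

/-- The next edge in the counterclockwise order around a vertex: the incoming edges are labeled in
counterclockwise order, the outgoing ones in clockwise order. -/
def ccw {m : ℕ} : Port m → Port m
  | into k => if h : k.1 + 1 < m then into ⟨k.1 + 1, by omega⟩ else outOf k
  | outOf k => if h : k.1 = 1 then into k else outOf ⟨k.1 - 1, by omega⟩

/-- The next edge in the clockwise order around a vertex. -/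
def cw {m : ℕ} : Port m → Port m
  | into k => if h : k.1 = 1 then outOf k else into ⟨k.1 - 1, by omega⟩
  | outOf k => if h : k.1 + 1 < m then outOf ⟨k.1 + 1, by omega⟩ else into k

theorem cw_ccw {m : ℕ} (p : Port m) : p.ccw.cw = p := by
  rcases p with ⟨k, h1, h2⟩ | ⟨k, h1, h2⟩ <;> simp only [ccw] <;> split_ifs <;>
    simp only [cw] <;> split_ifs <;> (try simp) <;> omega

theorem ccw_cw {m : ℕ} (p : Port m) : p.cw.ccw = p := by
  rcases p with ⟨k, h1, h2⟩ | ⟨k, h1, h2⟩ <;> simp only [cw] <;> split_ifs <;>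
    simp only [ccw] <;> split_ifs <;> (try simp) <;> omega

/-- The letter of the sector between the edge `p` and its counterclockwise neighbour `p.ccw`. -/
def sector {m : ℕ} : Port m → Letter m
  | into k => if h : k.1 + 1 < m then .R (k.1 + 1) (by omega) else .Uₘ (by omega)
  | outOf k => if h : k.1 = 1 then .U₁ (by omega) else .L k.1 (by omega)

end Port

/-- Ends of edges at the internal vertices `Fin d`; also the sectors at the internal vertices, the
sector of `(v, p)` being the one between `p` and `p.ccw`. -/
abbrev Dart (m d : ℕ) := Fin d × Port m

/-- Rotation by one step around the vertices. -/
def rotate (m d : ℕ) : Equiv.Perm (Dart m d) where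
  toFun x := (x.1, x.2.ccw)
  invFun x := (x.1, x.2.cw)
  left_inv x := by simp [Port.cw_ccw]
  right_inv x := by simp [Port.ccw_cw]

/-- Going around the regions of the complement of a graph, with the edges between internal
vertices given by an involution `glue` of the ends of edges; a fixed point of `glue` is an edge
that ends in a leaf on the boundary of the disk. The sector `x` is followed by the sector
`face glue x` across the edge-end `rotate x`: one goes along that edge to its other end, or, if it
is a leaf edge, to the boundary of the disk and back on the other side of the edge. Hence the
orbits of `face glue` are the regions that do not meet the boundary of the disk, together
with one orbit for each boundary circle that carries leaves. -/
def face {m d : ℕ} (glue : Equiv.Perm (Dart m d)) : Equiv.Perm (Dart m d) :=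
  (rotate m d).trans glue

/-- The set of orbits of `face glue`. -/
abbrev Faces {m d : ℕ} (glue : Equiv.Perm (Dart m d)) :=
  Quotient (Equiv.Perm.SameCycle.setoid (face glue))

/-- There is an edge from the vertex `u` to the vertex `v`. -/
def Arrow {m d : ℕ} (glue : Equiv.Perm (Dart m d)) (u v : Fin d) : Prop :=
  ∃ k : Node m, glue (u, .outOf k) = (v, .into k)

/-- Centered tiling graphs: connected, compatibly decorated, rooted planar graphs in the disk, all
of whose cycles have length one, up to isotopy and with an enumeration of the internal vertices.
The planar embedding is recorded by the cyclic order of the edges around the vertices. -/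
structure TilingGraph (m : ℕ) where
  /-- The number of internal vertices. -/
  d : ℕ
  glue : Equiv.Perm (Dart m d)
  involutive : ∀ x, glue (glue x) = x
  /-- Orientations and labels agree along the edges. -/
  compatible : ∀ x, glue x ≠ x → (glue x).2 = x.2.flip
  /-- The root is one of the leaves, given by the edge that ends there. -/
  root : Dart m d
  root_leaf : glue root = root
  connected : ∀ u v, Relation.EqvGen (Arrow glue) u v
  /-- All leaves are on the boundary circle of the disk. -/
  leaves : ∀ x, glue x = x → (face glue).SameCycle root x
  /-- The surface is a disk: twice the Euler formula `V - E + F = 2`, where the boundary circle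
  is contracted to a point and the leaf edges are left out. -/
  planar : 2 * d + 2 * Nat.card (Faces glue) = Nat.card {x // glue x ≠ x} + 4
  /-- Apart from edges that start and end at the same vertex, there are no oriented cycles. -/
  cycles : ∀ u v, Relation.ReflTransGen (Arrow glue) u v →
    Relation.ReflTransGen (Arrow glue) v u → u = v
  /-- A region that does not meet the boundary of the disk is a monogon (containing `U₁` or
  `Uₘ`) or a bigon (containing `L i` and `R i`). -/
  regions : ∀ x, ¬ (face glue).SameCycle root x →
    ((x.2.sector.index = 1 ∨ x.2.sector.index = m) ∧ face glue x = x) ∨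
    ((x.2.sector.index ≠ 1 ∧ x.2.sector.index ≠ m) ∧
      face glue x ≠ x ∧ face glue (face glue x) = x)

namespace TilingGraph

/-- Isomorphism of (embedded, decorated, rooted) tiling graphs. -/
instance setoid (m : ℕ) : Setoid (TilingGraph m) where
  r Γ Γ' := ∃ e : Fin Γ.d ≃ Fin Γ'.d,
    (∀ x, Prod.map e id (Γ.glue x) = Γ'.glue (Prod.map e id x)) ∧
      Prod.map e id Γ.root = Γ'.root
  iseqv := by
    refine ⟨fun Γ => ⟨Equiv.refl _, fun x => rfl, rfl⟩, ?_, ?_⟩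
    · rintro Γ Γ' ⟨e, h, hr⟩
      refine ⟨e.symm, fun x => ?_, ?_⟩
      · have h2 := h (Prod.map e.symm id x)
        have h3 : Prod.map e id (Prod.map e.symm id x) = x := Prod.ext (by simp) rfl
        rw [h3] at h2
        rw [← h2]; exact Prod.ext (by simp) rfl
      · rw [← hr]; exact Prod.ext (by simp) rfl
    · rintro Γ Γ' Γ'' ⟨e, h, hr⟩ ⟨e', h', hr'⟩
      refine ⟨e.trans e', fun x => ?_, ?_⟩
      · have h2 := h' (Prod.map e id x)
        rw [← h] at h2
        exact h2
      · rw [← hr', ← hr]; rfl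

/-- The sectors met when going counterclockwise once around the boundary of the disk, starting at
the root. -/
noncomputable def outer {m : ℕ} (Γ : TilingGraph m) : List (Dart m Γ.d) :=
  List.iterate (face Γ.glue) Γ.root (Function.minimalPeriod (face Γ.glue) Γ.root)

/-- The algebra sequence: the sequence of sectors around the boundary is cut at each leaf, and
the words formed by the letters of the pieces are the elements of the sequence. -/
noncomputable def algebraSequence {m : ℕ} (Γ : TilingGraph m) : List (List (Letter m)) :=
  (Γ.outer.splitBy (fun _ y => decide (Γ.glue y ≠ y))).map
    (fun piece => piece.map (fun x => x.2.sector))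

/-- The weight vector: its component with index `i` (shifted by one) is the number of regions of
type `i` that do not meet the boundary of the disk. -/
noncomputable def weight {m : ℕ} (Γ : TilingGraph m) : Fin m → ℕ := fun i =>
  Nat.card {F : Faces Γ.glue // F ≠ Quotient.mk _ Γ.root ∧
    ∃ x, F = Quotient.mk _ x ∧ x.2.sector.index = i.1 + 1}

/-- The term `ι(Γ) t^d`, where `ι(Γ) = I_k` for the label `k` of the root edge. -/
noncomputable def output {m : ℕ} (Γ : TilingGraph m) : Alg m :=
  (Polynomial.X ^ Γ.d : ℤ[X]) • idem Γ.root.2.label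

end TilingGraph

/-! ## The operations -/

/-- `c^w_n(a_1, …, a_n)` for non-constant paths `a_i`, given by their words: the (finite) sum of
the outputs of all tiling graphs, up to isomorphism, with the given weight and algebra sequence. -/
noncomputable def centered {m : ℕ} (w : Fin m → ℕ) (a : List (List (Letter m))) : Alg m :=
  ∑ᶠ (G : Quotient (TilingGraph.setoid m)) (_ : G.out.weight = w ∧ G.out.algebraSequence = a),
    G.out.output

/-- The sum of `a' · c^w_n(a_1', a_2, …, a_n)` over the factorizations `a_1 = a' · a_1'` into
non-constant paths. -/
noncomputable def leftExtended {m : ℕ} (w : Fin m → ℕ) (a : List (List (Letter m))) : Alg m :=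
  ∑ j ∈ Finset.Ioo 0 (a.headD []).length,
    mul (ofWord ((a.headD []).take j)) (centered w ((a.headD []).drop j :: a.tail))

/-- The sum of `c^w_n(a_1, …, a_{n-1}, a_n') · a'` over the factorizations `a_n = a_n' · a'` into
non-constant paths. -/
noncomputable def rightExtended {m : ℕ} (w : Fin m → ℕ) (a : List (List (Letter m))) : Alg m :=
  ∑ j ∈ Finset.Ioo 0 (a.getLastD []).length,
    mul (centered w (a.dropLast ++ [(a.getLastD []).take j])) (ofWord ((a.getLastD []).drop j))

open Classical in
/-- The operations counting graphs, on sequences of paths; they vanish if one of the paths is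
constant. -/
noncomputable def muGraph {m : ℕ} (w : Fin m → ℕ) (ps : List (Path m)) : Alg m :=
  if ∃ p ∈ ps, p.letters = [] then 0
  else
    centered w (ps.map Path.letters) + leftExtended w (ps.map Path.letters) +
      rightExtended w (ps.map Path.letters)

open Classical in
/-- The operations `μ^w_n` on sequences of paths: `μ^0_2` is the product of the algebra,
`μ^w_0 = U_i` if `w` is the `i`-th basis vector and `μ^w_0 = 0` otherwise, and all
the other operations count graphs. -/
noncomputable def muPaths {m : ℕ} (w : Fin m → ℕ) : List (Path m) → Alg m
  | [] => ∑ i : Fin m, if w = Pi.single i 1 then U m (i.1 + 1) else 0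
  | [p, q] => if w = 0 then mulPath p q else muGraph w [p, q]
  | ps => muGraph w ps

open Classical in
/-- The operations `μ^w_n` on `C(m,1)[t]`, by `ℤ[t]`-multilinear extension. -/
noncomputable def mu (m : ℕ) (w : Fin m → ℕ) (n : ℕ) (a : Fin n → Alg m) : Alg m :=
  ∑ ps ∈ Fintype.piFinset (fun i => (a i).support),
    (∏ i, a i (ps i)) • muPaths w (List.ofFn ps)

end Bordered

/-!
The operations count graphs, and the structure relation follows from a recursion for the numbers of
graphs that is found by cutting an edge on the boundary of the outer region.

**Counting graphs.** A tiling graph is determined up to finitely many choices by its algebra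
sequence: every vertex is on the outer region (`PreTiling.exists_outer`), and Euler's formula gives
the number of vertices from the number of leaves and the weight (`IsTiling.degree`), which is also
the statement about degrees. All weights are treated at once: `gen` is the generating function of
the graphs with a given outer word, with variables for the weight, and `graphSum` is the same
function of the algebra sequence `s`, written `C(s)` below. It is invariant under rotation
of `s`, since the root can be moved (`gen_rotate`), and vanishes if `s` has odd length.

**The recursion.** Let an input `x ++ y` be a product of two words, so that an inner edge ends
between them, and cut this edge. If its other side is an inner region, that region is opened and its
word `u` becomes a new input between `x` and `y`. If its other side is the outer region, the
edge is a bridge: the graph would otherwise have negative genus after the cut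
(`genus_inequality`, `IsTiling.exists_bridgeCut`), and cutting it leaves two graphs. Conversely,
gluing two leaf edges produces no new oriented cycles and no other inner regions. Hence (`gen_cut`)
`C(x ++ y, s) = ∑ X_u C(x, u, y, s) + ∑ C(x, b'', l) C(y, k, b')`, the second sum being over the
decompositions `s = (k, b' ++ b'', l)`.

**The structure relation.** Consider an outer operation `C`. The inner operations with a
nonconstant output insert at a cut of the inputs the word of an inner region or a factor of some
input, or they multiply two adjacent inputs. By the recursion the first kinds, taken at an
interior cut, add up to the product of the inputs adjacent to this cut, which has the opposite sign,
and the two ends cancel each other (`CutSystem.trip_inner_C`). For the extended outer operations the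
same argument applies to a factor of the first or the last input; what remains
(`CutSystem.lamSum_add_rhoSum`) and the outer products involve only the first and the last input.
In `C(m,1)` each letter can be followed by a unique letter, so that nonzero words are determined by
their first letter and their length, and the remaining terms can be matched explicitly
(`exchange`, `exchange_self`). This gives `word_relation`. Constant inputs only allow
products, and are treated separately in `trip_relTerm`.

The operations are the coefficients of their generating functions (`muPaths_eq`), so that the
relation follows for basis elements (`trip_muPaths`) and by multilinear extension (`multiExt_trip`,
`multiExt_insert`) in general (`mu_relation`). The statements about bimodules hold because
consecutive inputs of nonzero operations are composable, and the outputs start where the first input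
starts and end where the last one ends (`muHat_eq_zero`, `muHat_mem_left`, `muHat_mem_right`).

Graphs are handled as parts of a permutation of `V × Port m`, for a set of vertices `V`, so that the
two pieces of a graph after a cut have vertices in the same type; orbits are handled as lists,
which are split and joined when two values of a permutation are exchanged (`IsCyc.split`,
`IsCyc.join`).
-/

/-! ### Letters and ports -/

namespace Bordered

/-- The unique letter that can follow a given letter in a nonzero path. -/
def Letter.next {m : ℕ} : Letter m → Letter m
  | .L i h => .R i h
  | .R i h => .L i h
  | .U₁ h => .U₁ h
  | .Uₘ h => .Uₘ h

theorem Letter.next_next {m : ℕ} (a : Letter m) : a.next.next = a := by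
  cases a <;> rfl

theorem Letter.index_next {m : ℕ} (a : Letter m) : a.next.index = a.index := by
  cases a <;> rfl

theorem Letter.tgt_eq_src_next {m : ℕ} (a : Letter m) : a.tgt = a.next.src := by
  cases a <;> rfl

theorem Letter.follows_iff {m : ℕ} (hm : 3 ≤ m) (a b : Letter m) : a.Follows b ↔ b = a.next := by
  constructor
  · rintro ⟨h, h'⟩
    cases a <;> cases b <;> simp only [tgt, src, Subtype.mk.injEq] at h <;>
      simp only [next, reduceCtorEq, L.injEq, R.injEq] <;> try omega
    case L.L i hi j hj => subst h; exact h' (by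
      obtain ⟨k, rfl⟩ : ∃ k, i = k + 1 := ⟨i - 1, by omega⟩
      exact .LL _ _ _)
    case L.U₁ i hi hj => obtain rfl : i = 2 := by omega
                         exact h' (.LU _ _)
    case R.R i hi j hj =>
      obtain rfl : j = i + 1 := by omega
      exact h' (.RR _ _ _)
    case R.Uₘ i hi hj => subst h; exact h' (.RU _ _)
    case U₁.R hi j hj => obtain rfl : j = 2 := by omega
                         exact h' (.UR _ _)
    case Uₘ.L hi j hj => subst h; exact h' (.UL _ _)
  · rintro rfl
    refine ⟨a.tgt_eq_src_next, fun h => ?_⟩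
    cases a <;> cases h

namespace Port

/-- The port at the same vertex that faces `p` in the graph with one vertex: the sector after the
edge with the ends `p.ccw` and `p.across` begins at `p.across`. -/
def across {m : ℕ} (p : Port m) : Port m := p.ccw.flip

theorem flip_flip {m : ℕ} (p : Port m) : p.flip.flip = p := by cases p <;> rfl

theorem flip_ne {m : ℕ} (p : Port m) : p.flip ≠ p := by cases p <;> simp [flip]

theorem label_flip {m : ℕ} (p : Port m) : p.flip.label = p.label := by cases p <;> rfl

theorem eq_or_eq_flip {m : ℕ} {p q : Port m} (h : p.label = q.label) : p = q ∨ p = q.flip := by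
  cases p <;> cases q <;> simp_all [label, flip]

theorem src_sector {m : ℕ} (p : Port m) : p.sector.src = p.label := by
  rcases p with ⟨k, h1, h2⟩ | ⟨k, h1, h2⟩ <;> simp only [sector] <;> split_ifs <;>
    simp only [Letter.src, label, Subtype.mk.injEq] <;> omega

theorem sector_across {m : ℕ} (p : Port m) : p.across.sector = p.sector.next := by
  rcases p with ⟨k, h1, h2⟩ | ⟨k, h1, h2⟩ <;> simp only [across, ccw, sector] <;> split_ifs <;>
    simp only [flip, Letter.next] <;> split_ifs <;> first | rfl | omega | skip
  simp only [Letter.R.injEq]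
  omega

theorem tgt_sector {m : ℕ} (p : Port m) : p.sector.tgt = p.ccw.label := by
  rw [Letter.tgt_eq_src_next, ← sector_across, src_sector, across, label_flip]

theorem sector_injective {m : ℕ} : Function.Injective (sector : Port m → Letter m) := by
  intro p q h
  rcases p with ⟨k, h1, h2⟩ | ⟨k, h1, h2⟩ <;> rcases q with ⟨l, h3, h4⟩ | ⟨l, h3, h4⟩ <;>
    simp only [sector] at h <;> split_ifs at h <;>
    simp_all only [Letter.L.injEq, Letter.R.injEq, into.injEq, Subtype.mk.injEq] <;> omega

theorem sector_surjective {m : ℕ} : Function.Surjective (sector : Port m → Letter m) := by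
  intro a
  cases a with
  | L i h => exact ⟨outOf ⟨i, by omega⟩, by simp only [sector]; rw [dif_neg (by omega)]⟩
  | R i h =>
    refine ⟨into ⟨i - 1, by omega⟩, ?_⟩
    simp only [sector]
    rw [dif_pos (by omega)]
    simp only [Letter.R.injEq]; omega
  | U₁ h => exact ⟨outOf ⟨1, by omega⟩, by simp [sector]⟩
  | Uₘ h =>
    refine ⟨into ⟨m - 1, by omega⟩, ?_⟩
    simp only [sector]
    rw [dif_neg (by omega)]

theorem across_across {m : ℕ} (p : Port m) : p.across.across = p :=
  sector_injective (by rw [sector_across, sector_across, Letter.next_next])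

theorem across_eq_self_iff {m : ℕ} (p : Port m) :
    p.across = p ↔ p.sector.index = 1 ∨ p.sector.index = m := by
  rw [← sector_injective.eq_iff, sector_across]
  cases p.sector <;> simp [Letter.next, Letter.index] <;> omega

theorem index_across {m : ℕ} (p : Port m) : p.across.sector.index = p.sector.index := by
  rw [sector_across, Letter.index_next]

/-- Ports as a sum type. -/
def equivSum (m : ℕ) : Port m ≃ Node m ⊕ Node m where
  toFun
    | into k => .inl k
    | outOf k => .inr k
  invFun
    | .inl k => into k
    | .inr k => outOf k
  left_inv p := by cases p <;> rfl
  right_inv p := by cases p <;> rfl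

instance (m : ℕ) : Fintype (Port m) := Fintype.ofEquiv _ (equivSum m).symm

theorem card_port (m : ℕ) : Fintype.card (Port m) = 2 * (m - 1) := by
  have h : Fintype.card (Node m) = m - 1 := by
    rw [Fintype.card_of_subtype (Finset.Ico 1 m) (by simp), Nat.card_Ico]
  rw [Fintype.card_congr (equivSum m), Fintype.card_sum, h]
  omega

/-- One port among the one or two ports of each index: the sectors of index `i` are those of
`pref` and of its `across`. -/
def pref {m : ℕ} (hm : 3 ≤ m) (i : Fin m) : Port m :=
  if h : i.1 = 0 then outOf ⟨1, by omega⟩ else into ⟨i.1, by omega⟩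

theorem index_pref {m : ℕ} (hm : 3 ≤ m) (i : Fin m) : (pref hm i).sector.index = i.1 + 1 := by
  unfold pref
  split_ifs with h
  · simp [sector, Letter.index, h]
  · simp only [sector]
    split_ifs
    · rfl
    · simp only [Letter.index]; omega

theorem eq_of_index_eq {m : ℕ} {p q : Port m} (h : p.sector.index = q.sector.index) :
    p = q ∨ p = q.across := by
  rw [← sector_injective.eq_iff, ← sector_injective.eq_iff, sector_across]
  revert h
  cases p.sector <;> cases q.sector <;>
    simp only [Letter.index, Letter.next, reduceCtorEq, or_false, false_or, Letter.L.injEq,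
      Letter.R.injEq, or_true, imp_true_iff, imp_self] <;> omega

theorem exists_index {m : ℕ} (p : Port m) : ∃ i : Fin m, p.sector.index = i.1 + 1 := by
  cases h : p.sector with
  | L i h => exact ⟨⟨i - 1, by omega⟩, by simp only [Letter.index]; omega⟩
  | R i h => exact ⟨⟨i - 1, by omega⟩, by simp only [Letter.index]; omega⟩
  | U₁ h => exact ⟨⟨0, by omega⟩, by simp [Letter.index]⟩
  | Uₘ h => exact ⟨⟨m - 1, by omega⟩, by simp only [Letter.index]; omega⟩

/-- All the ports at a vertex are met when going around the vertex. -/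
theorem exists_ccw_iterate {m : ℕ} (hm : 3 ≤ m) (p : Port m) :
    ∃ n, ccw^[n] (into ⟨1, by omega⟩) = p := by
  have h1 : ∀ k (h : 1 ≤ k ∧ k < m), ∃ n, ccw^[n] (into ⟨1, by omega⟩) = into ⟨k, h⟩ := by
    intro k
    induction k with
    | zero => intro h; omega
    | succ k ih =>
      intro h
      by_cases hk : k = 0
      · subst hk; exact ⟨0, rfl⟩
      · obtain ⟨n, hn⟩ := ih (by omega)
        refine ⟨n + 1, ?_⟩
        rw [Function.iterate_succ_apply', hn]
        simp [ccw, h.2]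
  have h2 : ∀ j k (h : 1 ≤ k ∧ k < m), k + j = m - 1 →
      ∃ n, ccw^[n] (into ⟨1, by omega⟩) = outOf ⟨k, h⟩ := by
    intro j
    induction j with
    | zero =>
      intro k h hk
      obtain ⟨n, hn⟩ := h1 k h
      refine ⟨n + 1, ?_⟩
      rw [Function.iterate_succ_apply', hn]
      simp only [ccw]
      rw [dif_neg (by omega)]
    | succ j ih =>
      intro k h hk
      obtain ⟨n, hn⟩ := ih (k + 1) (by omega) (by omega)
      refine ⟨n + 1, ?_⟩
      rw [Function.iterate_succ_apply', hn]
      simp only [ccw]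
      rw [dif_neg (by omega)]
      rfl
  cases p with
  | into k => exact h1 k.1 k.2
  | outOf k => exact h2 (m - 1 - k.1) k.1 k.2 (by have := k.2; omega)

end Port

end Bordered

/-! ### Orbits of permutations as lists -/

namespace Bordered

variable {α β : Type*}

/-- The map `f` leads from `a` through the elements of `l` to `b`. -/
def Seg (f : α → α) (a : α) : List α → α → Prop
  | [], b => f a = b
  | c :: l, b => f a = c ∧ Seg f c l b

theorem seg_append {f : α → α} {a b c : α} {l l' : List α} :
    Seg f a (l ++ c :: l') b ↔ Seg f a l c ∧ Seg f c l' b := by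
  induction l generalizing a with
  | nil => rfl
  | cons d l ih => simp [Seg, ih, and_assoc]

theorem Seg.map {f : α → α} {g : β → β} {a b : α} {l : List α} (φ : α → β) (h : Seg f a l b)
    (hfg : ∀ x ∈ a :: l, g (φ x) = φ (f x)) : Seg g (φ a) (l.map φ) (φ b) := by
  induction l generalizing a with
  | nil => rw [List.map_nil, Seg, hfg a (by simp), h]
  | cons d l ih =>
    exact ⟨by rw [hfg a (by simp), h.1], ih h.2 fun x hx => hfg x (by simp_all)⟩

/-- After exchanging two values of the map, a segment that leads to one of them leads to the
other one. -/
theorem Seg.swap [DecidableEq α] {f g : α → α} {a y z : α} {l : List α} (h : Seg f a l y)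
    (hy : y ∉ l) (hz : z ∉ l) (hg : ∀ x, g x = Equiv.swap y z (f x)) : Seg g a l z := by
  induction l generalizing a with
  | nil => rw [Seg, hg, show f a = y from h, Equiv.swap_apply_left]
  | cons d l ih =>
    simp only [List.mem_cons, not_or] at hy hz
    exact ⟨by rw [hg, h.1, Equiv.swap_apply_of_ne_of_ne (Ne.symm hy.1) (Ne.symm hz.1)],
      ih h.2 hy.2 hz.2⟩

theorem Seg.of_swap [DecidableEq α] {f g : α → α} {a b y z : α} {l : List α} (h : Seg f a l b)
    (hy : y ∉ l) (hz : z ∉ l) (hby : b ≠ y) (hbz : b ≠ z)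
    (hg : ∀ x, g x = Equiv.swap y z (f x)) : Seg g a l b := by
  induction l generalizing a with
  | nil => rw [Seg, hg, show f a = b from h, Equiv.swap_apply_of_ne_of_ne hby hbz]
  | cons d l ih =>
    simp only [List.mem_cons, not_or] at hy hz
    exact ⟨by rw [hg, h.1, Equiv.swap_apply_of_ne_of_ne (Ne.symm hy.1) (Ne.symm hz.1)],
      ih h.2 hy.2 hz.2⟩

/-- `a :: l` is the list of the elements of an orbit of `f`, in the order in which they are
met. -/
def IsCyc (f : α → α) (a : α) (l : List α) : Prop := (a :: l).Nodup ∧ Seg f a l a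

theorem Seg.iterate_mem {f : α → α} {a b : α} {l : List α} (h : Seg f a l b) :
    ∀ i (hi : i < (a :: l).length), (a :: l)[i] = f^[i] a := by
  induction l generalizing a with
  | nil => intro i hi; obtain rfl : i = 0 := by simpa using hi
           rfl
  | cons c l ih =>
    intro i hi
    cases i with
    | zero => rfl
    | succ i =>
      have := ih h.2 i (by simpa using hi)
      simp only [List.getElem_cons_succ, this, Function.iterate_succ_apply, h.1]

theorem Seg.iterate_length {f : α → α} {a b : α} {l : List α} (h : Seg f a l b) :
    f^[l.length + 1] a = b := by
  induction l generalizing a with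
  | nil => exact h
  | cons c l ih => rw [List.length_cons, Function.iterate_succ_apply, h.1, ih h.2]

theorem IsCyc.minimalPeriod {f : α → α} {a : α} {l : List α} (h : IsCyc f a l) :
    Function.minimalPeriod f a = l.length + 1 := by
  have hp : Function.IsPeriodicPt f (l.length + 1) a := h.2.iterate_length
  refine le_antisymm (hp.minimalPeriod_le (by omega)) ?_
  by_contra hlt
  push Not at hlt
  have hpos := hp.minimalPeriod_pos (by omega)
  have h1 := h.2.iterate_mem (Function.minimalPeriod f a) (by simpa using hlt)
  rw [Function.iterate_minimalPeriod] at h1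
  have h2 := (List.Nodup.getElem_inj_iff h.1 (i := Function.minimalPeriod f a) (j := 0)
    (hi := by simpa using hlt) (hj := by simp)).1 (by rw [h1]; rfl)
  omega

theorem IsCyc.eq_iterate {f : α → α} {a : α} {l : List α} (h : IsCyc f a l) :
    a :: l = List.iterate f a (Function.minimalPeriod f a) := by
  apply List.ext_getElem
  · simp [h.minimalPeriod]
  · intro i h1 h2
    rw [h.2.iterate_mem i h1]
    simp

theorem IsCyc.unique {f : α → α} {a : α} {l l' : List α} (h : IsCyc f a l) (h' : IsCyc f a l') :
    l = l' := by
  have := h.eq_iterate.trans h'.eq_iterate.symm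
  simpa using this

theorem seg_iterate (f : α → α) (a : α) (n : ℕ) :
    Seg f a (List.iterate f (f a) n) (f^[n + 1] a) := by
  induction n generalizing a with
  | zero => rfl
  | succ n ih => exact ⟨rfl, ih (f a)⟩

theorem exists_isCyc [Finite α] (f : Equiv.Perm α) (a : α) : ∃ l, IsCyc f a l := by
  have hpos : 0 < Function.minimalPeriod f a :=
    Function.minimalPeriod_pos_of_mem_periodicPts
      (Function.Injective.mem_periodicPts f.injective a)
  obtain ⟨n, hn⟩ : ∃ n, Function.minimalPeriod f a = n + 1 := ⟨_, (Nat.succ_pred hpos.ne').symm⟩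
  refine ⟨List.iterate f (f a) n, ?_, ?_⟩
  · change (List.iterate f a (n + 1)).Nodup
    rw [List.nodup_iff_injective_getElem]
    intro i j hij
    have hi := i.2
    have hj := j.2
    simp only [List.length_iterate] at hi hj
    simp only [List.getElem_iterate] at hij
    exact Fin.ext (Function.iterate_injOn_Iio_minimalPeriod (by rw [hn]; exact hi)
      (by rw [hn]; exact hj) hij)
  · have := seg_iterate f a n
    rwa [← hn, Function.iterate_minimalPeriod] at this

/-- Membership in an orbit list. -/
theorem IsCyc.mem_iff {f : Equiv.Perm α} {a : α} {l : List α} (h : IsCyc f a l) {x : α} :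
    x ∈ a :: l ↔ f.SameCycle a x := by
  constructor
  · intro hx
    obtain ⟨i, hi, rfl⟩ := List.getElem_of_mem hx
    rw [h.2.iterate_mem i hi]
    exact ⟨i, by rw [zpow_natCast, Equiv.Perm.coe_pow]⟩
  · have step : ∀ x ∈ a :: l, f x ∈ a :: l := by
      intro x hx
      obtain ⟨i, hi, rfl⟩ := List.getElem_of_mem hx
      rw [h.2.iterate_mem i hi, ← Function.iterate_succ_apply' f]
      by_cases hlt : i + 1 < (a :: l).length
      · rw [← h.2.iterate_mem _ hlt]; exact List.getElem_mem _
      · have : i = l.length := by simp only [List.length_cons] at hi hlt; omega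
        rw [this, h.2.iterate_length]; simp
    have back : ∀ x ∈ a :: l, f.symm x ∈ a :: l := by
      intro x hx
      have hinj := Set.InjOn.bijOn_image (f := f) (s := {x | x ∈ a :: l}) f.injective.injOn
      have hfin : Set.Finite {x | x ∈ a :: l} := List.finite_toSet _
      have hs : f '' {x | x ∈ a :: l} = {x | x ∈ a :: l} :=
        Set.eq_of_subset_of_ncard_le (by rintro _ ⟨x, hx, rfl⟩; exact step x hx)
          (by rw [Set.ncard_image_of_injective _ f.injective]) hfin
      have : x ∈ f '' {x | x ∈ a :: l} := by rw [hs]; exact hx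
      obtain ⟨w, hw, rfl⟩ := this
      simpa using hw
    rintro ⟨n, rfl⟩
    induction n using Int.induction_on with
    | zero => simp
    | succ i ih =>
      rw [add_comm, zpow_add, zpow_one, Equiv.Perm.mul_apply]
      exact step _ ih
    | pred i ih =>
      rw [sub_eq_add_neg, add_comm, zpow_add, zpow_neg_one, Equiv.Perm.mul_apply]
      exact back _ ih

theorem IsCyc.map {f : α → α} {g : β → β} {a : α} {l : List α} (φ : α → β) (h : IsCyc f a l)
    (hinj : Set.InjOn φ {x | x ∈ a :: l}) (hfg : ∀ x ∈ a :: l, g (φ x) = φ (f x)) :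
    IsCyc g (φ a) (l.map φ) :=
  ⟨by rw [← List.map_cons]; exact h.1.map_on fun x hx y hy => hinj hx hy, h.2.map φ hfg⟩

theorem IsCyc.rotate {f : α → α} {a b : α} {l l' : List α} (h : IsCyc f a (l ++ b :: l')) :
    IsCyc f b (l' ++ a :: l) := by
  have h2 := seg_append.1 h.2
  refine ⟨?_, seg_append.2 ⟨h2.2, h2.1⟩⟩
  rw [← List.cons_append, List.nodup_append_comm]
  exact h.1

section Swap

variable [DecidableEq α] {f g : α → α} {a y z : α}

/-- Exchanging two values of a permutation in the same orbit splits the orbit. -/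
theorem IsCyc.split {A B₁ B₂ : List α} (hg : ∀ x, g x = Equiv.swap y z (f x))
    (h : IsCyc f a (A ++ y :: (B₁ ++ z :: B₂))) :
    IsCyc g a (A ++ z :: B₂) ∧ IsCyc g y B₁ := by
  obtain ⟨hn, hs⟩ := h
  obtain ⟨s1, s2⟩ := seg_append.1 hs
  obtain ⟨s2, s3⟩ := seg_append.1 s2
  simp only [List.nodup_cons, List.nodup_append, List.mem_append, List.mem_cons] at hn
  have hg' : ∀ x, g x = Equiv.swap z y (f x) := fun x => by rw [Equiv.swap_comm]; exact hg x
  refine ⟨⟨?_, seg_append.2 ⟨s1.swap ?_ ?_ hg, s3.of_swap ?_ ?_ ?_ ?_ hg⟩⟩,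
    ⟨?_, s2.swap ?_ ?_ hg'⟩⟩ <;>
    grind

/-- Exchanging two values of a permutation in different orbits joins the orbits. -/
theorem IsCyc.join {A B₁ B₂ : List α} (hg : ∀ x, g x = Equiv.swap y z (f x))
    (h : IsCyc f a (A ++ z :: B₂)) (h' : IsCyc f y B₁)
    (hd : ∀ x ∈ y :: B₁, x ∉ a :: (A ++ z :: B₂)) :
    IsCyc g a (A ++ y :: (B₁ ++ z :: B₂)) := by
  obtain ⟨hn, hs⟩ := h
  obtain ⟨hn', hs'⟩ := h'
  obtain ⟨s1, s2⟩ := seg_append.1 hs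
  have hg' : ∀ x, g x = Equiv.swap z y (f x) := fun x => by rw [Equiv.swap_comm]; exact hg x
  simp only [List.mem_append, List.mem_cons] at hd
  simp only [List.nodup_cons, List.nodup_append, List.mem_append, List.mem_cons] at hn hn'
  refine ⟨?_, seg_append.2 ⟨s1.swap ?_ ?_ hg', seg_append.2 ⟨hs'.swap ?_ ?_ hg,
    s2.of_swap ?_ ?_ ?_ ?_ hg⟩⟩⟩ <;>
    grind

/-- Exchanging the first element of one orbit with an element of another orbit inserts the first
orbit into the second one. -/
theorem IsCyc.insert {A Z B : List α} (hg : ∀ x, g x = Equiv.swap y z (f x))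
    (h : IsCyc f a (A ++ y :: B)) (h' : IsCyc f z Z)
    (hd : ∀ x ∈ z :: Z, x ∉ a :: (A ++ y :: B)) :
    IsCyc g a (A ++ z :: (Z ++ y :: B)) :=
  IsCyc.join (fun x => by rw [Equiv.swap_comm]; exact hg x) h h' hd

theorem IsCyc.of_swap {l : List α} (hg : ∀ x, g x = Equiv.swap y z (f x)) (h : IsCyc f a l)
    (hy : y ∉ a :: l) (hz : z ∉ a :: l) : IsCyc g a l := by
  simp only [List.mem_cons, not_or] at hy hz
  exact ⟨h.1, h.2.of_swap hy.2 hz.2 (Ne.symm hy.1) (Ne.symm hz.1) hg⟩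

end Swap

end Bordered

/-! ### The genus of a rotation system -/

namespace Bordered

section Orbits

variable {α : Type*}

theorem IsCyc.join_self [DecidableEq α] {f g : α → α} {y z : α} {A B : List α}
    (hg : ∀ x, g x = Equiv.swap y z (f x)) (h : IsCyc f z A) (h' : IsCyc f y B)
    (hd : ∀ x ∈ y :: B, x ∉ z :: A) : IsCyc g z (A ++ y :: B) := by
  obtain ⟨hn, hs⟩ := h
  obtain ⟨hn', hs'⟩ := h'
  have hg' : ∀ x, g x = Equiv.swap z y (f x) := fun x => by rw [Equiv.swap_comm]; exact hg x
  simp only [List.mem_cons] at hd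
  simp only [List.nodup_cons] at hn hn'
  refine ⟨?_, seg_append.2 ⟨hs.swap ?_ ?_ hg', hs'.swap ?_ ?_ hg⟩⟩ <;>
    grind

theorem IsCyc.split_self [DecidableEq α] {f g : α → α} {y z : α} {A B : List α}
    (hg : ∀ x, g x = Equiv.swap y z (f x)) (h : IsCyc f z (A ++ y :: B)) :
    IsCyc g z A ∧ IsCyc g y B := by
  obtain ⟨hn, hs⟩ := h
  obtain ⟨s1, s2⟩ := seg_append.1 hs
  simp only [List.nodup_cons, List.nodup_append, List.mem_append, List.mem_cons] at hn
  have hg' : ∀ x, g x = Equiv.swap z y (f x) := fun x => by rw [Equiv.swap_comm]; exact hg x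
  refine ⟨⟨?_, s1.swap ?_ ?_ hg⟩, ⟨?_, s2.swap ?_ ?_ hg'⟩⟩ <;>
    grind

theorem card_quotient_merge [Finite α] {r s : Setoid α} {y z : α}
    (h : ∀ a b, s a b ↔ r a b ∨ (r a y ∨ r a z) ∧ (r b y ∨ r b z)) (hyz : ¬ r y z) :
    Nat.card (Quotient s) + 1 = Nat.card (Quotient r) := by
  classical
  rw [← Nat.card_congr (Equiv.optionSubtypeNe (Quotient.mk r z)), Finite.card_option]
  congr 1
  symm
  let φ : {c : Quotient r // c ≠ Quotient.mk r z} → Quotient s := fun c =>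
    Quotient.map' (s₁ := r) (s₂ := s) id (fun a b hab => (h a b).2 (.inl hab)) c.1
  refine Nat.card_congr (Equiv.ofBijective φ ⟨?_, ?_⟩)
  · rintro ⟨c, hc⟩ ⟨d, hd⟩ hcd
    induction c using Quotient.inductionOn with | _ a
    induction d using Quotient.inductionOn with | _ b
    have ha : ¬ r a z := fun h => hc (Quotient.sound h)
    have hb : ¬ r b z := fun h => hd (Quotient.sound h)
    have hab : s a b := Quotient.exact hcd
    refine Subtype.ext (Quotient.sound ?_)
    rcases (h a b).1 hab with h | ⟨h1 | h1, h2 | h2⟩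
    · exact h
    · exact r.trans h1 (r.symm h2)
    · exact absurd h2 hb
    · exact absurd h1 ha
    · exact absurd h1 ha
  · intro c
    induction c using Quotient.inductionOn with | _ a
    by_cases ha : r a z
    · refine ⟨⟨Quotient.mk r y, fun h => hyz (Quotient.exact h)⟩, ?_⟩
      exact Quotient.sound ((h y a).2 (.inr ⟨.inl (r.refl y), .inr ha⟩))
    · exact ⟨⟨Quotient.mk r a, fun h => ha (Quotient.exact h)⟩, rfl⟩

theorem mem_join_iff [Finite α] [DecidableEq α] {f g : Equiv.Perm α} {y z : α}
    (hg : ∀ x, g x = Equiv.swap y z (f x)) (hyz : ¬ f.SameCycle y z) (a b : α) :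
    g.SameCycle a b ↔ f.SameCycle a b ∨
      (f.SameCycle a y ∨ f.SameCycle a z) ∧ (f.SameCycle b y ∨ f.SameCycle b z) := by
  obtain ⟨A, hA⟩ := exists_isCyc f z
  obtain ⟨B, hB⟩ := exists_isCyc f y
  have hd : ∀ x ∈ y :: B, x ∉ z :: A := fun x hx hx' =>
    hyz ((hB.mem_iff.1 hx).trans (hA.mem_iff.1 hx').symm)
  have hJ := hA.join_self hg hB hd
  have key : ∀ x, g.SameCycle z x ↔ f.SameCycle x y ∨ f.SameCycle x z := by
    intro x
    rw [← hJ.mem_iff, f.sameCycle_comm (y := y), f.sameCycle_comm (y := z), ← hA.mem_iff,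
      ← hB.mem_iff]
    simp only [List.mem_cons, List.mem_append]
    tauto
  by_cases ha : f.SameCycle a y ∨ f.SameCycle a z
  · have h1 : g.SameCycle a b ↔ g.SameCycle z b :=
      ⟨fun h => ((key a).2 ha).trans h, fun h => ((key a).2 ha).symm.trans h⟩
    rw [h1, key]
    refine ⟨fun h => .inr ⟨ha, h⟩, ?_⟩
    rintro (h | ⟨_, h⟩)
    · exact ha.imp h.symm.trans h.symm.trans
    · exact h
  · obtain ⟨C, hC⟩ := exists_isCyc f a
    have hC' : IsCyc g a C := hC.of_swap hg
      (fun h => ha (.inl (hC.mem_iff.1 h))) (fun h => ha (.inr (hC.mem_iff.1 h)))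
    rw [← hC.mem_iff, ← hC'.mem_iff]
    tauto

theorem card_orbits_join [Finite α] [DecidableEq α] {f g : Equiv.Perm α} {y z : α}
    (hg : ∀ x, g x = Equiv.swap y z (f x)) (hyz : ¬ f.SameCycle y z) :
    Nat.card (Quotient (Equiv.Perm.SameCycle.setoid g)) + 1 =
      Nat.card (Quotient (Equiv.Perm.SameCycle.setoid f)) :=
  card_quotient_merge (mem_join_iff hg hyz) hyz

theorem not_sameCycle_of_sameCycle [Finite α] [DecidableEq α] {f g : Equiv.Perm α} {y z : α}
    (hg : ∀ x, g x = Equiv.swap y z (f x)) (hne : y ≠ z) (hyz : f.SameCycle y z) :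
    ¬ g.SameCycle y z := by
  obtain ⟨A, hA⟩ := exists_isCyc f z
  have hy := hA.mem_iff.2 hyz.symm
  rcases List.mem_cons.1 hy with h | h
  · exact absurd h hne
  · obtain ⟨A, B, rfl⟩ := List.append_of_mem h
    obtain ⟨h1, h2⟩ := hA.split_self hg
    rw [g.sameCycle_comm, ← h1.mem_iff]
    have := hA.1
    simp only [List.nodup_cons, List.nodup_append, List.mem_append, List.mem_cons] at this ⊢
    grind

end Orbits

variable {m : ℕ} {V : Type*}

/-- Rotation by one step around the vertices. -/
def rot (m : ℕ) (V : Type*) : Equiv.Perm (V × Port m) where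
  toFun x := (x.1, x.2.ccw)
  invFun x := (x.1, x.2.cw)
  left_inv x := by simp [Port.cw_ccw]
  right_inv x := by simp [Port.ccw_cw]

/-- Going around the regions of the complement of a graph. -/
def fc (G : Equiv.Perm (V × Port m)) : Equiv.Perm (V × Port m) := (rot m V).trans G

theorem fc_apply (G : Equiv.Perm (V × Port m)) (x : V × Port m) :
    fc G x = G (x.1, x.2.ccw) := rfl

/-- There is an edge with ends at `u` and `v`, or a leaf edge at `u = v`. -/
def Adj (G : Equiv.Perm (V × Port m)) (u v : V) : Prop := ∃ p q, G (u, p) = (v, q)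

theorem adj_fc (G : Equiv.Perm (V × Port m)) (x : V × Port m) : Adj G x.1 (fc G x).1 :=
  ⟨_, _, rfl⟩

theorem eqvGen_of_sameCycle [Finite V] {G : Equiv.Perm (V × Port m)} {x y : V × Port m}
    (h : (fc G).SameCycle x y) : Relation.EqvGen (Adj G) x.1 y.1 := by
  obtain ⟨n, rfl⟩ := h.exists_nat_pow_eq
  induction n with
  | zero => exact .refl _
  | succ n ih =>
    rw [pow_succ', Equiv.Perm.mul_apply]
    exact (ih ⟨n, by simp⟩).trans _ _ _ (.rel _ _ (adj_fc G _))

theorem eqvGen_join [DecidableEq (V × Port m)] {G G' : Equiv.Perm (V × Port m)} {y z : V × Port m}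
    (hG : ∀ x, G x = Equiv.swap y z (G' x)) (hy : G' y = y) (hz : G' z = z) (a b : V) :
    Relation.EqvGen (Adj G) a b ↔ Relation.EqvGen (Adj G') a b ∨
      (Relation.EqvGen (Adj G') a y.1 ∨ Relation.EqvGen (Adj G') a z.1) ∧
      (Relation.EqvGen (Adj G') b y.1 ∨ Relation.EqvGen (Adj G') b z.1) := by
  have hyz : Relation.EqvGen (Adj G) y.1 z.1 :=
    .rel _ _ ⟨y.2, z.2, by rw [hG, Prod.mk.eta, hy, Equiv.swap_apply_left]⟩
  have hsub : ∀ {a b}, Relation.EqvGen (Adj G') a b → Relation.EqvGen (Adj G) a b := by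
    intro a b h
    induction h with
    | refl => exact .refl _
    | symm _ _ _ ih => exact ih.symm
    | trans _ _ _ _ _ ih1 ih2 => exact ih1.trans _ _ _ ih2
    | rel a b hab =>
      obtain ⟨p, q, h⟩ := hab
      by_cases h1 : (b, q) = y
      · have : (a, p) = y := G'.injective (by rw [h, hy, h1])
        rw [← h1] at this
        cases this
        exact .refl _
      by_cases h2 : (b, q) = z
      · have : (a, p) = z := G'.injective (by rw [h, hz, h2])
        rw [← h2] at this
        cases this
        exact .refl _
      exact .rel _ _ ⟨p, q, by rw [hG, h, Equiv.swap_apply_of_ne_of_ne h1 h2]⟩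
  constructor
  · intro h
    induction h with
    | refl => exact .inl (.refl _)
    | symm a b _ ih => exact ih.imp (fun h => h.symm) (fun h => ⟨h.2, h.1⟩)
    | trans a b c _ _ ih1 ih2 =>
      rcases ih1 with h1 | ⟨h1, h1'⟩ <;> rcases ih2 with h2 | ⟨h2, h2'⟩
      · exact .inl (h1.trans _ _ _ h2)
      · exact .inr ⟨h2.imp (h1.trans _ _ _) (h1.trans _ _ _), h2'⟩
      · exact .inr ⟨h1, h1'.imp (h2.symm.trans _ _ _) (h2.symm.trans _ _ _)⟩
      · exact .inr ⟨h1, h2'⟩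
    | rel a b hab =>
      obtain ⟨p, q, h⟩ := hab
      rw [hG] at h
      by_cases h1 : G' (a, p) = y
      · have h3 : (a, p) = y := G'.injective (by rw [h1, hy])
        rw [h1, Equiv.swap_apply_left] at h
        subst h
        exact .inr ⟨.inl (by rw [← h3]; exact .refl _), .inr (.refl _)⟩
      by_cases h2 : G' (a, p) = z
      · have h3 : (a, p) = z := G'.injective (by rw [h2, hz])
        rw [h2, Equiv.swap_apply_right] at h
        subst h
        exact .inr ⟨.inr (by rw [← h3]; exact .refl _), .inl (.refl _)⟩
      rw [Equiv.swap_apply_of_ne_of_ne h1 h2] at h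
      exact .inl (.rel _ _ ⟨p, q, h⟩)
  · rintro (h | ⟨h1, h2⟩)
    · exact hsub h
    · have h3 : ∀ {c}, (Relation.EqvGen (Adj G') c y.1 ∨ Relation.EqvGen (Adj G') c z.1) →
          Relation.EqvGen (Adj G) c z.1 := by
        rintro c (h | h)
        · exact (hsub h).trans _ _ _ hyz
        · exact hsub h
      exact (h3 h1).trans _ _ _ (h3 h2).symm

theorem ncard_ne_swap [Finite V] [DecidableEq (V × Port m)] {G G' : Equiv.Perm (V × Port m)}
    {y z : V × Port m} (hG : ∀ x, G x = Equiv.swap y z (G' x)) (hy : G' y = y) (hz : G' z = z)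
    (hyz : y ≠ z) (S : Set (V × Port m)) (hyS : y ∈ S) (hzS : z ∈ S) :
    {x | x ∈ S ∧ G x ≠ x}.ncard = {x | x ∈ S ∧ G' x ≠ x}.ncard + 2 := by
  have h : {x | x ∈ S ∧ G x ≠ x} = insert y (insert z {x | x ∈ S ∧ G' x ≠ x}) := by
    ext x
    simp only [Set.mem_ofPred_eq, Set.mem_insert_iff, hG]
    by_cases h1 : x = y
    · subst h1; simp [hy, hyz.symm, hyS]
    by_cases h2 : x = z
    · subst h2; simp [hz, hyz, hzS]
    have h3 : G' x ≠ y := fun h => h1 (G'.injective (by rw [h, hy]))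
    have h4 : G' x ≠ z := fun h => h2 (G'.injective (by rw [h, hz]))
    rw [Equiv.swap_apply_of_ne_of_ne h3 h4]
    simp [h1, h2]
  rw [h, Set.ncard_insert_of_notMem _ (Set.toFinite _),
    Set.ncard_insert_of_notMem _ (Set.toFinite _)] <;> simp [hy, hz, hyz]

/-- The number of vertices and faces of a rotation system is at most the number of its edges plus
twice the number of its components (all numbers are doubled here). The inequality is preserved when
an edge is added: the new edge joins two faces, or divides a face of a single component. -/
theorem genus_inequality [Finite V] (hm : 3 ≤ m) (G : Equiv.Perm (V × Port m))
    (hG : ∀ x, G (G x) = x) :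
    2 * Nat.card V + 2 * Nat.card (Quotient (Equiv.Perm.SameCycle.setoid (fc G))) ≤
      {x | x ∈ Set.univ ∧ G x ≠ x}.ncard +
        4 * Nat.card (Quotient (Relation.EqvGen.setoid (Adj G))) := by
  classical
  induction hk : {x | x ∈ Set.univ ∧ G x ≠ x}.ncard using Nat.strong_induction_on generalizing G with
  | _ k ih
  by_cases hfix : ∀ x, G x = x
  · have h1 : Nat.card (Quotient (Equiv.Perm.SameCycle.setoid (fc G))) ≤ Nat.card V := by
      refine Nat.card_le_card_of_injective
        (fun c : Quotient (Equiv.Perm.SameCycle.setoid (fc G)) => c.out.1) ?_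
      intro c d hcd
      simp only at hcd
      have key : ∀ x : V × Port m, (fc G).SameCycle (x.1, .into ⟨1, by omega⟩) x := by
        rintro ⟨v, p⟩
        obtain ⟨n, rfl⟩ := Port.exists_ccw_iterate hm p
        induction n with
        | zero => exact .refl _ _
        | succ n ih =>
          refine ih.trans ⟨1, ?_⟩
          rw [zpow_one, fc_apply, hfix, Function.iterate_succ_apply']
      rw [← c.out_eq, ← d.out_eq]
      refine Quotient.sound ((key _).symm.trans ?_)
      rw [hcd]
      exact key _
    have h2 : Nat.card V ≤ Nat.card (Quotient (Relation.EqvGen.setoid (Adj G))) := by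
      refine Nat.card_le_card_of_injective (fun v => Quotient.mk _ v) ?_
      intro u v huv
      have h : Relation.EqvGen (Adj G) u v := Quotient.exact huv
      induction h with
      | refl => rfl
      | symm a b _ ih => exact (ih (Quotient.sound (by assumption))).symm
      | trans a b c h1 h2 ih1 ih2 => exact (ih1 (Quotient.sound h1)).trans (ih2 (Quotient.sound h2))
      | rel a b h =>
        obtain ⟨p, q, h⟩ := h
        rw [hfix] at h
        cases h; rfl
    omega
  push Not at hfix
  obtain ⟨y, hy⟩ := hfix
  obtain ⟨z, hz⟩ : ∃ z, G y = z := ⟨_, rfl⟩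
  have hz' : G z = y := by rw [← hz, hG]
  have hyz : y ≠ z := by rw [← hz]; exact Ne.symm hy
  obtain ⟨G', hG'⟩ : ∃ G', G' = Equiv.swap y z * G := ⟨_, rfl⟩
  have e1 : ∀ x, G' x = Equiv.swap y z (G x) := fun x => by rw [hG']; rfl
  have e2 : ∀ x, G x = Equiv.swap y z (G' x) := fun x => by rw [e1, Equiv.swap_apply_self]
  have hy' : G' y = y := by rw [e1, hz, Equiv.swap_apply_right]
  have hzz : G' z = z := by rw [e1, hz', Equiv.swap_apply_left]
  have inv' : ∀ x, G' (G' x) = x := by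
    intro x
    by_cases h1 : x = y
    · rw [h1, hy', hy']
    by_cases h2 : x = z
    · rw [h2, hzz, hzz]
    have h3 : G x ≠ y := fun h => h2 (by rw [← hz, ← h, hG])
    have h4 : G x ≠ z := fun h => h1 (by rw [← hz', ← h, hG])
    rw [e1 x, Equiv.swap_apply_of_ne_of_ne h3 h4, e1, hG, Equiv.swap_apply_of_ne_of_ne h1 h2]
  have hcard := ncard_ne_swap e2 hy' hzz hyz Set.univ trivial trivial
  have IH := ih _ (by omega) G' inv' rfl
  have f1 : ∀ x, fc G x = Equiv.swap y z (fc G' x) := fun x => e2 _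
  have f2 : ∀ x, fc G' x = Equiv.swap y z (fc G x) := fun x => e1 _
  by_cases hs : (fc G').SameCycle y z
  · have hF := card_orbits_join f2 (not_sameCycle_of_sameCycle f1 hyz hs)
    have hc : Relation.EqvGen.setoid (Adj G) = Relation.EqvGen.setoid (Adj G') := by
      ext a b
      have h0 := eqvGen_of_sameCycle hs
      refine (eqvGen_join e2 hy' hzz a b).trans ⟨?_, .inl⟩
      rintro (h | ⟨h1 | h1, h2 | h2⟩)
      · exact h
      · exact h1.trans _ _ _ h2.symm
      · exact h1.trans _ _ _ (h0.trans _ _ _ h2.symm)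
      · exact h1.trans _ _ _ (h2.trans _ _ _ h0).symm
      · exact h1.trans _ _ _ h2.symm
    rw [hc]
    omega
  · have hF := card_orbits_join f1 hs
    by_cases hc : Relation.EqvGen (Adj G') y.1 z.1
    · have hc' : Relation.EqvGen.setoid (Adj G) = Relation.EqvGen.setoid (Adj G') := by
        ext a b
        refine (eqvGen_join e2 hy' hzz a b).trans ⟨?_, .inl⟩
        rintro (h | ⟨h1 | h1, h2 | h2⟩)
        · exact h
        · exact h1.trans _ _ _ h2.symm
        · exact h1.trans _ _ _ (hc.trans _ _ _ h2.symm)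
        · exact h1.trans _ _ _ (h2.trans _ _ _ hc).symm
        · exact h1.trans _ _ _ h2.symm
      rw [hc']
      omega
    · have := card_quotient_merge (r := Relation.EqvGen.setoid (Adj G'))
        (s := Relation.EqvGen.setoid (Adj G)) (eqvGen_join e2 hy' hzz) hc
      omega

end Bordered

/-! ### Tiling graphs on a set of vertices -/

namespace Bordered

namespace Port

/-- A choice of one of the sectors of each index: `U₁`, `Uₘ` and the `R i`. -/
def IsPref {m : ℕ} : Port m → Prop
  | into _ => True
  | outOf k => k.1 = 1

theorem isPref_of_across_eq {m : ℕ} {p : Port m} (h : p.across = p) : p.IsPref := by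
  rcases p with ⟨k, h1, h2⟩ | ⟨k, h1, h2⟩
  · trivial
  · simp only [across, ccw, IsPref] at h ⊢
    split_ifs at h with h3
    · exact h3
    · simp only [flip, reduceCtorEq] at h

theorem isPref_across {m : ℕ} {p : Port m} (h : p.across ≠ p) : p.across.IsPref ↔ ¬ p.IsPref := by
  rcases p with ⟨k, h1, h2⟩ | ⟨k, h1, h2⟩
  · simp only [across, ccw, IsPref] at h ⊢
    split_ifs at h ⊢ with h3
    · simp only [flip, not_true, iff_false]; omega
    · simp only [flip, ne_eq, not_true] at h
  · simp only [across, ccw, IsPref] at h ⊢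
    split_ifs at h ⊢ with h3
    · simp only [flip, ne_eq, not_true] at h
    · simp [flip, h3]

end Port

variable {m : ℕ} {V V' : Type*}

/-- There is an edge from the vertex `u` to the vertex `v`. -/
def Arr (G : Equiv.Perm (V × Port m)) (u v : V) : Prop :=
  ∃ k : Node m, G (u, .outOf k) = (v, .into k)

/-- The part of the graph `G` with the vertices `S`, rooted at `r`, satisfies all the
conditions on a tiling graph with the possible exception of Euler's formula. -/
structure PreTiling (S : Set V) (G : Equiv.Perm (V × Port m)) (r : V × Port m) : Prop where
  root_mem : r.1 ∈ S
  mem : ∀ x, x.1 ∈ S → (G x).1 ∈ S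
  invol : ∀ x, x.1 ∈ S → G (G x) = x
  compat : ∀ x, x.1 ∈ S → G x ≠ x → (G x).2 = x.2.flip
  root_leaf : G r = r
  conn : ∀ u ∈ S, Relation.ReflTransGen (Adj G) r.1 u
  leaves : ∀ x, x.1 ∈ S → G x = x → (fc G).SameCycle r x
  cycles : ∀ u ∈ S, ∀ v, Relation.ReflTransGen (Arr G) u v →
    Relation.ReflTransGen (Arr G) v u → u = v
  regions : ∀ x, x.1 ∈ S → ¬ (fc G).SameCycle r x →
    (x.2.across = x.2 ∧ fc G x = x) ∨
    (x.2.across ≠ x.2 ∧ fc G x ≠ x ∧ fc G (fc G x) = x)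

/-- One sector of each inner region. -/
def innerPref (S : Set V) (G : Equiv.Perm (V × Port m)) (r : V × Port m) : Set (V × Port m) :=
  {x | x.1 ∈ S ∧ ¬ (fc G).SameCycle r x ∧ x.2.IsPref}

/-- The part of the graph `G` with the vertices `S`, rooted at `r`, is a tiling graph. Euler's
formula is expressed by counting the inner regions. -/
structure IsTiling (S : Set V) (G : Equiv.Perm (V × Port m)) (r : V × Port m) : Prop
    extends PreTiling S G r where
  euler : 2 * S.ncard + 2 * ((innerPref S G r).ncard + 1) = {x | x.1 ∈ S ∧ G x ≠ x}.ncard + 4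

/-- The number of inner regions of type `i + 1`. -/
noncomputable def wt (S : Set V) (G : Equiv.Perm (V × Port m)) (r : V × Port m) (i : Fin m) : ℕ :=
  {x | x ∈ innerPref S G r ∧ x.2.sector.index = i.1 + 1}.ncard

open Classical in
/-- The letter of a sector, with the information whether the preceding edge is a leaf edge. -/
noncomputable def mark (G : Equiv.Perm (V × Port m)) (x : V × Port m) : Bool × Letter m :=
  (decide (G x = x), x.2.sector)

/-- The letters around the outer region. -/
noncomputable def word (G : Equiv.Perm (V × Port m)) (r : V × Port m) : List (Bool × Letter m) :=
  (List.iterate (fc G) r (Function.minimalPeriod (fc G) r)).map (mark G)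

theorem IsCyc.word_eq {G : Equiv.Perm (V × Port m)} {r : V × Port m} {l : List (V × Port m)}
    (h : IsCyc (fc G) r l) : word G r = (r :: l).map (mark G) := by
  rw [word, ← h.eq_iterate]

theorem sum_wt [Finite V] (S : Set V) (G : Equiv.Perm (V × Port m)) (r : V × Port m) :
    ∑ i, wt S G r i = (innerPref S G r).ncard := by
  classical
  have hfin : (innerPref S G r).Finite := Set.toFinite _
  choose f hf using fun p : Port m => p.exists_index
  rw [Set.ncard_eq_toFinset_card _ hfin,
    Finset.card_eq_sum_card_fiberwise (f := fun x => f x.2) (t := Finset.univ) (by simp)]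
  refine Finset.sum_congr rfl fun i _ => ?_
  rw [wt, ← Set.ncard_coe_finset]
  congr 1
  ext x
  simp only [Set.mem_ofPred_eq, Finset.coe_filter, Set.Finite.mem_toFinset, hf, Nat.add_right_cancel_iff,
    Fin.ext_iff]

namespace PreTiling

variable {S : Set V} {G : Equiv.Perm (V × Port m)} {r x : V × Port m}

theorem mem_fc (h : PreTiling S G r) (hx : x.1 ∈ S) : (fc G x).1 ∈ S :=
  h.mem _ hx

theorem mem_of_sameCycle [Finite V] (h : PreTiling S G r) {y : V × Port m} (hx : x.1 ∈ S)
    (hxy : (fc G).SameCycle x y) : y.1 ∈ S := by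
  obtain ⟨n, rfl⟩ := hxy.exists_nat_pow_eq
  induction n with
  | zero => exact hx
  | succ n ih =>
    rw [pow_succ', Equiv.Perm.mul_apply]
    exact h.mem_fc (ih ⟨n, by simp⟩)

theorem rot_ne (h : PreTiling S G r) (hx : x.1 ∈ S) (hi : ¬ (fc G).SameCycle r x) :
    G (x.1, x.2.ccw) ≠ (x.1, x.2.ccw) := by
  intro h0
  have h1 := h.leaves (x.1, x.2.ccw) hx h0
  refine hi (h1.trans (Equiv.Perm.SameCycle.symm ⟨1, ?_⟩))
  rw [zpow_one, fc_apply, h0]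

theorem port_fc (h : PreTiling S G r) (hx : x.1 ∈ S) (hi : ¬ (fc G).SameCycle r x) :
    (fc G x).2 = x.2.across :=
  h.compat _ hx (h.rot_ne hx hi)

theorem fc_fc (h : PreTiling S G r) (hx : x.1 ∈ S) (hi : ¬ (fc G).SameCycle r x) :
    fc G (fc G x) = x := by
  rcases h.regions x hx hi with ⟨_, h1⟩ | ⟨_, _, h1⟩
  · rw [h1, h1]
  · exact h1

theorem sameCycle_iff [Finite V] (h : PreTiling S G r) (hx : x.1 ∈ S)
    (hi : ¬ (fc G).SameCycle r x) (y : V × Port m) :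
    (fc G).SameCycle x y ↔ y = x ∨ y = fc G x := by
  constructor
  · intro hxy
    obtain ⟨n, rfl⟩ := hxy.exists_nat_pow_eq
    clear hxy
    induction n with
    | zero => exact .inl rfl
    | succ n ih =>
      rw [pow_succ', Equiv.Perm.mul_apply]
      rcases ih with ih | ih
      · rw [ih]; exact .inr rfl
      · rw [ih, h.fc_fc hx hi]; exact .inl rfl
  · rintro (rfl | rfl)
    · exact .refl _ _
    · exact ⟨1, by simp⟩

/-- Every inner region contains exactly one of the preferred sectors. -/
theorem card_faces [Finite V] (h : PreTiling Set.univ G r) (P : ℕ → Prop) :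
    Nat.card {F : Quotient (Equiv.Perm.SameCycle.setoid (fc G)) // F ≠ Quotient.mk _ r ∧
      ∃ x, F = Quotient.mk _ x ∧ P x.2.sector.index} =
    {x | x ∈ innerPref Set.univ G r ∧ P x.2.sector.index}.ncard := by
  symm
  rw [← Nat.card_coe_set_eq]
  refine Nat.card_congr (Equiv.ofBijective (fun x => ⟨Quotient.mk _ x.1,
    fun h0 => x.2.1.2.1 ((Quotient.exact h0 : (fc G).SameCycle x.1 r).symm),
    x.1, rfl, x.2.2⟩) ⟨?_, ?_⟩)
  · rintro ⟨x, ⟨hx1, hx2, hx3⟩, hx4⟩ ⟨y, ⟨hy1, hy2, hy3⟩, hy4⟩ hxy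
    have h0 : (fc G).SameCycle x y := Quotient.exact (congrArg Subtype.val hxy)
    refine Subtype.ext ?_
    rcases (h.sameCycle_iff hx1 hx2 y).1 h0 with h1 | h1
    · exact h1.symm
    · rcases h.regions x hx1 hx2 with ⟨_, h2⟩ | ⟨h2, _, _⟩
      · exact (h1.trans h2).symm
      · have h3 := h.port_fc hx1 hx2
        rw [← h1] at h3
        rw [h3, Port.isPref_across h2] at hy3
        exact absurd hx3 hy3
  · rintro ⟨F, hF, x, rfl, hP⟩
    have hi : ¬ (fc G).SameCycle r x := fun h0 => hF (Quotient.sound h0.symm)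
    by_cases hp : x.2.IsPref
    · exact ⟨⟨x, ⟨trivial, hi, hp⟩, hP⟩, rfl⟩
    · have h1 : x.2.across ≠ x.2 := fun h1 => hp (Port.isPref_of_across_eq h1)
      have h2 : (fc G).SameCycle x (fc G x) := ⟨1, by simp⟩
      refine ⟨⟨fc G x, ⟨trivial, fun h0 => hi (h0.trans h2.symm), ?_⟩, ?_⟩, ?_⟩
      · rw [h.port_fc trivial hi, Port.isPref_across h1]; exact hp
      · rw [h.port_fc trivial hi, Port.index_across]; exact hP
      · exact Subtype.ext (Quotient.sound h2.symm)

theorem card_all_faces [Finite V] (h : PreTiling Set.univ G r) :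
    Nat.card (Quotient (Equiv.Perm.SameCycle.setoid (fc G))) =
      (innerPref Set.univ G r).ncard + 1 := by
  classical
  rw [← Nat.card_congr (Equiv.optionSubtypeNe (Quotient.mk _ r)), Finite.card_option]
  have := h.card_faces (fun _ => True)
  simp only [and_true, Set.ofPred_mem_eq] at this
  rw [← this]
  congr 1
  refine Nat.card_congr (Equiv.subtypeEquivRight fun F => ?_)
  refine ⟨fun h => ⟨h, F.out, F.out_eq.symm⟩, fun h => h.1⟩

end PreTiling

/-! ### Isomorphisms -/

/-- The map `φ` of vertices is an isomorphism of rooted graphs from the part with vertices `S` of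
`G` to the part with vertices `S'` of `G'`. -/
structure IsIso (φ : V → V') (S : Set V) (G : Equiv.Perm (V × Port m)) (r : V × Port m)
    (S' : Set V') (G' : Equiv.Perm (V' × Port m)) (r' : V' × Port m) : Prop where
  bij : Set.BijOn φ S S'
  comm : ∀ x, x.1 ∈ S → G' (Prod.map φ id x) = Prod.map φ id (G x)
  root : Prod.map φ id r = r'

namespace IsIso

variable {φ : V → V'} {S : Set V} {G : Equiv.Perm (V × Port m)} {r : V × Port m}
  {S' : Set V'} {G' : Equiv.Perm (V' × Port m)} {r' : V' × Port m}

theorem injOn (h : IsIso φ S G r S' G' r') :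
    Set.InjOn (Prod.map φ id : V × Port m → V' × Port m) {x | x.1 ∈ S} := by
  rintro ⟨u, p⟩ hu ⟨v, q⟩ hv huv
  simp only [Prod.map_apply, id_eq, Prod.mk.injEq] at huv
  exact Prod.ext (h.bij.injOn hu hv huv.1) huv.2

theorem surjOn (h : IsIso φ S G r S' G' r') (x' : V' × Port m) (hx' : x'.1 ∈ S') :
    ∃ x : V × Port m, x.1 ∈ S ∧ Prod.map φ id x = x' := by
  obtain ⟨u, hu, hu'⟩ := h.bij.surjOn hx'
  exact ⟨(u, x'.2), hu, Prod.ext hu' rfl⟩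

theorem comm_fc (h : IsIso φ S G r S' G' r') (x : V × Port m) (hx : x.1 ∈ S) :
    fc G' (Prod.map φ id x) = Prod.map φ id (fc G x) :=
  h.comm (x.1, x.2.ccw) hx

theorem isCyc [Finite V] (h : IsIso φ S G r S' G' r') (ht : PreTiling S G r)
    {x : V × Port m} (hx : x.1 ∈ S) {l : List (V × Port m)} (hl : IsCyc (fc G) x l) :
    IsCyc (fc G') (Prod.map φ id x) (l.map (Prod.map φ id)) :=
  hl.map _ (h.injOn.mono fun _ hy => ht.mem_of_sameCycle hx (hl.mem_iff.1 hy))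
    fun y hy => h.comm_fc y (ht.mem_of_sameCycle hx (hl.mem_iff.1 hy))

theorem sameCycle_iff [Finite V] (h : IsIso φ S G r S' G' r') (ht : PreTiling S G r)
    {x : V × Port m} (hx : x.1 ∈ S) :
    (fc G').SameCycle r' (Prod.map φ id x) ↔ (fc G).SameCycle r x := by
  obtain ⟨l, hl⟩ := exists_isCyc (fc G) r
  have hl' := h.isCyc ht ht.root_mem hl
  rw [h.root] at hl'
  rw [← hl.mem_iff, ← hl'.mem_iff, ← h.root, ← List.map_cons, List.mem_map]
  constructor
  · rintro ⟨y, hy, hyx⟩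
    rwa [← h.injOn (ht.mem_of_sameCycle ht.root_mem (hl.mem_iff.1 hy)) hx hyx]
  · exact fun hx => ⟨x, hx, rfl⟩

theorem leaf_iff (h : IsIso φ S G r S' G' r') (ht : PreTiling S G r)
    {x : V × Port m} (hx : x.1 ∈ S) :
    G' (Prod.map φ id x) = Prod.map φ id x ↔ G x = x := by
  rw [h.comm x hx]
  exact h.injOn.eq_iff (ht.mem x hx) hx

theorem mark_eq (h : IsIso φ S G r S' G' r') (ht : PreTiling S G r)
    {x : V × Port m} (hx : x.1 ∈ S) : mark G' (Prod.map φ id x) = mark G x :=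
  Prod.ext (decide_eq_decide.2 (h.leaf_iff ht hx)) rfl

theorem word_eq [Finite V] (h : IsIso φ S G r S' G' r') (ht : PreTiling S G r) :
    word G' r' = word G r := by
  obtain ⟨l, hl⟩ := exists_isCyc (fc G) r
  have hl' := h.isCyc ht ht.root_mem hl
  rw [h.root] at hl'
  rw [hl.word_eq, hl'.word_eq, ← h.root, ← List.map_cons, List.map_map]
  exact List.map_congr_left fun x hx =>
    h.mark_eq ht (ht.mem_of_sameCycle ht.root_mem (hl.mem_iff.1 hx))

theorem ncard_eq (h : IsIso φ S G r S' G' r') {P : V × Port m → Prop} {P' : V' × Port m → Prop}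
    (hP : ∀ x, x.1 ∈ S → (P' (Prod.map φ id x) ↔ P x)) :
    {x | x.1 ∈ S' ∧ P' x}.ncard = {x | x.1 ∈ S ∧ P x}.ncard := by
  have : {x | x.1 ∈ S' ∧ P' x} = Prod.map φ id '' {x | x.1 ∈ S ∧ P x} := by
    ext x'
    constructor
    · rintro ⟨h1, h2⟩
      obtain ⟨x, hx, rfl⟩ := h.surjOn x' h1
      exact ⟨x, ⟨hx, (hP x hx).1 h2⟩, rfl⟩
    · rintro ⟨x, ⟨h1, h2⟩, rfl⟩
      exact ⟨h.bij.mapsTo h1, (hP x h1).2 h2⟩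
  rw [this, (h.injOn.mono fun x hx => hx.1).ncard_image]

theorem wt_eq [Finite V] (h : IsIso φ S G r S' G' r') (ht : PreTiling S G r) :
    wt S' G' r' = wt S G r := by
  funext i
  simp only [wt, innerPref, Set.mem_ofPred_eq, and_assoc]
  refine h.ncard_eq fun x hx => ?_
  rw [h.sameCycle_iff ht hx]
  rfl

theorem adj (h : IsIso φ S G r S' G' r') (hmem : ∀ x, x.1 ∈ S → (G x).1 ∈ S) {u v : V}
    (hu : u ∈ S) (huv : Relation.ReflTransGen (Adj G) u v) :
    v ∈ S ∧ Relation.ReflTransGen (Adj G') (φ u) (φ v) := by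
  induction huv with
  | refl => exact ⟨hu, .refl⟩
  | tail _ hbc ih =>
    obtain ⟨p, q, hpq⟩ := hbc
    refine ⟨by have := hmem (_, p) ih.1; rwa [hpq] at this, ih.2.tail ⟨p, q, ?_⟩⟩
    have := h.comm (_, p) ih.1
    rw [hpq] at this
    exact this

theorem arr (h : IsIso φ S G r S' G' r') (ht : PreTiling S G r) {u : V} {v' : V'}
    (hu : u ∈ S) (huv : Relation.ReflTransGen (Arr G') (φ u) v') :
    ∃ v ∈ S, φ v = v' ∧ Relation.ReflTransGen (Arr G) u v := by
  induction huv with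
  | refl => exact ⟨u, hu, rfl, .refl⟩
  | tail _ hbc ih =>
    obtain ⟨v, hv, rfl, hr⟩ := ih
    obtain ⟨k, hk⟩ := hbc
    have h1 := h.comm (v, .outOf k) hv
    have h2 := h1.symm.trans hk
    refine ⟨(G (v, .outOf k)).1, ht.mem _ hv, congrArg Prod.fst h2, hr.tail ⟨k, ?_⟩⟩
    exact Prod.ext rfl (show (G (v, .outOf k)).2 = .into k from (Prod.ext_iff.1 h2).2)

theorem preTiling [Finite V] (h : IsIso φ S G r S' G' r') (ht : PreTiling S G r) :
    PreTiling S' G' r' where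
  root_mem := by rw [← h.root]; exact h.bij.mapsTo ht.root_mem
  mem x' hx' := by
    obtain ⟨x, hx, rfl⟩ := h.surjOn x' hx'
    rw [h.comm x hx]
    exact h.bij.mapsTo (ht.mem x hx)
  invol x' hx' := by
    obtain ⟨x, hx, rfl⟩ := h.surjOn x' hx'
    rw [h.comm x hx, h.comm _ (ht.mem x hx), ht.invol x hx]
  compat x' hx' := by
    obtain ⟨x, hx, rfl⟩ := h.surjOn x' hx'
    intro hne
    rw [ne_eq, h.leaf_iff ht hx] at hne
    rw [h.comm x hx]
    exact ht.compat x hx hne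
  root_leaf := by rw [← h.root, h.leaf_iff ht ht.root_mem, ht.root_leaf]
  conn u' hu' := by
    obtain ⟨u, hu, rfl⟩ := h.bij.surjOn hu'
    rw [← h.root]
    exact (h.adj ht.mem ht.root_mem (ht.conn u hu)).2
  leaves x' hx' := by
    obtain ⟨x, hx, rfl⟩ := h.surjOn x' hx'
    rw [h.leaf_iff ht hx, h.sameCycle_iff ht hx]
    exact ht.leaves x hx
  cycles u' hu' v' h1 h2 := by
    obtain ⟨u, hu, rfl⟩ := h.bij.surjOn hu'
    obtain ⟨v, hv, rfl, h3⟩ := h.arr ht hu h1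
    obtain ⟨w, hw, hwu, h4⟩ := h.arr ht hv h2
    rw [h.bij.injOn hw hu hwu] at h4
    rw [ht.cycles u hu v h3 h4]
  regions x' hx' := by
    obtain ⟨x, hx, rfl⟩ := h.surjOn x' hx'
    rw [h.sameCycle_iff ht hx, h.comm_fc x hx, h.comm_fc _ (ht.mem_fc hx), ne_eq, ne_eq,
      h.injOn.eq_iff (ht.mem_fc hx) hx, h.injOn.eq_iff (ht.mem_fc (ht.mem_fc hx)) hx]
    exact ht.regions x hx

theorem innerPref_eq [Finite V] (h : IsIso φ S G r S' G' r') (ht : PreTiling S G r) :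
    (innerPref S' G' r').ncard = (innerPref S G r).ncard :=
  h.ncard_eq fun x hx => by rw [h.sameCycle_iff ht hx]; rfl

theorem isTiling [Finite V] (h : IsIso φ S G r S' G' r') (ht : IsTiling S G r) :
    IsTiling S' G' r' where
  toPreTiling := h.preTiling ht.toPreTiling
  euler := by
    rw [h.innerPref_eq ht.toPreTiling, ← h.bij.image_eq, h.bij.injOn.ncard_image,
      ht.euler, h.bij.image_eq]
    congr 1
    exact (h.ncard_eq fun x hx => by rw [ne_eq, ne_eq, h.leaf_iff ht.toPreTiling hx]).symm

theorem refl (S : Set V) (G : Equiv.Perm (V × Port m)) (r : V × Port m) :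
    IsIso id S G r S G r :=
  ⟨Set.bijOn_id S, fun _ _ => rfl, rfl⟩

theorem symm (h : IsIso φ S G r S' G' r') (ht : PreTiling S G r) :
    ∃ ψ, IsIso ψ S' G' r' S G r := by
  have : Nonempty V := ⟨r.1⟩
  have hinv : Set.InvOn (Function.invFunOn φ S) φ S S' := h.bij.invOn_invFunOn
  have key : ∀ x : V × Port m, x.1 ∈ S →
      Prod.map (Function.invFunOn φ S) id (Prod.map φ id x) = x :=
    fun x hx => Prod.ext (hinv.1 hx) rfl
  refine ⟨Function.invFunOn φ S, hinv.symm.bijOn h.bij.surjOn.mapsTo_invFunOn h.bij.mapsTo,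
    fun x' hx' => ?_, by rw [← h.root, key r ht.root_mem]⟩
  obtain ⟨x, hx, rfl⟩ := h.surjOn x' hx'
  rw [key x hx, h.comm x hx, key _ (ht.mem x hx)]

theorem trans {V'' : Type*} {ψ : V' → V''} {S'' : Set V''} {G'' : Equiv.Perm (V'' × Port m)}
    {r'' : V'' × Port m} (h : IsIso φ S G r S' G' r') (h' : IsIso ψ S' G' r' S'' G'' r'') :
    IsIso (ψ ∘ φ) S G r S'' G'' r'' := by
  have key : ∀ x : V × Port m,
      (Prod.map (ψ ∘ φ) id x : V'' × Port m) = Prod.map ψ id (Prod.map φ id x) := fun x => rfl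
  refine ⟨h'.bij.comp h.bij, fun x hx => ?_, by rw [key, h.root, h'.root]⟩
  rw [key, h'.comm _ (h.bij.mapsTo hx), h.comm x hx, key]

end IsIso

end Bordered

/-! ### Isomorphism classes of tiling graphs -/

namespace Bordered

variable {m : ℕ} {V V' : Type*}

theorem reflTransGen_symm {α : Type*} {R : α → α → Prop} (hR : ∀ a b, R a b → R b a) {a b : α}
    (h : Relation.ReflTransGen R a b) : Relation.ReflTransGen R b a := by
  induction h with
  | refl => exact .refl
  | tail _ hbc ih => exact .head (hR _ _ hbc) ih

theorem ncard_univ_and {α : Type*} (P : V × α → Prop) :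
    {x : V × α | x.1 ∈ Set.univ ∧ P x}.ncard = Nat.card {x // P x} := by
  simp only [Set.mem_univ, true_and]
  exact (Nat.card_coe_set_eq _).symm

theorem TilingGraph.preTiling (Γ : TilingGraph m) : PreTiling Set.univ Γ.glue Γ.root where
  root_mem := trivial
  mem _ _ := trivial
  invol x _ := Γ.involutive x
  compat x _ := Γ.compatible x
  root_leaf := Γ.root_leaf
  conn u hu := by
    clear hu
    have h := Γ.connected Γ.root.1 u
    have hs : ∀ u v, Adj Γ.glue u v → Adj Γ.glue v u := by
      rintro u v ⟨p, q, h⟩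
      exact ⟨q, p, by rw [← h, Γ.involutive]⟩
    generalize Γ.root.1 = v at h
    induction h with
    | refl => exact .refl
    | symm _ _ _ ih => exact reflTransGen_symm hs ih
    | trans _ _ _ _ _ ih1 ih2 => exact ih1.trans ih2
    | rel a b h => obtain ⟨k, hk⟩ := h; exact .single ⟨_, _, hk⟩
  leaves x _ := Γ.leaves x
  cycles u _ := Γ.cycles u
  regions x _ hx := by
    have := Γ.regions x hx
    rwa [← not_or, ← Port.across_eq_self_iff] at this

theorem TilingGraph.isTiling (Γ : TilingGraph m) : IsTiling Set.univ Γ.glue Γ.root where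
  toPreTiling := Γ.preTiling
  euler := by
    have h1 := Γ.planar
    have h2 := Γ.preTiling.card_all_faces
    have h3 : Nat.card (Faces Γ.glue) =
      Nat.card (Quotient (Equiv.Perm.SameCycle.setoid (fc Γ.glue))) := rfl
    rw [Set.ncard_univ, Nat.card_eq_fintype_card, Fintype.card_fin, ← h2, ← h3, h1,
      ncard_univ_and]

theorem TilingGraph.weight_eq (Γ : TilingGraph m) :
    Γ.weight = wt Set.univ Γ.glue Γ.root := by
  funext i
  exact Γ.preTiling.card_faces (fun k => k = i.1 + 1)

/-- A graph on a finite set of vertices can be transported to `Fin d`. -/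
theorem PreTiling.exists_iso [Finite V] {S : Set V} {G : Equiv.Perm (V × Port m)}
    {r : V × Port m} (h : PreTiling S G r) :
    ∃ (d : ℕ) (H : Equiv.Perm (Fin d × Port m)) (r' : Fin d × Port m) (φ : V → Fin d),
      IsIso φ S G r Set.univ H r' := by
  classical
  have e : S ≃ Fin (Nat.card S) := Finite.equivFin S
  let E : {x : V × Port m // x.1 ∈ S} ≃ Fin (Nat.card S) × Port m :=
    { toFun := fun x => (e ⟨x.1.1, x.2⟩, x.1.2)
      invFun := fun y => ⟨((e.symm y.1).1, y.2), (e.symm y.1).2⟩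
      left_inv := fun x => Subtype.ext (Prod.ext (by simp only [Equiv.symm_apply_apply]) rfl)
      right_inv := fun y => Prod.ext (by simp only [Subtype.coe_eta, Equiv.apply_symm_apply]) rfl }
  let g : Fin (Nat.card S) × Port m → Fin (Nat.card S) × Port m := fun y =>
    E ⟨G (E.symm y).1, h.mem _ (E.symm y).2⟩
  have hg : Function.Involutive g := by
    intro y
    simp only [g, Equiv.symm_apply_apply, h.invol _ (E.symm y).2, Subtype.coe_eta,
      Equiv.apply_symm_apply]
  obtain ⟨H, hH⟩ : ∃ H : Equiv.Perm (Fin (Nat.card S) × Port m), ∀ y, H y = g y :=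
    ⟨Function.Involutive.toPerm g hg, fun _ => rfl⟩
  have hHinv : ∀ y, H (H y) = y := fun y => by rw [hH, hH, hg]
  let φ : V → Fin (Nat.card S) := fun v => if hv : v ∈ S then e ⟨v, hv⟩ else e ⟨r.1, h.root_mem⟩
  have hφ : ∀ x (hx : x.1 ∈ S), Prod.map φ id x = E ⟨x, hx⟩ :=
    fun x hx => Prod.ext (dif_pos hx) rfl
  have hiso : IsIso φ S G r Set.univ H (Prod.map φ id r) := by
    refine ⟨⟨fun _ _ => trivial, fun u hu v hv huv => ?_, fun i _ => ?_⟩, fun x hx => ?_, rfl⟩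
    · simp only [φ, dif_pos hu, dif_pos hv] at huv
      exact congrArg Subtype.val (e.injective huv)
    · exact ⟨e.symm i, (e.symm i).2, by
        simp only [φ, dif_pos (e.symm i).2, Subtype.coe_eta, Equiv.apply_symm_apply]⟩
    · rw [hH, hφ x hx, hφ _ (h.mem x hx)]
      simp only [g, Equiv.symm_apply_apply]
  exact ⟨_, H, _, φ, hiso⟩

theorem IsTiling.exists_tilingGraph [Finite V] {S : Set V} {G : Equiv.Perm (V × Port m)}
    {r : V × Port m} (h : IsTiling S G r) :
    ∃ (Γ : TilingGraph m) (φ : V → Fin Γ.d), IsIso φ S G r Set.univ Γ.glue Γ.root := by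
  obtain ⟨d, H, r', φ, hiso⟩ := h.toPreTiling.exists_iso
  have ht := hiso.isTiling h
  refine ⟨{ d := d, glue := H, involutive := fun x => ht.invol x trivial,
            compatible := fun x => ?_,
            root := r', root_leaf := ht.root_leaf, connected := ?_,
            leaves := fun x => ht.leaves x trivial, planar := ?_,
            cycles := fun u => ht.cycles u trivial, regions := fun x hx => ?_ }, φ, hiso⟩
  · exact ht.compat x trivial
  · have key : ∀ u, Relation.EqvGen (Arrow H) r'.1 u := by
      intro u
      have := ht.conn u trivial
      induction this with
      | refl => exact .refl _
      | @tail b c _ hbc ih =>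
        refine ih.trans _ _ _ ?_
        obtain ⟨p, q, hpq⟩ := hbc
        by_cases hfix : H (b, p) = (b, p)
        · rw [hfix] at hpq
          cases hpq
          exact .refl _
        · have hc := ht.compat (b, p) trivial hfix
          rw [hpq] at hc
          simp only at hc
          subst hc
          cases p with
          | outOf k => exact .rel _ _ ⟨k, hpq⟩
          | into k =>
            refine .symm _ _ (.rel _ _ ⟨k, ?_⟩)
            have := ht.invol (b, .into k) trivial
            rwa [hpq] at this
    exact fun u v => (key u).symm.trans _ _ _ (key v)
  · have h1 := ht.euler
    rw [← ht.toPreTiling.card_all_faces, Set.ncard_univ, Nat.card_eq_fintype_card,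
      Fintype.card_fin] at h1
    rw [ncard_univ_and] at h1
    exact h1
  · rw [← not_or, ← Port.across_eq_self_iff]
    exact ht.regions x trivial hx

theorem TilingGraph.equiv_iff (Γ Γ' : TilingGraph m) :
    Γ ≈ Γ' ↔ ∃ φ, IsIso φ Set.univ Γ.glue Γ.root Set.univ Γ'.glue Γ'.root := by
  constructor
  · rintro ⟨e, h, hr⟩
    exact ⟨e, Set.bijOn_univ.2 e.bijective, fun x _ => (h x).symm, hr⟩
  · rintro ⟨φ, h⟩
    exact ⟨Equiv.ofBijective φ (Set.bijOn_univ.1 h.bij), fun x => (h.comm x trivial).symm, h.root⟩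

/-- Isomorphism classes of tiling graphs. -/
abbrev TClass (m : ℕ) := Quotient (TilingGraph.setoid m)

/-- The class `q` is the class of the part of `G` with the vertices `S` and the root `r`. -/
def Rep (q : TClass m) (S : Set V) (G : Equiv.Perm (V × Port m)) (r : V × Port m) : Prop :=
  ∃ φ, IsIso φ Set.univ q.out.glue q.out.root S G r

theorem rep_out (q : TClass m) : Rep q Set.univ q.out.glue q.out.root :=
  ⟨id, IsIso.refl _ _ _⟩

section Rep

variable {q q' : TClass m} {S : Set V} {G : Equiv.Perm (V × Port m)}
  {r : V × Port m} {S' : Set V'} {G' : Equiv.Perm (V' × Port m)} {r' : V' × Port m}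

theorem IsTiling.exists_rep [Finite V] (h : IsTiling S G r) : ∃ q : TClass m, Rep q S G r := by
  obtain ⟨Γ, φ, hφ⟩ := h.exists_tilingGraph
  obtain ⟨ψ, hψ⟩ := hφ.symm h.toPreTiling
  obtain ⟨χ, hχ⟩ := (TilingGraph.equiv_iff _ _).1
    (show (Quotient.mk _ Γ : TClass m).out ≈ Γ from Quotient.mk_out Γ)
  exact ⟨Quotient.mk _ Γ, _, hχ.trans hψ⟩

theorem Rep.isTiling (h : Rep q S G r) : IsTiling S G r := by
  obtain ⟨φ, hφ⟩ := h
  exact hφ.isTiling q.out.isTiling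

theorem Rep.iso (h : Rep q S G r) (h' : Rep q S' G' r') : ∃ φ, IsIso φ S G r S' G' r' := by
  obtain ⟨φ, hφ⟩ := h
  obtain ⟨ψ, hψ⟩ := h'
  obtain ⟨χ, hχ⟩ := hφ.symm q.out.preTiling
  exact ⟨_, hχ.trans hψ⟩

theorem Rep.unique (h : Rep q S G r) (h' : Rep q' S' G' r') {χ : V → V'}
    (hi : IsIso χ S G r S' G' r') : q = q' := by
  obtain ⟨φ, hφ⟩ := h
  obtain ⟨ψ, hψ⟩ := h'
  obtain ⟨ω, hω⟩ := hψ.symm q'.out.preTiling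
  rw [← q.out_eq, ← q'.out_eq]
  exact Quotient.sound ((TilingGraph.equiv_iff _ _).2 ⟨_, (hφ.trans hi).trans hω⟩)

theorem Rep.word_eq (h : Rep q S G r) : word q.out.glue q.out.root = word G r := by
  obtain ⟨φ, hφ⟩ := h
  exact (hφ.word_eq q.out.preTiling).symm

theorem Rep.wt_eq (h : Rep q S G r) : wt Set.univ q.out.glue q.out.root = wt S G r := by
  obtain ⟨φ, hφ⟩ := h
  exact (hφ.wt_eq q.out.preTiling).symm

theorem Rep.card_eq (h : Rep q S G r) : q.out.d = S.ncard := by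
  obtain ⟨φ, hφ⟩ := h
  rw [← hφ.bij.image_eq, hφ.bij.injOn.ncard_image, Set.ncard_univ]
  simp

end Rep

/-! ### Local structure of tiling graphs -/

section Local

variable {S : Set V} {G : Equiv.Perm (V × Port m)} {r : V × Port m}

/-- Consecutive sectors around a region: their letters can be multiplied if and only if the
edge between them is not a leaf edge. -/
theorem PreTiling.mark_fc (h : PreTiling S G r) (x : V × Port m) (hx : x.1 ∈ S) :
    (mark G x).2.tgt = (mark G (fc G x)).2.src ∧
      ((mark G (fc G x)).1 = false ↔ (mark G (fc G x)).2 = (mark G x).2.next) := by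
  obtain ⟨y, hy⟩ : ∃ y, y = (x.1, x.2.ccw) := ⟨_, rfl⟩
  have hfc : fc G x = G y := by rw [hy]; rfl
  have hyS : y.1 ∈ S := by rw [hy]; exact hx
  have hyx : y.2 = x.2.ccw := by rw [hy]
  have hinv := h.invol y hyS
  rw [hfc]
  simp only [mark, decide_eq_false_iff_not, hinv]
  rw [Port.tgt_sector, Port.src_sector, ← Port.sector_across, Port.sector_injective.eq_iff, ← hyx]
  by_cases hl : G y = y
  · rw [hl]
    refine ⟨rfl, ?_⟩
    simp only [not_true_eq_false, false_iff, Port.across, ← hyx]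
    exact (Port.flip_ne _).symm
  · rw [h.compat y hyS hl, Port.label_flip, Port.across, ← hyx]
    exact ⟨rfl, by simpa [eq_comm] using hl⟩

/-- Every vertex of a tiling graph is on the boundary of the outer region. -/
theorem PreTiling.exists_outer (hm : 3 ≤ m) (h : PreTiling S G r) (v : V) (hv : v ∈ S) :
    ∃ p, (fc G).SameCycle r (v, p) := by
  by_contra hno
  push Not at hno
  have step : ∀ p, (G (v, p.ccw)).1 = (G (v, p)).1 := by
    intro p
    have h1 := h.fc_fc (x := (v, p)) hv (hno p)
    have h2 : ((fc G (v, p)).1, (fc G (v, p)).2.ccw) = G (v, p) := by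
      have h3 := h.invol ((fc G (v, p)).1, (fc G (v, p)).2.ccw) (h.mem_fc (x := (v, p)) hv)
      rw [← fc_apply, h1] at h3
      exact h3.symm
    exact (Prod.ext_iff.1 h2).1
  have hconst : ∀ p, (G (v, p)).1 = (G (v, .into ⟨1, by omega⟩)).1 := by
    intro p
    obtain ⟨n, rfl⟩ := Port.exists_ccw_iterate hm p
    induction n with
    | zero => rfl
    | succ n ih => rw [Function.iterate_succ_apply', step, ih]
  have hv' : ∀ p, (G (v, p)).1 = v := by
    have h0 : (Port.outOf ⟨1, by omega⟩ : Port m).across = Port.outOf ⟨1, by omega⟩ := by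
      simp [Port.across, Port.ccw, Port.flip]
    rcases h.regions (v, .outOf ⟨1, by omega⟩) hv (hno _) with ⟨_, h1⟩ | ⟨h1, _⟩
    · intro p
      rw [hconst, ← hconst (Port.outOf ⟨1, by omega⟩ : Port m).ccw]
      exact congrArg Prod.fst h1
    · exact absurd h0 h1
  have hr : ∀ u, Relation.ReflTransGen (Adj G) r.1 u → u = v → r.1 = v := by
    intro u hu
    induction hu with
    | refl => exact id
    | @tail b c hb hbc ih =>
      rintro rfl
      obtain ⟨p, q, hpq⟩ := hbc
      have hbS : b ∈ S := by
        clear ih hpq p q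
        induction hb with
        | refl => exact h.root_mem
        | tail _ hbc ih =>
          obtain ⟨p, q, hpq⟩ := hbc
          have := h.mem (_, p) ih
          rwa [hpq] at this
      have h1 := h.invol (b, p) hbS
      rw [hpq] at h1
      refine ih ?_
      rw [← hv' q, h1]
  have := hr v (h.conn v hv) rfl
  exact hno r.2 (by rw [← this])

theorem PreTiling.ncard_le [Finite V] (hm : 3 ≤ m) (h : PreTiling S G r) :
    S.ncard ≤ (word G r).length := by
  classical
  obtain ⟨l, hl⟩ := exists_isCyc (fc G) r
  rw [hl.word_eq, List.length_map]
  have : S ⊆ ((r :: l).map Prod.fst).toFinset := by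
    intro v hv
    obtain ⟨p, hp⟩ := h.exists_outer hm v hv
    simp only [Finset.mem_coe, List.mem_toFinset, List.mem_map]
    exact ⟨_, hl.mem_iff.2 hp, rfl⟩
  refine (Set.ncard_le_ncard this).trans ?_
  rw [Set.ncard_coe_finset]
  exact (List.toFinset_card_le _).trans (by simp)

/-- The number of vertices is determined by the number of leaves and the weight. -/
theorem IsTiling.degree [Finite V] (h : IsTiling S G r) (hm : 3 ≤ m) :
    (2 * m - 4) * S.ncard + 2 =
      (word G r).countP (fun a => a.1) + 2 * ∑ i, wt S G r i := by
  classical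
  obtain ⟨l, hl⟩ := exists_isCyc (fc G) r
  have h1 : {x | x.1 ∈ S ∧ G x = x}.ncard = (word G r).countP (fun a => a.1) := by
    rw [hl.word_eq, List.countP_map, List.countP_eq_length_filter,
      ← List.toFinset_card_of_nodup (hl.1.filter _), ← Set.ncard_coe_finset]
    congr 1
    ext x
    simp only [Set.mem_ofPred_eq, List.coe_toFinset, List.mem_filter, Function.comp, mark,
      decide_eq_true_eq]
    refine ⟨fun hx => ⟨hl.mem_iff.2 (h.leaves x hx.1 hx.2), hx.2⟩, fun hx => ⟨?_, hx.2⟩⟩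
    exact h.toPreTiling.mem_of_sameCycle h.root_mem (hl.mem_iff.1 hx.1)
  have h2 : {x : V × Port m | x.1 ∈ S}.ncard = S.ncard * (2 * (m - 1)) := by
    have : {x : V × Port m | x.1 ∈ S} = S ×ˢ Set.univ := by ext x; simp
    rw [this, Set.ncard_prod, Set.ncard_univ, Nat.card_eq_fintype_card, Port.card_port]
  have h3 : {x : V × Port m | x.1 ∈ S}.ncard =
      {x | x.1 ∈ S ∧ G x = x}.ncard + {x | x.1 ∈ S ∧ G x ≠ x}.ncard := by
    rw [← Set.ncard_union_eq _ (Set.toFinite _) (Set.toFinite _)]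
    · congr 1; ext x; simp only [Set.mem_ofPred_eq, Set.mem_union]; tauto
    · rw [Set.disjoint_left]; rintro x ⟨_, h1⟩ ⟨_, h2⟩; exact h2 h1
  have h4 := h.euler
  rw [sum_wt]
  obtain ⟨k, rfl⟩ : ∃ k, m = k + 3 := ⟨m - 3, by omega⟩
  rw [show 2 * (k + 3) - 4 = 2 * k + 2 by omega]
  rw [show k + 3 - 1 = k + 2 by omega] at h2
  nlinarith

end Local

end Bordered

/-! ### Cutting and gluing edges -/

namespace Bordered

variable {m : ℕ} {V : Type*}

/-- The graph `G'` arises from `G` by cutting the edge with the ends `y` and `z`. -/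
structure EdgeCut (S : Set V) (G G' : Equiv.Perm (V × Port m)) (y z : V × Port m) : Prop where
  ne : y ≠ z
  left : G y = z
  right : G z = y
  left' : G' y = y
  right' : G' z = z
  other : ∀ x, x ≠ y → x ≠ z → G' x = G x
  flip : z.2 = y.2.flip
  mem_left : y.1 ∈ S
  mem_right : z.1 ∈ S

namespace EdgeCut

variable {S : Set V} {G G' : Equiv.Perm (V × Port m)} {y z : V × Port m}

theorem symm (h : EdgeCut S G G' y z) : EdgeCut S G G' z y where
  ne := h.ne.symm
  left := h.right
  right := h.left
  left' := h.right'
  right' := h.left'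
  other x h1 h2 := h.other x h2 h1
  flip := by rw [h.flip, Port.flip_flip]
  mem_left := h.mem_right
  mem_right := h.mem_left

theorem swap [DecidableEq (V × Port m)] (h : EdgeCut S G G' y z) (x : V × Port m) :
    G' x = Equiv.swap y z (G x) := by
  by_cases h1 : x = y
  · rw [h1, h.left, h.left', Equiv.swap_apply_right]
  by_cases h2 : x = z
  · rw [h2, h.right, h.right', Equiv.swap_apply_left]
  rw [h.other x h1 h2, Equiv.swap_apply_of_ne_of_ne]
  · exact fun h3 => h2 (G.injective (h3.trans h.right.symm))
  · exact fun h3 => h1 (G.injective (h3.trans h.left.symm))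

theorem swap' [DecidableEq (V × Port m)] (h : EdgeCut S G G' y z) (x : V × Port m) :
    G x = Equiv.swap y z (G' x) := by
  rw [h.swap, Equiv.swap_apply_self]

/-- Cutting an edge. -/
theorem of_cut [DecidableEq (V × Port m)] (hne : y ≠ z) (hl : G y = z) (hr : G z = y)
    (hf : z.2 = y.2.flip) (hy : y.1 ∈ S) (hz : z.1 ∈ S) :
    EdgeCut S G (Equiv.swap y z * G) y z where
  ne := hne
  left := hl
  right := hr
  left' := by rw [Equiv.Perm.mul_apply, hl, Equiv.swap_apply_right]
  right' := by rw [Equiv.Perm.mul_apply, hr, Equiv.swap_apply_left]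
  other x h1 h2 := by
    rw [Equiv.Perm.mul_apply, Equiv.swap_apply_of_ne_of_ne]
    · exact fun h3 => h2 (G.injective (h3.trans hr.symm))
    · exact fun h3 => h1 (G.injective (h3.trans hl.symm))
  flip := hf
  mem_left := hy
  mem_right := hz

/-- Gluing two leaf edges. -/
theorem of_glue [DecidableEq (V × Port m)] (hne : y ≠ z) (hl : G' y = y) (hr : G' z = z)
    (hf : z.2 = y.2.flip) (hy : y.1 ∈ S) (hz : z.1 ∈ S) :
    EdgeCut S (Equiv.swap y z * G') G' y z where
  ne := hne
  left := by rw [Equiv.Perm.mul_apply, hl, Equiv.swap_apply_left]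
  right := by rw [Equiv.Perm.mul_apply, hr, Equiv.swap_apply_right]
  left' := hl
  right' := hr
  other x h1 h2 := by
    rw [Equiv.Perm.mul_apply, Equiv.swap_apply_of_ne_of_ne]
    · exact fun h3 => h1 (G'.injective (h3.trans hl.symm))
    · exact fun h3 => h2 (G'.injective (h3.trans hr.symm))
  flip := hf
  mem_left := hy
  mem_right := hz

theorem cases (_ : EdgeCut S G G' y z) (x : V × Port m) : x = y ∨ x = z ∨ (x ≠ y ∧ x ≠ z) := by
  tauto

theorem ne_of_ne (h : EdgeCut S G G' y z) {x : V × Port m} (h1 : x ≠ y) (h2 : x ≠ z) :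
    G x ≠ y ∧ G x ≠ z :=
  ⟨fun h3 => h2 (G.injective (h3.trans h.right.symm)),
    fun h3 => h1 (G.injective (h3.trans h.left.symm))⟩

theorem mem_iff (h : EdgeCut S G G' y z) :
    (∀ x, x.1 ∈ S → (G x).1 ∈ S) ↔ ∀ x, x.1 ∈ S → (G' x).1 ∈ S := by
  refine forall_congr' fun x => forall_congr' fun hx => ?_
  rcases h.cases x with rfl | rfl | ⟨h1, h2⟩
  · rw [h.left, h.left']; exact iff_of_true h.mem_right hx
  · rw [h.right, h.right']; exact iff_of_true h.mem_left hx
  · rw [h.other x h1 h2]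

theorem invol_iff (h : EdgeCut S G G' y z) :
    (∀ x, x.1 ∈ S → G (G x) = x) ↔ ∀ x, x.1 ∈ S → G' (G' x) = x := by
  refine forall_congr' fun x => forall_congr' fun hx => ?_
  rcases h.cases x with rfl | rfl | ⟨h1, h2⟩
  · rw [h.left, h.left', h.right, h.left']
  · rw [h.right, h.right', h.left, h.right']
  · rw [h.other x h1 h2, h.other _ (h.ne_of_ne h1 h2).1 (h.ne_of_ne h1 h2).2]

theorem compat_iff (h : EdgeCut S G G' y z) :
    (∀ x, x.1 ∈ S → G x ≠ x → (G x).2 = x.2.flip) ↔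
      ∀ x, x.1 ∈ S → G' x ≠ x → (G' x).2 = x.2.flip := by
  refine forall_congr' fun x => forall_congr' fun hx => ?_
  rcases h.cases x with rfl | rfl | ⟨h1, h2⟩
  · rw [h.left, h.left']; simp [h.flip]
  · rw [h.right, h.right']; simp [h.flip, Port.flip_flip]
  · rw [h.other x h1 h2]

theorem leaf_iff (h : EdgeCut S G G' y z) (x : V × Port m) :
    G' x = x ↔ G x = x ∨ x = y ∨ x = z := by
  rcases h.cases x with rfl | rfl | ⟨h1, h2⟩
  · simp [h.left']
  · simp [h.right']
  · rw [h.other x h1 h2]; simp [h1, h2]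

theorem adj_cut (h : EdgeCut S G G' y z) {u v : V} (huv : Adj G' u v) : Adj G u v ∨ u = v := by
  obtain ⟨p, q, hpq⟩ := huv
  rcases h.cases (u, p) with h1 | h1 | ⟨h1, h2⟩
  · rw [h1, h.left', ← h1] at hpq; cases hpq; exact .inr rfl
  · rw [h1, h.right', ← h1] at hpq; cases hpq; exact .inr rfl
  · exact .inl ⟨p, q, by rw [← h.other _ h1 h2, hpq]⟩

theorem adj_glue (h : EdgeCut S G G' y z) {u v : V} (huv : Adj G u v) :
    Adj G' u v ∨ (u = y.1 ∧ v = z.1) ∨ (u = z.1 ∧ v = y.1) := by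
  obtain ⟨p, q, hpq⟩ := huv
  rcases h.cases (u, p) with h1 | h1 | ⟨h1, h2⟩
  · rw [h1, h.left] at hpq; exact .inr (.inl ⟨by rw [← h1], by rw [hpq]⟩)
  · rw [h1, h.right] at hpq; exact .inr (.inr ⟨by rw [← h1], by rw [hpq]⟩)
  · exact .inl ⟨p, q, by rw [h.other _ h1 h2, hpq]⟩

theorem arr_cut (h : EdgeCut S G G' y z) {u v : V} (huv : Arr G' u v) : Arr G u v := by
  obtain ⟨k, hk⟩ := huv
  rcases h.cases (u, .outOf k) with h1 | h1 | ⟨h1, h2⟩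
  · rw [h1, h.left', ← h1] at hk; simp at hk
  · rw [h1, h.right', ← h1] at hk; simp at hk
  · exact ⟨k, by rw [← h.other _ h1 h2, hk]⟩

theorem reflTransGen_arr (h : EdgeCut S G G' y z) {u v : V}
    (huv : Relation.ReflTransGen (Arr G') u v) : Relation.ReflTransGen (Arr G) u v := by
  induction huv with
  | refl => exact .refl
  | tail _ hbc ih => exact ih.tail (h.arr_cut hbc)

theorem arr_glue (h : EdgeCut S G G' y z) {u v : V} (huv : Arr G u v) :
    Arr G' u v ∨ (u = y.1 ∧ v = z.1 ∧ ∃ k, y.2 = .outOf k) ∨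
      (u = z.1 ∧ v = y.1 ∧ ∃ k, z.2 = .outOf k) := by
  obtain ⟨k, hk⟩ := huv
  rcases h.cases (u, .outOf k) with h1 | h1 | ⟨h1, h2⟩
  · rw [h1, h.left] at hk
    exact .inr (.inl ⟨by rw [← h1], by rw [hk], k, by rw [← h1]⟩)
  · rw [h1, h.right] at hk
    exact .inr (.inr ⟨by rw [← h1], by rw [hk], k, by rw [← h1]⟩)
  · exact .inl ⟨k, by rw [h.other _ h1 h2, hk]⟩

theorem swap_fc [DecidableEq (V × Port m)] (h : EdgeCut S G G' y z) (x : V × Port m) :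
    fc G' x = Equiv.swap y z (fc G x) := h.swap _

theorem swap_fc' [DecidableEq (V × Port m)] (h : EdgeCut S G G' y z) (x : V × Port m) :
    fc G x = Equiv.swap y z (fc G' x) := h.swap' _

theorem fc_eq (h : EdgeCut S G G' y z) {x : V × Port m} (h1 : fc G x ≠ y) (h2 : fc G x ≠ z) :
    fc G' x = fc G x := by
  classical
  rw [h.swap_fc, Equiv.swap_apply_of_ne_of_ne h1 h2]

theorem ncard_eq [Finite V] (h : EdgeCut S G G' y z) :
    {x | x.1 ∈ S ∧ G x ≠ x}.ncard = {x | x.1 ∈ S ∧ G' x ≠ x}.ncard + 2 := by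
  classical
  exact ncard_ne_swap h.swap' h.left' h.right' h.ne {x | x.1 ∈ S} h.mem_left h.mem_right

end EdgeCut

/-- The edge that is cut separates the outer region of `G` from an inner region. After the cut,
the sectors `z :: Z` of the inner region appear in the outer region before the sector `y`. -/
structure LoopCut (S : Set V) (G G' : Equiv.Perm (V × Port m)) (r y z : V × Port m)
    (A Z B : List (V × Port m)) : Prop extends EdgeCut S G G' y z where
  cyc : IsCyc (fc G) r (A ++ y :: B)
  cyc_inner : IsCyc (fc G) z Z
  disjoint : ∀ x ∈ z :: Z, x ∉ r :: (A ++ y :: B)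
  shape : (Z = [] ∧ z.2.across = z.2) ∨
    ∃ w, Z = [w] ∧ w.2 = z.2.across ∧ z.2.across ≠ z.2 ∧ G w ≠ w

namespace LoopCut

variable {S : Set V} {G G' : Equiv.Perm (V × Port m)} {r y z : V × Port m}
  {A Z B : List (V × Port m)}

theorem cyc' (h : LoopCut S G G' r y z A Z B) : IsCyc (fc G') r (A ++ z :: (Z ++ y :: B)) := by
  classical
  exact h.cyc.insert h.swap_fc h.cyc_inner h.disjoint

theorem outer_iff [Finite V] (h : LoopCut S G G' r y z A Z B) (x : V × Port m) :
    (fc G').SameCycle r x ↔ (fc G).SameCycle r x ∨ x ∈ z :: Z := by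
  rw [← h.cyc.mem_iff, ← h.cyc'.mem_iff]
  simp only [List.mem_cons, List.mem_append]
  tauto

theorem not_outer [Finite V] (h : LoopCut S G G' r y z A Z B) {x : V × Port m}
    (hx : x ∈ z :: Z) : ¬ (fc G).SameCycle r x := by
  rw [← h.cyc.mem_iff]; exact h.disjoint x hx

theorem outer_left [Finite V] (h : LoopCut S G G' r y z A Z B) : (fc G).SameCycle r y :=
  h.cyc.mem_iff.1 (by simp)

theorem fc_eq_of_inner [Finite V] (h : LoopCut S G G' r y z A Z B) {x : V × Port m}
    (hx : ¬ (fc G').SameCycle r x) : fc G' x = fc G x ∧ ¬ (fc G').SameCycle r (fc G x) := by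
  have h1 : (fc G').SameCycle x (fc G' x) := ⟨1, by simp⟩
  have h2 : ¬ (fc G').SameCycle r (fc G' x) := fun h0 => hx (h0.trans h1.symm)
  have h3 : fc G' x = fc G x := by
    classical
    rw [h.swap_fc' x, Equiv.swap_apply_of_ne_of_ne]
    · rintro h0
      exact h2 (by rw [h0, h.outer_iff]; exact .inl h.outer_left)
    · rintro h0
      exact h2 (by rw [h0, h.outer_iff]; exact .inr (by simp))
  exact ⟨h3, by rwa [← h3]⟩

theorem linked (h : LoopCut S G G' r y z A Z B)
    (hinv : ∀ x, x.1 ∈ S → G (G x) = x) : y.1 = z.1 ∨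
      ∃ w, w.1 = y.1 ∧ w.2 = z.2.across ∧ z.2.across ≠ z.2 ∧ G' (z.1, z.2.ccw) = w ∧
        G' w = (z.1, z.2.ccw) := by
  rcases h.shape with ⟨rfl, _⟩ | ⟨w, rfl, hw, hne, hl⟩
  · left
    have h1 : fc G z = z := h.cyc_inner.2
    rw [fc_apply] at h1
    have h2 := G.injective (h1.trans h.left.symm)
    rw [← h2]
  · right
    obtain ⟨h1, h2⟩ := h.cyc_inner.2
    have hn := h.cyc_inner.1
    have hwz : w ≠ z := fun h0 => by simp [h0] at hn
    have hwy : w ≠ y := fun h0 => h.disjoint w (by simp) (by simp [h0])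
    have h3 : (w.1, w.2.ccw) = y := G.injective (Eq.trans h2 h.left.symm)
    have h4 : ((z.1, z.2.ccw) : V × Port m) ≠ y := fun h0 => hwz (by
      rw [← h1, fc_apply, h0, h.left])
    have h5 : ((z.1, z.2.ccw) : V × Port m) ≠ z := fun h0 => hwy (by
      rw [← h1, fc_apply, h0, h.right])
    refine ⟨w, by rw [← h3], hw, hne, ?_, ?_⟩
    · rw [h.other _ h4 h5]; exact h1
    · rw [h.other _ hwy hwz, ← h1]
      exact hinv (z.1, z.2.ccw) h.mem_right

theorem conn_iff (h : LoopCut S G G' r y z A Z B) (hinv : ∀ x, x.1 ∈ S → G (G x) = x) (u v : V) :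
    Relation.ReflTransGen (Adj G) u v ↔ Relation.ReflTransGen (Adj G') u v := by
  constructor
  · intro huv
    induction huv with
    | refl => exact .refl
    | tail _ hbc ih =>
      refine ih.trans ?_
      rcases h.adj_glue hbc with h1 | h1
      · exact .single h1
      · rcases h.linked hinv with h2 | ⟨w, h2, _, _, h3, h4⟩
        · rcases h1 with ⟨rfl, rfl⟩ | ⟨rfl, rfl⟩ <;> rw [h2]
        · rw [← h2] at h1
          rcases h1 with ⟨rfl, rfl⟩ | ⟨rfl, rfl⟩
          · exact .single ⟨_, _, h4⟩
          · exact .single ⟨_, w.2, h3⟩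
  · intro huv
    induction huv with
    | refl => exact .refl
    | tail _ hbc ih =>
      rcases h.adj_cut hbc with h1 | rfl
      · exact ih.tail h1
      · exact ih

theorem arr_iff (h : LoopCut S G G' r y z A Z B) (hinv : ∀ x, x.1 ∈ S → G (G x) = x) (u v : V) :
    Relation.ReflTransGen (Arr G) u v ↔ Relation.ReflTransGen (Arr G') u v := by
  constructor
  · intro huv
    induction huv with
    | refl => exact .refl
    | tail _ hbc ih =>
      refine ih.trans ?_
      rcases h.arr_glue hbc with h1 | h1
      · exact .single h1
      · rcases h.linked hinv with h2 | ⟨w, h2, h5, h6, h3, h4⟩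
        · rcases h1 with ⟨rfl, rfl, _⟩ | ⟨rfl, rfl, _⟩ <;> rw [h2]
        · have hw : w = (y.1, w.2) := by rw [← h2]
          rw [hw] at h3 h4
          rcases h1 with ⟨rfl, rfl, k, hk⟩ | ⟨rfl, rfl, k, hk⟩
          · have hz := h.flip
            rw [hk, Port.flip] at hz
            have hz' : z.2.ccw = Port.flip w.2 := by rw [h5, Port.across, Port.flip_flip]
            by_cases hk' : k.1 + 1 < m
            · rw [h5, hz, Port.across, Port.ccw, dif_pos hk'] at h4
              exact .single ⟨_, h4⟩
            · exact absurd (by rw [hz, Port.across, Port.ccw, dif_neg hk']; rfl) h6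
          · by_cases hk' : k.1 = 1
            · exact absurd (by rw [hk, Port.across, Port.ccw, dif_pos hk']; rfl) h6
            · rw [h5, hk, Port.across, Port.ccw, dif_neg hk'] at h3
              exact .single ⟨_, h3⟩
  · intro huv
    induction huv with
    | refl => exact .refl
    | tail _ hbc ih => exact ih.tail (h.arr_cut hbc)

theorem innerPref_eq [Finite V] (h : LoopCut S G G' r y z A Z B)
    (hmem : ∀ x, x.1 ∈ S → (G x).1 ∈ S) :
    ∃ w, w ∉ innerPref S G' r ∧ innerPref S G r = insert w (innerPref S G' r) ∧
      w.2.sector.index = z.2.sector.index := by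
  have key : ∃ w ∈ z :: Z, w.1 ∈ S ∧ w.2.IsPref ∧ w.2.sector.index = z.2.sector.index ∧
      ∀ x ∈ z :: Z, x.2.IsPref → x = w := by
    rcases h.shape with ⟨rfl, h1⟩ | ⟨w, rfl, hw, hne, hl⟩
    · exact ⟨z, by simp, h.mem_right, Port.isPref_of_across_eq h1, rfl, by simp⟩
    · have h2 := Port.isPref_across hne
      by_cases hz : z.2.IsPref
      · refine ⟨z, by simp, h.mem_right, hz, rfl, fun x hx hxp => ?_⟩
        rcases List.mem_cons.1 hx with h3 | h3
        · exact h3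
        · rw [List.mem_singleton.1 h3, hw, h2] at hxp
          exact absurd hz hxp
      · have hwS : w.1 ∈ S := by
          have h3 : fc G z = w := h.cyc_inner.2.1
          rw [← h3]
          exact hmem (z.1, z.2.ccw) h.mem_right
        refine ⟨w, by simp, hwS, by rw [hw, h2]; exact hz, by rw [hw, Port.index_across],
          fun x hx hxp => ?_⟩
        rcases List.mem_cons.1 hx with h3 | h3
        · exact absurd (h3 ▸ hxp) hz
        · exact List.mem_singleton.1 h3
  obtain ⟨w, hw, hwS, hwp, hwi, huniq⟩ := key
  refine ⟨w, fun h0 => h0.2.1 ((h.outer_iff w).2 (.inr hw)), ?_, hwi⟩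
  ext x
  simp only [innerPref, Set.mem_ofPred_eq, Set.mem_insert_iff, h.outer_iff]
  constructor
  · rintro ⟨h1, h2, h3⟩
    by_cases hx : x ∈ z :: Z
    · exact .inl (huniq x hx h3)
    · exact .inr ⟨h1, by tauto, h3⟩
  · rintro (rfl | ⟨h1, h2, h3⟩)
    · exact ⟨hwS, h.not_outer hw, hwp⟩
    · exact ⟨h1, by tauto, h3⟩

theorem wt_eq [Finite V] (h : LoopCut S G G' r y z A Z B)
    (hmem : ∀ x, x.1 ∈ S → (G x).1 ∈ S) (i : Fin m) :
    wt S G r i = wt S G' r i + if z.2.sector.index = i.1 + 1 then 1 else 0 := by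
  obtain ⟨w, hw, h1, h2⟩ := h.innerPref_eq hmem
  unfold wt
  rw [h1]
  split_ifs with hi
  · rw [← Set.ncard_insert_of_notMem (a := w) (fun h0 => hw h0.1) (Set.toFinite _)]
    congr 1
    ext x
    simp only [Set.mem_ofPred_eq, Set.mem_insert_iff]
    constructor
    · rintro ⟨h3 | h3, h4⟩
      · exact .inl h3
      · exact .inr ⟨h3, h4⟩
    · rintro (rfl | ⟨h3, h4⟩)
      · exact ⟨.inl rfl, h2.trans hi⟩
      · exact ⟨.inr h3, h4⟩
  · rw [add_zero]
    congr 1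
    ext x
    simp only [Set.mem_ofPred_eq, Set.mem_insert_iff]
    constructor
    · rintro ⟨rfl | h3, h4⟩
      · exact absurd (h2.symm.trans h4) hi
      · exact ⟨h3, h4⟩
    · exact fun h3 => ⟨.inr h3.1, h3.2⟩

theorem isTiling_iff [Finite V] (h : LoopCut S G G' r y z A Z B) (hr : G' r = r) :
    IsTiling S G r ↔ IsTiling S G' r := by
  have hry : r ≠ y := by
    have := h.cyc.1
    rw [List.nodup_cons] at this
    exact fun h0 => this.1 (by simp [h0])
  have hrz : r ≠ z := fun h0 => h.disjoint z (by simp) (by simp [h0])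
  have euler : (∀ x, x.1 ∈ S → (G x).1 ∈ S) →
      (2 * S.ncard + 2 * ((innerPref S G r).ncard + 1) = {x | x.1 ∈ S ∧ G x ≠ x}.ncard + 4 ↔
      2 * S.ncard + 2 * ((innerPref S G' r).ncard + 1) = {x | x.1 ∈ S ∧ G' x ≠ x}.ncard + 4) := by
    intro hmem
    obtain ⟨w, hw, h1, h2⟩ := h.innerPref_eq hmem
    rw [h.ncard_eq, h1, Set.ncard_insert_of_notMem hw (Set.toFinite _)]
    omega
  constructor
  · intro ht
    refine { root_mem := ht.root_mem, mem := h.mem_iff.1 ht.mem, invol := h.invol_iff.1 ht.invol,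
             compat := h.compat_iff.1 ht.compat, root_leaf := hr,
             conn := fun u hu => (h.conn_iff ht.invol _ _).1 (ht.conn u hu), leaves := ?_,
             cycles := ?_, regions := ?_, euler := (euler ht.mem).1 ht.euler }
    · intro x hx hl
      rw [h.outer_iff]
      rcases (h.leaf_iff x).1 hl with h1 | rfl | rfl
      · exact .inl (ht.leaves x hx h1)
      · exact .inl h.outer_left
      · exact .inr (by simp)
    · intro u hu v
      rw [← h.arr_iff ht.invol, ← h.arr_iff ht.invol]
      exact ht.cycles u hu v
    · intro x hx hi
      have h1 := h.fc_eq_of_inner hi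
      have h2 := h.fc_eq_of_inner h1.2
      rw [h1.1, h2.1]
      exact ht.regions x hx fun h0 => hi ((h.outer_iff x).2 (.inl h0))
  · intro ht
    have hmem := h.mem_iff.2 ht.mem
    have hinv := h.invol_iff.2 ht.invol
    refine { root_mem := ht.root_mem, mem := hmem, invol := hinv,
             compat := h.compat_iff.2 ht.compat, root_leaf := by rw [← h.other r hry hrz, hr],
             conn := fun u hu => (h.conn_iff hinv _ _).2 (ht.conn u hu), leaves := ?_,
             cycles := ?_, regions := ?_, euler := (euler hmem).2 ht.euler }
    · intro x hx hl
      rcases (h.outer_iff x).1 (ht.leaves x hx ((h.leaf_iff x).2 (.inl hl))) with h1 | h1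
      · exact h1
      · exfalso
        rcases List.mem_cons.1 h1 with rfl | h2
        · exact h.ne (h.right.symm.trans hl)
        · rcases h.shape with ⟨rfl, _⟩ | ⟨w, rfl, _, _, hw⟩
          · simp at h2
          · rw [List.mem_singleton.1 h2] at hl
            exact hw hl
    · intro u hu v
      rw [h.arr_iff hinv, h.arr_iff hinv]
      exact ht.cycles u hu v
    · intro x hx hi
      by_cases hxz : x ∈ z :: Z
      · rcases h.shape with ⟨rfl, h1⟩ | ⟨w, rfl, hw, hne, _⟩
        · rw [List.mem_singleton.1 hxz]
          exact .inl ⟨h1, h.cyc_inner.2⟩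
        · obtain ⟨h1, h2⟩ := h.cyc_inner.2
          have h2 : fc G w = z := h2
          have hwz : w ≠ z := fun h0 => by have := h.cyc_inner.1; simp [h0] at this
          simp only [List.mem_cons, List.not_mem_nil, or_false] at hxz
          rcases hxz with rfl | rfl
          · exact .inr ⟨hne, by rw [h1]; exact hwz, by rw [h1, h2]⟩
          · refine .inr ⟨?_, by rw [h2]; exact hwz.symm, by rw [h2, h1]⟩
            rw [hw, Port.across_across]
            exact hne.symm
      · have hi' : ¬ (fc G').SameCycle r x := by rw [h.outer_iff]; tauto
        have h1 := h.fc_eq_of_inner hi'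
        have h2 := h.fc_eq_of_inner h1.2
        have h3 := ht.regions x hx hi'
        rwa [h1.1, h2.1] at h3

end LoopCut

end Bordered

namespace Bordered

variable {m : ℕ} {V : Type*}

theorem reflTransGen_of_sameCycle [Finite V] {G : Equiv.Perm (V × Port m)} {x y : V × Port m}
    (h : (fc G).SameCycle x y) : Relation.ReflTransGen (Adj G) x.1 y.1 := by
  obtain ⟨n, rfl⟩ := h.exists_nat_pow_eq
  clear h
  induction n with
  | zero => exact .refl
  | succ n ih =>
    rw [pow_succ', Equiv.Perm.mul_apply]
    exact ih.tail (adj_fc G _)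

theorem card_components_of_conn [Finite V] {G : Equiv.Perm (V × Port m)} (r : V)
    (h : ∀ u, Relation.ReflTransGen (Adj G) r u) :
    Nat.card (Quotient (Relation.EqvGen.setoid (Adj G))) ≤ 1 := by
  rw [Finite.card_le_one_iff_subsingleton]
  have key : ∀ c : Quotient (Relation.EqvGen.setoid (Adj G)), c = Quotient.mk _ r := by
    intro c
    induction c using Quotient.inductionOn with | _ u
    refine Quotient.sound (Relation.EqvGen.symm _ _ ?_)
    have := h u
    induction this with
    | refl => exact .refl _
    | tail _ hbc ih => exact ih.trans _ _ _ (.rel _ _ hbc)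
  exact ⟨fun c d => (key c).trans (key d).symm⟩

/-- The genus of a graph is nonnegative. -/
theorem PreTiling.euler_le [Finite V] (hm : 3 ≤ m) {S : Set V} {G : Equiv.Perm (V × Port m)}
    {r : V × Port m} (h : PreTiling S G r) :
    2 * S.ncard + 2 * ((innerPref S G r).ncard + 1) ≤ {x | x.1 ∈ S ∧ G x ≠ x}.ncard + 4 := by
  obtain ⟨d, H, r', φ, hiso⟩ := h.exists_iso
  have ht := hiso.preTiling h
  have h1 := genus_inequality hm H fun x => ht.invol x trivial
  have h2 := card_components_of_conn r'.1 fun u => ht.conn u trivial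
  have h3 := ht.card_all_faces
  have h4 : {x | x ∈ Set.univ ∧ H x ≠ x}.ncard = {x | x.1 ∈ S ∧ G x ≠ x}.ncard := by
    rw [← hiso.ncard_eq (P' := fun x => H x ≠ x)
      fun x hx => by rw [ne_eq, ne_eq, hiso.leaf_iff h hx]]
    simp
  have h5 : S.ncard = Nat.card (Fin d) := by
    rw [← Set.ncard_univ, ← hiso.bij.image_eq, hiso.bij.injOn.ncard_image]
  rw [hiso.innerPref_eq h] at h3
  omega

/-- The edge that is cut is a bridge: it joins the part of the graph with the vertices `S` that
contains the root to another part. -/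
structure BridgeCut (S : Set V) (G G' : Equiv.Perm (V × Port m)) (r y z : V × Port m)
    (A B₁ B₂ : List (V × Port m)) : Prop extends EdgeCut Set.univ G G' y z where
  closed : ∀ x, (G' x).1 ∈ S ↔ x.1 ∈ S
  root_mem : r.1 ∈ S
  mem : z.1 ∈ S
  notMem : y.1 ∉ S
  cyc₁ : IsCyc (fc G') r (A ++ z :: B₂)
  cyc₂ : IsCyc (fc G') y B₁

namespace BridgeCut

variable {S : Set V} {G G' : Equiv.Perm (V × Port m)} {r y z : V × Port m}
  {A B₁ B₂ : List (V × Port m)}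

theorem sameCycle_mem [Finite V] (h : BridgeCut S G G' r y z A B₁ B₂) {x w : V × Port m}
    (hxw : (fc G').SameCycle x w) : w.1 ∈ S ↔ x.1 ∈ S := by
  obtain ⟨n, rfl⟩ := hxw.exists_nat_pow_eq
  clear hxw
  induction n with
  | zero => rfl
  | succ n ih =>
    rw [pow_succ', Equiv.Perm.mul_apply, ← ih, fc_apply, h.closed]

theorem mem₁ [Finite V] (h : BridgeCut S G G' r y z A B₁ B₂) {x : V × Port m}
    (hx : (fc G').SameCycle r x) : x.1 ∈ S := (h.sameCycle_mem hx).2 h.root_mem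

theorem notMem₂ [Finite V] (h : BridgeCut S G G' r y z A B₁ B₂) {x : V × Port m}
    (hx : (fc G').SameCycle y x) : x.1 ∉ S := fun h0 => h.notMem ((h.sameCycle_mem hx).1 h0)

theorem cyc [Finite V] (h : BridgeCut S G G' r y z A B₁ B₂) :
    IsCyc (fc G) r (A ++ y :: (B₁ ++ z :: B₂)) := by
  classical
  exact h.cyc₁.join h.swap_fc' h.cyc₂ fun x hx hx' =>
    h.notMem₂ (h.cyc₂.mem_iff.1 hx) (h.mem₁ (h.cyc₁.mem_iff.1 hx'))

theorem outer_iff [Finite V] (h : BridgeCut S G G' r y z A B₁ B₂) (x : V × Port m) :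
    (fc G).SameCycle r x ↔ (fc G').SameCycle r x ∨ (fc G').SameCycle y x := by
  rw [← h.cyc.mem_iff, ← h.cyc₁.mem_iff, ← h.cyc₂.mem_iff]
  simp only [List.mem_cons, List.mem_append]
  tauto

theorem outer_iff₁ [Finite V] (h : BridgeCut S G G' r y z A B₁ B₂) {x : V × Port m}
    (hx : x.1 ∈ S) : (fc G).SameCycle r x ↔ (fc G').SameCycle r x := by
  rw [h.outer_iff]
  exact or_iff_left fun h0 => h.notMem₂ h0 hx

theorem outer_iff₂ [Finite V] (h : BridgeCut S G G' r y z A B₁ B₂) {x : V × Port m}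
    (hx : x.1 ∈ Sᶜ) : (fc G).SameCycle r x ↔ (fc G').SameCycle y x := by
  rw [h.outer_iff]
  exact or_iff_right fun h0 => hx (h.mem₁ h0)

theorem fc_eq_of_inner [Finite V] (h : BridgeCut S G G' r y z A B₁ B₂) {x : V × Port m}
    (hx : ¬ (fc G).SameCycle r x) : fc G' x = fc G x ∧ ¬ (fc G).SameCycle r (fc G x) := by
  have h1 : (fc G).SameCycle x (fc G x) := ⟨1, by simp⟩
  have h2 : ¬ (fc G).SameCycle r (fc G x) := fun h0 => hx (h0.trans h1.symm)
  refine ⟨h.fc_eq ?_ ?_, h2⟩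
  · rintro h0; exact h2 (by rw [h0, ← h.cyc.mem_iff]; simp)
  · rintro h0; exact h2 (by rw [h0, ← h.cyc.mem_iff]; simp)

theorem regions_iff [Finite V] (h : BridgeCut S G G' r y z A B₁ B₂) {x : V × Port m}
    (hx : ¬ (fc G).SameCycle r x) :
    ((x.2.across = x.2 ∧ fc G x = x) ∨
      (x.2.across ≠ x.2 ∧ fc G x ≠ x ∧ fc G (fc G x) = x)) ↔
    ((x.2.across = x.2 ∧ fc G' x = x) ∨
      (x.2.across ≠ x.2 ∧ fc G' x ≠ x ∧ fc G' (fc G' x) = x)) := by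
  have h1 := h.fc_eq_of_inner hx
  have h2 := h.fc_eq_of_inner h1.2
  rw [h1.1, h2.1]

theorem innerPref_eq [Finite V] (h : BridgeCut S G G' r y z A B₁ B₂) :
    innerPref Set.univ G r = innerPref S G' r ∪ innerPref Sᶜ G' y := by
  ext x
  simp only [innerPref, Set.mem_ofPred_eq, Set.mem_union]
  by_cases hx : x.1 ∈ S
  · simp [hx, h.outer_iff₁ hx]
  · simp [hx, h.outer_iff₂ hx]

theorem wt_eq [Finite V] (h : BridgeCut S G G' r y z A B₁ B₂) (i : Fin m) :
    wt Set.univ G r i = wt S G' r i + wt Sᶜ G' y i := by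
  unfold wt
  rw [h.innerPref_eq, ← Set.ncard_union_eq _ (Set.toFinite _) (Set.toFinite _)]
  · congr 1; ext x; simp only [Set.mem_ofPred_eq, Set.mem_union]; tauto
  · rw [Set.disjoint_left]; rintro x ⟨⟨h1, _⟩, _⟩ ⟨⟨h2, _⟩, _⟩; exact h2 h1

theorem ncard_innerPref [Finite V] (h : BridgeCut S G G' r y z A B₁ B₂) :
    (innerPref Set.univ G r).ncard = (innerPref S G' r).ncard + (innerPref Sᶜ G' y).ncard := by
  rw [← sum_wt, ← sum_wt, ← sum_wt, ← Finset.sum_add_distrib]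
  exact Finset.sum_congr rfl fun i _ => h.wt_eq i

theorem ncard_nonleaf [Finite V] (h : BridgeCut S G G' r y z A B₁ B₂) :
    {x | x.1 ∈ Set.univ ∧ G x ≠ x}.ncard =
      {x | x.1 ∈ S ∧ G' x ≠ x}.ncard + {x | x.1 ∈ Sᶜ ∧ G' x ≠ x}.ncard + 2 := by
  rw [h.ncard_eq, ← Set.ncard_union_eq _ (Set.toFinite _) (Set.toFinite _)]
  · congr 2
    ext x; simp only [Set.mem_ofPred_eq, Set.mem_union, Set.mem_univ, Set.mem_compl_iff]; tauto
  · rw [Set.disjoint_left]; rintro x ⟨h1, _⟩ ⟨h2, _⟩; exact h2 h1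

theorem reach [Finite V] (h : BridgeCut S G G' r y z A B₁ B₂) {u : V}
    (hu : Relation.ReflTransGen (Adj G) r.1 u) :
    Relation.ReflTransGen (Adj G') r.1 u ∨ Relation.ReflTransGen (Adj G') y.1 u := by
  induction hu with
  | refl => exact .inl .refl
  | tail _ hbc ih =>
    rcases h.adj_glue hbc with h1 | ⟨_, rfl⟩ | ⟨_, rfl⟩
    · exact ih.imp (fun h0 => h0.tail h1) (fun h0 => h0.tail h1)
    · exact .inl (reflTransGen_of_sameCycle (h.cyc₁.mem_iff.1 (by simp)))
    · exact .inr .refl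

theorem reach_mem (h : BridgeCut S G G' r y z A B₁ B₂) {u v : V}
    (hu : Relation.ReflTransGen (Adj G') u v) : v ∈ S ↔ u ∈ S := by
  induction hu with
  | refl => rfl
  | @tail b c _ hbc ih =>
    obtain ⟨p, q, hpq⟩ := hbc
    have := h.closed (b, p)
    rw [hpq] at this
    exact this.trans ih

theorem reach_glue (h : BridgeCut S G G' r y z A B₁ B₂) {u v : V}
    (hu : Relation.ReflTransGen (Adj G') u v) : Relation.ReflTransGen (Adj G) u v := by
  induction hu with
  | refl => exact .refl
  | tail _ hbc ih =>
    rcases h.adj_cut hbc with h1 | rfl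
    · exact ih.tail h1
    · exact ih

/-- The bridge is the only edge between the two parts, so that no oriented cycle passes
through it. -/
theorem arr_glue_of_closed (h : BridgeCut S G G' r y z A B₁ B₂) {T : Set V}
    (hT : T = S ∨ T = Sᶜ) (hcl : ∀ u v, Arr G u v → u ∈ T → v ∈ T) {u v : V}
    (huv : Relation.ReflTransGen (Arr G) u v) (h0 : u ∈ T ∨ v ∉ T) :
    Relation.ReflTransGen (Arr G') u v := by
  have side : ∀ b c, Arr G b c → (b ∈ T ↔ c ∈ T) → Arr G' b c := by
    intro b c hbc hiff
    rcases h.arr_glue hbc with h1 | ⟨rfl, rfl, _⟩ | ⟨rfl, rfl, _⟩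
    · exact h1
    · have := h.mem; have := h.notMem
      rcases hT with rfl | rfl <;> simp_all
    · have := h.mem; have := h.notMem
      rcases hT with rfl | rfl <;> simp_all
  rcases h0 with hu | hv
  · suffices v ∈ T ∧ Relation.ReflTransGen (Arr G') u v from this.2
    induction huv with
    | refl => exact ⟨hu, .refl⟩
    | tail _ hbc ih =>
      have hc := hcl _ _ hbc ih.1
      exact ⟨hc, ih.2.tail (side _ _ hbc (iff_of_true ih.1 hc))⟩
  · induction huv with
    | refl => exact .refl
    | tail _ hbc ih =>
      have hb := fun hb => hv (hcl _ _ hbc hb)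
      exact (ih hb).tail (side _ _ hbc (iff_of_false hb hv))

theorem exists_closed (h : BridgeCut S G G' r y z A B₁ B₂) :
    ∃ T, (T = S ∨ T = Sᶜ) ∧ ∀ u v, Arr G u v → u ∈ T → v ∈ T := by
  have key : ∀ u v, Arr G' u v → (v ∈ S ↔ u ∈ S) := by
    rintro u v ⟨k, hk⟩
    rw [← h.closed (u, _), hk]
  have hz := h.flip
  cases hy : y.2 with
  | outOf k =>
    refine ⟨S, .inl rfl, fun u v huv hu => ?_⟩
    rcases h.arr_glue huv with h1 | ⟨rfl, rfl, _⟩ | ⟨_, _, k', hk'⟩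
    · exact (key u v h1).2 hu
    · exact absurd hu h.notMem
    · rw [hy, hk'] at hz; cases hz
  | into k =>
    refine ⟨Sᶜ, .inr rfl, fun u v huv hu => ?_⟩
    rcases h.arr_glue huv with h1 | ⟨_, _, k', hk'⟩ | ⟨rfl, _, _⟩
    · exact fun h0 => hu ((key u v h1).1 h0)
    · rw [hy] at hk'; cases hk'
    · exact absurd h.mem hu

theorem isTiling_iff [Finite V] (hm : 3 ≤ m) (h : BridgeCut S G G' r y z A B₁ B₂)
    (hr : G' r = r) : IsTiling Set.univ G r ↔ IsTiling S G' r ∧ IsTiling Sᶜ G' y := by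
  have hry : r ≠ y := fun h0 => h.notMem (h0 ▸ h.root_mem)
  have hrz : r ≠ z := by
    have := h.cyc₁.1
    rw [List.nodup_cons] at this
    exact fun h0 => this.1 (by simp [h0])
  have hzO : (fc G').SameCycle r z := h.cyc₁.mem_iff.1 (by simp)
  have hcard := Set.ncard_add_ncard_compl S
  rw [← Set.ncard_univ] at hcard
  constructor
  · intro ht
    have hinv := h.invol_iff.1 ht.invol
    have hcompat := h.compat_iff.1 ht.compat
    have p1 : PreTiling S G' r :=
      { root_mem := h.root_mem
        mem := fun x hx => (h.closed x).2 hx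
        invol := fun x _ => hinv x trivial
        compat := fun x _ => hcompat x trivial
        root_leaf := hr
        conn := fun u hu => (h.reach (ht.conn u trivial)).resolve_right
          fun h0 => h.notMem ((h.reach_mem h0).1 hu)
        leaves := fun x hx hl => by
          rcases (h.leaf_iff x).1 hl with h1 | rfl | rfl
          · exact (h.outer_iff₁ hx).1 (ht.leaves x trivial h1)
          · exact absurd hx h.notMem
          · exact hzO
        cycles := fun u _ v h1 h2 => ht.cycles u trivial v
          (h.reflTransGen_arr h1)
          (h.reflTransGen_arr h2)
        regions := fun x hx hi => by
          rw [← h.outer_iff₁ hx] at hi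
          exact (h.regions_iff hi).1 (ht.regions x trivial hi) }
    have p2 : PreTiling Sᶜ G' y :=
      { root_mem := h.notMem
        mem := fun x hx h0 => hx ((h.closed x).1 h0)
        invol := fun x _ => hinv x trivial
        compat := fun x _ => hcompat x trivial
        root_leaf := h.left'
        conn := fun u hu => (h.reach (ht.conn u trivial)).resolve_left
          fun h0 => hu ((h.reach_mem h0).2 h.root_mem)
        leaves := fun x hx hl => by
          rcases (h.leaf_iff x).1 hl with h1 | rfl | rfl
          · exact (h.outer_iff₂ hx).1 (ht.leaves x trivial h1)
          · exact .refl _ _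
          · exact absurd h.mem hx
        cycles := fun u _ v h1 h2 => ht.cycles u trivial v
          (h.reflTransGen_arr h1)
          (h.reflTransGen_arr h2)
        regions := fun x hx hi => by
          rw [← h.outer_iff₂ hx] at hi
          exact (h.regions_iff hi).1 (ht.regions x trivial hi) }
    have e := ht.euler
    have e1 := p1.euler_le hm
    have e2 := p2.euler_le hm
    rw [h.ncard_innerPref, h.ncard_nonleaf] at e
    exact ⟨⟨p1, by omega⟩, ⟨p2, by omega⟩⟩
  · rintro ⟨h1, h2⟩
    have both : ∀ {P : V × Port m → Prop}, (∀ x, x.1 ∈ S → P x) → (∀ x, x.1 ∈ Sᶜ → P x) →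
        ∀ x, x.1 ∈ Set.univ → P x := fun h1 h2 x _ => by
      by_cases hx : x.1 ∈ S
      · exact h1 x hx
      · exact h2 x hx
    have hy : Relation.ReflTransGen (Adj G) r.1 y.1 :=
      (h.reach_glue (h1.conn z.1 h.mem)).tail ⟨z.2, y.2, h.right⟩
    obtain ⟨T, hT, hcl⟩ := h.exists_closed
    have e1 := h1.euler
    have e2 := h2.euler
    refine
      { root_mem := trivial
        mem := fun _ _ => trivial
        invol := h.invol_iff.2 (both h1.invol h2.invol)
        compat := h.compat_iff.2 (both h1.compat h2.compat)
        root_leaf := by rw [← h.other r hry hrz, hr]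
        conn := fun u _ => ?_
        leaves := both (fun x hx hl => (h.outer_iff₁ hx).2 (h1.leaves x hx
          ((h.leaf_iff x).2 (.inl hl)))) (fun x hx hl => (h.outer_iff₂ hx).2 (h2.leaves x hx
          ((h.leaf_iff x).2 (.inl hl))))
        cycles := fun u _ v huv hvu => ?_
        regions := both (fun x hx hi => (h.regions_iff hi).2 (h1.regions x hx
          (by rwa [← h.outer_iff₁ hx]))) (fun x hx hi => (h.regions_iff hi).2 (h2.regions x hx
          (by rwa [← h.outer_iff₂ hx])))
        euler := by rw [h.ncard_innerPref, h.ncard_nonleaf]; omega }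
    · by_cases hu : u ∈ S
      · exact h.reach_glue (h1.conn u hu)
      · exact hy.trans (h.reach_glue (h2.conn u hu))
    · have hc : Relation.ReflTransGen (Arr G') u v ∧ Relation.ReflTransGen (Arr G') v u := by
        have hmono : ∀ a b, Relation.ReflTransGen (Arr G) a b → a ∈ T → b ∈ T := by
          intro a b hab ha
          induction hab with
          | refl => exact ha
          | tail _ hbc ih => exact hcl _ _ hbc ih
        by_cases hu : u ∈ T
        · exact ⟨h.arr_glue_of_closed hT hcl huv (.inl hu),
            h.arr_glue_of_closed hT hcl hvu (.inl (hmono u v huv hu))⟩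
        · exact ⟨h.arr_glue_of_closed hT hcl huv (.inr fun h0 => hu (hmono v u hvu h0)),
            h.arr_glue_of_closed hT hcl hvu (.inr hu)⟩
      by_cases hu : u ∈ S
      · exact h1.cycles u hu v hc.1 hc.2
      · exact h2.cycles u hu v hc.1 hc.2

end BridgeCut

/-- An edge with the outer region on both sides is a bridge: if the graph remained connected after
the cut, its genus would be negative. -/
theorem IsTiling.exists_bridgeCut [Finite V] (hm : 3 ≤ m) {G G' : Equiv.Perm (V × Port m)}
    {r y z : V × Port m} {A B₁ B₂ : List (V × Port m)} (ht : IsTiling Set.univ G r)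
    (h : EdgeCut Set.univ G G' y z) (hc : IsCyc (fc G) r (A ++ y :: (B₁ ++ z :: B₂))) :
    ∃ S, BridgeCut S G G' r y z A B₁ B₂ := by
  classical
  have hinv : ∀ x, G' (G' x) = x := fun x => h.invol_iff.1 ht.invol x trivial
  obtain ⟨h1, h2⟩ := hc.split h.swap_fc
  have hz : Relation.ReflTransGen (Adj G') r.1 z.1 :=
    reflTransGen_of_sameCycle (h1.mem_iff.1 (by simp))
  refine ⟨{u | Relation.ReflTransGen (Adj G') r.1 u}, h, fun x => ?_, .refl, hz, fun hy => ?_, h1, h2⟩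
  · constructor
    · exact fun h0 => h0.tail ⟨(G' x).2, x.2, hinv x⟩
    · exact fun h0 => Relation.ReflTransGen.tail h0 ⟨x.2, (G' x).2, rfl⟩
  · have hy : Relation.ReflTransGen (Adj G') r.1 y.1 := hy
    have hall : ∀ u, Relation.ReflTransGen (Adj G') r.1 u := by
      intro u
      have := ht.conn u trivial
      induction this with
      | refl => exact .refl
      | tail _ hbc ih =>
        rcases h.adj_glue hbc with h3 | ⟨_, rfl⟩ | ⟨_, rfl⟩
        · exact ih.tail h3
        · exact hz
        · exact hy
    have hns : ¬ (fc G').SameCycle y z := by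
      intro h0
      have h3 := h2.mem_iff.2 h0
      have h4 := hc.1
      simp only [List.nodup_cons, List.nodup_append, List.mem_append, List.mem_cons] at h3 h4
      grind
    have e1 := genus_inequality hm G' hinv
    have e2 := card_components_of_conn r.1 hall
    have e3 := card_orbits_join h.swap_fc' hns
    have e4 := ht.toPreTiling.card_all_faces
    have e5 := ht.euler
    have e6 := h.ncard_eq
    have e7 : {x : V × Port m | x.1 ∈ Set.univ ∧ G' x ≠ x}.ncard =
        {x : V × Port m | x ∈ Set.univ ∧ G' x ≠ x}.ncard := by simp
    rw [Set.ncard_univ] at e5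
    omega

end Bordered

/-! ### Generating functions of tiling graphs -/

namespace Bordered

variable {m : ℕ}

/-- Two sums are equal if their terms are matched by a relation that is a bijection. -/
theorem sum_eq_of_rel {α β M : Type*} [AddCommMonoid M] {s : Finset α} {t : Finset β}
    {φ : α → M} {ψ : β → M} (ρ : α → β → Prop) (h1 : ∀ a ∈ s, ∃ b ∈ t, ρ a b)
    (h2 : ∀ b ∈ t, ∃ a ∈ s, ρ a b) (h3 : ∀ a b b', ρ a b → ρ a b' → b = b')
    (h4 : ∀ a a' b, ρ a b → ρ a' b → a = a') (h5 : ∀ a b, ρ a b → φ a = ψ b) :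
    ∑ a ∈ s, φ a = ∑ b ∈ t, ψ b := by
  choose f hf hρ using h1
  refine Finset.sum_bij f hf (fun a ha a' ha' h => ?_) (fun b hb => ?_)
    (fun a ha => h5 _ _ (hρ a ha))
  · exact h4 a a' _ (hρ a ha) (h ▸ hρ a' ha')
  · obtain ⟨a, ha, hab⟩ := h2 b hb
    exact ⟨a, ha, h3 a _ _ (hρ a ha) hab⟩

/-- The coefficients: polynomials over `ℤ[t]` in variables that record the weight. -/
abbrev Coef (m : ℕ) := MvPolynomial (Fin m) ℤ[X]

/-- The outer word of a class of tiling graphs. -/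
noncomputable def TClass.word (q : TClass m) : List (Bool × Letter m) :=
  Bordered.word q.out.glue q.out.root

/-- The weight of a class of tiling graphs. -/
noncomputable def TClass.wt (q : TClass m) : Fin m → ℕ :=
  Bordered.wt Set.univ q.out.glue q.out.root

/-- The monomial that records the weight and the number of vertices. -/
noncomputable def TClass.mon (q : TClass m) : Coef m :=
  MvPolynomial.monomial (Finsupp.equivFunOnFinite.symm q.wt) (Polynomial.X ^ q.out.d)

theorem finite_word (hm : 3 ≤ m) (W : List (Bool × Letter m)) :
    {q : TClass m | q.word = W}.Finite := by
  let f : TClass m → Σ d : ℕ, Equiv.Perm (Dart m d) × Dart m d :=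
    fun q => ⟨q.out.d, q.out.glue, q.out.root⟩
  have hf : Function.Injective f := by
    intro q q' h
    have : q.out = q'.out := by
      revert h
      simp only [f]
      generalize q.out = Γ
      generalize q'.out = Γ'
      intro h
      cases Γ
      cases Γ'
      simp only [Sigma.mk.injEq] at h
      obtain ⟨rfl, h⟩ := h
      simp only [heq_eq_eq, Prod.mk.injEq] at h
      obtain ⟨rfl, rfl⟩ := h
      rfl
    rw [← q.out_eq, this, q'.out_eq]
  refine Set.Finite.of_finite_image (f := f) (Set.Finite.subset
    (s := ⋃ d ∈ Set.Iic W.length, Set.range (Sigma.mk d)) ?_ ?_) hf.injOn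
  · exact (Set.finite_Iic _).biUnion fun d _ => Set.finite_range _
  · rintro _ ⟨q, hq, rfl⟩
    simp only [Set.mem_iUnion, Set.mem_Iic]
    refine ⟨q.out.d, ?_, ⟨_, rfl⟩⟩
    have := q.out.preTiling.ncard_le hm
    rw [Set.ncard_univ] at this
    simp only [Nat.card_eq_fintype_card, Fintype.card_fin] at this
    rw [← (hq : q.word = W)]
    exact this

/-- The classes of tiling graphs with a given outer word. -/
noncomputable def classes (hm : 3 ≤ m) (W : List (Bool × Letter m)) : Finset (TClass m) :=
  (finite_word hm W).toFinset

theorem mem_classes (hm : 3 ≤ m) {W : List (Bool × Letter m)} {q : TClass m} :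
    q ∈ classes hm W ↔ q.word = W := by
  simp [classes]

/-- The generating function of the tiling graphs with a given outer word. -/
noncomputable def gen (hm : 3 ≤ m) (W : List (Bool × Letter m)) : Coef m :=
  ∑ q ∈ classes hm W, q.mon

theorem gen_eq_zero (hm : 3 ≤ m) {W : List (Bool × Letter m)} (h : ∀ q : TClass m, q.word ≠ W) :
    gen hm W = 0 := by
  rw [gen, Finset.sum_eq_zero]
  intro q hq
  exact absurd ((mem_classes hm).1 hq) (h q)

theorem Rep.mon_eq {V : Type*} [Finite V] {q : TClass m} {S : Set V}
    {G : Equiv.Perm (V × Port m)} {r : V × Port m} (h : Rep q S G r) :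
    q.mon = MvPolynomial.monomial (Finsupp.equivFunOnFinite.symm (wt S G r))
      (Polynomial.X ^ S.ncard) := by
  rw [TClass.mon, TClass.wt, h.wt_eq, h.card_eq]

theorem Rep.word_eq' {V : Type*} [Finite V] {q : TClass m} {S : Set V}
    {G : Equiv.Perm (V × Port m)} {r : V × Port m} (h : Rep q S G r) : q.word = word G r :=
  h.word_eq

/-- A tiling graph has an even number of leaves. -/
theorem TClass.even_leaves (hm : 3 ≤ m) (q : TClass m) : Even (q.word.countP fun a => a.1) := by
  have := q.out.isTiling.degree hm
  obtain ⟨k, rfl⟩ : ∃ k, m = k + 3 := ⟨m - 3, by omega⟩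
  rw [show 2 * (k + 3) - 4 = 2 * (k + 1) by omega, mul_assoc] at this
  rw [TClass.word, Nat.even_iff]
  omega

theorem gen_eq_zero_of_odd (hm : 3 ≤ m) {W : List (Bool × Letter m)}
    (h : ¬ Even (W.countP fun a => a.1)) : gen hm W = 0 :=
  gen_eq_zero hm fun q hq => h (hq ▸ q.even_leaves hm)

/-- Two consecutive entries of an outer word. -/
def Consec (a b : Bool × Letter m) : Prop :=
  a.2.tgt = b.2.src ∧ (b.1 = false ↔ b.2 = a.2.next)

theorem PreTiling.isChain_mark {V : Type*} [Finite V] {S : Set V} {G : Equiv.Perm (V × Port m)}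
    {r : V × Port m} (h : PreTiling S G r) {x y : V × Port m} {l : List (V × Port m)}
    (hx : x.1 ∈ S) (hl : Seg (fc G) x l y) :
    ((x :: (l ++ [y])).map (mark G)).IsChain Consec := by
  induction l generalizing x with
  | nil =>
    have hl : fc G x = y := hl
    subst hl
    simp only [List.nil_append, List.map_cons, List.map_nil, List.isChain_cons_cons,
      List.isChain_singleton, and_true]
    exact h.mark_fc x hx
  | cons c l ih =>
    obtain ⟨h1, h2⟩ := hl
    subst h1
    have := ih (h.mem_fc hx) h2
    rw [List.map_cons, List.cons_append, List.map_cons, List.isChain_cons_cons]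
    rw [List.map_cons] at this
    exact ⟨h.mark_fc x hx, this⟩

theorem TClass.isChain_word (q : TClass m) (a : Bool × Letter m) (l : List (Bool × Letter m))
    (h : q.word = a :: l) : a.1 = true ∧ (a :: (l ++ [a])).IsChain Consec := by
  obtain ⟨l', hl'⟩ := exists_isCyc (fc q.out.glue) q.out.root
  have h1 := hl'.word_eq
  rw [TClass.word] at h
  rw [h, List.map_cons, List.cons.injEq] at h1
  obtain ⟨rfl, rfl⟩ := h1
  refine ⟨by simp [mark, q.out.root_leaf], ?_⟩
  simpa using q.out.preTiling.isChain_mark trivial hl'.2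

/-- If there are tiling graphs with a given outer word, then it satisfies the local
conditions. -/
theorem isChain_of_gen_ne_zero (hm : 3 ≤ m) {a : Bool × Letter m} {l : List (Bool × Letter m)}
    (h : gen hm (a :: l) ≠ 0) : a.1 = true ∧ (a :: (l ++ [a])).IsChain Consec := by
  by_contra h0
  exact h (gen_eq_zero hm fun q hq => h0 (q.isChain_word a l hq))

/-! #### Moving the root -/

theorem PreTiling.reflTransGen_mem {V : Type*} {S : Set V} {G : Equiv.Perm (V × Port m)}
    {r : V × Port m} (h : PreTiling S G r) {u v : V} (hu : u ∈ S)
    (huv : Relation.ReflTransGen (Adj G) u v) :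
    v ∈ S ∧ Relation.ReflTransGen (Adj G) v u := by
  induction huv with
  | refl => exact ⟨hu, .refl⟩
  | @tail b c _ hbc ih =>
    obtain ⟨p, q, hpq⟩ := hbc
    have h1 := h.mem (b, p) ih.1
    have h2 := h.invol (b, p) ih.1
    rw [hpq] at h1 h2
    exact ⟨h1, .head ⟨q, p, h2⟩ ih.2⟩

theorem IsTiling.reroot {V : Type*} [Finite V] {S : Set V} {G : Equiv.Perm (V × Port m)}
    {r r' : V × Port m} (h : IsTiling S G r) (hr : (fc G).SameCycle r r') (hl : G r' = r') :
    IsTiling S G r' := by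
  have key : ∀ x, (fc G).SameCycle r' x ↔ (fc G).SameCycle r x :=
    fun x => ⟨hr.trans, hr.symm.trans⟩
  have hmem := h.toPreTiling.mem_of_sameCycle h.root_mem hr
  exact
    { root_mem := hmem
      mem := h.mem
      invol := h.invol
      compat := h.compat
      root_leaf := hl
      conn := fun u hu =>
        (h.toPreTiling.reflTransGen_mem h.root_mem (h.conn _ hmem)).2.trans (h.conn u hu)
      leaves := fun x hx hx' => (key x).2 (h.leaves x hx hx')
      cycles := h.cycles
      regions := fun x hx hx' => h.regions x hx (by rwa [key] at hx')
      euler := by simp only [innerPref, key]; exact h.euler }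

theorem wt_reroot {V : Type*} {S : Set V} {G : Equiv.Perm (V × Port m)}
    {r r' : V × Port m} (hr : (fc G).SameCycle r r') : wt S G r' = wt S G r := by
  have key : ∀ x, (fc G).SameCycle r' x ↔ (fc G).SameCycle r x :=
    fun x => ⟨hr.trans, hr.symm.trans⟩
  funext i
  simp only [wt, innerPref, key]

/-- The class `q'` arises from `q` by moving the root to the position `n` of the outer word. -/
def RootMove (n : ℕ) (q q' : TClass m) : Prop :=
  ∃ (V : Type) (_ : Finite V) (S : Set V) (G : Equiv.Perm (V × Port m)) (r r' : V × Port m)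
    (A B : List (V × Port m)), IsCyc (fc G) r (A ++ r' :: B) ∧ G r' = r' ∧ A.length = n ∧
    Rep q S G r ∧ Rep q' S G r'

theorem RootMove.exists (hm : 3 ≤ m) {a b : Letter m} {A B : List (Bool × Letter m)} {q : TClass m}
    (hq : q ∈ classes hm ((true, a) :: (A ++ (true, b) :: B))) :
    ∃ q' ∈ classes hm ((true, b) :: (B ++ (true, a) :: A)), RootMove A.length q q' := by
  rw [mem_classes] at hq
  obtain ⟨l, hl⟩ := exists_isCyc (fc q.out.glue) q.out.root
  have h1 := hl.word_eq
  rw [← TClass.word, hq, List.map_cons, List.cons.injEq] at h1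
  obtain ⟨hr, h1⟩ := h1
  obtain ⟨A', l', rfl, hA, h2⟩ := List.map_eq_append_iff.1 h1.symm
  obtain ⟨r', B', rfl, hr', hB⟩ := List.map_eq_cons_iff.1 h2
  have hl' : q.out.glue r' = r' := by
    have := congrArg Prod.fst hr'
    simpa [mark] using this
  have ht := q.out.isTiling.reroot (hl.mem_iff.1 (by simp)) hl'
  obtain ⟨q', hq'⟩ := ht.exists_rep
  refine ⟨q', ?_, _, inferInstance, _, _, _, r', A', B', hl, hl', ?_, rep_out q, hq'⟩
  · rw [mem_classes, hq'.word_eq', hl.rotate.word_eq, ← hA, ← hB, ← hr', hr]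
    simp
  · rw [← hA, List.length_map]

theorem RootMove.unique {n : ℕ} {q₁ q₂ q₁' q₂' : TClass m} (h₁ : RootMove n q₁ q₁')
    (h₂ : RootMove n q₂ q₂') (h : q₁ = q₂) : q₁' = q₂' := by
  subst h
  obtain ⟨V, _, S, G, r, r', A, B, hc, hl, hA, h1, h1'⟩ := h₁
  obtain ⟨V', _, S', G', s, s', A', B', hc', hl', hA', h2, h2'⟩ := h₂
  obtain ⟨φ, hφ⟩ := h1.iso h2
  have h3 := hφ.isCyc h1.isTiling.toPreTiling h1.isTiling.root_mem hc
  rw [hφ.root] at h3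
  have h4 := h3.unique hc'
  rw [List.map_append, List.map_cons] at h4
  have h5 := (List.append_inj h4 (by simp [hA, hA'])).2
  rw [List.cons.injEq] at h5
  exact h1'.unique h2' ⟨hφ.bij, hφ.comm, h5.1⟩

theorem RootMove.symm {n : ℕ} {q q' : TClass m} (h : RootMove n q q') :
    ∃ k, n + k + 2 = q.word.length ∧ RootMove k q' q := by
  obtain ⟨V, _, S, G, r, r', A, B, hc, hl, hA, h1, h1'⟩ := h
  refine ⟨B.length, ?_, V, inferInstance, S, G, r', r, B, A, hc.rotate, h1.isTiling.root_leaf,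
    rfl, h1', h1⟩
  rw [h1.word_eq', hc.word_eq]
  simp [hA]
  omega

theorem RootMove.mon_eq {n : ℕ} {q q' : TClass m} (h : RootMove n q q') : q.mon = q'.mon := by
  obtain ⟨V, _, S, G, r, r', A, B, hc, hl, hA, h1, h1'⟩ := h
  have h2 : wt S G r' = wt S G r := wt_reroot (hc.mem_iff.1 (by simp))
  rw [h1.mon_eq, h1'.mon_eq, h2]

/-- The generating function is invariant under rotation of the outer word. -/
theorem gen_rotate (hm : 3 ≤ m) (a b : Letter m) (A B : List (Bool × Letter m)) :
    gen hm ((true, a) :: (A ++ (true, b) :: B)) = gen hm ((true, b) :: (B ++ (true, a) :: A)) := by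
  refine sum_eq_of_rel (fun q q' => RootMove A.length q q' ∧ RootMove B.length q' q) ?_ ?_ ?_ ?_ ?_
  · intro q hq
    obtain ⟨q', h1, h2⟩ := RootMove.exists hm hq
    refine ⟨q', h1, h2, ?_⟩
    obtain ⟨k, hk, h3⟩ := h2.symm
    rw [(mem_classes hm).1 hq] at hk
    simp only [List.length_cons, List.length_append] at hk
    obtain rfl : k = B.length := by omega
    exact h3
  · intro q hq
    obtain ⟨q', h1, h2⟩ := RootMove.exists hm hq
    refine ⟨q', h1, ?_, h2⟩
    obtain ⟨k, hk, h3⟩ := h2.symm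
    rw [(mem_classes hm).1 hq] at hk
    simp only [List.length_cons, List.length_append] at hk
    obtain rfl : k = A.length := by omega
    exact h3
  · exact fun a b b' h1 h2 => h1.1.unique h2.1 rfl
  · exact fun a a' b h1 h2 => h1.2.unique h2.2 rfl
  · exact fun a b h => h.1.mon_eq

end Bordered

/-! ### Cutting an edge on the boundary -/

namespace Bordered

variable {m : ℕ} {V V' : Type*}

/-- The entries of the outer word that appear when an edge next to an inner region with the
sector `x` is cut. -/
def uWord (x : Port m) : List (Bool × Letter m) :=
  (true, x.sector) :: if x.across = x then [] else [(false, x.across.sector)]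

/-- The entry with the flag set to true: the preceding edge is a leaf edge. -/
def hat : List (Bool × Letter m) → List (Bool × Letter m)
  | [] => []
  | c :: l => (true, c.2) :: l

/-- The type of the inner region with the sector `x`. -/
noncomputable def typ (x : Port m) : Fin m := x.exists_index.choose

theorem index_typ (x : Port m) : x.sector.index = (typ x).1 + 1 := x.exists_index.choose_spec

section EdgeCut

variable {S : Set V} {G G' : Equiv.Perm (V × Port m)} {y z : V × Port m}

theorem EdgeCut.mark_left (h : EdgeCut S G G' y z) : mark G y = (false, y.2.sector) := by
  simp [mark, h.left, h.ne.symm]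

theorem EdgeCut.mark_left' (h : EdgeCut S G G' y z) : mark G' y = (true, y.2.sector) := by
  simp [mark, h.left']

theorem EdgeCut.mark_other (h : EdgeCut S G G' y z) {x : V × Port m} (h1 : x ≠ y) (h2 : x ≠ z) :
    mark G' x = mark G x := by
  simp [mark, h.other x h1 h2]

theorem EdgeCut.map_mark (h : EdgeCut S G G' y z) {l : List (V × Port m)} (h1 : y ∉ l)
    (h2 : z ∉ l) : l.map (mark G') = l.map (mark G) :=
  List.map_congr_left fun _ hx => h.mark_other (fun h0 => h1 (h0 ▸ hx)) (fun h0 => h2 (h0 ▸ hx))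

end EdgeCut

theorem LoopCut.word_eq {S : Set V} {G G' : Equiv.Perm (V × Port m)} {r y z : V × Port m}
    {A Z B : List (V × Port m)} (h : LoopCut S G G' r y z A Z B) :
    word G r = mark G r :: (A.map (mark G) ++ (false, y.2.sector) :: B.map (mark G)) := by
  rw [h.cyc.word_eq, List.map_cons, List.map_append, List.map_cons, h.mark_left]

theorem LoopCut.word_eq' {S : Set V} {G G' : Equiv.Perm (V × Port m)} {r y z : V × Port m}
    {A Z B : List (V × Port m)} (h : LoopCut S G G' r y z A Z B) :
    word G' r =
      mark G r :: (A.map (mark G) ++ (uWord z.2 ++ (true, y.2.sector) :: B.map (mark G))) := by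
  have hn := h.cyc'.1
  simp only [List.nodup_cons, List.nodup_append, List.mem_append, List.mem_cons, not_or] at hn
  have hZ : (z :: Z).map (mark G') = uWord z.2 := by
    rcases h.shape with ⟨rfl, h1⟩ | ⟨w, rfl, hw, hne, hl⟩
    · simp [uWord, h1, h.symm.mark_left']
    · have : mark G' w = (false, z.2.across.sector) := by
        rw [h.mark_other (by grind) (by grind), mark, hw]
        simp [hl]
      simp [uWord, hne, h.symm.mark_left', this]
  rw [h.cyc'.word_eq, ← hZ]
  simp only [List.map_cons, List.map_append, List.cons_append, h.mark_left']
  rw [h.mark_other (x := r) (by grind) (by grind), h.map_mark (l := A) (by grind) (by grind),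
    h.map_mark (l := B) (by grind) (by grind)]

namespace BridgeCut

variable {S : Set V} {G G' : Equiv.Perm (V × Port m)} {r y z : V × Port m}
  {A B₁ B₂ : List (V × Port m)}

theorem word_eq [Finite V] (h : BridgeCut S G G' r y z A B₁ B₂) :
    word G r = mark G r :: (A.map (mark G) ++ (false, y.2.sector) ::
      (B₁.map (mark G) ++ (false, z.2.sector) :: B₂.map (mark G))) := by
  rw [h.cyc.word_eq]
  simp only [List.map_cons, List.map_append, h.mark_left, h.symm.mark_left]

theorem word_eq₁ [Finite V] (h : BridgeCut S G G' r y z A B₁ B₂) :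
    word G' r = mark G r :: (A.map (mark G) ++ (true, z.2.sector) :: B₂.map (mark G)) := by
  have hn := h.cyc.1
  simp only [List.nodup_cons, List.nodup_append, List.mem_append, List.mem_cons, not_or] at hn
  rw [h.cyc₁.word_eq]
  simp only [List.map_cons, List.map_append, h.symm.mark_left']
  rw [h.mark_other (x := r) (by grind) (by grind), h.map_mark (l := A) (by grind) (by grind),
    h.map_mark (l := B₂) (by grind) (by grind)]

theorem word_eq₂ [Finite V] (h : BridgeCut S G G' r y z A B₁ B₂) :
    word G' y = (true, y.2.sector) :: B₁.map (mark G) := by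
  have hn := h.cyc.1
  simp only [List.nodup_cons, List.nodup_append, List.mem_append, List.mem_cons, not_or] at hn
  rw [h.cyc₂.word_eq]
  simp only [List.map_cons, h.mark_left']
  rw [h.map_mark (l := B₁) (by grind) (by grind)]

/-- The two parts are determined by the graph after the cut. -/
theorem mem_iff_reach [Finite V] (h : BridgeCut S G G' r y z A B₁ B₂) (ht : IsTiling S G' r)
    (u : V) : u ∈ S ↔ Relation.ReflTransGen (Adj G') r.1 u :=
  ⟨ht.conn u, fun h0 => (h.reach_mem h0).2 h.root_mem⟩

end BridgeCut

/-! #### Isomorphisms and cuts -/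

section Iso

variable {φ : V → V'} {G₁ G₁' : Equiv.Perm (V × Port m)} {G₂ G₂' : Equiv.Perm (V' × Port m)}
  {r₁ y₁ z₁ : V × Port m} {r₂ y₂ z₂ : V' × Port m}

theorem IsIso.map_injective (h : IsIso φ Set.univ G₁ r₁ Set.univ G₂ r₂) :
    Function.Injective (Prod.map φ id : V × Port m → V' × Port m) :=
  fun _ _ hxy => h.injOn trivial trivial hxy

theorem IsIso.glue (h : IsIso φ Set.univ G₁' r₁ Set.univ G₂' r₂)
    (e₁ : EdgeCut Set.univ G₁ G₁' y₁ z₁) (e₂ : EdgeCut Set.univ G₂ G₂' y₂ z₂)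
    (hy : Prod.map φ id y₁ = y₂) (hz : Prod.map φ id z₁ = z₂) :
    IsIso φ Set.univ G₁ r₁ Set.univ G₂ r₂ := by
  refine ⟨h.bij, fun x _ => ?_, h.root⟩
  rcases e₁.cases x with rfl | rfl | ⟨h1, h2⟩
  · rw [hy, e₂.left, e₁.left, hz]
  · rw [hz, e₂.right, e₁.right, hy]
  · rw [← e₁.other x h1 h2, ← h.comm x trivial, e₂.other]
    · exact fun h0 => h1 (h.map_injective (h0.trans hy.symm))
    · exact fun h0 => h2 (h.map_injective (h0.trans hz.symm))

theorem IsIso.cut (h : IsIso φ Set.univ G₁ r₁ Set.univ G₂ r₂)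
    (e₁ : EdgeCut Set.univ G₁ G₁' y₁ z₁) (e₂ : EdgeCut Set.univ G₂ G₂' y₂ z₂)
    (hy : Prod.map φ id y₁ = y₂) :
    IsIso φ Set.univ G₁' r₁ Set.univ G₂' r₂ := by
  have hz : Prod.map φ id z₁ = z₂ := by rw [← e₁.left, ← h.comm _ trivial, hy, e₂.left]
  refine ⟨h.bij, fun x _ => ?_, h.root⟩
  rcases e₁.cases x with rfl | rfl | ⟨h1, h2⟩
  · rw [hy, e₂.left', e₁.left', hy]
  · rw [hz, e₂.right', e₁.right', hz]
  · rw [e₁.other x h1 h2, ← h.comm x trivial, e₂.other]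
    · exact fun h0 => h1 (h.map_injective (h0.trans hy.symm))
    · exact fun h0 => h2 (h.map_injective (h0.trans hz.symm))

/-- An isomorphism maps the entry of the outer cycle at a given position to the entry at the same
position. -/
theorem IsIso.map_eq_of_cyc [Finite V] {S : Set V} {S' : Set V'}
    (h : IsIso φ S G₁ r₁ S' G₂ r₂) (ht : PreTiling S G₁ r₁) {A₁ B₁ : List (V × Port m)}
    {A₂ B₂ : List (V' × Port m)} (c₁ : IsCyc (fc G₁) r₁ (A₁ ++ y₁ :: B₁))
    (c₂ : IsCyc (fc G₂) r₂ (A₂ ++ y₂ :: B₂)) (hl : A₁.length = A₂.length) :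
    Prod.map φ id y₁ = y₂ ∧ B₁.map (Prod.map φ id) = B₂ := by
  have h3 := h.isCyc ht ht.root_mem c₁
  rw [h.root] at h3
  have h4 := h3.unique c₂
  rw [List.map_append, List.map_cons] at h4
  have h5 := (List.append_inj h4 (by simp [hl])).2
  rwa [List.cons.injEq] at h5

open Classical in
theorem IsIso.union {φ' : V → V'} {S : Set V} {S' : Set V'} {s₁ : V × Port m} {s₂ : V' × Port m}
    (hS : ∀ x, (G₁ x).1 ∈ S ↔ x.1 ∈ S) (hr : r₁.1 ∈ S)
    (h : IsIso φ S G₁ r₁ S' G₂ r₂) (h' : IsIso φ' Sᶜ G₁ s₁ S'ᶜ G₂ s₂) :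
    IsIso (S.piecewise φ φ') Set.univ G₁ r₁ Set.univ G₂ r₂ := by
  have key : ∀ x : V × Port m, x.1 ∈ S → Prod.map (S.piecewise φ φ') id x = Prod.map φ id x :=
    fun x hx => Prod.ext (Set.piecewise_eq_of_mem _ _ _ hx) rfl
  have key' : ∀ x : V × Port m, x.1 ∉ S → Prod.map (S.piecewise φ φ') id x = Prod.map φ' id x :=
    fun x hx => Prod.ext (Set.piecewise_eq_of_notMem _ _ _ hx) rfl
  refine ⟨?_, fun x _ => ?_, by rw [key _ hr, h.root]⟩
  · have h1 := h.bij.congr (fun x hx => (Set.piecewise_eq_of_mem S φ φ' hx).symm)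
    have h2 := h'.bij.congr (fun x hx => (Set.piecewise_eq_of_notMem S φ φ' hx).symm)
    have h3 := h1.union h2 ?_
    · rwa [Set.union_compl_self, Set.union_compl_self] at h3
    · rw [Set.injOn_union disjoint_compl_right]
      exact ⟨h1.injOn, h2.injOn, fun a ha b hb hab => h2.mapsTo hb (hab ▸ h1.mapsTo ha)⟩
  · by_cases hx : x.1 ∈ S
    · rw [key x hx, key _ ((hS x).2 hx), h.comm x hx]
    · rw [key' x hx, key' _ (fun h0 => hx ((hS x).1 h0)), h'.comm x hx]

end Iso

/-! #### The two kinds of cuts of classes -/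

/-- Cutting the edge at the position `n` of the outer word of `q` gives `q'`: on the other side of
the edge is an inner region with the sector `x`. -/
def IsLoopCut (n : ℕ) (x : Port m) (q q' : TClass m) : Prop :=
  ∃ (V : Type) (_ : Finite V) (G G' : Equiv.Perm (V × Port m)) (r y z : V × Port m)
    (A Z B : List (V × Port m)), LoopCut Set.univ G G' r y z A Z B ∧ A.length = n ∧ z.2 = x ∧
    Rep q Set.univ G r ∧ Rep q' Set.univ G' r

/-- Cutting the edge at the position `n` of the outer word of `q` separates it into `q₁` and
`q₂`; the other side of the edge appears after `k` more steps in the outer word. -/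
def IsBridgeCut (n k : ℕ) (q q₁ q₂ : TClass m) : Prop :=
  ∃ (V : Type) (_ : Finite V) (S : Set V) (G G' : Equiv.Perm (V × Port m)) (r y z : V × Port m)
    (A B₁ B₂ : List (V × Port m)), BridgeCut S G G' r y z A B₁ B₂ ∧ A.length = n ∧
    B₁.length = k ∧ Rep q Set.univ G r ∧ Rep q₁ S G' r ∧ Rep q₂ Sᶜ G' y

section Unique

variable {n : ℕ}

theorem IsLoopCut.unique_right {x x' : Port m} {q q₁ q₂ : TClass m} (h : IsLoopCut n x q q₁)
    (h' : IsLoopCut n x' q q₂) : x = x' ∧ q₁ = q₂ := by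
  obtain ⟨V, _, G, G', r, y, z, A, Z, B, hc, hA, rfl, h1, h2⟩ := h
  obtain ⟨V', _, H, H', s, v, w, A', Z', B', hc', hA', rfl, h1', h2'⟩ := h'
  obtain ⟨φ, hφ⟩ := h1.iso h1'
  have hy := (hφ.map_eq_of_cyc h1.isTiling.toPreTiling hc.cyc hc'.cyc (hA.trans hA'.symm)).1
  refine ⟨?_, h2.unique h2' (hφ.cut hc.toEdgeCut hc'.toEdgeCut hy)⟩
  rw [← hc.left, ← hc'.left, ← hy, hφ.comm _ trivial]
  rfl

theorem IsLoopCut.unique_left {x : Port m} {q q₁ q₂ : TClass m} (h : IsLoopCut n x q₁ q)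
    (h' : IsLoopCut n x q₂ q) : q₁ = q₂ := by
  obtain ⟨V, _, G, G', r, y, z, A, Z, B, hc, hA, hx, h1, h2⟩ := h
  obtain ⟨V', _, H, H', s, v, w, A', Z', B', hc', hA', rfl, h1', h2'⟩ := h'
  obtain ⟨φ, hφ⟩ := h2.iso h2'
  have hz := hφ.map_eq_of_cyc h2.isTiling.toPreTiling hc.cyc' hc'.cyc' (hA.trans hA'.symm)
  have hZ : Z.length = Z'.length := by
    rcases hc.shape with ⟨rfl, _⟩ | ⟨_, rfl, _, _, _⟩ <;>
      rcases hc'.shape with ⟨rfl, _⟩ | ⟨_, rfl, _, _, _⟩ <;> simp_all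
  have hy := hz.2
  rw [List.map_append, List.map_cons] at hy
  have hy := (List.append_inj hy (by simp [hZ])).2
  rw [List.cons.injEq] at hy
  exact h1.unique h1' (hφ.glue hc.toEdgeCut hc'.toEdgeCut hy.1 hz.1)

theorem IsBridgeCut.unique_right {k k' : ℕ} {q q₁ q₂ q₁' q₂' : TClass m}
    (h : IsBridgeCut n k q q₁ q₂) (h' : IsBridgeCut n k' q q₁' q₂') :
    k = k' ∧ q₁ = q₁' ∧ q₂ = q₂' := by
  obtain ⟨V, _, S, G, G', r, y, z, A, B₁, B₂, hc, hA, rfl, h1, h2, h3⟩ := h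
  obtain ⟨V', _, T, H, H', s, v, w, A', B₁', B₂', hc', hA', rfl, h1', h2', h3'⟩ := h'
  obtain ⟨φ, hφ⟩ := h1.iso h1'
  have hy := hφ.map_eq_of_cyc h1.isTiling.toPreTiling hc.cyc hc'.cyc (hA.trans hA'.symm)
  have hψ := hφ.cut hc.toEdgeCut hc'.toEdgeCut hy.1
  have hz : Prod.map φ id z = w := by rw [← hc.left, ← hφ.comm _ trivial, hy.1, hc'.left]
  have hST : ∀ u, φ u ∈ T ↔ u ∈ S := by
    intro u
    rw [hc.mem_iff_reach h2.isTiling, hc'.mem_iff_reach h2'.isTiling, ← hψ.root]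
    constructor
    · intro h0
      obtain ⟨ψ, hψ'⟩ := IsIso.symm hφ h1.isTiling.toPreTiling
      by_contra hu
      rw [← hc.mem_iff_reach h2.isTiling] at hu
      have hu' := (hc.reach (h1.isTiling.conn u trivial)).resolve_left
        (fun h4 => hu ((hc.mem_iff_reach h2.isTiling u).2 h4))
      have h5 := (hψ.adj (fun _ _ => trivial) trivial hu').2
      rw [show φ y.1 = v.1 from congrArg Prod.fst hy.1] at h5
      rw [hψ.root] at h0
      exact hc'.notMem ((hc'.reach_mem h5).1 ((hc'.reach_mem h0).2 hc'.root_mem))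
    · exact fun h0 => (hψ.adj (fun _ _ => trivial) trivial h0).2
  have hbij : ∀ (P : Set V) (Q : Set V'), (∀ u, φ u ∈ Q ↔ u ∈ P) → Set.BijOn φ P Q :=
    fun P Q hPQ => ⟨fun u hu => (hPQ u).2 hu, hφ.bij.injOn.mono (Set.subset_univ _), fun v hv => by
      obtain ⟨u, _, rfl⟩ := hφ.bij.surjOn (Set.mem_univ v)
      exact ⟨u, (hPQ u).1 hv, rfl⟩⟩
  refine ⟨?_, ?_, ?_⟩
  · have h5 := hy.2
    rw [List.map_append, List.map_cons, hz] at h5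
    have hn : w ∉ B₁' := by
      have := hc'.cyc.1
      simp only [List.nodup_cons, List.nodup_append, List.mem_append, List.mem_cons, not_or] at this
      grind
    have hn' : w ∉ B₁.map (Prod.map φ id) := by
      have := hc.cyc.1
      simp only [List.nodup_cons, List.nodup_append, List.mem_append, List.mem_cons, not_or] at this
      rw [List.mem_map]
      rintro ⟨b, hb, hbw⟩
      have := hφ.map_injective (hbw.trans hz.symm)
      grind
    have h6 : B₁.map (Prod.map φ id) = B₁' := by
      rcases List.append_eq_append_iff.1 h5 with ⟨t, h6, h7⟩ | ⟨t, h6, h7⟩ <;> cases t <;> simp_all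
    rw [← h6, List.length_map]
  · exact h2.unique h2' ⟨hbij S T hST, fun x _ => hψ.comm x trivial, hψ.root⟩
  · exact h3.unique h3' ⟨hbij Sᶜ Tᶜ fun u => not_congr (hST u), fun x _ => hψ.comm x trivial, hy.1⟩

theorem IsBridgeCut.unique_left {k : ℕ} {q q' q₁ q₂ : TClass m}
    (h : IsBridgeCut n k q q₁ q₂) (h' : IsBridgeCut n k q' q₁ q₂) : q = q' := by
  classical
  obtain ⟨V, _, S, G, G', r, y, z, A, B₁, B₂, hc, hA, rfl, h1, h2, h3⟩ := h
  obtain ⟨V', _, T, H, H', s, v, w, A', B₁', B₂', hc', hA', hB, h1', h2', h3'⟩ := h'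
  obtain ⟨φ, hφ⟩ := h2.iso h2'
  obtain ⟨ψ, hψ⟩ := h3.iso h3'
  have hz := (hφ.map_eq_of_cyc h2.isTiling.toPreTiling hc.cyc₁ hc'.cyc₁ (hA.trans hA'.symm)).1
  have hu := hφ.union hc.closed hc.root_mem hψ
  refine h1.unique h1' (hu.glue hc.toEdgeCut hc'.toEdgeCut ?_ ?_)
  · rw [← hψ.root]
    exact Prod.ext (Set.piecewise_eq_of_notMem _ _ _ hc.notMem) rfl
  · rw [← hz]
    exact Prod.ext (Set.piecewise_eq_of_mem _ _ _ hc.mem) rfl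

theorem IsLoopCut.not_isBridgeCut {k : ℕ} {x : Port m} {q q' q₁ q₂ : TClass m}
    (h : IsLoopCut n x q q') : ¬ IsBridgeCut n k q q₁ q₂ := by
  intro h'
  obtain ⟨V, _, G, G', r, y, z, A, Z, B, hc, hA, hx, h1, h2⟩ := h
  obtain ⟨V', _, T, H, H', s, v, w, A', B₁', B₂', hc', hA', rfl, h1', h2', h3'⟩ := h'
  obtain ⟨φ, hφ⟩ := h1.iso h1'
  have hy := hφ.map_eq_of_cyc h1.isTiling.toPreTiling hc.cyc hc'.cyc (hA.trans hA'.symm)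
  have hz : Prod.map φ id z = w := by rw [← hc.left, ← hφ.comm _ trivial, hy.1, hc'.left]
  have h5 : w ∈ B.map (Prod.map φ id) := by rw [hy.2]; simp
  rw [List.mem_map] at h5
  obtain ⟨b, hb, hbw⟩ := h5
  rw [← hz] at hbw
  have := hφ.map_injective hbw
  exact hc.disjoint z (by simp) (by rw [← this]; simp [hb])

theorem IsLoopCut.mon_eq {x : Port m} {q q' : TClass m} (h : IsLoopCut n x q q') :
    q.mon = MvPolynomial.X (typ x) * q'.mon := by
  obtain ⟨V, _, G, G', r, y, z, A, Z, B, hc, hA, rfl, h1, h2⟩ := h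
  rw [h1.mon_eq, h2.mon_eq, MvPolynomial.X, MvPolynomial.monomial_mul, one_mul]
  congr 2
  ext i
  rw [Finsupp.add_apply, Finsupp.single_apply]
  simp only [Finsupp.equivFunOnFinite_symm_apply_apply]
  rw [hc.wt_eq (fun _ _ => trivial), add_comm, index_typ]
  simp [Fin.ext_iff]

theorem IsBridgeCut.mon_eq {k : ℕ} {q q₁ q₂ : TClass m} (h : IsBridgeCut n k q q₁ q₂) :
    q.mon = q₁.mon * q₂.mon := by
  obtain ⟨V, _, S, G, G', r, y, z, A, B₁, B₂, hc, hA, rfl, h1, h2, h3⟩ := h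
  rw [h1.mon_eq, h2.mon_eq, h3.mon_eq, MvPolynomial.monomial_mul, ← pow_add, Set.ncard_univ,
    ← Set.ncard_add_ncard_compl S]
  congr 2
  ext i
  rw [Finsupp.add_apply]
  simp only [Finsupp.equivFunOnFinite_symm_apply_apply]
  rw [hc.wt_eq]

end Unique

end Bordered

/-! ### The recursion for the generating functions -/

namespace Bordered

variable {m : ℕ}

theorem mark_eq_true {V : Type*} {G : Equiv.Perm (V × Port m)} {x : V × Port m} {a : Letter m}
    (h : mark G x = (true, a)) : G x = x ∧ x.2.sector = a := by
  simpa [mark] using h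

theorem mark_eq_false {V : Type*} {G : Equiv.Perm (V × Port m)} {x : V × Port m} {a : Letter m}
    (h : mark G x = (false, a)) : G x ≠ x ∧ x.2.sector = a := by
  simpa [mark] using h

/-- The dart before a leaf edge. -/
theorem port_of_fc_leaf {V : Type*} {G : Equiv.Perm (V × Port m)} {x y : V × Port m}
    (h : fc G x = y) (hy : G y = y) : y.2 = x.2.ccw := by
  rw [fc_apply] at h
  have := G.injective (h.trans hy.symm)
  rw [← this]

theorem exists_cut (hm : 3 ≤ m) {a b : Letter m} {A' B' : List (Bool × Letter m)}
    (hA : ∀ c ∈ A', c.1 = false) {q : TClass m}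
    (hq : q.word = (true, a) :: (A' ++ (false, b) :: B')) :
    (∃ x q', q'.word = (true, a) :: (A' ++ (uWord x ++ (true, b) :: B')) ∧
      IsLoopCut A'.length x q q') ∨
    ∃ k q₁ q₂, k < B'.length ∧ B'[k]?.map Prod.fst = some false ∧
      q₁.word = (true, a) :: (A' ++ hat (B'.drop k)) ∧ q₂.word = (true, b) :: B'.take k ∧
      IsBridgeCut A'.length k q q₁ q₂ := by
  classical
  have ht := q.out.isTiling
  have hrep := rep_out q
  have hw := hrep.word_eq'
  rw [hq] at hw
  generalize q.out.glue = G at ht hrep hw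
  generalize q.out.root = r at ht hrep hw
  obtain ⟨l, hl⟩ := exists_isCyc (fc G) r
  rw [hl.word_eq, List.map_cons, List.cons.injEq] at hw
  obtain ⟨hr, h1⟩ := hw
  obtain ⟨A, l', rfl, rfl, h2⟩ := List.map_eq_append_iff.1 h1.symm
  obtain ⟨y, B, rfl, hy, rfl⟩ := List.map_eq_cons_iff.1 h2
  obtain ⟨hyl, rfl⟩ := mark_eq_false hy
  clear hy
  rename' hyl => hy
  obtain ⟨z, hz⟩ : ∃ z, z = G y := ⟨_, rfl⟩
  have hzy : G z = y := by rw [hz, ht.invol y trivial]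
  have hec : EdgeCut Set.univ G (Equiv.swap y z * G) y z :=
    EdgeCut.of_cut (by rw [hz]; exact hy.symm) hz.symm hzy
      (by rw [hz]; exact ht.compat y trivial hy) trivial trivial
  generalize Equiv.swap y z * G = G' at hec
  have hrz : r ≠ z := by rintro rfl; exact hec.ne (by rw [← hzy, ht.root_leaf])
  have hry : r ≠ y := by rintro rfl; exact hy ht.root_leaf
  have hr' : G' r = r := by rw [hec.other r hry hrz, ht.root_leaf]
  rw [List.length_map]
  by_cases hzo : (fc G).SameCycle r z
  · right
    rw [← hl.mem_iff] at hzo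
    simp only [List.mem_cons, List.mem_append, hrz.symm, hec.ne.symm, false_or] at hzo
    rcases hzo with hzo | hzo
    · exfalso
      obtain ⟨A₁, A₂, rfl⟩ := List.append_of_mem hzo
      rw [List.append_assoc, List.cons_append] at hl
      obtain ⟨S, hS⟩ := ht.exists_bridgeCut hm hec.symm hl
      have hd := ((hS.isTiling_iff hm hr').1 ht).2.degree hm
      rw [hS.word_eq₂, List.countP_cons_of_pos (by simp), List.countP_eq_zero.2] at hd
      · obtain ⟨k, rfl⟩ : ∃ k, m = k + 3 := ⟨m - 3, by omega⟩
        rw [show 2 * (k + 3) - 4 = 2 * (k + 1) by omega, mul_assoc] at hd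
        omega
      · intro c hc
        rw [hA c (by simp only [List.map_append, List.map_cons, List.mem_append, List.mem_cons]
                     exact .inr (.inr hc))]
        simp
    · obtain ⟨B₁, B₂, rfl⟩ := List.append_of_mem hzo
      obtain ⟨S, hS⟩ := ht.exists_bridgeCut hm hec hl
      obtain ⟨t1, t2⟩ := (hS.isTiling_iff hm hr').1 ht
      obtain ⟨q₁, h₁⟩ := t1.exists_rep
      obtain ⟨q₂, h₂⟩ := t2.exists_rep
      refine ⟨B₁.length, q₁, q₂, by simp, ?_, ?_, ?_,
        _, inferInstance, S, G, G', r, y, z, A, B₁, B₂, hS, rfl, rfl, hrep, h₁, h₂⟩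
      · simp [hec.symm.mark_left]
      · rw [h₁.word_eq', hS.word_eq₁, hr, List.map_append, List.drop_left' (by simp)]
        simp [hat, hec.symm.mark_left]
      · rw [h₂.word_eq', hS.word_eq₂, List.map_append, List.take_left' (by simp)]
  · left
    have hsame : (fc G).SameCycle z (fc G z) := ⟨1, by simp⟩
    have hlc : ∃ Z, LoopCut Set.univ G G' r y z A Z B := by
      have hd : ∀ x, (fc G).SameCycle z x → x ∉ r :: (A ++ y :: B) :=
        fun x hx hx' => hzo ((hl.mem_iff.1 hx').trans hx.symm)
      rcases ht.regions z trivial hzo with ⟨h1, h2⟩ | ⟨h1, h2, h3⟩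
      · refine ⟨[], hec, hl, ⟨by simp, h2⟩, fun x hx => hd x ?_, .inl ⟨rfl, h1⟩⟩
        rw [List.mem_singleton.1 hx]
      · refine ⟨[fc G z], hec, hl, ⟨by simp [Ne.symm h2], rfl, h3⟩, fun x hx => hd x ?_,
          .inr ⟨_, rfl, ht.port_fc trivial hzo, h1, fun h0 => ?_⟩⟩
        · simp only [List.mem_cons, List.not_mem_nil, or_false] at hx
          rcases hx with rfl | rfl
          · exact .refl _ _
          · exact hsame
        · exact hzo ((ht.leaves _ trivial h0).trans hsame.symm)
    obtain ⟨Z, hc⟩ := hlc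
    obtain ⟨q', h'⟩ := ((hc.isTiling_iff hr').1 ht).exists_rep
    refine ⟨z.2, q', ?_, _, inferInstance, G, G', r, y, z, A, Z, B, hc, rfl, rfl, hrep, h'⟩
    rw [h'.word_eq', hc.word_eq', hr]

theorem exists_of_loopCut {a b : Letter m} {A' B' : List (Bool × Letter m)}
    {x : Port m} {q' : TClass m}
    (hq : q'.word = (true, a) :: (A' ++ (uWord x ++ (true, b) :: B'))) :
    ∃ q : TClass m, q.word = (true, a) :: (A' ++ (false, b) :: B') ∧
      IsLoopCut A'.length x q q' := by
  classical
  have ht := q'.out.isTiling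
  have hrep := rep_out q'
  have hw := hrep.word_eq'
  rw [hq] at hw
  generalize q'.out.glue = G' at ht hrep hw
  generalize q'.out.root = r at ht hrep hw
  obtain ⟨l, hl⟩ := exists_isCyc (fc G') r
  rw [hl.word_eq, List.map_cons, List.cons.injEq] at hw
  obtain ⟨hr, h1⟩ := hw
  obtain ⟨A, l', rfl, hA, h2⟩ := List.map_eq_append_iff.1 h1.symm
  rw [uWord, List.cons_append] at h2
  obtain ⟨z, l'', rfl, hz, h3⟩ := List.map_eq_cons_iff.1 h2
  obtain ⟨Z, l', rfl, hZ, h4⟩ := List.map_eq_append_iff.1 h3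
  obtain ⟨y, B, rfl, hy, hB⟩ := List.map_eq_cons_iff.1 h4
  obtain ⟨hzl, hzx⟩ := mark_eq_true hz
  obtain rfl := Port.sector_injective hzx
  clear hz
  rename' hzl => hz
  obtain ⟨hy, hyb⟩ := mark_eq_true hy
  have hn := hl.1
  simp only [List.nodup_cons, List.nodup_append, List.mem_append, List.mem_cons, not_or] at hn
  have hyz : y ≠ z := by grind
  have hseg := (seg_append.1 (seg_append.1 hl.2).2).1
  have hsh : ((Z = [] ∧ z.2.across = z.2) ∨
      ∃ w, Z = [w] ∧ w.2 = z.2.across ∧ z.2.across ≠ z.2 ∧ G' w ≠ w) ∧ z.2 = y.2.flip := by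
    split_ifs at hZ with hx
    · obtain rfl := List.map_eq_nil_iff.1 hZ
      refine ⟨.inl ⟨rfl, hx⟩, ?_⟩
      rw [port_of_fc_leaf hseg hy]
      exact hx.symm
    · obtain ⟨w, rfl, hw⟩ := List.map_eq_singleton_iff.1 hZ
      obtain ⟨hw, hw'⟩ := mark_eq_false hw
      have hw' := Port.sector_injective hw'
      refine ⟨.inr ⟨w, rfl, hw', hx, hw⟩, ?_⟩
      rw [port_of_fc_leaf hseg.2 hy]
      change z.2 = w.2.across
      rw [hw', Port.across_across]
  have hec : EdgeCut Set.univ (Equiv.swap y z * G') G' y z :=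
    EdgeCut.of_glue hyz hy hz hsh.2 trivial trivial
  generalize Equiv.swap y z * G' = G at hec
  have hsplit := hl.split (g := fc G) (fun u => by rw [Equiv.swap_comm]; exact hec.swap_fc' u)
  have hc : LoopCut Set.univ G G' r y z A Z B := by
    refine ⟨hec, hsplit.1, hsplit.2, fun u hu => ?_, ?_⟩
    · simp only [List.mem_cons, List.mem_append] at hu ⊢
      grind
    · rcases hsh.1 with h | ⟨w, rfl, h5, h6, h7⟩
      · exact .inl h
      · refine .inr ⟨w, rfl, h5, h6, ?_⟩
        rwa [← hec.other w (by grind) (by grind)]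
  obtain ⟨q, h'⟩ := ((hc.isTiling_iff ht.root_leaf).2 ht).exists_rep
  have hmark : ∀ {u}, u ≠ y → u ≠ z → mark G u = mark G' u := fun h1 h2 =>
    (hec.mark_other h1 h2).symm
  refine ⟨q, ?_, _, inferInstance, G, G', r, y, z, A, Z, B, hc, ?_, rfl, h', hrep⟩
  · rw [h'.word_eq', hc.word_eq, hr, ← hA, ← hB, hyb, hmark (by grind) (by grind),
      hec.map_mark (l := A) (by grind) (by grind), hec.map_mark (l := B) (by grind) (by grind)]
  · rw [← hA, List.length_map]

theorem exists_of_bridgeCut (hm : 3 ≤ m) {a b c : Letter m} {A' B₁' B₂' : List (Bool × Letter m)}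
    (hB : ((false, b) :: (B₁' ++ [(false, c)])).IsChain fun d e => e.1 = false → e.2 = d.2.next)
    {q₁ q₂ : TClass m} (h₁ : q₁.word = (true, a) :: (A' ++ (true, c) :: B₂'))
    (h₂ : q₂.word = (true, b) :: B₁') :
    ∃ q : TClass m, q.word = (true, a) :: (A' ++ (false, b) :: (B₁' ++ (false, c) :: B₂')) ∧
      IsBridgeCut A'.length B₁'.length q q₁ q₂ := by
  classical
  let E : (Fin q₁.out.d ⊕ Fin q₂.out.d) × Port m ≃ Dart m q₁.out.d ⊕ Dart m q₂.out.d :=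
    Equiv.sumProdDistrib _ _ _
  obtain ⟨G', hG'⟩ : ∃ G' : Equiv.Perm ((Fin q₁.out.d ⊕ Fin q₂.out.d) × Port m),
      G' = E.symm.permCongr (Equiv.sumCongr q₁.out.glue q₂.out.glue) := ⟨_, rfl⟩
  have hinl : ∀ x, G' (Prod.map Sum.inl id x) = Prod.map Sum.inl id (q₁.out.glue x) := by
    rintro ⟨u, p⟩; rw [hG']; rfl
  have hinr : ∀ x, G' (Prod.map Sum.inr id x) = Prod.map Sum.inr id (q₂.out.glue x) := by
    rintro ⟨u, p⟩; rw [hG']; rfl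
  have i₁ : IsIso Sum.inl Set.univ q₁.out.glue q₁.out.root (Set.range Sum.inl) G'
      (Prod.map Sum.inl id q₁.out.root) :=
    ⟨by rw [← Set.image_univ]; exact Sum.inl_injective.injOn.bijOn_image, fun x _ => hinl x, rfl⟩
  have i₂ : IsIso Sum.inr Set.univ q₂.out.glue q₂.out.root (Set.range Sum.inl)ᶜ G'
      (Prod.map Sum.inr id q₂.out.root) :=
    ⟨by rw [Set.compl_range_inl, ← Set.image_univ]; exact Sum.inr_injective.injOn.bijOn_image,
      fun x _ => hinr x, rfl⟩
  have r₁ : Rep q₁ _ _ _ := ⟨_, i₁⟩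
  have r₂ : Rep q₂ _ _ _ := ⟨_, i₂⟩
  have t₁ := r₁.isTiling
  have t₂ := r₂.isTiling
  have hcl : ∀ x, (G' x).1 ∈ Set.range Sum.inl ↔ x.1 ∈ Set.range Sum.inl := fun x =>
    ⟨fun h0 => by_contra fun h1 => t₂.mem x h1 h0, t₁.mem x⟩
  clear i₁ i₂ hinl hinr hG'
  generalize (Prod.map Sum.inl id q₁.out.root :
    (Fin q₁.out.d ⊕ Fin q₂.out.d) × Port m) = r at *
  generalize (Prod.map Sum.inr id q₂.out.root :
    (Fin q₁.out.d ⊕ Fin q₂.out.d) × Port m) = y at *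
  generalize (Set.range Sum.inl : Set (Fin q₁.out.d ⊕ Fin q₂.out.d)) = S at *
  have w₁ := h₁.symm.trans r₁.word_eq'
  have w₂ := h₂.symm.trans r₂.word_eq'
  obtain ⟨l₁, hl₁⟩ := exists_isCyc (fc G') r
  obtain ⟨B₁, hl₂⟩ := exists_isCyc (fc G') y
  rw [hl₁.word_eq, List.map_cons, List.cons.injEq] at w₁
  rw [hl₂.word_eq, List.map_cons, List.cons.injEq] at w₂
  obtain ⟨hr, w₁⟩ := w₁
  obtain ⟨hyb, hB₁⟩ := w₂
  obtain ⟨A, l', rfl, hA, h2⟩ := List.map_eq_append_iff.1 w₁.symm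
  obtain ⟨z, B₂, rfl, hz, hB₂⟩ := List.map_eq_cons_iff.1 h2
  obtain ⟨hz, hzc⟩ := mark_eq_true hz
  obtain ⟨hy, hyb⟩ := mark_eq_true hyb.symm
  have hzS : z.1 ∈ S := t₁.mem_of_sameCycle t₁.root_mem (hl₁.mem_iff.1 (by simp))
  have hyz : y ≠ z := by rintro rfl; exact t₂.root_mem hzS
  have hflip : z.2 = y.2.flip := by
    have key : ∃ w, fc G' w = y ∧ c = w.2.sector.next := by
      rcases List.eq_nil_or_concat B₁ with rfl | ⟨B₃, w, rfl⟩
      · refine ⟨y, hl₂.2, ?_⟩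
        rw [hB₁, List.map_nil, List.nil_append, List.isChain_pair] at hB
        rw [hyb]
        exact hB rfl
      · refine ⟨w, (seg_append (l' := []) |>.1 (by simpa using hl₂.2)).2, ?_⟩
        rw [hB₁, List.concat_eq_append, List.map_append, List.append_assoc, ← List.cons_append,
          List.isChain_append] at hB
        have := hB.2.1
        rw [List.map_cons, List.map_nil, List.singleton_append, List.isChain_pair] at this
        exact this rfl
    obtain ⟨w, hw, hcw⟩ := key
    rw [port_of_fc_leaf hw hy]
    apply Port.sector_injective
    rw [hzc, hcw, ← Port.sector_across]
    rfl
  have hec : EdgeCut Set.univ (Equiv.swap y z * G') G' y z :=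
    EdgeCut.of_glue hyz hy hz hflip trivial trivial
  generalize Equiv.swap y z * G' = G at hec
  have hc : BridgeCut S G G' r y z A B₁ B₂ := ⟨hec, hcl, t₁.root_mem, hzS, t₂.root_mem, hl₁, hl₂⟩
  obtain ⟨q, h'⟩ := ((hc.isTiling_iff hm t₁.root_leaf).2 ⟨t₁, t₂⟩).exists_rep
  have hn := hc.cyc.1
  simp only [List.nodup_cons, List.nodup_append, List.mem_append, List.mem_cons, not_or] at hn
  refine ⟨q, ?_, _, inferInstance, S, G, G', r, y, z, A, B₁, B₂, hc, ?_, ?_, h', r₁, r₂⟩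
  · rw [h'.word_eq', hc.word_eq, hr, ← hA, ← hB₂, hyb, hzc, hB₁,
      ← hec.mark_other (x := r) (by grind) (by grind),
      ← hec.map_mark (l := A) (by grind) (by grind), ← hec.map_mark (l := B₁) (by grind) (by grind),
      ← hec.map_mark (l := B₂) (by grind) (by grind)]
  · rw [← hA, List.length_map]
  · rw [hB₁, List.length_map]

/-- Two graphs that are related by the cut of the edge at the position `n` of the outer word. -/
def IsCut (n : ℕ) (q : TClass m) :
    (Σ _ : Port m, TClass m) ⊕ (Σ _ : ℕ, TClass m × TClass m) → Prop
  | .inl b => IsLoopCut n b.1 q b.2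
  | .inr b => IsBridgeCut n b.1 q b.2.1 b.2.2

theorem sum_disjSum_sigma {ι κ α R : Type*} [Fintype ι] [CommSemiring R] (s : ι → Finset α)
    (t : Finset κ) (u v : κ → Finset α) (g : ι → R) (f : α → R) :
    ∑ b ∈ (Finset.univ.sigma s).disjSum (t.sigma fun k => u k ×ˢ v k),
      Sum.elim (fun b : Σ _ : ι, α => g b.1 * f b.2)
        (fun b : Σ _ : κ, α × α => f b.2.1 * f b.2.2) b =
    ∑ x, g x * ∑ q ∈ s x, f q + ∑ k ∈ t, (∑ q ∈ u k, f q) * ∑ q ∈ v k, f q := by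
  rw [Finset.sum_disjSum, Finset.sum_sigma, Finset.sum_sigma]
  simp only [Sum.elim_inl, Sum.elim_inr, Finset.sum_product, Finset.sum_mul_sum]
  simp only [Finset.mul_sum]

/-- The recursion for the generating functions: one cuts the inner edge that precedes the sector of
the letter `b` of the outer word. If there is an inner region on the other side of the edge, its
sectors join the outer region (first sum). Otherwise the edge is a bridge, and the graph falls apart
into two graphs (second sum, where `k` is the position at which the outer word returns to the
edge). -/
theorem gen_cut (hm : 3 ≤ m) (a b : Letter m) (A' B' : List (Bool × Letter m))
    (hA : ∀ c ∈ A', c.1 = false)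
    (hB : ((false, b) :: B').IsChain fun d e => e.1 = false → e.2 = d.2.next) :
    gen hm ((true, a) :: (A' ++ (false, b) :: B')) =
      ∑ x : Port m, MvPolynomial.X (typ x) *
        gen hm ((true, a) :: (A' ++ (uWord x ++ (true, b) :: B'))) +
      ∑ k ∈ (Finset.range B'.length).filter (fun k => B'[k]?.map Prod.fst = some false),
        gen hm ((true, a) :: (A' ++ hat (B'.drop k))) * gen hm ((true, b) :: B'.take k) := by
  classical
  let s : Finset (Σ _ : Port m, TClass m) := Finset.univ.sigma fun x =>
    classes hm ((true, a) :: (A' ++ (uWord x ++ (true, b) :: B')))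
  let t : Finset (Σ _ : ℕ, TClass m × TClass m) :=
    ((Finset.range B'.length).filter (fun k => B'[k]?.map Prod.fst = some false)).sigma fun k =>
      classes hm ((true, a) :: (A' ++ hat (B'.drop k))) ×ˢ classes hm ((true, b) :: B'.take k)
  have key : ∑ q ∈ classes hm ((true, a) :: (A' ++ (false, b) :: B')), q.mon =
      ∑ b ∈ s.disjSum t, Sum.elim (fun b => MvPolynomial.X (typ b.1) * b.2.mon)
        (fun b => b.2.1.mon * b.2.2.mon) b := by
    refine sum_eq_of_rel (IsCut A'.length) ?_ ?_ ?_ ?_ ?_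
    · intro q hq
      rcases exists_cut hm hA ((mem_classes hm).1 hq) with ⟨x, q', h1, h2⟩ |
        ⟨k, q₁, q₂, h1, h2, h3, h4, h5⟩
      · refine ⟨.inl ⟨x, q'⟩, ?_, h2⟩
        simp [s, mem_classes, h1]
      · refine ⟨.inr ⟨k, q₁, q₂⟩, ?_, h5⟩
        rw [Finset.inr_mem_disjSum, Finset.mem_sigma, Finset.mem_product, mem_classes, mem_classes,
          Finset.mem_filter, Finset.mem_range]
        exact ⟨⟨h1, h2⟩, h3, h4⟩
    · rintro (⟨x, q'⟩ | ⟨k, q₁, q₂⟩) hq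
      · simp only [s, Finset.inl_mem_disjSum, Finset.mem_sigma, Finset.mem_univ, mem_classes,
          true_and] at hq
        obtain ⟨q, h1, h2⟩ := exists_of_loopCut hq
        exact ⟨q, (mem_classes hm).2 h1, h2⟩
      · simp only [t, Finset.inr_mem_disjSum, Finset.mem_sigma, Finset.mem_filter,
          Finset.mem_range, mem_classes, Finset.mem_product] at hq
        obtain ⟨⟨hk, hc⟩, h1, h2⟩ := hq
        rw [List.getElem?_eq_getElem hk, Option.map_some, Option.some_inj] at hc
        obtain ⟨c, hc⟩ : ∃ c, B'[k] = (false, c) := ⟨_, Prod.ext hc rfl⟩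
        have hd : B'.drop k = (false, c) :: B'.drop (k + 1) := by
          rw [List.drop_eq_getElem_cons hk, hc]
        have hsplit : B' = B'.take k ++ (false, c) :: B'.drop (k + 1) := by
          rw [← hd, List.take_append_drop]
        rw [hd] at h1
        have hB' : ((false, b) :: (B'.take k ++ [(false, c)])).IsChain
            fun d e => e.1 = false → e.2 = d.2.next := by
          rw [hsplit, List.append_cons, ← List.cons_append] at hB
          exact hB.left_of_append
        obtain ⟨q, h3, h4⟩ := exists_of_bridgeCut hm hB' h1 h2
        rw [← hsplit] at h3
        refine ⟨q, (mem_classes hm).2 h3, ?_⟩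
        rwa [List.length_take, min_eq_left hk.le] at h4
    · rintro q (⟨x, q'⟩ | ⟨k, q₁, q₂⟩) (⟨x', q''⟩ | ⟨k', q₁', q₂'⟩) h h'
      · obtain ⟨rfl, rfl⟩ := IsLoopCut.unique_right h h'
        rfl
      · exact (IsLoopCut.not_isBridgeCut h h').elim
      · exact (IsLoopCut.not_isBridgeCut h' h).elim
      · obtain ⟨rfl, rfl, rfl⟩ := IsBridgeCut.unique_right h h'
        rfl
    · rintro q q' (⟨x, q''⟩ | ⟨k, q₁, q₂⟩) h h'
      · exact IsLoopCut.unique_left h h'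
      · exact IsBridgeCut.unique_left h h'
    · rintro q (⟨x, q''⟩ | ⟨k, q₁, q₂⟩) h
      · exact IsLoopCut.mon_eq h
      · exact IsBridgeCut.mon_eq h
  rw [gen, key]
  exact sum_disjSum_sigma
    (fun x => classes hm ((true, a) :: (A' ++ (uWord x ++ (true, b) :: B'))))
    ((Finset.range B'.length).filter (fun k => B'[k]?.map Prod.fst = some false))
    (fun k => classes hm ((true, a) :: (A' ++ hat (B'.drop k))))
    (fun k => classes hm ((true, b) :: B'.take k)) (fun x => MvPolynomial.X (typ x)) TClass.mon

end Bordered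

/-! ### Sums over decompositions of lists -/

namespace Bordered

section Sums

variable {α β M N : Type*} [AddCommMonoid M] [AddCommMonoid N]

/-- The sum of `f x y` over the decompositions `l = x ++ y`. -/
def cuts (f : List α → List α → M) : List α → M
  | [] => f [] []
  | a :: l => f [] (a :: l) + cuts (fun x y => f (a :: x) y) l

/-- The sum of `f x b y` over the decompositions `l = x ++ b :: y`. -/
def pts (f : List α → α → List α → M) : List α → M
  | [] => 0
  | a :: l => f [] a l + pts (fun x b y => f (a :: x) b y) l

/-- The sum of `f x y` over the decompositions `l = x ++ y` into nonempty lists. -/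
def icuts (f : List α → List α → M) : List α → M
  | [] => 0
  | a :: l => pts (fun x b y => f (a :: x) (b :: y)) l

theorem cuts_congr {f g : List α → List α → M} {l : List α}
    (h : ∀ x y, x ++ y = l → f x y = g x y) : cuts f l = cuts g l := by
  induction l generalizing f g with
  | nil => exact h [] [] rfl
  | cons a l ih =>
    exact congrArg₂ (· + ·) (h _ _ rfl) (ih fun x y hxy => h _ _ (by rw [List.cons_append, hxy]))

theorem pts_congr {f g : List α → α → List α → M} {l : List α}
    (h : ∀ x b y, x ++ b :: y = l → f x b y = g x b y) : pts f l = pts g l := by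
  induction l generalizing f g with
  | nil => rfl
  | cons a l ih =>
    exact congrArg₂ (· + ·) (h _ _ _ rfl) (ih fun x b y hxy => h _ _ _ (by rw [List.cons_append, hxy]))

theorem icuts_congr {f g : List α → List α → M} {l : List α}
    (h : ∀ x y, x ≠ [] → y ≠ [] → x ++ y = l → f x y = g x y) : icuts f l = icuts g l := by
  cases l with
  | nil => rfl
  | cons a l =>
    exact pts_congr fun x b y hxy => h _ _ (by simp) (by simp) (by rw [List.cons_append, hxy])

@[simp]
theorem cuts_zero (l : List α) : cuts (fun _ _ => (0 : M)) l = 0 := by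
  induction l with
  | nil => rfl
  | cons a l ih => rw [cuts, ih, add_zero]

@[simp]
theorem pts_zero (l : List α) : pts (fun _ _ _ => (0 : M)) l = 0 := by
  induction l with
  | nil => rfl
  | cons a l ih => rw [pts, ih, add_zero]

@[simp]
theorem icuts_zero (l : List α) : icuts (fun _ _ => (0 : M)) l = 0 := by
  cases l with
  | nil => rfl
  | cons a l => exact pts_zero l

theorem cuts_eq_zero {f : List α → List α → M} {l : List α} (h : ∀ x y, x ++ y = l → f x y = 0) :
    cuts f l = 0 := (cuts_congr h).trans (cuts_zero l)

theorem pts_eq_zero {f : List α → α → List α → M} {l : List α}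
    (h : ∀ x b y, x ++ b :: y = l → f x b y = 0) : pts f l = 0 := (pts_congr h).trans (pts_zero l)

theorem icuts_eq_zero {f : List α → List α → M} {l : List α}
    (h : ∀ x y, x ≠ [] → y ≠ [] → x ++ y = l → f x y = 0) : icuts f l = 0 :=
  (icuts_congr h).trans (icuts_zero l)

theorem cuts_add (f g : List α → List α → M) (l : List α) :
    cuts (fun x y => f x y + g x y) l = cuts f l + cuts g l := by
  induction l generalizing f g with
  | nil => rfl
  | cons a l ih => rw [cuts, cuts, cuts, ih, add_add_add_comm]

theorem pts_add (f g : List α → α → List α → M) (l : List α) :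
    pts (fun x b y => f x b y + g x b y) l = pts f l + pts g l := by
  induction l generalizing f g with
  | nil => exact (add_zero 0).symm
  | cons a l ih => rw [pts, pts, pts, ih, add_add_add_comm]

theorem icuts_add (f g : List α → List α → M) (l : List α) :
    icuts (fun x y => f x y + g x y) l = icuts f l + icuts g l := by
  cases l with
  | nil => exact (add_zero 0).symm
  | cons a l => exact pts_add _ _ l

theorem map_cuts {F : Type*} [FunLike F M N] [AddMonoidHomClass F M N] (φ : F)
    (f : List α → List α → M) (l : List α) : φ (cuts f l) = cuts (fun x y => φ (f x y)) l := by
  induction l generalizing f with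
  | nil => rfl
  | cons a l ih => rw [cuts, cuts, map_add, ih]

theorem map_pts {F : Type*} [FunLike F M N] [AddMonoidHomClass F M N] (φ : F)
    (f : List α → α → List α → M) (l : List α) :
    φ (pts f l) = pts (fun x b y => φ (f x b y)) l := by
  induction l generalizing f with
  | nil => exact map_zero φ
  | cons a l ih => rw [pts, pts, map_add, ih]

theorem map_icuts {F : Type*} [FunLike F M N] [AddMonoidHomClass F M N] (φ : F)
    (f : List α → List α → M) (l : List α) : φ (icuts f l) = icuts (fun x y => φ (f x y)) l := by
  cases l with
  | nil => exact map_zero φ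
  | cons a l => exact map_pts φ _ l

theorem cuts_smul {R : Type*} [Monoid R] [DistribMulAction R M] (c : R)
    (f : List α → List α → M) (l : List α) : cuts (fun x y => c • f x y) l = c • cuts f l :=
  (map_cuts (DistribSMul.toAddMonoidHom M c) f l).symm

theorem pts_smul {R : Type*} [Monoid R] [DistribMulAction R M] (c : R)
    (f : List α → α → List α → M) (l : List α) :
    pts (fun x b y => c • f x b y) l = c • pts f l :=
  (map_pts (DistribSMul.toAddMonoidHom M c) f l).symm

theorem icuts_smul {R : Type*} [Monoid R] [DistribMulAction R M] (c : R)
    (f : List α → List α → M) (l : List α) : icuts (fun x y => c • f x y) l = c • icuts f l :=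
  (map_icuts (DistribSMul.toAddMonoidHom M c) f l).symm

theorem pts_append (f : List α → α → List α → M) (l l' : List α) :
    pts f (l ++ l') =
      pts (fun x b y => f x b (y ++ l')) l + pts (fun x b y => f (l ++ x) b y) l' := by
  induction l generalizing f with
  | nil => exact (zero_add _).symm
  | cons a l ih => rw [List.cons_append, pts, pts, ih, add_assoc]; rfl

theorem cuts_append_cons (f : List α → List α → M) (l : List α) (a : α) (l' : List α) :
    cuts f (l ++ a :: l') =
      cuts (fun x y => f x (y ++ a :: l')) l + cuts (fun x y => f (l ++ a :: x) y) l' := by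
  induction l generalizing f with
  | nil => rfl
  | cons b l ih => rw [List.cons_append, cuts, cuts, ih, add_assoc]; rfl

theorem icuts_append (f : List α → List α → M) {p q : List α} (hp : p ≠ []) (hq : q ≠ []) :
    icuts f (p ++ q) =
      icuts (fun x y => f x (y ++ q)) p + (f p q + icuts (fun x y => f (p ++ x) y) q) := by
  obtain ⟨a, p, rfl⟩ := List.exists_cons_of_ne_nil hp
  obtain ⟨b, q, rfl⟩ := List.exists_cons_of_ne_nil hq
  rw [List.cons_append, icuts, pts_append, pts, List.append_nil]
  rfl

theorem cuts_eq_left (f : List α → List α → M) (l : List α) :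
    cuts f l = f [] l + pts (fun x b y => f (x ++ [b]) y) l := by
  induction l generalizing f with
  | nil => exact (add_zero _).symm
  | cons a l ih => rw [cuts, ih, pts]; rfl

theorem cuts_eq_right (f : List α → List α → M) (l : List α) :
    cuts f l = pts (fun x b y => f x (b :: y)) l + f l [] := by
  induction l generalizing f with
  | nil => exact (zero_add _).symm
  | cons a l ih => rw [cuts, ih, pts, add_assoc]

theorem cuts_cuts (f : List α → List α → List α → M) (l : List α) :
    cuts (fun x z => cuts (fun x y => f x y z) x) l = cuts (fun x y => cuts (f x) y) l := by
  induction l generalizing f with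
  | nil => rfl
  | cons a l ih =>
    simp only [cuts, cuts_add]
    rw [ih, add_assoc]

theorem pts_pts (f : List α → α → List α → α → List α → M) (l : List α) :
    pts (fun x b y => pts (fun u c v => f u c v b y) x) l =
      pts (fun x b y => pts (fun u c v => f x b u c v) y) l := by
  induction l generalizing f with
  | nil => rfl
  | cons a l ih =>
    simp only [pts, pts_add]
    rw [ih, zero_add]

theorem icuts_icuts (f : List α → List α → List α → M) (l : List α) :
    icuts (fun x z => icuts (fun x y => f x y z) x) l = icuts (fun x y => icuts (f x) y) l := by
  cases l with
  | nil => rfl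
  | cons a l => exact pts_pts (fun x b y c z => f (a :: x) (b :: y) (c :: z)) l

theorem pts_eq_sum (f : List α → α → List α → M) (l : List α) :
    pts f l = ∑ i : Fin l.length, f (l.take i) l[i] (l.drop (i + 1)) := by
  induction l generalizing f with
  | nil => rfl
  | cons a l ih => rw [pts, ih]; exact (Fin.sum_univ_succ (M := M) (n := l.length)
      fun i => f ((a :: l).take i) (a :: l)[i] ((a :: l).drop (i + 1))).symm

theorem cuts_eq_sum (f : List α → List α → M) (l : List α) :
    cuts f l = ∑ i ∈ Finset.range (l.length + 1), f (l.take i) (l.drop i) := by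
  induction l generalizing f with
  | nil => simp [cuts]
  | cons a l ih => rw [cuts, ih, List.length_cons, Finset.sum_range_succ' _ (l.length + 1), add_comm]; rfl

theorem icuts_eq_sum (f : List α → List α → M) (l : List α) :
    icuts f l = ∑ i ∈ Finset.Ioo 0 l.length, f (l.take i) (l.drop i) := by
  cases l with
  | nil => rfl
  | cons a l =>
    have h := cuts_eq_sum (fun x y => f (a :: x) y) l
    rw [cuts_eq_right, Finset.sum_range_succ, List.take_length, List.drop_length] at h
    rw [icuts, pts_eq_sum]
    rw [pts_eq_sum] at h
    rw [show Finset.Ioo 0 (a :: l).length = (Finset.range l.length).map ⟨Nat.succ, Nat.succ_injective⟩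
      by ext i; simp only [List.length_cons, Finset.mem_Ioo, Finset.mem_map, Finset.mem_range,
           Function.Embedding.coeFn_mk]
         constructor
         · rintro ⟨h1, h2⟩; exact ⟨i - 1, by omega, by omega⟩
         · rintro ⟨j, h1, rfl⟩; omega, Finset.sum_map, Finset.sum_range]
    refine Finset.sum_congr rfl fun i _ => ?_
    simp

/-! #### Reversal -/

theorem cuts_reverse (f : List α → List α → M) (l : List α) :
    cuts f l.reverse = cuts (fun x y => f y.reverse x.reverse) l := by
  induction l generalizing f with
  | nil => rfl
  | cons a l ih =>
    rw [List.reverse_cons, cuts_append_cons, cuts, cuts, List.reverse_cons, add_comm, ih]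
    simp

theorem pts_reverse (f : List α → α → List α → M) (l : List α) :
    pts f l.reverse = pts (fun x b y => f y.reverse b x.reverse) l := by
  induction l generalizing f with
  | nil => rfl
  | cons a l ih =>
    rw [List.reverse_cons, pts_append, pts, pts, pts, ih, add_comm]
    simp

theorem icuts_reverse (f : List α → List α → M) (l : List α) :
    icuts f l.reverse = icuts (fun x y => f y.reverse x.reverse) l := by
  rw [icuts_eq_sum, icuts_eq_sum, List.length_reverse]
  refine Finset.sum_nbij' (fun i => l.length - i) (fun i => l.length - i) ?_ ?_ ?_ ?_ ?_
  · intro i hi; simp only [Finset.mem_Ioo] at hi ⊢; omega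
  · intro i hi; simp only [Finset.mem_Ioo] at hi ⊢; omega
  · intro i hi; simp only [Finset.mem_Ioo] at hi; omega
  · intro i hi; simp only [Finset.mem_Ioo] at hi; omega
  · intro i hi; rw [List.take_reverse, List.drop_reverse]

theorem cuts_map (g : β → α) (f : List α → List α → M) (l : List β) :
    cuts f (l.map g) = cuts (fun x y => f (x.map g) (y.map g)) l := by
  induction l generalizing f with
  | nil => rfl
  | cons a l ih => rw [List.map_cons, cuts, cuts, ih]; rfl

theorem pts_map (g : β → α) (f : List α → α → List α → M) (l : List β) :
    pts f (l.map g) = pts (fun x b y => f (x.map g) (g b) (y.map g)) l := by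
  induction l generalizing f with
  | nil => rfl
  | cons a l ih => rw [List.map_cons, pts, pts, ih]; rfl

/-- A sum over decompositions to which only the last element contributes. -/
theorem pts_concat {f : List α → α → List α → M} {l : List α} {a : α}
    (h : ∀ x b y, x ++ b :: y = l → f x b (y ++ [a]) = 0) : pts f (l ++ [a]) = f l a [] := by
  rw [pts_append, pts_eq_zero h, zero_add, pts, pts, List.append_nil, add_zero]

end Sums

end Bordered

/-! ### Cut systems -/

namespace Bordered

/-- Scalars `C` attached to cyclic sequences of words that satisfy the recursion for the
generating functions of tiling graphs (the axiom `cut`). The cancellations in the structure relation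
that hold for all words depend on these axioms only. They are invariant under the reversal of
words, so that every statement about the left extension has a counterpart for the right one. -/
structure CutSystem (A ι K : Type*) [Fintype ι] [CommRing K] where
  C : List (List A) → K
  /-- The words of the inner regions. -/
  u : ι → List A
  /-- The weights of the inner regions. -/
  X : ι → K
  /-- The words that are nonzero in the algebra. -/
  adm : List A → Prop
  u_ne_nil : ∀ i, u i ≠ []
  adm_u : ∀ i, adm (u i)
  adm_left : ∀ {x y}, adm (x ++ y) → adm x
  adm_right : ∀ {x y}, adm (x ++ y) → adm y
  adm_glue : ∀ {x y z}, y ≠ [] → adm (x ++ y) → adm (y ++ z) → adm (x ++ (y ++ z))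
  adm_of_ne_zero : ∀ {s}, C s ≠ 0 → ∀ b ∈ s, adm b
  rotate : ∀ s t, C (s ++ t) = C (t ++ s)
  odd : ∀ {s : List (List A)}, Odd s.length → C s = 0
  cut : ∀ {x y s}, (∀ b ∈ x :: y :: s, b ≠ [] ∧ adm b) → C ((x ++ y) :: s) =
    ∑ i, X i * C (x :: u i :: y :: s) +
      pts (fun k b l => icuts (fun b' b'' => C (x :: b'' :: l) * C (y :: (k ++ [b']))) b) s

section Trip

variable {α β M : Type*} [AddCommMonoid M]

/-- The sum of `f x y z` over the decompositions `l = x ++ y ++ z`. -/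
def trip (f : List α → List α → List α → M) (l : List α) : M :=
  cuts (fun x r => cuts (f x) r) l

theorem trip_congr {f g : List α → List α → List α → M} {l : List α}
    (h : ∀ x y z, x ++ (y ++ z) = l → f x y z = g x y z) : trip f l = trip g l :=
  cuts_congr fun x r hr => cuts_congr fun y z hz => h x y z (by rw [hz, hr])

theorem trip_add (f g : List α → List α → List α → M) (l : List α) :
    trip (fun x y z => f x y z + g x y z) l = trip f l + trip g l := by
  simp only [trip, cuts_add]

theorem trip_reverse (f : List α → List α → List α → M) (l : List α) :
    trip f l.reverse = trip (fun x y z => f z.reverse y.reverse x.reverse) l := by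
  simp only [trip]
  rw [cuts_reverse, ← cuts_cuts]
  exact cuts_congr fun x y _ => cuts_reverse _ _

theorem trip_map (g : β → α) (f : List α → List α → List α → M) (l : List β) :
    trip f (l.map g) = trip (fun x y z => f (x.map g) (y.map g) (z.map g)) l := by
  simp only [trip, cuts_map]

theorem map_trip {N F : Type*} [AddCommMonoid N] [FunLike F M N] [AddMonoidHomClass F M N] (φ : F)
    (f : List α → List α → List α → M) (l : List α) :
    φ (trip f l) = trip (fun x y z => φ (f x y z)) l := by
  simp only [trip, map_cuts]

theorem cuts_icuts_comm (f : List α → List α → List β → List β → M) (l : List α) (w : List β) :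
    cuts (fun x y => icuts (f x y) w) l = icuts (fun g h => cuts (fun x y => f x y g h) l) w := by
  induction l generalizing f with
  | nil => rfl
  | cons a l ih => simp only [cuts, icuts_add, ih]

theorem trip_icuts_comm (f : List α → List α → List α → List β → List β → M) (l : List α)
    (w : List β) :
    trip (fun x y z => icuts (f x y z) w) l =
      icuts (fun g h => trip (fun x y z => f x y z g h) l) w := by
  simp only [trip, cuts_icuts_comm]

end Trip

namespace CutSystem

variable {A ι K : Type*} [Fintype ι] [CommRing K] (S : CutSystem A ι K)
variable {N N' : Type*} [AddCommGroup N] [Module K N] [AddCommGroup N'] [Module K N']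

/-- The left extension: the sum over the factorizations of the first word, with the left factors as
outputs. -/
def lamI (f : List A → N) (s : List (List A)) : N :=
  icuts (fun g h => S.C (h :: s.tail) • f g) (s.headD [])

/-- The right extension: the sum over the factorizations of the last word, with the right factors
as outputs. -/
def rhoI (f : List A → N) (s : List (List A)) : N :=
  icuts (fun h g => S.C (s.dropLast ++ [h]) • f g) (s.getLastD [])

/-- The product, an operation with two inputs. -/
def prodI (f : List A → N) : List (List A) → N
  | [p, q] => f (p ++ q)
  | _ => 0

/-- The operation without inputs: the sum of the words of the inner regions. -/
def unitI (f : List A → N) : List (List A) → N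
  | [] => ∑ i, S.X i • f (S.u i)
  | _ => 0

/-- The part of an operation whose values are nonconstant paths, with a linear map applied to it
that is given by its values `f w` on words. -/
def inner (f : List A → N) (s : List (List A)) : N :=
  S.lamI f s + S.rhoI f s + prodI f s + S.unitI f s

@[simp] theorem lamI_nil (f : List A → N) : S.lamI f [] = 0 := rfl

@[simp] theorem rhoI_nil (f : List A → N) : S.rhoI f [] = 0 := rfl

theorem lamI_cons (f : List A → N) (b : List A) (s : List (List A)) :
    S.lamI f (b :: s) = icuts (fun g h => S.C (h :: s) • f g) b := rfl

theorem rhoI_concat (f : List A → N) (s : List (List A)) (b : List A) :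
    S.rhoI f (s ++ [b]) = icuts (fun h g => S.C (s ++ [h]) • f g) b := by
  simp [rhoI]

theorem unitI_concat (f : List A → N) (s : List (List A)) (b : List A) :
    S.unitI f (s ++ [b]) = 0 := by
  cases s <;> rfl

theorem inner_congr {f g : List A → N} {s : List (List A)}
    (h : ∀ w, w ≠ [] → f w = g w) (hs : ∀ b ∈ s, b ≠ []) : S.inner f s = S.inner g s := by
  have h1 : S.lamI f s = S.lamI g s := icuts_congr fun x y hx _ _ => by rw [h x hx]
  have h2 : S.rhoI f s = S.rhoI g s := icuts_congr fun x y _ hy _ => by rw [h y hy]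
  have h3 : prodI f s = prodI g s := by
    rcases s with _ | ⟨p, _ | ⟨q, _ | ⟨r, s⟩⟩⟩
    · rfl
    · rfl
    · exact h _ (by simp [hs p])
    · rfl
  have h4 : S.unitI f s = S.unitI g s := by
    cases s with
    | nil => exact Finset.sum_congr rfl fun i _ => by rw [h _ (S.u_ne_nil i)]
    | cons a s => rfl
  rw [inner, inner, h1, h2, h3, h4]

theorem map_inner (φ : N →ₗ[K] N') (f : List A → N) (s : List (List A)) :
    φ (S.inner f s) = S.inner (fun w => φ (f w)) s := by
  simp only [inner, lamI, rhoI, map_add, map_icuts, map_smul]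
  congr 1
  · congr 1
    rcases s with _ | ⟨p, _ | ⟨q, _ | ⟨r, s⟩⟩⟩ <;> simp [prodI]
  · cases s <;> simp [unitI]

theorem inner_smul_const (f : List A → K) (x : N) (s : List (List A)) :
    S.inner (fun w => f w • x) s = S.inner f s • x :=
  (S.map_inner (LinearMap.toSpanSingleton K N x) f s).symm

theorem inner_add (f g : List A → N) (s : List (List A)) :
    S.inner (fun w => f w + g w) s = S.inner f s + S.inner g s := by
  have h1 : S.lamI (fun w => f w + g w) s = S.lamI f s + S.lamI g s := by
    simp only [lamI, smul_add, icuts_add]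
  have h2 : S.rhoI (fun w => f w + g w) s = S.rhoI f s + S.rhoI g s := by
    simp only [rhoI, smul_add, icuts_add]
  have h3 : prodI (fun w => f w + g w) s = prodI f s + prodI g s := by
    rcases s with _ | ⟨p, _ | ⟨q, _ | ⟨r, s⟩⟩⟩ <;> simp [prodI]
  have h4 : S.unitI (fun w => f w + g w) s = S.unitI f s + S.unitI g s := by
    cases s <;> simp [unitI, Finset.sum_add_distrib]
  rw [inner, inner, inner, h1, h2, h3, h4]
  abel

theorem inner_icuts {β : Type*} (f : List β → List β → List A → N) (v : List β)
    (s : List (List A)) :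
    S.inner (fun w => icuts (fun g h => f g h w) v) s = icuts (fun g h => S.inner (f g h) s) v := by
  let φ : (List A → N) →+ N := AddMonoidHom.mk' (fun f => S.inner f s) fun f g => S.inner_add f g s
  refine Eq.trans ?_ (map_icuts φ f v)
  change S.inner _ s = S.inner _ s
  congr 1
  funext w
  exact (map_icuts (Pi.evalAddMonoidHom (fun _ : List A => N) w) f v).symm

theorem inner_of_odd (f : List A → N) {s : List (List A)} (hs : Odd s.length) :
    S.inner f s = 0 := by
  have h1 : S.lamI f s = 0 := by
    cases s with
    | nil => rfl
    | cons b s => exact icuts_eq_zero fun x y _ _ _ => by rw [S.odd (by simpa using hs), zero_smul]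
  have h2 : S.rhoI f s = 0 := by
    rcases List.eq_nil_or_concat s with rfl | ⟨s, b, rfl⟩
    · rfl
    · rw [List.concat_eq_append] at hs ⊢
      rw [rhoI_concat]
      exact icuts_eq_zero fun x y _ _ _ => by rw [S.odd (by simpa using hs), zero_smul]
  have h3 : prodI f s = 0 := by
    rcases s with _ | ⟨p, _ | ⟨q, _ | ⟨r, s⟩⟩⟩ <;> first | rfl | exact absurd hs (by simp)
  have h4 : S.unitI f s = 0 := by
    cases s with
    | nil => simp at hs
    | cons b s => rfl
  rw [inner, h1, h2, h3, h4]
  simp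

/-- All words are nonempty and nonzero in the algebra. -/
def Good (s : List (List A)) : Prop := ∀ b ∈ s, b ≠ [] ∧ S.adm b

/-! #### The sum of all operations in front of `C` -/

/-- The sum of the values of `C` over the words that can be inserted between `l₁` and `l₂`: words of
inner regions, right factors of words in `l₂` and left factors of words in `l₁`. In the last two
cases the inputs up to the word with these factors are absorbed by another factor `C`. -/
def ins (l₁ l₂ : List (List A)) : K :=
  ∑ i, S.X i * S.C (l₁ ++ S.u i :: l₂) +
    pts (fun k b l => icuts (fun b' b'' => S.C (k ++ [b']) * S.C (l₁ ++ b'' :: l)) b) l₂ +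
    pts (fun k b l => icuts (fun b' b'' => S.C (b'' :: l) * S.C (k ++ b' :: l₂)) b) l₁

theorem C_singleton (b : List A) : S.C [b] = 0 := S.odd (by simp)

/-- If `p` and `q` are the words before and after the cut, the terms in `ins` are those of the
recursion for the sequence in which `p` and `q` are multiplied. -/
theorem ins_interior {k l : List (List A)} {p q : List A} (h : S.Good (p :: q :: (l ++ k))) :
    S.ins (k ++ [p]) (q :: l) = S.C (k ++ (p ++ q) :: l) := by
  rw [S.rotate, List.cons_append, S.cut h, ins, pts_append, pts_append, pts, pts, pts]
  have e1 : ∀ i, S.C (k ++ [p] ++ S.u i :: q :: l) = S.C (p :: S.u i :: q :: (l ++ k)) := by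
    intro i
    rw [List.append_assoc, S.rotate]; simp
  simp only [e1, List.nil_append, C_singleton, zero_mul, icuts_zero, zero_add, add_zero]
  rw [add_assoc]
  congr 2
  · refine pts_congr fun x b y _ => icuts_congr fun b' b'' _ _ _ => ?_
    rw [List.append_assoc, S.rotate k, mul_comm]
    simp
  · refine pts_congr fun x b y _ => icuts_congr fun b' b'' _ _ _ => ?_
    have e2 : S.C (b'' :: (y ++ [p])) = S.C (p :: b'' :: y) := by
      rw [← List.cons_append, S.rotate]; rfl
    have e3 : S.C (x ++ b' :: q :: l) = S.C (q :: (l ++ x ++ [b'])) := by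
      simpa using S.rotate (x ++ [b']) (q :: l)
    rw [e2, e3]

theorem ins_ends {s : List (List A)} : S.ins [] s = S.ins s [] := by
  simp only [ins, pts, List.nil_append, add_zero]
  congr 1
  · exact Finset.sum_congr rfl fun i _ => by rw [S.rotate s]; rfl
  · exact pts_congr fun x b y _ => icuts_congr fun b' b'' _ _ _ => mul_comm _ _

theorem trip_unitI (s : List (List A)) :
    trip (fun x y z => (-1 : ℤ) ^ x.length • S.unitI (fun w => S.C (x ++ w :: z)) y) s =
      cuts (fun l₁ l₂ => (-1 : ℤ) ^ l₁.length • ∑ i, S.X i * S.C (l₁ ++ S.u i :: l₂)) s := by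
  refine cuts_congr fun x r _ => ?_
  rw [cuts_eq_left, pts_eq_zero, add_zero]
  · rfl
  · intro u b v _
    dsimp only
    rw [unitI_concat, smul_zero]

theorem trip_rhoI (s : List (List A)) :
    trip (fun x y z => (-1 : ℤ) ^ x.length • S.rhoI (fun w => S.C (x ++ w :: z)) y) s =
      cuts (fun l₁ l₂ => (-1 : ℤ) ^ l₁.length • pts (fun k b l =>
        icuts (fun b' b'' => S.C (k ++ [b']) * S.C (l₁ ++ b'' :: l)) b) l₂) s := by
  refine cuts_congr fun x r _ => ?_
  rw [cuts_eq_left]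
  dsimp only
  rw [rhoI_nil, smul_zero, zero_add, ← pts_smul]
  exact pts_congr fun u b v _ => by rw [rhoI_concat]; rfl

theorem trip_lamI (s : List (List A)) :
    trip (fun x y z => (-1 : ℤ) ^ x.length • S.lamI (fun w => S.C (x ++ w :: z)) y) s =
      cuts (fun l₁ l₂ => (-1 : ℤ) ^ l₁.length • pts (fun k b l =>
        icuts (fun b' b'' => S.C (b'' :: l) * S.C (k ++ b' :: l₂)) b) l₁) s := by
  rw [trip, ← cuts_cuts]
  refine cuts_congr fun l z _ => ?_
  rw [cuts_eq_right, lamI_nil, smul_zero, add_zero, ← pts_smul]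
  refine pts_congr fun x b y hl => ?_
  rw [lamI_cons, ← icuts_smul, ← icuts_smul]
  refine icuts_congr fun b' b'' _ _ _ => ?_
  by_cases hy : Odd y.length
  · congr 1
    rw [← hl, List.length_append, List.length_cons, pow_add, pow_succ]
    simp [hy.neg_one_pow]
  · have : S.C (b'' :: y) = 0 := S.odd (by
      rw [List.length_cons]; exact (Nat.not_odd_iff_even.1 hy).add_one)
    rw [this, zero_smul, zero_mul, smul_zero, smul_zero]

theorem trip_prodI (s : List (List A)) :
    trip (fun x y z => (-1 : ℤ) ^ x.length • prodI (fun w => S.C (x ++ w :: z)) y) s =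
      pts (fun x p r => (-1 : ℤ) ^ x.length • r.head?.elim 0
        fun q => S.C (x ++ (p ++ q) :: r.tail)) s := by
  rw [trip, cuts_eq_right]
  have h0 : ∀ x : List (List A),
      cuts (fun y z => (-1 : ℤ) ^ x.length • prodI (fun w => S.C (x ++ w :: z)) y) [] = 0 :=
    fun x => smul_zero _
  rw [h0, add_zero]
  refine pts_congr fun x p r _ => ?_
  rcases r with _ | ⟨q, r⟩
  · simp [cuts, prodI]
  · rw [cuts, cuts, cuts_eq_left, pts_eq_zero]
    · simp [prodI]
    · intro u b v _
      rcases u with _ | ⟨c, u⟩ <;> simp [prodI]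

/-- The sum of all operations in front of `C` vanishes: the extended operations and the one without
inputs contribute `ins` at every cut of the sequence. At the interior cuts this cancels the products
of adjacent inputs, and the contributions of the two ends are opposite since the length is odd. -/
theorem trip_inner_C {s : List (List A)} (h : S.Good s) (hs : Odd s.length) :
    trip (fun x y z => (-1 : ℤ) ^ x.length • S.inner (fun w => S.C (x ++ w :: z)) y) s = 0 := by
  have key : trip (fun x y z => (-1 : ℤ) ^ x.length • S.inner (fun w => S.C (x ++ w :: z)) y) s =
      cuts (fun l₁ l₂ => (-1 : ℤ) ^ l₁.length • S.ins l₁ l₂) s +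
        pts (fun x p r => (-1 : ℤ) ^ x.length • r.head?.elim 0
          fun q => S.C (x ++ (p ++ q) :: r.tail)) s := by
    simp only [inner, smul_add, trip_add, ins, cuts_add]
    rw [trip_unitI, trip_rhoI, trip_lamI, trip_prodI]
    abel
  rw [key, cuts_eq_left, add_assoc, ← pts_add]
  rcases List.eq_nil_or_concat s with rfl | ⟨s, a, rfl⟩
  · simp at hs
  rw [List.concat_eq_append] at *
  rw [pts_concat]
  · simp only [List.length_nil, pow_zero, one_smul, hs.neg_one_pow, neg_smul, S.ins_ends]
    simp
  · intro x p r hr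
    obtain ⟨q, t, ht⟩ : ∃ q t, r ++ [a] = q :: t := by
      cases r with
      | nil => exact ⟨_, _, rfl⟩
      | cons q r => exact ⟨_, _, rfl⟩
    have hg : S.Good (p :: q :: (t ++ x)) := by
      intro b hb
      apply h
      rw [← hr, List.append_assoc, List.cons_append, ht]
      simp only [List.mem_cons, List.mem_append] at hb ⊢
      tauto
    rw [ht, S.ins_interior hg]
    simp [pow_succ]

/-! #### The sum of all operations in front of the left extension -/

open Classical in
/-- The terms of the structure relation in which the outer operation is the left extension. -/
noncomputable def lamSum (W : List A → N) (s : List (List A)) : N :=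
  trip (fun x y z => (-1 : ℤ) ^ x.length •
    S.inner (fun w => if S.adm w then S.lamI W (x ++ w :: z) else 0) y) s

open Classical in
/-- The terms of `lamSum` in which the outer factorization cuts the second factor of a product. -/
noncomputable def prodL (W : List A → N) : List (List A) → N
  | a :: q :: s => if S.adm (a ++ q) then
      S.C (q :: s) • W a + icuts (fun g h => S.C (h :: s) • W (a ++ g)) q else 0
  | _ => 0

theorem trip_cons {α M : Type*} [AddCommMonoid M] (f : List α → List α → List α → M) (a : α)
    (l : List α) : trip f (a :: l) = cuts (f []) (a :: l) + trip (fun x => f (a :: x)) l := rfl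

theorem cuts_unitI (f : List (List A) → List A → N) (s : List (List A)) :
    cuts (fun y z => S.unitI (f z) y) s = ∑ i, S.X i • f s (S.u i) := by
  rw [cuts_eq_left, pts_eq_zero, add_zero]
  · rfl
  · exact fun u b v _ => S.unitI_concat _ _ _

theorem cuts_lamI (f : List (List A) → List A → N) (a : List A) (s : List (List A)) :
    cuts (fun y z => S.lamI (f z) y) (a :: s) =
      icuts (fun g h => cuts (fun t z => S.C (h :: t) • f z g) s) a := by
  rw [cuts, lamI_nil, zero_add]
  exact cuts_icuts_comm _ _ _

theorem cuts_rhoI (f : List (List A) → List A → N) (s : List (List A)) :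
    cuts (fun y z => S.rhoI (f z) y) s =
      pts (fun k b z => icuts (fun b' w => S.C (k ++ [b']) • f z w) b) s := by
  rw [cuts_eq_left, rhoI_nil, zero_add]
  exact pts_congr fun k b z _ => S.rhoI_concat _ _ _

theorem cuts_prodI (f : List (List A) → List A → N) (a : List A) (s : List (List A)) :
    cuts (fun y z => prodI (f z) y) (a :: s) =
      s.head?.elim 0 fun q => f s.tail (a ++ q) := by
  rcases s with _ | ⟨q, s⟩
  · simp [cuts, prodI]
  · rw [cuts, cuts, cuts_eq_left, pts_eq_zero]
    · simp [prodI]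
    · intro u b v _
      rcases u with _ | ⟨c, u⟩ <;> simp [prodI]

theorem C_eq_zero {s : List (List A)} {b : List A} (hb : b ∈ s) (h : ¬ S.adm b) : S.C s = 0 :=
  by_contra fun h0 => h (S.adm_of_ne_zero h0 b hb)

/-- The terms of `trip_inner_C` in which the first word is cut by a product or by the recursion at
the cut before it. -/
def tail (h : List A) (s : List (List A)) : K :=
  ∑ i, S.X i * S.C (S.u i :: h :: s) +
    pts (fun k q l => icuts (fun q' q'' => S.C (h :: (k ++ [q'])) * S.C (q'' :: l)) q) s

theorem tail_concat {h z : List A} {s : List (List A)} (hs : S.Good (z :: h :: s)) :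
    S.tail h (s ++ [z]) = S.C ((z ++ h) :: s) := by
  rw [S.cut hs, tail, pts_append, pts, pts]
  simp only [C_singleton, mul_zero, icuts_zero, add_zero]
  congr 1
  · refine Finset.sum_congr rfl fun i _ => ?_
    congr 1
    exact S.rotate (S.u i :: h :: s) [z]
  · refine pts_congr fun x b y _ => icuts_congr fun b' b'' _ _ _ => ?_
    rw [mul_comm]
    congr 1
    exact S.rotate (b'' :: y) [z]

/-- The sum `trip_inner_C` with a factor of the first word in place of the whole word removes all
terms in which the inner operation is not involved with the first word. -/
theorem lamSum_eq (W : List A → N) {a : List A} {s : List (List A)} (h : S.Good (a :: s))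
    (hs : Odd (a :: s).length) :
    S.lamSum W (a :: s) =
      ∑ i, S.X i • icuts (fun g h => S.C (h :: a :: s) • W g) (S.u i) +
      cuts (fun y z => S.rhoI (fun w => icuts (fun g h => S.C (h :: z) • W g) w) y) (a :: s) +
      S.prodL W (a :: s) - icuts (fun g h => S.tail h s • W g) a := by
  classical
  have ha := (h a (by simp)).2
  -- the terms in which the inner operation does not involve the first word
  have h1 : ∀ f : List (List A) → List (List A) → List (List A) → N,
      f = (fun x y z => (-1 : ℤ) ^ x.length •
        S.inner (fun w => if S.adm w then S.lamI W (x ++ w :: z) else 0) y) →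
      trip (fun x => f (a :: x)) s =
        - icuts (fun g h => cuts (fun y z => S.inner (fun w => S.C (w :: z)) y) (h :: s) • W g) a := by
    rintro f rfl
    have e1 : ∀ x y z, (-1 : ℤ) ^ (a :: x).length •
        S.inner (fun w => if S.adm w then S.lamI W (a :: x ++ w :: z) else 0) y =
        icuts (fun g h => (-(1 : K)) •
          ((-1 : ℤ) ^ x.length • S.inner (fun w => S.C (h :: x ++ w :: z)) y) • W g) a := by
      intro x y z
      have : ∀ w, (if S.adm w then S.lamI W (a :: x ++ w :: z) else 0) =
          icuts (fun g h => S.C (h :: x ++ w :: z) • W g) a := by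
        intro w
        split_ifs with hw
        · rfl
        · exact (icuts_eq_zero fun g h _ _ _ => by
            rw [S.C_eq_zero (b := w) (by simp) hw, zero_smul]).symm
      simp only [this]
      rw [inner_icuts, ← icuts_smul]
      refine icuts_congr fun g h _ _ _ => ?_
      rw [inner_smul_const, List.length_cons, pow_succ]
      rcases neg_one_pow_eq_or ℤ x.length with h0 | h0 <;> simp [h0]
    simp only [e1]
    rw [trip_icuts_comm]
    have e2 : ∀ t : N, -t = (-(1 : K)) • t := fun t => by simp
    rw [e2, ← icuts_smul]
    refine icuts_congr fun g h' hg hh' hgh => ?_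
    have e3 := S.trip_inner_C (s := h' :: s) (fun b hb => by
      rcases List.mem_cons.1 hb with rfl | hb
      · exact ⟨hh', S.adm_right (x := g) (hgh ▸ ha)⟩
      · exact h b (List.mem_cons_of_mem _ hb)) hs
    rw [trip_cons] at e3
    have e4 := map_trip (LinearMap.toSpanSingleton K N (W g))
      (fun x y z => (-1 : ℤ) ^ x.length • S.inner (fun w => S.C (h' :: x ++ w :: z)) y) s
    have e5 := map_trip (- LinearMap.id : K →ₗ[K] K)
      (fun x y z => (-1 : ℤ) ^ x.length • S.inner (fun w => S.C (h' :: x ++ w :: z)) y) s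
    have e6 : cuts (fun y z => S.inner (fun w => S.C (w :: z)) y) (h' :: s) =
        trip (fun x y z => (-1 : ℤ) ^ x.length • S.inner (fun w => S.C (h' :: x ++ w :: z)) y) s := by
      rw [← sub_eq_zero, sub_eq_add_neg, ← e3]
      congr 1
      · simp
      · refine e5.trans (trip_congr fun x y z _ => ?_)
        simp [pow_succ]
    rw [e6]
    have e7 := map_trip (DistribSMul.toAddMonoidHom N (-(1 : K)))
      (fun x y z =>
        ((-1 : ℤ) ^ x.length • S.inner (fun w => S.C (h' :: x ++ w :: z)) y) • W g) s
    exact e7.symm.trans (congrArg _ e4.symm)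
  rw [lamSum, trip_cons, h1 _ rfl]
  clear h1
  simp only [List.length_nil, pow_zero, one_smul, List.nil_append]
  have hW : ∀ z w, S.adm w →
      (if S.adm w then S.lamI W (w :: z) else 0) = icuts (fun g h => S.C (h :: z) • W g) w :=
    fun z w hw => by rw [if_pos hw]; rfl
  have hL : cuts (fun y z => S.inner (fun w => if S.adm w then S.lamI W (w :: z) else 0) y)
      (a :: s) =
      icuts (fun g h => cuts (fun t z => S.C (h :: t) •
        icuts (fun g' h' => S.C (h' :: z) • W g') g) s) a +
      cuts (fun y z => S.rhoI (fun w => icuts (fun g h => S.C (h :: z) • W g) w) y) (a :: s) +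
      (s.head?.elim 0 fun q => if S.adm (a ++ q) then S.lamI W ((a ++ q) :: s.tail) else 0) +
      ∑ i, S.X i • icuts (fun g h => S.C (h :: a :: s) • W g) (S.u i) := by
    simp only [inner, cuts_add, cuts_unitI, cuts_lamI, cuts_prodI, cuts_rhoI]
    congr 1
    · congr 2
      · refine icuts_congr fun g h' _ _ hgh => cuts_congr fun t z _ => ?_
        rw [hW z g (S.adm_left (hgh ▸ ha))]
      · refine pts_congr fun k b z hk => icuts_congr fun b' w _ _ hbw => ?_
        rw [hW z w (S.adm_right (x := b') (hbw ▸ (h b (hk ▸ by simp)).2))]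
    · exact Finset.sum_congr rfl fun i _ => by rw [hW _ _ (S.adm_u i)]
  have hR : ∀ h : List A, cuts (fun y z => S.inner (fun w => S.C (w :: z)) y) (h :: s) =
      icuts (fun h' h'' => cuts (fun t z => S.C (h'' :: t) * S.C (h' :: z)) s) h +
      (s.head?.elim 0 fun q => S.C ((h ++ q) :: s.tail)) + S.tail h s := by
    intro h
    simp only [inner, cuts_add, cuts_unitI, cuts_lamI, cuts_prodI, cuts_rhoI, pts, tail,
      List.nil_append, C_singleton, smul_eq_mul, zero_mul, icuts_zero, List.cons_append]
    ring
  have hP : (s.head?.elim 0 fun q => if S.adm (a ++ q) then S.lamI W ((a ++ q) :: s.tail) else 0) =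
      icuts (fun g h => (s.head?.elim 0 fun q => S.C ((h ++ q) :: s.tail)) • W g) a +
        S.prodL W (a :: s) := by
    rcases s with _ | ⟨q, s⟩
    · simp [prodL]
    simp only [List.head?_cons, Option.elim_some, List.tail_cons, prodL, lamI_cons]
    split_ifs with hq
    · rw [icuts_append _ (h a (by simp)).1 (h q (by simp)).1]
    · rw [add_zero, icuts_eq_zero]
      intro g h' hg hh' hgh
      rw [S.C_eq_zero (b := h' ++ q) (by simp), zero_smul]
      intro h0
      refine hq ?_
      rw [← hgh, List.append_assoc]
      exact S.adm_glue hh' (hgh ▸ ha) h0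
  have hI : icuts (fun g h => cuts (fun t z => S.C (h :: t) •
        icuts (fun g' h' => S.C (h' :: z) • W g') g) s) a =
      icuts (fun g h => icuts (fun h' h'' =>
        cuts (fun t z => S.C (h'' :: t) * S.C (h' :: z)) s) h • W g) a := by
    have e1 : ∀ g h : List A, cuts (fun t z => S.C (h :: t) •
        icuts (fun g' h' => S.C (h' :: z) • W g') g) s =
        icuts (fun g' h' => cuts (fun t z => S.C (h :: t) * S.C (h' :: z)) s • W g') g := by
      intro g h
      simp only [← icuts_smul]
      rw [cuts_icuts_comm]
      refine icuts_congr fun g' h' _ _ _ => ?_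
      refine (cuts_congr fun t z _ => smul_smul _ _ _).trans ?_
      exact (map_cuts (LinearMap.toSpanSingleton K N (W g'))
        (fun t z => S.C (h :: t) * S.C (h' :: z)) s).symm
    simp only [e1]
    rw [icuts_icuts]
    refine icuts_congr fun g h _ _ _ => ?_
    exact (map_icuts (LinearMap.toSpanSingleton K N (W g)) _ h).symm
  rw [hL, hP, hI]
  simp only [hR, add_smul, icuts_add]
  abel

/-! #### Reversal -/

/-- The reversed sequence of the reversed words. -/
def rev (s : List (List A)) : List (List A) := (s.map List.reverse).reverse

theorem rev_append (s t : List (List A)) : rev (s ++ t) = rev t ++ rev s := by simp [rev]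

theorem rev_cons (b : List A) (s : List (List A)) : rev (b :: s) = rev s ++ [b.reverse] := by
  simp [rev]

theorem rev_concat (b : List A) (s : List (List A)) : rev (s ++ [b]) = b.reverse :: rev s := by
  simp [rev]

theorem rev_rev (s : List (List A)) : rev (rev s) = s := by
  simp [rev]

theorem length_rev (s : List (List A)) : (rev s).length = s.length := by simp [rev]

theorem mem_rev {b : List A} {s : List (List A)} : b ∈ rev s ↔ b.reverse ∈ s := by
  simp only [rev, List.mem_reverse, List.mem_map]
  exact ⟨by rintro ⟨c, hc, rfl⟩; simpa using hc, fun h => ⟨_, h, by simp⟩⟩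

theorem cuts_rev {M : Type*} [AddCommMonoid M] (f : List (List A) → List (List A) → M)
    (s : List (List A)) : cuts f (rev s) = cuts (fun x y => f (rev y) (rev x)) s := by
  rw [rev, cuts_reverse, cuts_map]; rfl

theorem pts_rev {M : Type*} [AddCommMonoid M] (f : List (List A) → List A → List (List A) → M)
    (s : List (List A)) :
    pts f (rev s) = pts (fun x b y => f (rev y) b.reverse (rev x)) s := by
  rw [rev, pts_reverse, pts_map]; rfl

theorem trip_rev {M : Type*} [AddCommMonoid M]
    (f : List (List A) → List (List A) → List (List A) → M) (s : List (List A)) :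
    trip f (rev s) = trip (fun x y z => f (rev z) (rev y) (rev x)) s := by
  rw [rev, trip_reverse, trip_map]; rfl

/-- The cut system given by reversed words: it corresponds to the reflection of tiling graphs. -/
def mirror : CutSystem A ι K where
  C s := S.C (rev s)
  u i := (S.u i).reverse
  X := S.X
  adm w := S.adm w.reverse
  u_ne_nil i := by simpa using S.u_ne_nil i
  adm_u i := by simpa using S.adm_u i
  adm_left h := by rw [List.reverse_append] at h; exact S.adm_right h
  adm_right h := by rw [List.reverse_append] at h; exact S.adm_left h
  adm_glue hy h1 h2 := by
    rw [List.reverse_append] at h1 h2 ⊢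
    rw [List.reverse_append, List.append_assoc]
    exact S.adm_glue (by simpa using hy) h2 h1
  adm_of_ne_zero h b hb := S.adm_of_ne_zero h _ (by rw [mem_rev]; simpa using hb)
  rotate s t := by rw [rev_append, rev_append, S.rotate]
  odd h := S.odd (by rwa [length_rev])
  cut {x y s} h := by
    rw [rev_cons, S.rotate, List.reverse_append, List.singleton_append, S.cut]
    · congr 1
      · refine Finset.sum_congr rfl fun i _ => ?_
        simp only [rev_cons, List.reverse_reverse, List.append_assoc, List.cons_append,
          List.nil_append]
        rw [S.rotate (rev s)]
        rfl
      · rw [pts_rev]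
        refine pts_congr fun k b l _ => ?_
        rw [icuts_reverse]
        refine icuts_congr fun b' b'' _ _ _ => ?_
        rw [mul_comm]
        congr 1
        · rw [rev_cons, rev_cons, S.rotate _ [x.reverse], List.singleton_append]
        · rw [rev_cons, rev_concat, S.rotate _ [y.reverse], List.singleton_append]
    · intro b hb
      have := h b.reverse (by
        simp only [List.mem_cons, mem_rev] at hb ⊢
        simpa [List.reverse_eq_iff] using by tauto)
      simpa using this

theorem mirror_C (s : List (List A)) : S.mirror.C s = S.C (rev s) := rfl

theorem mirror_lamI (f : List A → N) (s : List (List A)) :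
    S.mirror.lamI f (rev s) = S.rhoI (fun w => f w.reverse) s := by
  rcases List.eq_nil_or_concat s with rfl | ⟨s, b, rfl⟩
  · rfl
  · rw [List.concat_eq_append, rev_concat, lamI_cons, rhoI_concat, icuts_reverse]
    refine icuts_congr fun x y _ _ _ => ?_
    rw [mirror_C, rev_cons, rev_rev, List.reverse_reverse]

theorem mirror_rhoI (f : List A → N) (s : List (List A)) :
    S.mirror.rhoI f (rev s) = S.lamI (fun w => f w.reverse) s := by
  cases s with
  | nil => rfl
  | cons b s =>
    rw [rev_cons, lamI_cons, rhoI_concat, icuts_reverse]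
    refine icuts_congr fun x y _ _ _ => ?_
    rw [mirror_C, rev_concat, rev_rev, List.reverse_reverse]

theorem mirror_inner (f : List A → N) (s : List (List A)) :
    S.mirror.inner f (rev s) = S.inner (fun w => f w.reverse) s := by
  rw [inner, mirror_lamI, mirror_rhoI, inner, add_comm (S.rhoI _ s)]
  congr 1
  · congr 1
    rcases s with _ | ⟨p, _ | ⟨q, _ | ⟨r, s⟩⟩⟩
    · rfl
    · rfl
    · simp [rev, prodI]
    · rw [rev_cons, rev_cons, rev_cons]
      rcases rev s with _ | ⟨c, _ | ⟨d, _ | ⟨e, l⟩⟩⟩ <;> rfl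
  · cases s with
    | nil => rfl
    | cons b s => rw [rev_cons, unitI_concat]; rfl

theorem mirror_good {s : List (List A)} (h : S.Good s) : S.mirror.Good (rev s) := by
  intro b hb
  have := h _ (mem_rev.1 hb)
  exact ⟨by simpa using this.1, this.2⟩

open Classical in
/-- The terms of the structure relation in which the outer operation is the right extension. -/
noncomputable def rhoSum (W : List A → N) (s : List (List A)) : N :=
  trip (fun x y z => (-1 : ℤ) ^ x.length •
    S.inner (fun w => if S.adm w then S.rhoI W (x ++ w :: z) else 0) y) s

theorem rhoSum_eq_mirror (W : List A → N) {s : List (List A)} (hs : Odd s.length) :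
    S.rhoSum W s = - S.mirror.lamSum (fun w => W w.reverse) (rev s) := by
  classical
  rw [lamSum, trip_rev, rhoSum, ← sub_eq_zero, sub_neg_eq_add, ← trip_add]
  have e0 : trip (fun _ _ _ => (0 : N)) s = 0 := by simp [trip]
  refine (trip_congr fun x y z hxyz => ?_).trans e0
  have e1 : ∀ w, (if S.mirror.adm w then
      S.mirror.lamI (fun w => W w.reverse) (rev z ++ w :: rev x) else 0) =
      if S.adm w.reverse then S.rhoI W (x ++ w.reverse :: z) else 0 := by
    intro w
    have e2 : rev z ++ w :: rev x = rev (x ++ w.reverse :: z) := by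
      rw [rev_append, rev_cons, List.reverse_reverse, List.append_assoc]; rfl
    rw [e2, mirror_lamI]
    simp only [List.reverse_reverse]
    rfl
  simp only [e1]
  rw [mirror_inner]
  simp only [List.reverse_reverse]
  by_cases hy : Odd y.length
  · rw [inner_of_odd _ _ hy, smul_zero, smul_zero, add_zero]
  · have e3 : Odd (x.length + z.length) := by
      rw [← hxyz, List.length_append, List.length_append] at hs
      rw [Nat.odd_iff] at hs hy ⊢
      omega
    rw [length_rev]
    rcases Nat.even_or_odd x.length with hx | hx
    · have hz : Odd z.length := by
        rcases Nat.even_or_odd z.length with hz | hz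
        · exact absurd (hx.add hz) (Nat.not_even_iff_odd.2 e3)
        · exact hz
      rw [hx.neg_one_pow, hz.neg_one_pow, one_smul, neg_one_smul, add_neg_cancel]
    · have hz : Even z.length := by
        rcases Nat.even_or_odd z.length with hz | hz
        · exact hz
        · exact absurd (hx.add_odd hz) (Nat.not_even_iff_odd.2 e3)
      rw [hx.neg_one_pow, hz.neg_one_pow, one_smul, neg_one_smul, neg_add_cancel]

open Classical in
/-- The terms of `rhoSum` in which the outer factorization cuts the first factor of a product. -/
noncomputable def prodR (W : List A → N) (s : List (List A)) : N :=
  S.mirror.prodL (fun w => W w.reverse) (rev s)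

open Classical in
theorem prodR_concat (W : List A → N) (s : List (List A)) (q z : List A) :
    S.prodR W (s ++ [q, z]) = if S.adm (q ++ z) then
      S.C (s ++ [q]) • W z + icuts (fun h g => S.C (s ++ [h]) • W (g ++ z)) q else 0 := by
  have e1 : rev (s ++ [q, z]) = z.reverse :: q.reverse :: rev s := by simp [rev]
  have e2 : S.mirror.adm (z.reverse ++ q.reverse) = S.adm (q ++ z) := by simp [mirror]
  rw [prodR, e1]
  simp only [prodL, e2, mirror_C, rev_cons, rev_rev, List.reverse_reverse, icuts_reverse,
    List.reverse_append]

theorem rhoSum_eq (W : List A → N) {z : List A} {t : List (List A)} (h : S.Good (t ++ [z]))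
    (hs : Odd (t ++ [z]).length) :
    S.rhoSum W (t ++ [z]) =
      -(∑ i, S.X i • icuts (fun h g => S.C (t ++ [z] ++ [h]) • W g) (S.u i) +
        cuts (fun x y => S.lamI (fun w => icuts (fun h g => S.C (x ++ [h]) • W g) w) y) (t ++ [z]) +
        S.prodR W (t ++ [z]) - icuts (fun h g => S.mirror.tail h.reverse (rev t) • W g) z) := by
  rw [rhoSum_eq_mirror _ _ hs, prodR]
  have hg := S.mirror_good h
  rw [rev_concat] at hg ⊢
  rw [lamSum_eq _ _ hg (by simpa [length_rev] using hs)]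
  congr 2
  · congr 1
    congr 1
    · refine Finset.sum_congr rfl fun i _ => ?_
      congr 1
      rw [show S.mirror.u i = (S.u i).reverse from rfl, icuts_reverse]
      refine icuts_congr fun x y _ _ _ => ?_
      rw [mirror_C, rev_cons, rev_cons, rev_rev, List.reverse_reverse, List.reverse_reverse,
        List.reverse_reverse]
    · rw [← rev_concat, cuts_rev]
      refine cuts_congr fun x y _ => ?_
      rw [mirror_rhoI]
      congr 1
      funext w
      rw [icuts_reverse]
      refine icuts_congr fun x y _ _ _ => ?_
      rw [mirror_C, rev_cons, rev_rev, List.reverse_reverse, List.reverse_reverse]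
  · rw [icuts_reverse]
    refine icuts_congr fun x y _ _ _ => ?_
    rw [List.reverse_reverse]

theorem mirror_tail {h a : List A} {s : List (List A)} (hs : S.Good (h :: a :: s)) :
    S.mirror.tail h.reverse (rev (a :: s)) = S.C ((h ++ a) :: s) := by
  rw [rev_cons, tail_concat]
  · rw [mirror_C, rev_cons, rev_rev, List.reverse_append, List.reverse_reverse,
      List.reverse_reverse, S.rotate]
    rfl
  · intro b hb
    have := S.mirror_good hs b (by
      rw [rev_cons, rev_cons]
      simp only [List.mem_cons, List.mem_append] at hb ⊢
      tauto)
    exact this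

/-- A left extension whose output is factored for a right extension gives the same terms as a right
extension whose output is factored for a left extension. -/
theorem cross_eq (W : List A → N) (s : List (List A)) :
    cuts (fun y z => S.rhoI (fun w => icuts (fun g h => S.C (h :: z) • W g) w) y) s =
      cuts (fun x y => S.lamI (fun w => icuts (fun h g => S.C (x ++ [h]) • W g) w) y) s := by
  rw [cuts_rhoI, cuts_eq_right, lamI_nil, add_zero]
  refine pts_congr fun k b z _ => ?_
  rw [lamI_cons]
  simp only [← icuts_smul]
  rw [icuts_icuts]
  refine icuts_congr fun x y _ _ _ => icuts_congr fun u v _ _ _ => ?_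
  exact smul_comm _ _ _

/-- The sum of all operations in front of the left and right extensions, for at least two
words. -/
theorem lamSum_add_rhoSum (W : List A → N) {a z : List A} {t : List (List A)}
    (h : S.Good (a :: (t ++ [z]))) (hs : Odd (a :: (t ++ [z])).length)
    (hu : ∑ i, S.X i • icuts (fun g h => S.C (h :: (a :: (t ++ [z]))) • W g) (S.u i) =
      ∑ i, S.X i • icuts (fun h g => S.C (a :: (t ++ [z]) ++ [h]) • W g) (S.u i)) :
    S.lamSum W (a :: (t ++ [z])) + S.rhoSum W (a :: (t ++ [z])) =
      S.prodL W (a :: (t ++ [z])) - S.prodR W (a :: (t ++ [z])) -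
        icuts (fun g h => S.C ((z ++ h) :: t) • W g) a +
        icuts (fun h g => S.C ((h ++ a) :: t) • W g) z := by
  have h1 := S.rhoSum_eq W (t := a :: t) h hs
  have ha := h a (by simp)
  have hz := h z (by simp)
  have ht : ∀ b ∈ t, b ≠ [] ∧ S.adm b := fun b hb => h b (by simp [hb])
  have e1 : icuts (fun g h => S.tail h (t ++ [z]) • W g) a =
      icuts (fun g h => S.C ((z ++ h) :: t) • W g) a := by
    refine icuts_congr fun x y _ hy hxy => ?_
    rw [tail_concat]
    simp only [Good, List.forall_mem_cons]
    exact ⟨hz, ⟨hy, S.adm_right (hxy ▸ ha.2)⟩, ht⟩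
  have e2 : icuts (fun h g => S.mirror.tail h.reverse (rev (a :: t)) • W g) z =
      icuts (fun h g => S.C ((h ++ a) :: t) • W g) z := by
    refine icuts_congr fun x y hx _ hxy => ?_
    rw [mirror_tail]
    simp only [Good, List.forall_mem_cons]
    exact ⟨⟨hx, S.adm_left (hxy ▸ hz.2)⟩, ha, ht⟩
  rw [S.lamSum_eq W h hs, cross_eq, hu, e1]
  rw [List.cons_append] at h1
  rw [h1, e2]
  simp only [List.cons_append]
  abel

theorem lamSum_add_rhoSum_singleton (W : List A → N) {a : List A} (h : S.Good [a])
    (hu : ∑ i, S.X i • icuts (fun g h => S.C (h :: [a]) • W g) (S.u i) =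
      ∑ i, S.X i • icuts (fun h g => S.C ([a] ++ [h]) • W g) (S.u i)) :
    S.lamSum W [a] + S.rhoSum W [a] =
      icuts (fun h g => (∑ i, S.X i * S.C [S.u i, h]) • W g) a -
        icuts (fun g h => (∑ i, S.X i * S.C [S.u i, h]) • W g) a := by
  have h1 := S.rhoSum_eq W (t := []) (z := a) h (by simp)
  have e1 : ∀ h, S.tail h [] = ∑ i, S.X i * S.C [S.u i, h] := fun h => by simp [tail, pts]
  have e2 : ∀ h : List A, S.mirror.tail h.reverse (rev []) = ∑ i, S.X i * S.C [S.u i, h] := by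
    intro h
    simp only [tail, rev, List.map_nil, List.reverse_nil, pts, add_zero, mirror_C]
    refine Finset.sum_congr rfl fun i _ => ?_
    rw [show S.mirror.u i = (S.u i).reverse from rfl, show S.mirror.X i = S.X i from rfl]
    simp only [List.map_cons, List.map_nil, List.reverse_reverse, List.reverse_cons,
      List.reverse_nil, List.nil_append]
    rw [S.rotate [h]]
    rfl
  simp only [List.nil_append] at h1
  rw [S.lamSum_eq W h (by simp), cross_eq, hu, h1]
  simp only [e1, e2]
  have e3 : S.prodL W [a] = 0 := rfl
  have e4 : S.prodR W [a] = 0 := rfl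
  rw [e3, e4]
  abel

end CutSystem

end Bordered

/-! ### The cut system of tiling graphs -/

namespace Bordered

variable {m : ℕ}

/-- The entries of the outer word at one interval of the boundary circle. -/
def flatWord : List (Letter m) → List (Bool × Letter m)
  | [] => []
  | a :: l => (true, a) :: l.map (Prod.mk false)

/-- The outer word of a graph with a given algebra sequence. -/
def flat (s : List (List (Letter m))) : List (Bool × Letter m) := s.flatMap flatWord

@[simp] theorem flat_nil : flat ([] : List (List (Letter m))) = [] := rfl

@[simp] theorem flat_cons (b : List (Letter m)) (s : List (List (Letter m))) :
    flat (b :: s) = flatWord b ++ flat s := rfl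

@[simp] theorem flat_append (s t : List (List (Letter m))) : flat (s ++ t) = flat s ++ flat t :=
  List.flatMap_append

theorem countP_flatWord {b : List (Letter m)} (hb : b ≠ []) :
    (flatWord b).countP (fun c => c.1) = 1 := by
  obtain ⟨a, b, rfl⟩ := List.exists_cons_of_ne_nil hb
  rw [flatWord, List.countP_cons_of_pos rfl, List.countP_eq_zero.2]
  simp

theorem countP_flat {s : List (List (Letter m))} (hs : [] ∉ s) :
    (flat s).countP (fun c => c.1) = s.length := by
  induction s with
  | nil => rfl
  | cons b s ih =>
    rw [List.mem_cons, not_or] at hs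
    rw [flat_cons, List.countP_append, countP_flatWord (Ne.symm hs.1), ih hs.2, List.length_cons,
      add_comm]

theorem flat_eq_cons {b : List (Letter m)} {s : List (List (Letter m))} (hb : b ≠ []) :
    ∃ a l, flat (b :: s) = (true, a) :: l := by
  obtain ⟨a, b, rfl⟩ := List.exists_cons_of_ne_nil hb
  exact ⟨a, _, rfl⟩

/-- The words that are nonzero in the algebra. -/
def Adm (w : List (Letter m)) : Prop := w.IsChain fun a b => b = a.next

theorem Adm.flatWord {w : List (Letter m)} (h : Adm w) :
    (flatWord w).IsChain fun d e => e.1 = false → e.2 = d.2.next := by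
  cases w with
  | nil => simp [Bordered.flatWord]
  | cons a l =>
    induction l generalizing a with
    | nil => simp [Bordered.flatWord]
    | cons b l ih =>
      rw [Adm, List.isChain_cons_cons] at h
      have := ih b h.2
      simp only [Bordered.flatWord, List.map_cons, List.isChain_cons_cons] at this ⊢
      refine ⟨fun _ => h.1, ?_⟩
      cases l with
      | nil => simp
      | cons c l =>
        simp only [List.map_cons, List.isChain_cons_cons] at this ⊢
        exact this

theorem isChain_flat {s : List (List (Letter m))} (h : ∀ b ∈ s, Adm b) :
    (flat s).IsChain fun d e => e.1 = false → e.2 = d.2.next := by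
  induction s with
  | nil => simp
  | cons b s ih =>
    rw [flat_cons, List.isChain_append]
    refine ⟨(h b (by simp)).flatWord, ih fun c hc => h c (by simp [hc]), ?_⟩
    intro x _ y hy h0
    exfalso
    clear ih h
    induction s with
    | nil => simp at hy
    | cons c s ih =>
      cases c with
      | nil => exact ih hy
      | cons d c =>
        simp only [flat_cons, Bordered.flatWord, List.cons_append, List.head?_cons,
          Option.mem_some_iff] at hy
        rw [← hy] at h0
        exact Bool.noConfusion h0

theorem adm_of_isChain {w : List (Letter m)} (h : (flatWord w).IsChain Consec) : Adm w := by
  cases w with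
  | nil => simp [Adm]
  | cons a l =>
    induction l generalizing a with
    | nil => simp [Adm]
    | cons b l ih =>
      simp only [Bordered.flatWord, List.map_cons, List.isChain_cons_cons] at h
      rw [Adm, List.isChain_cons_cons]
      refine ⟨h.1.2.1 rfl, ih b ?_⟩
      cases l with
      | nil => simp [Bordered.flatWord]
      | cons c l =>
        simp only [Bordered.flatWord, List.map_cons, List.isChain_cons_cons] at h ⊢
        exact h.2

/-- The word of the inner regions with the sector `x`. -/
def innerWord (x : Port m) : List (Letter m) :=
  x.sector :: if x.across = x then [] else [x.across.sector]

theorem flatWord_innerWord (x : Port m) : flatWord (innerWord x) = uWord x := by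
  unfold innerWord uWord
  split_ifs <;> rfl

open Classical in
/-- The generating function of the tiling graphs with a given algebra sequence. -/
noncomputable def graphSum (hm : 3 ≤ m) (s : List (List (Letter m))) : Coef m :=
  if [] ∈ s then 0 else gen hm (flat s)

theorem graphSum_of_good (hm : 3 ≤ m) {s : List (List (Letter m))} (h : [] ∉ s) :
    graphSum hm s = gen hm (flat s) := if_neg h

theorem isChain_of_graphSum_ne_zero (hm : 3 ≤ m) {s : List (List (Letter m))}
    (h : graphSum hm s ≠ 0) : [] ∉ s ∧ (flat s).IsChain Consec := by
  unfold graphSum at h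
  split_ifs at h with h0
  · exact absurd rfl h
  · refine ⟨h0, ?_⟩
    cases hs : flat s with
    | nil => simp
    | cons a l =>
      rw [hs] at h
      have := (isChain_of_gen_ne_zero hm h).2
      rw [← List.cons_append] at this
      exact this.left_of_append

theorem adm_of_graphSum_ne_zero (hm : 3 ≤ m) {s : List (List (Letter m))}
    (h : graphSum hm s ≠ 0) : ∀ b ∈ s, Adm b := by
  intro b hb
  obtain ⟨s, t, rfl⟩ := List.append_of_mem hb
  have := (isChain_of_graphSum_ne_zero hm h).2
  rw [flat_append, flat_cons] at this
  exact adm_of_isChain this.right_of_append.left_of_append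

theorem graphSum_rotate (hm : 3 ≤ m) (s t : List (List (Letter m))) :
    graphSum hm (s ++ t) = graphSum hm (t ++ s) := by
  by_cases h : [] ∈ s ++ t
  · rw [graphSum, graphSum, if_pos h, if_pos (by simpa [or_comm] using h)]
  rw [graphSum_of_good hm h, graphSum_of_good hm (by simpa [and_comm] using h)]
  rcases s with _ | ⟨b, s⟩
  · simp
  rcases t with _ | ⟨c, t⟩
  · simp
  simp only [List.mem_append, List.mem_cons, not_or] at h
  obtain ⟨a, l, h1⟩ := flat_eq_cons (s := s) (Ne.symm h.1.1)
  obtain ⟨a', l', h2⟩ := flat_eq_cons (s := t) (Ne.symm h.2.1)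
  rw [flat_append, flat_append, h1, h2]
  exact gen_rotate hm a a' l l'

theorem graphSum_of_odd (hm : 3 ≤ m) {s : List (List (Letter m))} (h : Odd s.length) :
    graphSum hm s = 0 := by
  unfold graphSum
  split_ifs with h0
  · rfl
  · exact gen_eq_zero_of_odd hm (by rwa [countP_flat h0, Nat.not_even_iff_odd])

/-- The decompositions of an outer word before an entry that does not follow a leaf edge. -/
theorem pts_flat {M : Type*} [AddCommMonoid M]
    (F : List (Bool × Letter m) → List (Bool × Letter m) → M)
    {s : List (List (Letter m))} :
    pts (fun k c l => if c.1 = false then F k (hat (c :: l)) else 0) (flat s) =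
      pts (fun k b l => icuts (fun b' b'' => F (flat k ++ flatWord b') (flatWord b'' ++ flat l)) b)
        s := by
  induction s generalizing F with
  | nil => rfl
  | cons b s ih =>
    rw [flat_cons, pts_append, pts]
    congr 1
    · cases b with
      | nil => rfl
      | cons a b =>
        rw [flatWord, pts, icuts, pts_map]
        simp only [Bool.true_eq_false, if_false, zero_add, if_true]
        rfl
    · rw [ih fun k l => F (flatWord b ++ k) l]
      simp only [flat_cons, List.append_assoc]

theorem sum_filter_eq_pts {M : Type*} [AddCommMonoid M]
    (F : List (Bool × Letter m) → List (Bool × Letter m) → M) (B : List (Bool × Letter m)) :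
    ∑ k ∈ (Finset.range B.length).filter (fun k => B[k]?.map Prod.fst = some false),
      F (B.take k) (B.drop k) =
    pts (fun k c l => if c.1 = false then F k (c :: l) else 0) B := by
  rw [pts_eq_sum, Finset.sum_filter, Finset.sum_range]
  refine Finset.sum_congr rfl fun i _ => ?_
  rw [List.getElem?_eq_getElem i.2, List.drop_eq_getElem_cons i.2]
  simp

theorem graphSum_cut (hm : 3 ≤ m) {x y : List (Letter m)} {s : List (List (Letter m))}
    (h : ∀ b ∈ x :: y :: s, b ≠ [] ∧ Adm b) :
    graphSum hm ((x ++ y) :: s) =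
      ∑ i, MvPolynomial.X (typ i) * graphSum hm (x :: innerWord i :: y :: s) +
      pts (fun k b l => icuts (fun b' b'' =>
        graphSum hm (x :: b'' :: l) * graphSum hm (y :: (k ++ [b']))) b) s := by
  simp only [List.forall_mem_cons] at h
  obtain ⟨⟨hx, -⟩, ⟨hy, hy'⟩, hs⟩ := h
  have hs' : [] ∉ s := fun h0 => (hs _ h0).1 rfl
  obtain ⟨a, x, rfl⟩ := List.exists_cons_of_ne_nil hx
  obtain ⟨b, y, rfl⟩ := List.exists_cons_of_ne_nil hy
  have h1 := gen_cut hm a b (x.map (Prod.mk false)) (y.map (Prod.mk false) ++ flat s) (by simp) (by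
    have := isChain_flat (s := (b :: y) :: s) (by
      simp only [List.forall_mem_cons]; exact ⟨hy', fun b hb => (hs b hb).2⟩)
    rw [flat_cons, flatWord, List.cons_append] at this
    cases hl : y.map (Prod.mk false) ++ flat s with
    | nil => simp
    | cons c l =>
      rw [hl] at this
      simp only [List.isChain_cons_cons] at this ⊢
      exact this)
  have e1 : flat ((a :: x ++ b :: y) :: s) =
      (true, a) :: (x.map (Prod.mk false) ++ (false, b) :: (y.map (Prod.mk false) ++ flat s)) := by
    simp [flatWord]
  rw [graphSum_of_good hm (by simpa using hs'), e1, h1]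
  refine congrArg₂ (· + ·) ?_ ?_
  · refine Finset.sum_congr rfl fun i _ => ?_
    rw [graphSum_of_good hm (by simpa [innerWord] using hs')]
    simp only [flat_cons, flatWord_innerWord]
    simp [flatWord]
  · rw [sum_filter_eq_pts (fun k l => gen hm ((true, a) :: (x.map (Prod.mk false) ++ hat l)) *
      gen hm ((true, b) :: k)), pts_append, pts_eq_zero, zero_add]
    · have e2 : ∀ c l, (hat (hat (c :: l)) : List (Bool × Letter m)) = hat (c :: l) :=
        fun _ _ => rfl
      have e3 := pts_flat (s := s) (fun k l =>
        gen hm ((true, a) :: (x.map (Prod.mk false) ++ hat l)) *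
          gen hm ((true, b) :: (y.map (Prod.mk false) ++ k)))
      simp only [e2] at e3
      rw [e3]
      refine pts_congr fun k c l hk => icuts_congr fun b' b'' hb' hb'' _ => ?_
      obtain ⟨d, b'', rfl⟩ := List.exists_cons_of_ne_nil hb''
      have hkl : [] ∉ k ∧ [] ∉ l := by
        rw [← hk] at hs'
        simp only [List.mem_append, List.mem_cons, not_or] at hs'
        exact ⟨hs'.1, hs'.2.2⟩
      rw [graphSum_of_good hm (by simpa using hkl.2), graphSum_of_good hm (by simpa using
        ⟨hkl.1, hb'⟩)]
      simp [flatWord, hat]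
    · intro k c l hk
      split_ifs with hc
      · rw [gen_eq_zero_of_odd hm (W := (true, b) :: k), mul_zero]
        rw [List.countP_cons_of_pos rfl, List.countP_eq_zero.2]
        · simp
        · intro d hd
          have : d ∈ y.map (Prod.mk false) := by rw [← hk]; simp [hd]
          obtain ⟨d, _, rfl⟩ := List.mem_map.1 this
          simp
      · rfl

theorem adm_innerWord (x : Port m) : Adm (innerWord x) := by
  unfold innerWord Adm
  split_ifs
  · simp
  · simp [Port.sector_across]

theorem adm_append {x y : List (Letter m)} : Adm (x ++ y) ↔ Adm x ∧ Adm y ∧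
    ∀ a ∈ x.getLast?, ∀ b ∈ y.head?, b = a.next := List.isChain_append

/-- The cut system of tiling graphs. -/
noncomputable def graphSystem (hm : 3 ≤ m) : CutSystem (Letter m) (Port m) (Coef m) where
  C := graphSum hm
  u := innerWord
  X i := MvPolynomial.X (typ i)
  adm := Adm
  u_ne_nil _ := by simp [innerWord]
  adm_u := adm_innerWord
  adm_left h := h.left_of_append
  adm_right h := h.right_of_append
  adm_glue {x y z} hy h1 h2 := by
    rw [adm_append] at h1 h2 ⊢
    refine ⟨h1.1, adm_append.2 h2, fun a ha b hb => h1.2.2 a ha b ?_⟩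
    rwa [List.head?_append_of_ne_nil _ hy] at hb
  adm_of_ne_zero := adm_of_graphSum_ne_zero hm
  rotate := graphSum_rotate hm
  odd := graphSum_of_odd hm
  cut := graphSum_cut hm

theorem getLast?_flatWord (w : List (Letter m)) :
    (flatWord w).getLast?.map Prod.snd = w.getLast? := by
  rw [← List.getLast?_map]
  cases w with
  | nil => rfl
  | cons a w => simp [flatWord, Function.comp_def]

/-- Consecutive words of an algebra sequence are composable, but their product is zero. -/
theorem adjacent_of_graphSum_ne_zero (hm : 3 ≤ m) {v w : List (Letter m)}
    {s : List (List (Letter m))} (h : graphSum hm (v :: w :: s) ≠ 0) {a b : Letter m}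
    (ha : v.getLast? = some a) (hb : w.head? = some b) : a.tgt = b.src ∧ b ≠ a.next := by
  have h1 := (isChain_of_graphSum_ne_zero hm h).2
  rw [flat_cons, flat_cons, List.isChain_append] at h1
  obtain ⟨w, rfl⟩ : ∃ w', w = b :: w' := by
    cases w with
    | nil => simp at hb
    | cons c w => simp only [List.head?_cons, Option.some.injEq] at hb; exact ⟨w, by rw [hb]⟩
  rw [← getLast?_flatWord, Option.map_eq_some_iff] at ha
  obtain ⟨c, hc, rfl⟩ := ha
  have h2 := h1.2.2 c hc (true, b) (by simp [flatWord])
  exact ⟨h2.1, fun h0 => Bool.noConfusion (h2.2.2 h0)⟩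

/-- The two orders of the letters of the inner bigons are interchanged. -/
theorem sum_innerWord_swap {K N : Type*} [CommRing K] [AddCommGroup N] [Module K N]
    (X : Fin m → K) (F : List (Letter m) → List (Letter m) → N) :
    ∑ i : Port m, X (typ i) • icuts F (innerWord i) =
      ∑ i : Port m, X (typ i) • icuts (fun g h => F h g) (innerWord i) := by
  have hinv : Function.Involutive (Port.across : Port m → Port m) := Port.across_across
  rw [← Equiv.sum_comp hinv.toPerm]
  refine Finset.sum_congr rfl fun i _ => ?_
  have h1 : typ i.across = typ i := by
    apply Fin.ext
    have h2 := index_typ i.across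
    rw [Port.index_across, index_typ] at h2
    exact (Nat.add_right_cancel h2).symm
  change X (typ i.across) • icuts F (innerWord i.across) = _
  rw [h1]
  congr 1
  unfold innerWord
  rw [Port.across_across]
  by_cases h : i.across = i
  · rw [if_pos h, if_pos h.symm]; rfl
  · rw [if_neg h, if_neg (Ne.symm h)]; simp [icuts, pts]

/-! #### Alternating words -/

/-- The admissible word of length `n` that starts with `x`. -/
def alt (x : Letter m) (n : ℕ) : List (Letter m) := List.iterate Letter.next x n

@[simp] theorem length_alt (x : Letter m) (n : ℕ) : (alt x n).length = n := by simp [alt]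

theorem alt_succ (x : Letter m) (n : ℕ) : alt x (n + 1) = x :: alt x.next n := rfl

theorem adm_alt (x : Letter m) (n : ℕ) : Adm (alt x n) := by
  induction n generalizing x with
  | zero => simp [alt, Adm]
  | succ n ih =>
    have := ih x.next
    cases n with
    | zero => simp [alt, Adm]
    | succ n =>
      rw [alt_succ, alt_succ, Adm, List.isChain_cons_cons]
      rw [alt_succ] at this
      exact ⟨rfl, this⟩

theorem Adm.eq_alt {x : Letter m} {l : List (Letter m)} (h : Adm (x :: l)) :
    x :: l = alt x (l.length + 1) := by
  induction l generalizing x with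
  | nil => rfl
  | cons y l ih =>
    rw [Adm, List.isChain_cons_cons] at h
    obtain ⟨rfl, h⟩ := h
    rw [List.length_cons, alt_succ x, ← ih h]

theorem alt_append (x : Letter m) (p q : ℕ) :
    alt x (p + q) = alt x p ++ alt (Letter.next^[p] x) q := by
  induction p generalizing x with
  | zero => rw [zero_add]; rfl
  | succ p ih => rw [Nat.succ_add, alt_succ, alt_succ, ih]; rfl

theorem take_alt (x : Letter m) {i n : ℕ} (h : i ≤ n) : (alt x n).take i = alt x i := by
  obtain ⟨k, rfl⟩ := Nat.exists_eq_add_of_le h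
  rw [alt_append, List.take_left' (length_alt x i)]

theorem drop_alt (x : Letter m) {i n : ℕ} (h : i ≤ n) :
    (alt x n).drop i = alt (Letter.next^[i] x) (n - i) := by
  obtain ⟨k, rfl⟩ := Nat.exists_eq_add_of_le h
  rw [alt_append, List.drop_left' (length_alt x i), Nat.add_sub_cancel_left]

theorem adm_alt_append_iff {x y : Letter m} {p q : ℕ} (hp : 0 < p) (hq : 0 < q) :
    Adm (alt x p ++ alt y q) ↔ y = Letter.next^[p] x := by
  constructor
  · intro h
    obtain ⟨p, rfl⟩ := Nat.exists_eq_succ_of_ne_zero hp.ne'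
    obtain ⟨q, rfl⟩ := Nat.exists_eq_succ_of_ne_zero hq.ne'
    rw [Nat.succ_eq_add_one, Nat.succ_eq_add_one, alt_succ, List.cons_append] at h
    have h1 := h.eq_alt
    rw [← List.cons_append, ← alt_succ, List.length_append, length_alt, length_alt,
      show p + (q + 1) + 1 = (p + 1) + (q + 1) by omega] at h1
    have h2 := List.append_cancel_left (h1.trans (alt_append x (p + 1) (q + 1)))
    rw [alt_succ, alt_succ, List.cons.injEq] at h2
    exact h2.1
  · rintro rfl
    rw [← alt_append]
    exact adm_alt x _

theorem next_injective : Function.Injective (Letter.next : Letter m → Letter m) :=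
  Function.Involutive.injective Letter.next_next

/-- The value at `alt y q ++ alt w r` of a function that vanishes on inadmissible words. -/
theorem apply_alt_append {M : Type*} [Zero M] {Φ : List (Letter m) → M}
    (hΦ : ∀ w, ¬ Adm w → Φ w = 0) (y w : Letter m) {q r : ℕ} (hq : 0 < q) (hr : 0 < r)
    [Decidable (w = Letter.next^[q] y)] :
    Φ (alt y q ++ alt w r) = if w = Letter.next^[q] y then Φ (alt y (q + r)) else 0 := by
  split_ifs with h
  · rw [alt_append, h]
  · exact hΦ _ fun h0 => h ((adm_alt_append_iff hq hr).1 h0)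

theorem sum_Ioo_reflect {N : Type*} [AddCommMonoid N] (p q : ℕ) (G : ℕ → N) :
    ∑ i ∈ Finset.Ioo 0 q, G (p + q - i) = ∑ i ∈ Finset.Ioo p (p + q), G i := by
  refine Finset.sum_nbij' (fun i => p + q - i) (fun i => p + q - i) ?_ ?_ ?_ ?_ fun _ _ => rfl
  all_goals intro i hi; simp only [Finset.mem_Ioo] at hi ⊢; omega

theorem sum_Ioo_shift {N : Type*} [AddCommMonoid N] (p q : ℕ) (G : ℕ → N) :
    ∑ i ∈ Finset.Ioo 0 q, G (p + i) = ∑ i ∈ Finset.Ioo p (p + q), G i := by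
  refine Finset.sum_nbij' (fun i => p + i) (fun i => i - p) ?_ ?_ ?_ ?_ fun _ _ => rfl
  all_goals intro i hi; simp only [Finset.mem_Ioo] at hi ⊢; omega

theorem sum_Ioo_split {N : Type*} [AddCommMonoid N] (G : ℕ → N) {k n : ℕ} (h1 : 0 < k)
    (h2 : k < n) :
    ∑ i ∈ Finset.Ioo 0 k, G i + G k + ∑ i ∈ Finset.Ioo k n, G i = ∑ i ∈ Finset.Ioo 0 n, G i := by
  have h : Finset.Ioo 0 n = Finset.Ioo 0 k ∪ insert k (Finset.Ioo k n) := by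
    ext i; simp only [Finset.mem_Ioo, Finset.mem_union, Finset.mem_insert]; omega
  rw [h, Finset.sum_union, Finset.sum_insert (by simp), add_assoc]
  rw [Finset.disjoint_left]
  intro i hi
  simp only [Finset.mem_Ioo, Finset.mem_insert] at hi ⊢
  omega

section Exchange

variable {K N : Type*} [CommRing K] [AddCommGroup N] [Module K N]

open Classical in
/-- The terms of the structure relation that involve only the first and the last input. Both sides
are equal to the sum of `Φ (alt y (p + q - i)) • W (alt x i)` over all `0 < i < p + q` for which
both words end at the same letter. -/
theorem exchange {Φ : List (Letter m) → K} {W : List (Letter m) → N}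
    (hΦ : ∀ w, ¬ Adm w → Φ w = 0) (hW : ∀ w, ¬ Adm w → W w = 0) (x y : Letter m) {p q : ℕ}
    (hp : 0 < p) (hq : 0 < q) :
    icuts (fun g h => Φ (alt y q ++ h) • W g) (alt x p) +
        (if Letter.next^[p] x = Letter.next^[q] y then Φ (alt y q) • W (alt x p) else 0) +
        icuts (fun g h => Φ g • W (alt x p ++ h)) (alt y q) =
      icuts (fun g h => Φ (g ++ alt x p) • W h) (alt y q) +
        (if x = y then Φ (alt x p) • W (alt y q) else 0) +
        icuts (fun g h => Φ h • W (g ++ alt y q)) (alt x p) := by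
  have inj : ∀ n, Function.Injective (Letter.next^[n] : Letter m → Letter m) :=
    fun n => next_injective.iterate n
  let G : ℕ → N := fun i =>
    if Letter.next^[i] x = Letter.next^[q] y then Φ (alt y (p + q - i)) • W (alt x i) else 0
  have e1 : icuts (fun g h => Φ (alt y q ++ h) • W g) (alt x p) = ∑ i ∈ Finset.Ioo 0 p, G i := by
    rw [icuts_eq_sum, length_alt]
    refine Finset.sum_congr rfl fun i hi => ?_
    rw [Finset.mem_Ioo] at hi
    rw [take_alt x hi.2.le, drop_alt x hi.2.le, apply_alt_append hΦ _ _ hq (by omega)]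
    simp only [G]
    split_ifs with h
    · rw [show q + (p - i) = p + q - i by omega]
    · rw [zero_smul]
  have e2 : icuts (fun g h => Φ g • W (alt x p ++ h)) (alt y q) =
      ∑ i ∈ Finset.Ioo 0 q, G (p + q - i) := by
    rw [icuts_eq_sum, length_alt]
    refine Finset.sum_congr rfl fun i hi => ?_
    rw [Finset.mem_Ioo] at hi
    rw [take_alt y hi.2.le, drop_alt y hi.2.le, apply_alt_append hW _ _ hp (by omega)]
    have h1 : (Letter.next^[p + q - i] x = Letter.next^[q] y) ↔
        Letter.next^[i] y = Letter.next^[p] x := by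
      rw [← (inj (q - i)).eq_iff (a := Letter.next^[i] y), ← Function.iterate_add_apply,
        ← Function.iterate_add_apply, show q - i + i = q by omega,
        show q - i + p = p + q - i by omega, eq_comm]
    simp only [G, h1]
    split_ifs with h
    · rw [show p + (q - i) = p + q - i by omega, show p + q - (p + q - i) = i by omega]
    · rw [smul_zero]
  have e3 : icuts (fun g h => Φ (g ++ alt x p) • W h) (alt y q) =
      ∑ i ∈ Finset.Ioo 0 q, G (q - i) := by
    rw [icuts_eq_sum, length_alt]
    refine Finset.sum_congr rfl fun i hi => ?_
    rw [Finset.mem_Ioo] at hi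
    rw [take_alt y hi.2.le, drop_alt y hi.2.le, apply_alt_append hΦ _ _ hi.1 hp]
    have h1 : (Letter.next^[q - i] x = Letter.next^[q] y) ↔ x = Letter.next^[i] y := by
      rw [← (inj (q - i)).eq_iff (a := x), ← Function.iterate_add_apply,
        show q - i + i = q by omega]
    simp only [G, h1]
    split_ifs with h
    · rw [show p + q - (q - i) = i + p by omega, h]
    · rw [zero_smul]
  have e4 : icuts (fun g h => Φ h • W (g ++ alt y q)) (alt x p) =
      ∑ i ∈ Finset.Ioo 0 p, G (q + i) := by
    rw [icuts_eq_sum, length_alt]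
    refine Finset.sum_congr rfl fun i hi => ?_
    rw [Finset.mem_Ioo] at hi
    rw [take_alt x hi.2.le, drop_alt x hi.2.le, apply_alt_append hW _ _ hi.1 hq]
    have h1 : (Letter.next^[q + i] x = Letter.next^[q] y) ↔ y = Letter.next^[i] x := by
      rw [Function.iterate_add_apply, (inj q).eq_iff, eq_comm]
    simp only [G, h1]
    split_ifs with h
    · rw [show p + q - (q + i) = p - i by omega, ← h, add_comm]
    · rw [smul_zero]
  have e5 : (if Letter.next^[p] x = Letter.next^[q] y then Φ (alt y q) • W (alt x p) else 0) =
      G p := by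
    simp only [G, Nat.add_sub_cancel_left]
  have e6 : (if x = y then Φ (alt x p) • W (alt y q) else 0) = G q := by
    simp only [G, (inj q).eq_iff, Nat.add_sub_cancel]
    split_ifs with h
    · rw [h]
    · rfl
  rw [e1, e2, e3, e4, e5, e6]
  rw [sum_Ioo_reflect p q, sum_Ioo_shift q p, add_comm q p]
  have s2 := sum_Ioo_reflect 0 q G
  rw [zero_add] at s2
  rw [s2, sum_Ioo_split G hp (by omega), sum_Ioo_split G hq (by omega)]

/-- The counterpart of `exchange` for the relation with a single input: if `T` is invariant under
cyclic rotation and vanishes on words that are not closed, the terms of the two sides agree after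
the lengths of the factors are exchanged. -/
theorem exchange_self {T : List (Letter m) → K} {W : List (Letter m) → N} (x : Letter m) (p : ℕ)
    (hT : ∀ g h, g ≠ [] → h ≠ [] → Adm g → Adm h → T (g ++ h) = T (h ++ g))
    (h0 : ∀ (y : Letter m) (n : ℕ), Letter.next^[n] y ≠ y → T (alt y n) = 0) :
    icuts (fun h g => T h • W g) (alt x p) = icuts (fun g h => T h • W g) (alt x p) := by
  have key : ∀ (i k : ℕ), 0 < k → Letter.next^[k] x = x →
      T (alt (Letter.next^[i] x) k) = T (alt x k) := by
    intro i k hk hx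
    induction i with
    | zero => rfl
    | succ i ih =>
      rw [← ih, Function.iterate_succ_apply']
      have hz : Letter.next^[k] (Letter.next^[i] x) = Letter.next^[i] x := by
        rw [← Function.iterate_add_apply, add_comm, Function.iterate_add_apply, hx]
      generalize Letter.next^[i] x = z at hz
      obtain ⟨_ | k, rfl⟩ := Nat.exists_eq_succ_of_ne_zero hk.ne'
      · rw [show z.next = z from hz]
      · have h1 : alt z (k + 1 + 1) = [z] ++ alt z.next (k + 1) := rfl
        have h2 : alt z.next (k + 1 + 1) = alt z.next (k + 1) ++ [z] := by
          rw [alt_append z.next, ← Function.iterate_succ_apply, hz]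
          rfl
        rw [Nat.succ_eq_add_one, h1, h2]
        exact hT _ _ (by simp [alt]) (by simp) (adm_alt _ _) (by simp [Adm])
  rw [icuts_eq_sum, icuts_eq_sum, length_alt]
  have hsum := sum_Ioo_reflect 0 p
    (fun i => T ((alt x p).take i) • W ((alt x p).drop i))
  rw [zero_add] at hsum
  rw [← hsum]
  refine Finset.sum_congr rfl fun i hi => ?_
  rw [Finset.mem_Ioo] at hi
  rw [take_alt x hi.2.le, drop_alt x hi.2.le, take_alt x (by omega), drop_alt x (by omega),
    Nat.sub_sub_self hi.2.le]
  by_cases hx : Letter.next^[p - i] x = x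
  · rw [hx, key i _ (by omega) hx]
  · have hx' : Letter.next^[p - i] (Letter.next^[i] x) ≠ Letter.next^[i] x := by
      rw [← Function.iterate_add_apply, add_comm, Function.iterate_add_apply]
      exact fun h => hx (next_injective.iterate i h)
    rw [h0 _ _ hx, h0 _ _ hx', zero_smul, zero_smul]

end Exchange

end Bordered

/-! ### The structure relation for words -/

namespace Bordered

variable {m : ℕ}

theorem trip_ends {α M : Type*} [AddCommMonoid M] {f : List α → List α → List α → M} (a z : α)
    {r i s : List α} (h1 : s = a :: r) (h2 : s = i ++ [z])
    (h : ∀ x y w, x.length + w.length ≠ 1 → f x y w = 0) :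
    trip f s = f [a] r [] + f [] i [z] := by
  have e1 : cuts (f []) s = f [] i [z] := by
    rw [h2, cuts_append_cons, cuts_eq_right, pts_eq_zero, zero_add, cuts, h [] (i ++ [z]) [] (by simp),
      add_zero]
    · rfl
    · intro x b y _
      exact h _ _ _ (by simp)
  have e2 : trip (fun x => f (a :: x)) r = f [a] r [] := by
    rw [trip, cuts_eq_left, pts_eq_zero, add_zero, cuts_eq_right, pts_eq_zero, zero_add]
    · intro x b y _
      exact h _ _ _ (by simp)
    · intro x b y _
      exact cuts_eq_zero fun x y _ => h _ _ _ (by simp only [List.length_append, List.length_cons]; omega)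
  rw [← e1, ← e2, h1, add_comm]
  rfl

/-! #### Letters at a vertex -/

theorem eq_of_src_eq {a b c : Letter m} (h1 : a.src = c.src) (h2 : b.src = c.src) (h3 : a ≠ c)
    (h4 : b ≠ c) : a = b := by
  obtain ⟨p, rfl⟩ := Port.sector_surjective a
  obtain ⟨q, rfl⟩ := Port.sector_surjective b
  obtain ⟨r, rfl⟩ := Port.sector_surjective c
  rw [Port.src_sector, Port.src_sector] at h1 h2
  rw [ne_eq, Port.sector_injective.eq_iff] at h3 h4
  rw [(Port.eq_or_eq_flip h1).resolve_left h3, (Port.eq_or_eq_flip h2).resolve_left h4]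

theorem innerWord_eq_alt (i : Port m) :
    innerWord i = alt i.sector (if i.across = i then 1 else 2) := by
  unfold innerWord
  split_ifs
  · rfl
  · rw [Port.sector_across]; rfl

theorem iterate_next_innerWord (i : Port m) :
    Letter.next^[if i.across = i then 1 else 2] i.sector = i.sector := by
  split_ifs with h
  · rw [Function.iterate_one, ← Port.sector_across, h]
  · exact Letter.next_next _

theorem getLast?_alt (x : Letter m) (n : ℕ) :
    (alt x (n + 1)).getLast? = some (Letter.next^[n] x) := by
  rw [alt_append]
  simp [alt]

theorem head?_alt (x : Letter m) (n : ℕ) : (alt x (n + 1)).head? = some x := rfl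

theorem getLast?_innerWord (i : Port m) : (innerWord i).getLast? = some i.sector.next := by
  rw [innerWord_eq_alt]
  split_ifs with h
  · rw [getLast?_alt, ← Port.sector_across, h]; rfl
  · rw [getLast?_alt]; rfl

theorem tgt_getLast_innerWord (i : Port m) : i.sector.next.tgt = i.sector.src := by
  rw [Letter.tgt_eq_src_next, Letter.next_next]

theorem Adm.exists_eq_alt {w : List (Letter m)} (h : Adm w) (hw : w ≠ []) :
    ∃ x n, w = alt x (n + 1) := by
  obtain ⟨x, l, rfl⟩ := List.exists_cons_of_ne_nil hw
  exact ⟨x, _, h.eq_alt⟩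

/-! #### The relation -/

/-- The image under a map `e` of the idempotent at the start of a sequence of words. -/
def startM {N : Type*} [AddCommGroup N] (e : Node m → N) : List (List (Letter m)) → N
  | (c :: _) :: _ => e c.src
  | _ => 0

theorem startM_cons_append {N : Type*} [AddCommGroup N] {e : Node m → N}
    {g h : List (Letter m)} {z z' : List (List (Letter m))} (hg : g ≠ []) :
    startM e ((g ++ h) :: z) = startM e (g :: z') := by
  obtain ⟨a, g, rfl⟩ := List.exists_cons_of_ne_nil hg
  rfl

theorem startM_cons_of_head? {N : Type*} [AddCommGroup N] {e : Node m → N}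
    {g : List (Letter m)} {z : List (List (Letter m))} {c : Letter m} (hc : g.head? = some c) : startM e (g :: z) = e c.src := by
  cases g with
  | nil => simp at hc
  | cons d g => simp only [List.head?_cons, Option.some.injEq] at hc; rw [← hc]; rfl

section Relation

variable (hm : 3 ≤ m) {N : Type*} [AddCommGroup N] [Module (Coef m) N] (e : Node m → N)
  (W : List (Letter m) → N)

/-- The generating function of the operations on sequences of words. The values are mapped to a
module by `e` on the idempotents and by `W` on the words. -/
noncomputable def muWord (s : List (List (Letter m))) : N :=
  graphSum hm s • startM e s + (graphSystem hm).inner W s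

open Classical in
/-- The product of a word with the idempotent at the start of a sequence of words. -/
noncomputable def insStart (x y z : List (List (Letter m))) : N :=
  match x, z with
  | [a], [] => startM (fun k => if a.getLast?.map Letter.tgt = some k then W a else 0) y
  | [], [b] => startM (fun k => if b.head?.map Letter.src = some k then W b else 0) y
  | _, _ => 0

variable {hm} {e W}

/-- All idempotents that appear as outputs are at the start of the sequence. -/
theorem smul_startM {s : List (List (Letter m))} (hs : (graphSystem hm).Good s)
    (hs0 : s ≠ []) {x y z : List (List (Letter m))} (hxyz : x ++ (y ++ z) = s) :
    (graphSystem hm).inner (fun w => graphSum hm (x ++ w :: z) • startM e (x ++ w :: z)) y =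
      (graphSystem hm).inner (fun w => graphSum hm (x ++ w :: z)) y • startM e s := by
  rw [← CutSystem.inner_smul_const]
  rcases x with _ | ⟨a, x⟩
  swap
  · have ha := (hs a (by rw [← hxyz]; simp)).1
    have : ∀ w, startM e (a :: x ++ w :: z) = startM e s := fun w => by
      rw [← hxyz, List.cons_append, List.cons_append]
      have := startM_cons_append (e := e) (h := []) (z := x ++ w :: z) (z' := x ++ (y ++ z)) ha
      rwa [List.append_nil] at this
    simp only [this]
  subst hxyz
  simp only [List.nil_append] at *
  have h1 : (graphSystem hm).lamI (fun w => graphSum hm (w :: z) • startM e (w :: z)) y =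
      (graphSystem hm).lamI (fun w => graphSum hm (w :: z) • startM e (y ++ z)) y := by
    rcases y with _ | ⟨b, y⟩
    · rfl
    · rw [CutSystem.lamI_cons, CutSystem.lamI_cons]
      refine icuts_congr fun g h hg _ hgh => ?_
      rw [← hgh, List.cons_append, ← startM_cons_append (h := h) (z := y ++ z) hg]
  have h2 : (graphSystem hm).rhoI (fun w => graphSum hm (w :: z) • startM e (w :: z)) y =
      (graphSystem hm).rhoI (fun w => graphSum hm (w :: z) • startM e (y ++ z)) y := by
    rcases List.eq_nil_or_concat y with rfl | ⟨y, b, rfl⟩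
    · rfl
    · rw [List.concat_eq_append] at hs ⊢
      rw [CutSystem.rhoI_concat, CutSystem.rhoI_concat]
      refine icuts_congr fun h g hh hg hgh => ?_
      by_cases h0 : graphSum hm (y ++ [h]) = 0
      · change graphSum hm (y ++ [h]) • _ = graphSum hm (y ++ [h]) • _
        rw [h0, zero_smul, zero_smul]
      congr 2
      rcases y with _ | ⟨c, y⟩
      · exact absurd (graphSum_of_odd hm (by simp)) h0
      have hc := hs c (by simp)
      have hb := (hs b (by simp)).2
      rw [← hgh] at hb
      have hb : Adm (h ++ g) := hb
      obtain ⟨u, n, hu⟩ := (adm_append.1 hb).1.exists_eq_alt hh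
      obtain ⟨v, k, hv⟩ := (adm_append.1 hb).2.1.exists_eq_alt hg
      obtain ⟨c', l, hcl⟩ := hc.2.exists_eq_alt hc.1
      rw [graphSum_rotate] at h0
      have h3 := adjacent_of_graphSum_ne_zero hm h0 (hu ▸ getLast?_alt u n)
        (hcl ▸ head?_alt c' l)
      have h4 := (adm_append.1 hb).2.2 _ (hu ▸ getLast?_alt u n) _ (hv ▸ head?_alt v k)
      rw [List.cons_append, List.cons_append, startM_cons_of_head? (hv ▸ head?_alt v k),
        startM_cons_of_head? (hcl ▸ head?_alt c' l), h4, ← Letter.tgt_eq_src_next, h3.1]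
  have h3 : CutSystem.prodI (fun w => graphSum hm (w :: z) • startM e (w :: z)) y =
      CutSystem.prodI (fun w => graphSum hm (w :: z) • startM e (y ++ z)) y := by
    rcases y with _ | ⟨p, _ | ⟨q, _ | ⟨r, s⟩⟩⟩
    · rfl
    · rfl
    · simp only [CutSystem.prodI]
      rw [List.cons_append, startM_cons_append (hs p (by simp)).1]
    · rfl
  have h4 : (graphSystem hm).unitI (fun w => graphSum hm (w :: z) • startM e (w :: z)) y =
      (graphSystem hm).unitI (fun w => graphSum hm (w :: z) • startM e (y ++ z)) y := by
    rcases y with _ | ⟨b, y⟩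
    · refine Finset.sum_congr rfl fun i _ => ?_
      by_cases h0 : graphSum hm (innerWord i :: z) = 0
      · change _ • graphSum hm (innerWord i :: z) • _ = _ • graphSum hm (innerWord i :: z) • _
        rw [h0, zero_smul, zero_smul]
      congr 2
      rcases z with _ | ⟨c, z⟩
      · exact absurd rfl hs0
      have hc := hs c (by simp)
      obtain ⟨c', l, hcl⟩ := hc.2.exists_eq_alt hc.1
      have h5 := adjacent_of_graphSum_ne_zero hm h0 (getLast?_innerWord i) (hcl ▸ head?_alt c' l)
      rw [List.nil_append, startM_cons_of_head? (hcl ▸ head?_alt c' l), ← h5.1,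
        tgt_getLast_innerWord]
      rfl
    · rfl
  rw [CutSystem.inner, CutSystem.inner, h1, h2, h3, h4]

open Classical in
/-- The terms of the relation in which the outer operation is the product with a left input. -/
theorem prodL_cancel (hW : ∀ w, ¬ Adm w → W w = 0) {a q z : List (Letter m)}
    {t : List (List (Letter m))} (h : (graphSystem hm).Good (a :: q :: (t ++ [z])))
    {la lz : Letter m} (hla : a.getLast? = some la) (hlz : z.getLast? = some lz) :
    (graphSystem hm).lamI (fun w => W (a ++ w)) (q :: (t ++ [z])) +
        graphSum hm (q :: (t ++ [z])) • insStart W [a] (q :: (t ++ [z])) [] =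
      (graphSystem hm).prodL W (a :: q :: (t ++ [z])) +
        if la.next = lz.next then graphSum hm (z :: q :: t) • W a else 0 := by
  have hq := h q (by simp)
  have ha := h a (by simp)
  obtain ⟨c, n, hc⟩ := (show Adm q from hq.2).exists_eq_alt hq.1
  have hhead : q.head? = some c := hc ▸ head?_alt c n
  have hrot : graphSum hm (z :: q :: t) = graphSum hm (q :: (t ++ [z])) :=
    graphSum_rotate hm [z] (q :: t)
  have hadm : Adm (a ++ q) ↔ c = la.next := by
    rw [adm_append]
    refine ⟨fun h0 => h0.2.2 _ hla _ hhead, fun h0 => ⟨ha.2, hq.2, fun l hl b hb => ?_⟩⟩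
    rw [hla] at hl
    rw [hhead] at hb
    cases hl; cases hb
    exact h0
  have hins : insStart W [a] (q :: (t ++ [z])) [] = if la.tgt = c.src then W a else 0 := by
    simp only [insStart]
    rw [startM_cons_of_head? hhead, hla]
    simp
  have hadj : graphSum hm (q :: (t ++ [z])) ≠ 0 → lz.tgt = c.src ∧ c ≠ lz.next := by
    rw [← hrot]
    exact fun h0 => adjacent_of_graphSum_ne_zero hm h0 hlz hhead
  rw [hins, hrot, CutSystem.lamI_cons, CutSystem.prodL]
  simp only [show (graphSystem hm).adm = Adm from rfl, show (graphSystem hm).C = graphSum hm from rfl]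
  by_cases h0 : graphSum hm (q :: (t ++ [z])) = 0
  · rw [h0]
    simp only [zero_smul, ite_self, zero_add, add_zero]
    split_ifs with h1
    · rfl
    · refine icuts_eq_zero fun g k hg hk hgk => ?_
      rw [hW, smul_zero]
      intro h2
      refine h1 ?_
      rw [← hgk] at hq ⊢
      exact (graphSystem hm).adm_glue hg h2 hq.2
  obtain ⟨h3, h4⟩ := hadj h0
  by_cases h1 : c = la.next
  · rw [if_pos (hadm.2 h1), if_pos (by rw [h1, Letter.tgt_eq_src_next]),
      if_neg (fun h5 => h4 (h1.trans h5))]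
    abel
  · rw [if_neg (fun h5 => h1 (hadm.1 h5)), zero_add, icuts_eq_zero, zero_add, smul_ite, smul_zero]
    · congr 1
      rw [Letter.tgt_eq_src_next] at h3 ⊢
      refine propext ⟨fun h5 => eq_of_src_eq h5 h3 (Ne.symm h1) (Ne.symm h4), fun h5 => ?_⟩
      rw [h5, h3]
    · intro g k hg hk hgk
      rw [hW, smul_zero]
      intro h2
      refine h1 (hadm.1 ?_)
      rw [← hgk] at hq ⊢
      exact (graphSystem hm).adm_glue hg h2 hq.2

open Classical in
/-- The terms of the relation in which the outer operation is the product with a right input. -/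
theorem prodR_cancel (hW : ∀ w, ¬ Adm w → W w = 0) {a q z : List (Letter m)}
    {t : List (List (Letter m))} (h : (graphSystem hm).Good (a :: (t ++ [q, z])))
    {x y : Letter m} (hx : a.head? = some x) (hy : z.head? = some y) :
    (graphSystem hm).rhoI (fun w => W (w ++ z)) (a :: t ++ [q]) +
        graphSum hm (a :: t ++ [q]) • insStart W [] (a :: t ++ [q]) [z] =
      (graphSystem hm).prodR W (a :: t ++ [q, z]) +
        if x = y then graphSum hm (a :: t ++ [q]) • W z else 0 := by
  have hq := h q (by simp)
  have hz := h z (by simp)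
  obtain ⟨c, n, hc⟩ := (show Adm q from hq.2).exists_eq_alt hq.1
  have hlast : q.getLast? = some (Letter.next^[n] c) := hc ▸ getLast?_alt c n
  generalize Letter.next^[n] c = lq at hlast
  have hadm : Adm (q ++ z) ↔ y = lq.next := by
    rw [adm_append]
    refine ⟨fun h0 => h0.2.2 _ hlast _ hy, fun h0 => ⟨hq.2, hz.2, fun l hl b hb => ?_⟩⟩
    rw [hlast] at hl
    rw [hy] at hb
    cases hl; cases hb
    exact h0
  have hins : insStart W [] (a :: t ++ [q]) [z] = if y.src = x.src then W z else 0 := by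
    simp only [insStart]
    rw [List.cons_append, startM_cons_of_head? hx, hy]
    simp
  have hadj : graphSum hm (a :: t ++ [q]) ≠ 0 → lq.tgt = x.src ∧ x ≠ lq.next := by
    rw [graphSum_rotate]
    exact fun h0 => adjacent_of_graphSum_ne_zero hm h0 hlast hx
  rw [hins, CutSystem.rhoI_concat, CutSystem.prodR_concat]
  simp only [show (graphSystem hm).adm = Adm from rfl,
    show (graphSystem hm).C = graphSum hm from rfl]
  have hzero : y ≠ lq.next → icuts (fun h g => graphSum hm (a :: t ++ [h]) • W (g ++ z)) q = 0 := by
    refine fun h1 => icuts_eq_zero fun k g hk hg hgk => ?_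
    rw [hW, smul_zero]
    intro h2
    refine h1 (hadm.1 ?_)
    rw [← hgk] at hq ⊢
    rw [List.append_assoc]
    exact (graphSystem hm).adm_glue hg hq.2 h2
  by_cases h0 : graphSum hm (a :: t ++ [q]) = 0
  · rw [h0]
    simp only [zero_smul, ite_self, zero_add, add_zero]
    split_ifs with h1
    · rfl
    · exact hzero fun h2 => h1 (hadm.2 h2)
  obtain ⟨h3, h4⟩ := hadj h0
  by_cases h1 : y = lq.next
  · rw [if_pos (hadm.2 h1), if_pos (by rw [h1, ← Letter.tgt_eq_src_next, h3]),
      if_neg (fun h5 => h4 (h5.trans h1))]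
    abel
  · rw [if_neg (fun h5 => h1 (hadm.1 h5)), zero_add, hzero h1, zero_add, smul_ite, smul_zero]
    congr 1
    rw [Letter.tgt_eq_src_next] at h3
    refine propext ⟨fun h5 => ?_, fun h5 => by rw [h5]⟩
    exact eq_of_src_eq h3.symm (h5.trans h3.symm) h4 h1

/-- The weighted sum of the elements `U_i` is central: a word can be followed and preceded by the
words around the inner regions of exactly one type. -/
theorem sum_innerWord_append (hW : ∀ w, ¬ Adm w → W w = 0) {a : List (Letter m)} (ha : Adm a)
    (ha0 : a ≠ []) :
    ∑ i : Port m, (MvPolynomial.X (typ i) : Coef m) • W (a ++ innerWord i) =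
      ∑ i : Port m, (MvPolynomial.X (typ i) : Coef m) • W (innerWord i ++ a) := by
  classical
  obtain ⟨x, p, rfl⟩ := ha.exists_eq_alt ha0
  have hinv : Function.Involutive (Port.across : Port m → Port m) := Port.across_across
  have hbij : Function.Bijective (Port.across^[p + 1] : Port m → Port m) :=
    hinv.bijective.iterate _
  rw [← (Equiv.ofBijective _ hbij).sum_comp]
  refine Finset.sum_congr rfl fun i _ => ?_
  simp only [Equiv.ofBijective_apply]
  have h1 : ∀ n, typ (Port.across^[n] i) = typ i := by
    intro n
    induction n with
    | zero => rfl
    | succ n ih =>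
      rw [← ih, Function.iterate_succ_apply']
      apply Fin.ext
      have h2 := index_typ (Port.across^[n] i).across
      rw [Port.index_across, index_typ] at h2
      exact (Nat.add_right_cancel h2).symm
  have h2 : ∀ n, (Port.across^[n] i).sector = Letter.next^[n] i.sector := by
    intro n
    induction n with
    | zero => rfl
    | succ n ih =>
      rw [Function.iterate_succ_apply', Function.iterate_succ_apply', Port.sector_across, ih]
  have h3 : ∀ n, ((Port.across^[n] i).across = Port.across^[n] i) ↔ i.across = i := by
    intro n
    rw [← Function.iterate_succ_apply' Port.across, Function.iterate_succ_apply]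
    exact (hinv.injective.iterate n).eq_iff
  rw [h1, innerWord_eq_alt, innerWord_eq_alt, h2]
  simp only [h3]
  have h4 := iterate_next_innerWord i
  have h5 : 0 < if i.across = i then 1 else 2 := by split_ifs <;> omega
  generalize (if i.across = i then 1 else 2) = k at *
  rw [apply_alt_append hW _ _ (Nat.succ_pos p) h5, apply_alt_append hW _ _ h5 (Nat.succ_pos p), h4,
    (next_injective.iterate (p + 1)).eq_iff, add_comm k]
  by_cases h : i.sector = x
  · rw [if_pos h, if_pos h.symm, h]
  · rw [if_neg h, if_neg (Ne.symm h)]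

theorem prodI_assoc {N' : Type*} [AddCommGroup N'] (W : List (Letter m) → N') (a z : List (Letter m))
    (t : List (List (Letter m))) :
    CutSystem.prodI (fun w => W (a ++ w)) (t ++ [z]) =
      CutSystem.prodI (fun w => W (w ++ z)) (a :: t) := by
  rcases t with _ | ⟨q, _ | ⟨r, t⟩⟩
  · rfl
  · simp [CutSystem.prodI]
  · rcases t with _ | ⟨c, t⟩ <;> rfl

theorem graphSum_pair_comm (hm : 3 ≤ m) (a b : List (Letter m)) :
    graphSum hm [a, b] = graphSum hm [b, a] :=
  graphSum_rotate hm [a] [b]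

theorem sum_graphSum_append (hm : 3 ≤ m) {g h : List (Letter m)} (hg : g ≠ []) (hh : h ≠ [])
    (ag : Adm g) (ah : Adm h) :
    ∑ i : Port m, (MvPolynomial.X (typ i) : Coef m) * graphSum hm [innerWord i, g ++ h] =
      ∑ i : Port m, ∑ j : Port m, (MvPolynomial.X (typ i) : Coef m) * (MvPolynomial.X (typ j) *
        graphSum hm [g, innerWord j, h, innerWord i]) +
      ∑ i : Port m, (MvPolynomial.X (typ i) : Coef m) • icuts (fun b' b'' =>
        graphSum hm [g, b''] * graphSum hm [h, b']) (innerWord i) := by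
  rw [← Finset.sum_add_distrib]
  refine Finset.sum_congr rfl fun i _ => ?_
  rw [graphSum_pair_comm, graphSum_cut hm, mul_add, Finset.mul_sum]
  · simp only [pts, add_zero, List.nil_append]
    rfl
  · simp only [List.forall_mem_cons]
    exact ⟨⟨hg, ag⟩, ⟨hh, ah⟩, ⟨(graphSystem hm).u_ne_nil i, adm_innerWord i⟩, by simp⟩

/-- The sum of the generating functions of the sequences of a face word and a given word depends
only on the cyclic word. -/
theorem sum_graphSum_comm (hm : 3 ≤ m) {g h : List (Letter m)} (hg : g ≠ []) (hh : h ≠ [])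
    (ag : Adm g) (ah : Adm h) :
    ∑ i : Port m, (MvPolynomial.X (typ i) : Coef m) * graphSum hm [innerWord i, g ++ h] =
      ∑ i : Port m, (MvPolynomial.X (typ i) : Coef m) * graphSum hm [innerWord i, h ++ g] := by
  rw [sum_graphSum_append hm hg hh ag ah, sum_graphSum_append hm hh hg ah ag,
    sum_innerWord_swap fun i => (MvPolynomial.X i : Coef m), Finset.sum_comm]
  refine congrArg₂ _ (Finset.sum_congr rfl fun i _ => Finset.sum_congr rfl fun j _ => ?_)
    (Finset.sum_congr rfl fun i _ => congrArg _ (icuts_congr fun x y _ _ _ => mul_comm _ _))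
  have h1 : graphSum hm [g, innerWord i, h, innerWord j] =
      graphSum hm [h, innerWord j, g, innerWord i] :=
    graphSum_rotate hm [g, innerWord i] [h, innerWord j]
  rw [h1, mul_left_comm]

theorem graphSum_innerWord_alt (hm : 3 ≤ m) (i : Port m) (y : Letter m) (n : ℕ)
    (h : Letter.next^[n] y ≠ y) : graphSum hm [innerWord i, alt y n] = 0 := by
  by_contra h0
  rcases n with _ | n
  · exact h rfl
  have h1 := adjacent_of_graphSum_ne_zero hm h0 (getLast?_innerWord i) (head?_alt y n)
  rw [show graphSum hm [innerWord i, alt y (n + 1)] = graphSum hm [alt y (n + 1), innerWord i] from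
    graphSum_rotate hm [innerWord i] [alt y (n + 1)]] at h0
  have h2 := adjacent_of_graphSum_ne_zero hm h0 (getLast?_alt y n)
    (show (innerWord i).head? = some i.sector from rfl)
  rw [tgt_getLast_innerWord, Letter.next_next] at h1
  rw [← Function.iterate_succ_apply' Letter.next, Letter.tgt_eq_src_next,
    ← Function.iterate_succ_apply' Letter.next] at h2
  exact h (eq_of_src_eq h2.1 h1.1.symm h2.2.symm h1.2)

/-- The structure relation on words. Its terms are sorted by the outer operation. The sum of those
with an idempotent as output vanishes by `trip_inner_C`. The others are the left and right
extensions, computed by `lamSum_add_rhoSum`, and the products with the first or the last input. What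
remains of them involves only these two inputs; it cancels by the exchange of their factors. -/
theorem word_relation (hW : ∀ w, ¬ Adm w → W w = 0) {s : List (List (Letter m))}
    (h : (graphSystem hm).Good s) (hs : Odd s.length) :
    trip (fun x y z => (-1 : ℤ) ^ x.length • (graphSum hm y • insStart W x y z +
      (graphSystem hm).inner (fun w => open Classical in
        if Adm w then muWord hm e W (x ++ w :: z) else 0) y)) s = 0 := by
  classical
  have hs0 : s ≠ [] := by rintro rfl; simp at hs
  have split : ∀ (x z : List (List (Letter m))) (w : List (Letter m)),
      (if Adm w then muWord hm e W (x ++ w :: z) else 0) =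
        graphSum hm (x ++ w :: z) • startM e (x ++ w :: z) +
        (if Adm w then (graphSystem hm).lamI W (x ++ w :: z) else 0) +
        (if Adm w then (graphSystem hm).rhoI W (x ++ w :: z) else 0) +
        CutSystem.prodI W (x ++ w :: z) := by
    intro x z w
    have hu : (graphSystem hm).unitI W (x ++ w :: z) = 0 := by cases x <;> rfl
    split_ifs with hw
    · rw [muWord, CutSystem.inner, hu]
      abel
    · rw [(graphSystem hm).C_eq_zero (b := w) (by simp) hw |> (show graphSum hm _ = 0 from ·)]
      have : CutSystem.prodI W (x ++ w :: z) = 0 := by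
        rcases x with _ | ⟨a, _ | ⟨b, _ | ⟨c, x⟩⟩⟩
        · rcases z with _ | ⟨b, _ | ⟨c, z⟩⟩
          · rfl
          · exact hW _ fun h0 => hw (adm_append.1 h0).1
          · rfl
        · rcases z with _ | ⟨b, z⟩
          · exact hW _ fun h0 => hw (adm_append.1 h0).2.1
          · rfl
        · rfl
        · rfl
      rw [this, zero_smul]
      simp
  simp only [split, CutSystem.inner_add, smul_add]
  have e1 : ∀ A B C D E : List (List (Letter m)) → List (List (Letter m)) →
      List (List (Letter m)) → N, trip (fun x y z => A x y z + (B x y z + C x y z + D x y z +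
        E x y z)) s = trip B s + (trip C s + trip D s) + trip (fun x y z => A x y z + E x y z) s := by
    intro A B C D E
    simp only [← trip_add]
    congr 1
    funext x y z
    abel
  rw [e1]
  -- the terms with an idempotent as output
  have e2 : trip (fun x y z => (-1 : ℤ) ^ x.length • (graphSystem hm).inner (fun w =>
      graphSum hm (x ++ w :: z) • startM e (x ++ w :: z)) y) s = 0 := by
    rw [trip_congr fun x y z hxyz => by rw [smul_startM h hs0 hxyz]]
    have h1 := map_trip (LinearMap.toSpanSingleton (Coef m) N (startM e s)) (fun x y z =>
      (-1 : ℤ) ^ x.length • (graphSystem hm).inner (fun w => graphSum hm (x ++ w :: z)) y) s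
    have h2 : trip (fun x y z => (-1 : ℤ) ^ x.length •
      (graphSystem hm).inner (fun w => graphSum hm (x ++ w :: z)) y) s = 0 :=
      (graphSystem hm).trip_inner_C h hs
    rw [h2, map_zero] at h1
    rw [h1]
    refine trip_congr fun x y z _ => ?_
    rw [map_zsmul]
    rfl
  rw [e2, zero_add]
  change (graphSystem hm).lamSum W s + (graphSystem hm).rhoSum W s + _ = 0
  obtain ⟨a, r, rfl⟩ := List.exists_cons_of_ne_nil hs0
  have hu : ∑ i, (graphSystem hm).X i • icuts (fun g h => (graphSystem hm).C (h :: (a :: r)) • W g)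
      ((graphSystem hm).u i) = ∑ i, (graphSystem hm).X i •
        icuts (fun h g => (graphSystem hm).C (a :: r ++ [h]) • W g) ((graphSystem hm).u i) := by
    have := sum_innerWord_swap (fun i => (MvPolynomial.X i : Coef m))
      (fun g h => graphSum hm (h :: a :: r) • W g)
    refine this.trans (Finset.sum_congr rfl fun i _ => ?_)
    congr 1
    refine icuts_congr fun x y _ _ _ => ?_
    rw [← List.singleton_append, graphSum_rotate]
    rfl
  -- an outer product has exactly one further input, the first or the last one
  have hf : ∀ x y z : List (List (Letter m)), x.length + z.length ≠ 1 →
      (-1 : ℤ) ^ x.length • graphSum hm y • insStart W x y z + (-1 : ℤ) ^ x.length •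
        (graphSystem hm).inner (fun w => CutSystem.prodI W (x ++ w :: z)) y = 0 := by
    intro x y z hxz
    have h1 : insStart W x y z = 0 := by
      rcases x with _ | ⟨a, _ | ⟨b, x⟩⟩
      · rcases z with _ | ⟨b, _ | ⟨c, z⟩⟩
        · rfl
        · simp at hxz
        · rfl
      · rcases z with _ | ⟨b, z⟩
        · simp at hxz
        · rfl
      · rfl
    have h2 : ∀ w, CutSystem.prodI W (x ++ w :: z) = 0 := by
      intro w
      rcases x with _ | ⟨a, _ | ⟨b, _ | ⟨c, x⟩⟩⟩
      · rcases z with _ | ⟨b, _ | ⟨c, z⟩⟩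
        · rfl
        · simp at hxz
        · rfl
      · rcases z with _ | ⟨b, z⟩
        · simp at hxz
        · rfl
      · rfl
      · rfl
    have h3 : (graphSystem hm).inner (fun _ => (0 : N)) y = 0 := by
      have := (graphSystem hm).inner_smul_const (fun _ => (0 : Coef m)) (0 : N) y
      simpa using this
    simp only [h1, h2, h3, smul_zero, add_zero]
  rcases List.eq_nil_or_concat r with rfl | ⟨t, z, rfl⟩
  · rw [(graphSystem hm).lamSum_add_rhoSum_singleton W h hu, trip_ends a a (r := []) (i := []) rfl rfl hf]
    have ha := h a (by simp)
    obtain ⟨x, p, hxp⟩ := (show Adm a from ha.2).exists_eq_alt ha.1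
    have h1 : icuts (fun h g => (∑ i, (graphSystem hm).X i * (graphSystem hm).C
          [(graphSystem hm).u i, h]) • W g) a =
        icuts (fun g h => (∑ i, (graphSystem hm).X i * (graphSystem hm).C
          [(graphSystem hm).u i, h]) • W g) a := by
      rw [hxp]
      refine exchange_self (T := fun h => ∑ i, (graphSystem hm).X i * (graphSystem hm).C
          [(graphSystem hm).u i, h]) x _ (fun g h hg hh ag ah => sum_graphSum_comm hm hg hh ag ah)
          fun y n hy => ?_
      exact Finset.sum_eq_zero fun i _ => mul_eq_zero_of_right _ (graphSum_innerWord_alt hm i y n hy)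
    have h2 := sum_innerWord_append (W := W) hW ha.2 ha.1
    have h3 : (graphSystem hm).inner (fun w => CutSystem.prodI W ([a] ++ w :: [])) [] =
        ∑ i : Port m, (MvPolynomial.X (typ i) : Coef m) • W (a ++ innerWord i) := by
      rw [CutSystem.inner, CutSystem.lamI_nil, CutSystem.rhoI_nil]
      simp only [CutSystem.prodI, add_zero, zero_add]
      rfl
    have h4 : (graphSystem hm).inner (fun w => CutSystem.prodI W ([] ++ w :: [a])) [] =
        ∑ i : Port m, (MvPolynomial.X (typ i) : Coef m) • W (innerWord i ++ a) := by
      rw [CutSystem.inner, CutSystem.lamI_nil, CutSystem.rhoI_nil]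
      simp only [CutSystem.prodI, add_zero, zero_add]
      rfl
    have h5 : insStart W [a] [] [] = 0 := rfl
    have h6 : insStart W [] [] [a] = 0 := rfl
    rw [h1, h3, h4, h2, h5, h6]
    simp
  · rw [List.concat_eq_append] at *
    rw [(graphSystem hm).lamSum_add_rhoSum W h hs hu,
      trip_ends a z (r := t ++ [z]) (i := a :: t) rfl rfl hf]
    have ha := h a (by simp)
    have hz := h z (by simp)
    obtain ⟨x, p, hxp⟩ := (show Adm a from ha.2).exists_eq_alt ha.1
    obtain ⟨y, q, hyq⟩ := (show Adm z from hz.2).exists_eq_alt hz.1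
    have ht : t ≠ [] := by rintro rfl; exact absurd hs (by simp [Nat.odd_iff])
    have hl : (graphSystem hm).lamI (fun w => W (a ++ w)) (t ++ [z]) +
        graphSum hm (t ++ [z]) • insStart W [a] (t ++ [z]) [] =
      (graphSystem hm).prodL W (a :: (t ++ [z])) +
        if Letter.next^[p + 1] x = Letter.next^[q + 1] y then graphSum hm (z :: t) • W a else 0 := by
      obtain ⟨q', t, rfl⟩ := List.exists_cons_of_ne_nil ht
      rw [Function.iterate_succ_apply', Function.iterate_succ_apply']
      exact prodL_cancel hW h (hxp ▸ getLast?_alt x p) (hyq ▸ getLast?_alt y q)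
    have hr : (graphSystem hm).rhoI (fun w => W (w ++ z)) (a :: t) +
        graphSum hm (a :: t) • insStart W [] (a :: t) [z] =
      (graphSystem hm).prodR W (a :: (t ++ [z])) +
        if x = y then graphSum hm (a :: t) • W z else 0 := by
      obtain ⟨t, q', rfl⟩ := (List.eq_nil_or_concat t).resolve_left ht
      rw [List.concat_eq_append] at *
      rw [List.append_assoc] at h ⊢
      exact prodR_cancel hW h (hxp ▸ head?_alt x p) (hyq ▸ head?_alt y q)
    have hex := exchange (Φ := fun w => graphSum hm (w :: t)) (W := W) (fun w hw =>
      (graphSystem hm).C_eq_zero (b := w) (by simp) hw) hW x y (Nat.succ_pos p) (Nat.succ_pos q)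
    simp only [Nat.succ_eq_add_one] at hex
    rw [← hxp, ← hyq] at hex
    have hi1 : (graphSystem hm).inner (fun w => CutSystem.prodI W ([a] ++ w :: [])) (t ++ [z]) =
        (graphSystem hm).lamI (fun w => W (a ++ w)) (t ++ [z]) +
        icuts (fun g h => graphSum hm (g :: t) • W (a ++ h)) z +
        CutSystem.prodI (fun w => W (a ++ w)) (t ++ [z]) := by
      rw [CutSystem.inner, CutSystem.unitI_concat, CutSystem.rhoI_concat, add_zero]
      congr 2
      refine icuts_congr fun g h _ _ _ => ?_
      change graphSum hm (t ++ [g]) • _ = _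
      rw [graphSum_rotate]
      rfl
    have hi2 : (graphSystem hm).inner (fun w => CutSystem.prodI W ([] ++ w :: [z])) (a :: t) =
        icuts (fun g h => graphSum hm (h :: t) • W (g ++ z)) a +
        (graphSystem hm).rhoI (fun w => W (w ++ z)) (a :: t) +
        CutSystem.prodI (fun w => W (w ++ z)) (a :: t) := by
      rw [CutSystem.inner, CutSystem.lamI_cons]
      exact add_zero _
    rw [hi1, hi2, prodI_assoc]
    change _ - _ - icuts (fun g h => graphSum hm ((z ++ h) :: t) • W g) a +
      icuts (fun h g => graphSum hm ((h ++ a) :: t) • W g) z + _ = 0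
    simp only [List.length_singleton, List.length_nil, pow_one, pow_zero, one_smul, neg_smul]
    linear_combination (norm := module) hr - hl - hex

end Relation

end Bordered

/-! ### Operations as coefficients of generating functions -/

namespace Bordered

variable {m : ℕ}

/-! #### Algebra sequences and outer words -/

theorem flat_map_of_leaf {α : Type*} (leaf : α → Bool) (f : α → Letter m) (D : List (List α))
    (h : ∀ p ∈ D, p.IsChain (fun _ y => leaf y = false)) (h' : ∀ p ∈ D, ∀ c ∈ p.head?, leaf c = true) :
    flat (D.map (List.map f)) = D.flatten.map fun x => (leaf x, f x) := by
  have key : ∀ p : List α, p.IsChain (fun _ y => leaf y = false) → (∀ c ∈ p.head?, leaf c = true) →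
      flatWord (p.map f) = p.map fun x => (leaf x, f x) := by
    intro p hp hc
    cases p with
    | nil => rfl
    | cons a p =>
      rw [List.map_cons, flatWord, List.map_cons, hc a rfl, List.map_map]
      congr 1
      clear hc
      induction p generalizing a with
      | nil => rfl
      | cons b p ih =>
        rw [List.isChain_cons_cons] at hp
        rw [List.map_cons, List.map_cons, ih b hp.2, hp.1]
        rfl
  induction D with
  | nil => rfl
  | cons p D ih =>
    rw [List.map_cons, flat_cons, key p (h p (by simp)) (h' p (by simp)),
      ih (fun q hq => h q (by simp [hq])) fun q hq => h' q (by simp [hq]), List.flatten_cons,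
      List.map_append]

theorem flat_splitBy {α : Type*} (leaf : α → Bool) (f : α → Letter m) {l : List α}
    (hl : ∀ c ∈ l.head?, leaf c = true) :
    flat ((l.splitBy fun _ y => !leaf y).map (List.map f)) = l.map fun x => (leaf x, f x) := by
  rw [flat_map_of_leaf leaf, List.flatten_splitBy]
  · intro p hp
    simpa using List.isChain_of_mem_splitBy hp
  · have h1 := List.isChain_getLast_head_splitBy (fun _ y => !leaf y) l
    have h2 : ∀ p ∈ (l.splitBy fun _ y => !leaf y).head?, ∀ c ∈ p.head?, c ∈ l.head? := by
      intro p hp c hc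
      have hn : l ≠ [] := by rintro rfl; simp at hp
      have h4 := List.head_head_splitBy (fun _ y => !leaf y) hn
      rw [List.head?_eq_some_head (List.splitBy_ne_nil.2 hn), Option.mem_some_iff] at hp
      subst hp
      rw [List.head?_eq_some_head (by intro h0; rw [h0] at hc; simp at hc), Option.mem_some_iff,
        h4] at hc
      rw [List.head?_eq_some_head hn, hc]
      rfl
    generalize l.splitBy (fun _ y => !leaf y) = D at h1 h2
    cases D with
    | nil => simp
    | cons p D =>
      intro q hq
      rw [List.mem_cons] at hq
      rcases hq with rfl | hq
      · exact fun c hc => hl c (h2 _ rfl c hc)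
      · clear h2
        induction D generalizing p with
        | nil => simp at hq
        | cons p' D ih =>
          rw [List.isChain_cons_cons] at h1
          rcases List.mem_cons.1 hq with rfl | hq
          · obtain ⟨_, hb, h4⟩ := h1.1
            intro c hc
            rw [List.head?_eq_some_head hb, Option.mem_some_iff] at hc
            rw [hc] at h4
            simpa using h4
          · exact ih p' h1.2 hq

theorem map_append_flat_inj {l l' : List (Letter m)} {s s' : List (List (Letter m))}
    (hs : [] ∉ s) (hs' : [] ∉ s')
    (h : l.map (Prod.mk false) ++ flat s = l'.map (Prod.mk false) ++ flat s') :
    l = l' ∧ flat s = flat s' := by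
  have key : ∀ {s : List (List (Letter m))} {b : Letter m} {t}, [] ∉ s → flat s ≠ (false, b) :: t := by
    intro s b t hs h0
    cases s with
    | nil => simp at h0
    | cons c s =>
      rw [List.mem_cons, not_or] at hs
      obtain ⟨a, r, hr⟩ := flat_eq_cons (s := s) (Ne.symm hs.1)
      rw [hr] at h0
      simp at h0
  induction l generalizing l' with
  | nil =>
    cases l' with
    | nil => exact ⟨rfl, h⟩
    | cons b l' => exact absurd h (key hs)
  | cons a l ih =>
    cases l' with
    | nil => exact absurd h.symm (key hs')
    | cons b l' =>
      simp only [List.map_cons, List.cons_append, List.cons.injEq, Prod.mk.injEq, true_and] at h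
      obtain ⟨rfl, h⟩ := h
      have := ih h
      exact ⟨by rw [this.1], this.2⟩

theorem flat_injective {s s' : List (List (Letter m))} (hs : [] ∉ s) (hs' : [] ∉ s')
    (h : flat s = flat s') : s = s' := by
  induction s generalizing s' with
  | nil =>
    cases s' with
    | nil => rfl
    | cons c s' =>
      rw [List.mem_cons, not_or] at hs'
      obtain ⟨a, r, hr⟩ := flat_eq_cons (s := s') (Ne.symm hs'.1)
      rw [hr] at h
      simp at h
  | cons b s ih =>
    rw [List.mem_cons, not_or] at hs
    cases s' with
    | nil =>
      obtain ⟨a, r, hr⟩ := flat_eq_cons (s := s) (Ne.symm hs.1)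
      rw [hr] at h
      simp at h
    | cons c s' =>
      rw [List.mem_cons, not_or] at hs'
      obtain ⟨a, l, rfl⟩ := List.exists_cons_of_ne_nil (Ne.symm hs.1)
      obtain ⟨a', l', rfl⟩ := List.exists_cons_of_ne_nil (Ne.symm hs'.1)
      simp only [flat_cons, flatWord, List.cons_append, List.cons.injEq, Prod.mk.injEq,
        true_and] at h
      obtain ⟨rfl, h⟩ := h
      have := map_append_flat_inj hs.2 hs'.2 h
      rw [this.1, ih hs.2 hs'.2 this.2]

theorem TilingGraph.nil_notMem_algebraSequence (Γ : TilingGraph m) : [] ∉ Γ.algebraSequence := by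
  intro h
  rw [algebraSequence, List.mem_map] at h
  obtain ⟨p, hp, h⟩ := h
  rw [List.map_eq_nil_iff] at h
  exact List.nil_notMem_splitBy _ _ (h ▸ hp)

theorem TilingGraph.flat_algebraSequence (Γ : TilingGraph m) :
    flat Γ.algebraSequence = Bordered.word Γ.glue Γ.root := by
  classical
  obtain ⟨l, hl⟩ := exists_isCyc (fc Γ.glue) Γ.root
  have h1 : Γ.outer = Γ.root :: l := hl.eq_iterate.symm
  rw [hl.word_eq, algebraSequence, h1]
  have h2 := flat_splitBy (fun x => decide (Γ.glue x = x)) (fun x : Dart m Γ.d => x.2.sector)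
    (l := Γ.root :: l) (by simp [Γ.root_leaf])
  simp only [decide_not]
  rw [h2]
  refine List.map_congr_left fun x _ => ?_
  simp [mark]

theorem TilingGraph.algebraSequence_eq_iff (Γ : TilingGraph m) {a : List (List (Letter m))}
    (ha : [] ∉ a) : Γ.algebraSequence = a ↔ Bordered.word Γ.glue Γ.root = flat a := by
  rw [← Γ.flat_algebraSequence]
  exact ⟨fun h => by rw [h], flat_injective Γ.nil_notMem_algebraSequence ha⟩

/-! #### Coefficients -/

/-- The coefficient of a generating function at a weight. -/
noncomputable def coeffAt (w : Fin m → ℕ) : Coef m →+ ℤ[X] where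
  toFun c := MvPolynomial.coeff (Finsupp.equivFunOnFinite.symm w) c
  map_zero' := MvPolynomial.coeff_zero _
  map_add' := MvPolynomial.coeff_add _

theorem coeffAt_mon (w : Fin m → ℕ) (q : TClass m) [Decidable (q.wt = w)] :
    coeffAt w q.mon = if q.wt = w then Polynomial.X ^ q.out.d else 0 := by
  classical
  change MvPolynomial.coeff _ (MvPolynomial.monomial _ _) = _
  rw [MvPolynomial.coeff_monomial]
  simp only [EmbeddingLike.apply_eq_iff_eq]

theorem coeffAt_graphSum (hm : 3 ≤ m) (w : Fin m → ℕ) {a : List (List (Letter m))} (ha : [] ∉ a)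
    [DecidablePred fun q : TClass m => q.wt = w] :
    coeffAt w (graphSum hm a) =
      ∑ q ∈ (classes hm (flat a)).filter (fun q => q.wt = w), Polynomial.X ^ q.out.d := by
  rw [graphSum_of_good hm ha, gen, map_sum, Finset.sum_filter]
  exact Finset.sum_congr rfl fun q _ => coeffAt_mon w q

theorem centered_eq (hm : 3 ≤ m) (w : Fin m → ℕ) (a : List (List (Letter m))) :
    centered w a = coeffAt w (graphSum hm a) • startM idem a := by
  classical
  by_cases ha : [] ∈ a
  · rw [graphSum, if_pos ha, map_zero, zero_smul, centered]
    refine finsum_mem_eq_zero_of_forall_eq_zero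
      (s := {G : TClass m | G.out.weight = w ∧ G.out.algebraSequence = a}) fun G h => ?_
    exact absurd (h.2 ▸ ha) G.out.nil_notMem_algebraSequence
  rw [coeffAt_graphSum hm w ha, Finset.sum_smul, centered]
  refine (finsum_cond_eq_sum_of_cond_iff _ (t := (classes hm (flat a)).filter fun q => q.wt = w)
    fun {q} _ => ?_).trans (Finset.sum_congr rfl fun q hq => ?_)
  · rw [Finset.mem_filter, mem_classes, q.out.algebraSequence_eq_iff ha, q.out.weight_eq, and_comm]
    rfl
  · rw [Finset.mem_filter, mem_classes] at hq
    rw [TilingGraph.output]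
    congr 1
    have h1 := hq.1
    obtain ⟨l, hl⟩ := exists_isCyc (fc q.out.glue) q.out.root
    rw [TClass.word, hl.word_eq] at h1
    rcases a with _ | ⟨b, s⟩
    · simp at h1
    · rw [List.mem_cons, not_or] at ha
      obtain ⟨c, b, rfl⟩ := List.exists_cons_of_ne_nil (Ne.symm ha.1)
      simp only [List.map_cons, flat_cons, flatWord, List.cons_append, List.cons.injEq, mark,
        Prod.mk.injEq] at h1
      rw [startM, ← h1.1.2, Port.src_sector]

theorem TClass.degree (hm : 3 ≤ m) {q : TClass m} {a : List (List (Letter m))} (ha : [] ∉ a)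
    (hq : q.word = flat a) : (2 * m - 4) * q.out.d + 2 = a.length + 2 * ∑ i, q.wt i := by
  have := q.out.isTiling.degree hm
  rw [Set.ncard_univ, Nat.card_eq_fintype_card, Fintype.card_fin] at this
  rw [this, ← countP_flat ha, ← hq]
  rfl

/-- The operations given by tiling graphs have the required degree. -/
theorem coeff_coeffAt_graphSum (hm : 3 ≤ m) (w : Fin m → ℕ) (a : List (List (Letter m))) (j : ℕ)
    (h : (coeffAt w (graphSum hm a)).coeff j ≠ 0) :
    0 < j ∧ (2 * m - 4) * j + 2 = a.length + 2 * ∑ i, w i := by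
  classical
  by_cases ha : [] ∈ a
  · rw [graphSum, if_pos ha, map_zero] at h
    exact absurd (Polynomial.coeff_zero j) h
  rw [coeffAt_graphSum hm w ha, Polynomial.finsetSum_coeff] at h
  obtain ⟨q, hq, h⟩ := Finset.exists_ne_zero_of_sum_ne_zero h
  rw [Polynomial.coeff_X_pow] at h
  have hj : j = q.out.d := by by_contra h0; simp [h0] at h
  rw [Finset.mem_filter, mem_classes] at hq
  rw [hj, ← hq.2]
  exact ⟨Fin.pos q.out.root.1, q.degree hm ha hq.1⟩

theorem coeffAt_zero_graphSum_pair (hm : 3 ≤ m) (a b : List (Letter m)) :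
    coeffAt 0 (graphSum hm [a, b]) = 0 := by
  ext j
  by_contra h
  obtain ⟨h1, h2⟩ := coeff_coeffAt_graphSum hm 0 _ j h
  simp only [List.length_cons, List.length_nil, Pi.zero_apply, Finset.sum_const_zero] at h2
  have : 0 < (2 * m - 4) * j := Nat.mul_pos (by omega) h1
  omega

/-! #### The algebra with coefficients in generating functions -/

/-- The algebra as the part of weight zero of its extension by the variables of `Coef m`. -/
noncomputable def toM : Alg m →+ (Path m →₀ Coef m) :=
  Finsupp.mapRange.addMonoidHom (MvPolynomial.C : ℤ[X] →+* Coef m).toAddMonoidHom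

/-- The coefficients at a weight: from the generating function of the operations to the operation
of that weight. -/
noncomputable def weightPart (w : Fin m → ℕ) : (Path m →₀ Coef m) →+ Alg m :=
  Finsupp.mapRange.addMonoidHom (coeffAt w)

theorem weightPart_smul (w : Fin m → ℕ) (c : Coef m) (a : Alg m) :
    weightPart w (c • toM a) = coeffAt w c • a := by
  ext1 p
  change coeffAt w (c * MvPolynomial.C (a p)) = coeffAt w c * a p
  change MvPolynomial.coeff _ _ = MvPolynomial.coeff _ _ * _
  rw [mul_comm, MvPolynomial.coeff_C_mul, mul_comm]

theorem coeffAt_one (w : Fin m → ℕ) [Decidable (w = 0)] :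
    coeffAt w 1 = if w = 0 then 1 else 0 := by
  classical
  change MvPolynomial.coeff _ (1 : Coef m) = _
  rw [MvPolynomial.coeff_one]
  by_cases h : w = 0
  · rw [if_pos h, if_pos (by rw [h]; ext; simp)]
  · rw [if_neg h, if_neg]
    intro h0
    refine h (funext fun i => ?_)
    have := DFunLike.congr_fun h0 i
    simpa using this.symm

theorem weightPart_toM (w : Fin m → ℕ) (a : Alg m) [Decidable (w = 0)] :
    weightPart w (toM a) = if w = 0 then a else 0 := by
  have := weightPart_smul w 1 a
  rw [one_smul, coeffAt_one] at this
  rw [this]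
  split_ifs <;> simp

theorem coeffAt_X (w : Fin m → ℕ) (i : Fin m) [Decidable (w = Pi.single i 1)] :
    coeffAt w (MvPolynomial.X i) = if w = Pi.single i 1 then 1 else 0 := by
  classical
  change MvPolynomial.coeff _ (MvPolynomial.X i : Coef m) = _
  rw [MvPolynomial.coeff_X]
  refine if_congr ?_ rfl rfl
  rw [eq_comm, ← Finsupp.equivFunOnFinite_symm_single, EmbeddingLike.apply_eq_iff_eq]

theorem isChain_follows_iff (hm : 3 ≤ m) (w : List (Letter m)) :
    w.IsChain Letter.Follows ↔ Adm w := by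
  rw [Adm, show (Letter.Follows : Letter m → Letter m → Prop) = fun a b => b = a.next from
    funext fun a => funext fun b => propext (Letter.follows_iff hm a b)]

theorem ofWord_of_not_adm (hm : 3 ≤ m) {w : List (Letter m)} (h : ¬ Adm w) : ofWord w = 0 := by
  cases w with
  | nil => rfl
  | cons a l => rw [ofWord, dif_neg (by rwa [isChain_follows_iff hm])]

theorem Path.adm (hm : 3 ≤ m) (p : Path m) : Adm p.letters :=
  (isChain_follows_iff hm _).1 p.chain

theorem Path.ofWord_letters (p : Path m) (hp : p.letters ≠ []) :
    ofWord p.letters = Finsupp.single p 1 := by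
  obtain ⟨s, l, h1, h2⟩ := p
  cases l with
  | nil => exact absurd rfl hp
  | cons a l =>
    rw [ofWord, dif_pos h2]
    congr 1
    ext1
    · exact h1 a rfl
    · rfl

theorem exists_path (hm : 3 ≤ m) {w : List (Letter m)} (h : Adm w) (hw : w ≠ []) :
    ∃ p : Path m, p.letters = w ∧ ofWord w = Finsupp.single p 1 := by
  cases w with
  | nil => exact absurd rfl hw
  | cons a l =>
    have h' := (isChain_follows_iff hm _).2 h
    exact ⟨⟨a.src, a :: l, by simp, h'⟩, rfl, by rw [ofWord, dif_pos h']⟩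

theorem Path.start_eq_src (p : Path m) {a : Letter m} (h : p.letters.head? = some a) :
    p.start = a.src := (p.start_eq a h).symm

theorem Path.finish_eq_tgt (p : Path m) {a : Letter m} (h : p.letters.getLast? = some a) :
    p.finish = a.tgt := by rw [Path.finish, h]; rfl

theorem mulPath_eq_ofWord {p q : Path m} (hm : 3 ≤ m) (hp : p.letters ≠ []) (hq : q.letters ≠ []) :
    mulPath p q = ofWord (p.letters ++ q.letters) := by
  classical
  rw [mulPath, if_neg hp, if_neg hq, ite_eq_left_iff]
  intro h
  refine (ofWord_of_not_adm hm fun h0 => h ?_).symm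
  have hl := List.getLast?_eq_some_getLast hp
  have hh := List.head?_eq_some_head hq
  rw [p.finish_eq_tgt hl, q.start_eq_src hh, (adm_append.1 h0).2.2 _ hl _ hh,
    Letter.tgt_eq_src_next]

theorem mulPath_const_right (p : Path m) (k : Node m) :
    mulPath p (Path.const k) = if p.finish = k then Finsupp.single p 1 else 0 := by
  classical
  rw [mulPath]
  by_cases h : p.finish = k
  · rw [if_pos h, if_pos (show p.finish = (Path.const k).start from h)]
    split_ifs with h1 h2
    · congr 1
      ext1
      · change k = p.start
        rw [← h, Path.finish, h1]
        rfl
      · exact h1.symm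
    · rfl
    · exact absurd rfl h2
  · rw [if_neg h, if_neg (show p.finish ≠ (Path.const k).start from h)]

theorem mulPath_const_left (p : Path m) (k : Node m) :
    mulPath (Path.const k) p = if k = p.start then Finsupp.single p 1 else 0 := by
  rw [mulPath, if_pos (show (Path.const k).letters = [] from rfl)]
  rfl

theorem mul_single_single (p q : Path m) (x y : ℤ[X]) :
    mul (Finsupp.single p x) (Finsupp.single q y) = (x * y) • mulPath p q := by
  rw [mul, Finsupp.sum_single_index, Finsupp.sum_single_index]
  · rw [mul_zero, zero_smul]
  · simp [Finsupp.sum]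

theorem mul_ofWord_smul_idem (c : ℤ[X]) {w : List (Letter m)} (hw : ∀ a ∈ w.getLast?, a.tgt = k) :
    mul (ofWord w) (c • idem k) = c • ofWord w := by
  classical
  cases w with
  | nil => simp [ofWord, mul]
  | cons a l =>
    rw [ofWord]
    split_ifs with h
    · rw [idem, Finsupp.smul_single, smul_eq_mul, mul_one, mul_single_single, mulPath_const_right,
        if_pos, one_mul]
      rw [Path.finish_eq_tgt _ (List.getLast?_eq_some_getLast (List.cons_ne_nil a l))]
      exact hw _ (List.getLast?_eq_some_getLast (List.cons_ne_nil a l))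
    · simp [mul]

theorem mul_smul_idem_ofWord (c : ℤ[X]) {w : List (Letter m)} (hw : ∀ a ∈ w.head?, a.src = k) :
    mul (c • idem k) (ofWord w) = c • ofWord w := by
  classical
  cases w with
  | nil => simp [ofWord, mul, Finsupp.sum]
  | cons a l =>
    rw [ofWord]
    split_ifs with h
    · rw [idem, Finsupp.smul_single, smul_eq_mul, mul_one, mul_single_single, mulPath_const_left,
        if_pos (hw a rfl).symm, mul_one]
    · simp [mul, Finsupp.sum]

end Bordered

/-! ### The generating functions of the operations -/

namespace Bordered

variable {m : ℕ}

/-- The product of two paths, as an operation on sequences of paths that vanishes on sequences of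
other lengths. -/
noncomputable def prodPaths : List (Path m) → Alg m
  | [p, q] => mulPath p q
  | _ => 0

open Classical in
/-- The generating function of the operations `μ^w_n`, over all weights `w`. -/
noncomputable def muHat (hm : 3 ≤ m) (l : List (Path m)) : Path m →₀ Coef m :=
  if ∃ p ∈ l, p.letters = [] then toM (prodPaths l)
  else muWord hm (fun k => toM (idem k)) (fun w => toM (ofWord w)) (l.map Path.letters)

theorem muHat_of_ne (hm : 3 ≤ m) {l : List (Path m)} (h : ¬ ∃ p ∈ l, p.letters = []) :
    muHat hm l = muWord hm (fun k => toM (idem k)) (fun w => toM (ofWord w)) (l.map Path.letters) :=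
  if_neg h

theorem muHat_of_const (hm : 3 ≤ m) {l : List (Path m)} (h : ∃ p ∈ l, p.letters = []) :
    muHat hm l = toM (prodPaths l) :=
  if_pos h

theorem startM_toM (s : List (List (Letter m))) :
    startM (fun k => toM (idem k)) s = toM (startM idem s) := by
  rcases s with _ | ⟨_ | ⟨c, b⟩, s⟩
  · exact (map_zero _).symm
  · exact (map_zero _).symm
  · rfl

/-- The element `U_i` is the sum of the words around the inner regions of type `i`. -/
theorem U_eq (hm : 3 ≤ m) (k : Fin m) [DecidablePred fun i : Port m => typ i = k] :
    U m (k.1 + 1) = ∑ i with typ i = k, ofWord (innerWord i) := by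
  classical
  let p := Port.pref hm k
  have hp : p.sector.index = k.1 + 1 := Port.index_pref hm k
  have hf : (Finset.univ.filter fun i : Port m => typ i = k) = {p, p.across} := by
    ext i
    simp only [Finset.mem_filter, Finset.mem_univ, true_and, Finset.mem_insert,
      Finset.mem_singleton]
    have h1 := index_typ i
    constructor
    · rintro rfl
      exact Port.eq_of_index_eq (h1.trans hp.symm) |>.imp_right id
    · rintro (rfl | rfl)
      · rw [hp] at h1
        exact Fin.ext (by omega)
      · rw [Port.index_across, hp] at h1
        exact Fin.ext (by omega)
  have hlt := k.2
  rw [hf, U, dif_pos (by omega)]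
  by_cases h : p.across = p
  · rw [h, Finset.pair_eq_singleton, Finset.sum_singleton, innerWord, if_pos h]
    have h1 := (Port.across_eq_self_iff p).1 h
    rw [hp] at h1
    revert hp
    cases p.sector with
    | L i hi => intro hp; simp only [Letter.index] at hp; omega
    | R i hi => intro hp; simp only [Letter.index] at hp; omega
    | U₁ h => intro hp; simp only [Letter.index] at hp; rw [if_pos hp.symm]
    | Uₘ h =>
      intro hp
      simp only [Letter.index] at hp
      rw [if_neg (by omega), if_pos hp.symm]
  · have h1 := mt (Port.across_eq_self_iff p).2 h
    rw [hp, not_or] at h1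
    rw [Finset.sum_pair (Ne.symm h), innerWord, innerWord, Port.across_across, if_neg h,
      if_neg (Ne.symm h), if_neg h1.1, if_neg h1.2, dif_pos (by omega), Port.sector_across]
    revert hp
    cases p.sector with
    | L i hi =>
      intro hp
      simp only [Letter.index] at hp
      subst hp
      simp only [Letter.next]
      exact add_comm _ _
    | R i hi =>
      intro hp
      simp only [Letter.index] at hp
      subst hp
      rfl
    | U₁ h => intro hp; simp only [Letter.index] at hp; omega
    | Uₘ h => intro hp; simp only [Letter.index] at hp; omega

theorem weightPart_unitI (hm : 3 ≤ m) (w : Fin m → ℕ) :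
    weightPart w ((graphSystem hm).unitI (fun w => toM (ofWord w)) []) = muPaths w [] := by
  classical
  change weightPart w (∑ i : Port m, (MvPolynomial.X (typ i) : Coef m) • toM (ofWord (innerWord i))) =
    _
  rw [map_sum, muPaths]
  simp only [weightPart_smul, coeffAt_X, ite_smul, one_smul, zero_smul]
  rw [← Finset.sum_fiberwise_of_maps_to (g := typ) (t := Finset.univ) (fun _ _ => Finset.mem_univ _)]
  refine Finset.sum_congr rfl fun k _ => ?_
  rw [U_eq hm k]
  split_ifs with h
  · refine Finset.sum_congr rfl fun i hi => ?_
    rw [(Finset.mem_filter.1 hi).2, if_pos h]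
  · refine Finset.sum_eq_zero fun i hi => ?_
    rw [(Finset.mem_filter.1 hi).2, if_neg h]

theorem weightPart_lamI (hm : 3 ≤ m) (w : Fin m → ℕ) {b : List (Letter m)}
    {s : List (List (Letter m))} (hb : Adm b) :
    weightPart w ((graphSystem hm).lamI (fun w => toM (ofWord w)) (b :: s)) =
      leftExtended w (b :: s) := by
  rw [CutSystem.lamI_cons, map_icuts, icuts_eq_sum, leftExtended]
  refine Finset.sum_congr rfl fun j hj => ?_
  simp only [List.headD_cons, List.tail_cons] at hj ⊢
  rw [Finset.mem_Ioo] at hj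
  rw [weightPart_smul, centered_eq hm]
  obtain ⟨c, n, hc⟩ := Adm.exists_eq_alt (w := b.drop j) (List.IsChain.drop hb _) (by simp; omega)
  rw [startM_cons_of_head? (hc ▸ head?_alt c n), mul_ofWord_smul_idem]
  · rfl
  · intro a ha
    have h1 := hb
    rw [← List.take_append_drop j b] at h1
    rw [(adm_append.1 h1).2.2 a ha c (hc ▸ head?_alt c n), Letter.tgt_eq_src_next]

theorem weightPart_rhoI (hm : 3 ≤ m) (w : Fin m → ℕ) {b : List (Letter m)}
    {s : List (List (Letter m))} (hs : ∀ c ∈ s, c ≠ [] ∧ Adm c) (hb : Adm b) :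
    weightPart w ((graphSystem hm).rhoI (fun w => toM (ofWord w)) (s ++ [b])) =
      rightExtended w (s ++ [b]) := by
  rw [CutSystem.rhoI_concat, map_icuts, icuts_eq_sum, rightExtended]
  simp only [List.getLastD_concat, List.dropLast_concat]
  refine Finset.sum_congr rfl fun j hj => ?_
  rw [Finset.mem_Ioo] at hj
  rw [weightPart_smul, centered_eq hm]
  change coeffAt w (graphSum hm (s ++ [b.take j])) • _ = _
  by_cases h0 : graphSum hm (s ++ [b.take j]) = 0
  · rw [h0, map_zero, zero_smul, zero_smul]
    simp [mul]
  rcases s with _ | ⟨d, s⟩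
  · exact absurd (graphSum_of_odd hm (by simp)) h0
  have hd := hs d (by simp)
  obtain ⟨c, n, hc⟩ := hd.2.exists_eq_alt hd.1
  obtain ⟨c', n', hc'⟩ := Adm.exists_eq_alt (w := b.take j) (List.IsChain.take hb _) (by
    intro h1
    have := congrArg List.length h1
    rw [List.length_take, List.length_nil] at this
    omega)
  rw [List.cons_append, startM_cons_of_head? (hc ▸ head?_alt c n), mul_smul_idem_ofWord]
  intro a ha
  rw [graphSum_rotate] at h0
  have h2 := adjacent_of_graphSum_ne_zero hm h0 (hc' ▸ getLast?_alt c' n') (hc ▸ head?_alt c n)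
  have h1 := hb
  rw [← List.take_append_drop j b] at h1
  rw [(adm_append.1 h1).2.2 _ (hc' ▸ getLast?_alt c' n') a ha, ← Letter.tgt_eq_src_next, h2.1]

theorem prodI_eq (hm : 3 ≤ m) {l : List (Path m)} (h : ∀ p ∈ l, p.letters ≠ []) :
    CutSystem.prodI (fun w => toM (ofWord w)) (l.map Path.letters) = toM (prodPaths l) := by
  rcases l with _ | ⟨p, _ | ⟨q, _ | ⟨r, s⟩⟩⟩
  · exact (map_zero _).symm
  · exact (map_zero _).symm
  · rw [prodPaths, mulPath_eq_ofWord hm (h p (by simp)) (h q (by simp))]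
    rfl
  · exact (map_zero _).symm

theorem centered_zero_pair (hm : 3 ≤ m) (a b : List (Letter m)) : centered 0 [a, b] = 0 := by
  rw [centered_eq hm, coeffAt_zero_graphSum_pair, zero_smul]

theorem muGraph_zero_pair (hm : 3 ≤ m) (p q : Path m) : muGraph 0 [p, q] = 0 := by
  have h1 : ∀ a : Alg m, mul a 0 = 0 := fun a => by simp [mul, Finsupp.sum]
  have h2 : ∀ a : Alg m, mul 0 a = 0 := fun a => by simp [mul]
  rw [muGraph]
  split_ifs
  · rfl
  · simp [leftExtended, rightExtended, centered_zero_pair hm, h1, h2]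

/-- The operations are the coefficients of their generating functions. -/
theorem muPaths_eq (hm : 3 ≤ m) (w : Fin m → ℕ) (l : List (Path m)) :
    muPaths w l = weightPart w (muHat hm l) := by
  classical
  have key : l ≠ [] → muPaths w l = muGraph w l + if w = 0 then prodPaths l else 0 := by
    intro hl
    rcases l with _ | ⟨p, _ | ⟨q, _ | ⟨r, s⟩⟩⟩
    · exact absurd rfl hl
    · exact ((congrArg _ (ite_self _)).trans (add_zero _)).symm
    · change (if w = 0 then mulPath p q else muGraph w [p, q]) = muGraph w [p, q] +
        if w = 0 then mulPath p q else 0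
      split_ifs with h
      · rw [h, muGraph_zero_pair hm, zero_add]
      · rw [add_zero]
    · exact ((congrArg _ (ite_self _)).trans (add_zero _)).symm
  by_cases hl : l = []
  · subst hl
    rw [muHat_of_ne hm (by simp), ← weightPart_unitI hm, muWord]
    congr 1
    simp [CutSystem.inner, startM, CutSystem.prodI]
  rw [key hl]
  by_cases hc : ∃ p ∈ l, p.letters = []
  · rw [muHat_of_const hm hc, weightPart_toM, muGraph, if_pos hc, zero_add]
  have hg : ∀ c ∈ l.map Path.letters, c ≠ [] ∧ Adm c := by
    intro c h
    obtain ⟨p, hp, rfl⟩ := List.mem_map.1 h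
    exact ⟨fun h0 => hc ⟨p, hp, h0⟩, p.adm hm⟩
  rw [muHat_of_ne hm hc, muGraph, if_neg hc, muWord, CutSystem.inner,
    prodI_eq hm fun p hp h0 => hc ⟨p, hp, h0⟩]
  simp only [map_add]
  rw [weightPart_toM, startM_toM, weightPart_smul, ← centered_eq hm]
  have hu : (graphSystem hm).unitI (fun w => toM (ofWord w)) (l.map Path.letters) = 0 := by
    cases l with
    | nil => exact absurd rfl hl
    | cons a l => rfl
  have hlam : weightPart w ((graphSystem hm).lamI (fun w => toM (ofWord w))
      (l.map Path.letters)) = leftExtended w (l.map Path.letters) := by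
    cases l with
    | nil => exact absurd rfl hl
    | cons a l => exact weightPart_lamI hm w (a.adm hm)
  have hrho : weightPart w ((graphSystem hm).rhoI (fun w => toM (ofWord w))
      (l.map Path.letters)) = rightExtended w (l.map Path.letters) := by
    obtain ⟨l, a, rfl⟩ := (List.eq_nil_or_concat l).resolve_left hl
    rw [List.concat_eq_append, List.map_append] at hg ⊢
    exact weightPart_rhoI hm w (fun c hc => hg c (List.mem_append_left _ hc)) (a.adm hm)
  rw [hu, hlam, hrho, map_zero]
  abel

end Bordered

/-! ### Sources and targets -/

namespace Bordered

variable {m : ℕ}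

/-- The vertex where a nonempty word starts. -/
def wordSrc (w : List (Letter m)) : Option (Node m) := w.head?.map Letter.src

/-- The vertex where a nonempty word ends. -/
def wordTgt (w : List (Letter m)) : Option (Node m) := w.getLast?.map Letter.tgt

theorem wordSrc_append {x : List (Letter m)} (hx : x ≠ []) (y : List (Letter m)) :
    wordSrc (x ++ y) = wordSrc x := by
  rw [wordSrc, List.head?_append_of_ne_nil _ hx]; rfl

theorem wordTgt_append (x : List (Letter m)) {y : List (Letter m)} (hy : y ≠ []) :
    wordTgt (x ++ y) = wordTgt y := by
  rw [wordTgt, List.getLast?_append_of_ne_nil _ hy]; rfl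

theorem Adm.wordTgt_eq {x y : List (Letter m)} (h : Adm (x ++ y)) (hx : x ≠ []) (hy : y ≠ []) :
    wordTgt x = wordSrc y := by
  have h1 := List.getLast?_eq_some_getLast hx
  have h2 := List.head?_eq_some_head hy
  rw [wordTgt, wordSrc, h1, h2, Option.map_some, Option.map_some, (adm_append.1 h).2.2 _ h1 _ h2,
    Letter.tgt_eq_src_next]

theorem wordTgt_eq_of_graphSum_ne_zero (hm : 3 ≤ m) {b c : List (Letter m)}
    {x z : List (List (Letter m))} (h : graphSum hm (x ++ b :: c :: z) ≠ 0) :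
    wordTgt b = wordSrc c := by
  have h1 := (isChain_of_graphSum_ne_zero hm h).1
  simp only [List.mem_append, List.mem_cons, not_or] at h1
  rw [graphSum_rotate] at h
  have h2 := List.getLast?_eq_some_getLast (Ne.symm h1.2.1)
  have h3 := List.head?_eq_some_head (Ne.symm h1.2.2.1)
  rw [wordTgt, wordSrc, h2, h3, Option.map_some, Option.map_some,
    (adjacent_of_graphSum_ne_zero hm h h2 h3).1]

theorem wordTgt_eq_of_graphSum_ne_zero' (hm : 3 ≤ m) {b c : List (Letter m)}
    {x : List (List (Letter m))} (h : graphSum hm (c :: x ++ [b]) ≠ 0) : wordTgt b = wordSrc c := by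
  rw [graphSum_rotate] at h
  exact wordTgt_eq_of_graphSum_ne_zero hm (x := []) h

theorem icuts_mem {α R M : Type*} [Semiring R] [AddCommMonoid M] [Module R M] (T : Submodule R M)
    {f : List α → List α → M} {l : List α}
    (h : ∀ x y, x ≠ [] → y ≠ [] → x ++ y = l → f x y ∈ T) : icuts f l ∈ T := by
  rw [icuts_eq_sum]
  refine Submodule.sum_mem _ fun i hi => ?_
  rw [Finset.mem_Ioo] at hi
  refine h _ _ ?_ ?_ (List.take_append_drop i l)
  · intro h0
    have := congrArg List.length h0
    rw [List.length_take, List.length_nil] at this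
    omega
  · intro h0
    have := congrArg List.length h0
    rw [List.length_drop, List.length_nil] at this
    omega

section Words

variable (hm : 3 ≤ m) {N : Type*} [AddCommGroup N] [Module (Coef m) N] {e : Node m → N}
  {W : List (Letter m) → N}

/-- The operations vanish on sequences of words that are not composable. -/
theorem muWord_eq_zero (hW : ∀ w, ¬ Adm w → W w = 0) {x z : List (List (Letter m))}
    {p q : List (Letter m)} (hp : p ≠ []) (hq : q ≠ []) (h : wordTgt p ≠ wordSrc q) :
    muWord hm e W (x ++ p :: q :: z) = 0 := by
  have h1 : graphSum hm (x ++ p :: q :: z) = 0 := by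
    by_contra h0
    exact h (wordTgt_eq_of_graphSum_ne_zero hm h0)
  have h2 : (graphSystem hm).lamI W (x ++ p :: q :: z) = 0 := by
    rcases x with _ | ⟨a, x⟩
    · rw [List.nil_append, CutSystem.lamI_cons]
      refine icuts_eq_zero fun g k _ hk hgk => ?_
      have : graphSum hm (k :: q :: z) = 0 := by
        by_contra h0
        refine h ?_
        rw [← hgk, wordTgt_append _ hk, wordTgt_eq_of_graphSum_ne_zero hm (x := []) h0]
      exact (congrArg (· • W g) this).trans (zero_smul _ _)
    · rw [List.cons_append, CutSystem.lamI_cons]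
      refine icuts_eq_zero fun g k _ hk hgk => ?_
      have : graphSum hm (k :: (x ++ p :: q :: z)) = 0 := by
        by_contra h0
        exact h (wordTgt_eq_of_graphSum_ne_zero hm (x := k :: x) h0)
      exact (congrArg (· • W g) this).trans (zero_smul _ _)
  have h3 : (graphSystem hm).rhoI W (x ++ p :: q :: z) = 0 := by
    rcases List.eq_nil_or_concat z with rfl | ⟨z, a, rfl⟩
    · rw [show x ++ [p, q] = (x ++ [p]) ++ [q] by simp, CutSystem.rhoI_concat]
      refine icuts_eq_zero fun k g hk _ hgk => ?_
      have : graphSum hm (x ++ [p] ++ [k]) = 0 := by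
        by_contra h0
        rw [List.append_assoc] at h0
        refine h ?_
        rw [← hgk, wordSrc_append hk, wordTgt_eq_of_graphSum_ne_zero hm h0]
      exact (congrArg (· • W g) this).trans (zero_smul _ _)
    · rw [List.concat_eq_append, show x ++ p :: q :: (z ++ [a]) = (x ++ p :: q :: z) ++ [a] by simp,
        CutSystem.rhoI_concat]
      refine icuts_eq_zero fun k g hk _ hgk => ?_
      have : graphSum hm (x ++ p :: q :: z ++ [k]) = 0 := by
        by_contra h0
        rw [List.append_assoc] at h0
        exact h (wordTgt_eq_of_graphSum_ne_zero hm h0)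
      exact (congrArg (· • W g) this).trans (zero_smul _ _)
  have h4 : CutSystem.prodI W (x ++ p :: q :: z) = 0 := by
    rcases x with _ | ⟨a, _ | ⟨b, x⟩⟩
    · rcases z with _ | ⟨c, z⟩
      · exact hW _ fun h0 => h (h0.wordTgt_eq hp hq)
      · rfl
    · rfl
    · rcases x with _ | ⟨c, x⟩ <;> rfl
  have h5 : (graphSystem hm).unitI W (x ++ p :: q :: z) = 0 := by cases x <;> rfl
  rw [muWord, CutSystem.inner, h1, h2, h3, h4, h5, zero_smul]
  simp

/-- The values of the operations start where the first word starts. -/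
theorem muWord_mem_left (T : Submodule (Coef m) N) {a : List (Letter m)}
    {r : List (List (Letter m))} (h : ∀ b ∈ a :: r, b ≠ [] ∧ Adm b)
    (hT : ∀ w, wordSrc w = wordSrc a → W w ∈ T) (he : ∀ k, wordSrc a = some k → e k ∈ T) :
    muWord hm e W (a :: r) ∈ T := by
  have ha := (h a (by simp)).1
  refine T.add_mem (T.smul_mem _ ?_) (T.add_mem (T.add_mem (T.add_mem ?_ ?_) ?_) ?_)
  · have h1 := List.head?_eq_some_head ha
    rw [startM_cons_of_head? h1]
    exact he _ (by rw [wordSrc, h1]; rfl)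
  · rw [CutSystem.lamI_cons]
    exact icuts_mem T fun g k hg _ hgk => T.smul_mem _ (hT _ (by rw [← hgk, wordSrc_append hg]))
  · rcases List.eq_nil_or_concat r with rfl | ⟨r, z, rfl⟩
    · rw [← List.nil_append [a], CutSystem.rhoI_concat]
      refine icuts_mem T fun k g _ _ _ => ?_
      rw [show (graphSystem hm).C ([] ++ [k]) = 0 from graphSum_of_odd hm (by simp), zero_smul]
      exact T.zero_mem
    · rw [List.concat_eq_append] at h ⊢
      rw [← List.cons_append, CutSystem.rhoI_concat]
      refine icuts_mem T fun k g hk hg hkg => ?_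
      by_cases h0 : graphSum hm (a :: r ++ [k]) = 0
      · rw [show (graphSystem hm).C (a :: r ++ [k]) = 0 from h0, zero_smul]
        exact T.zero_mem
      · refine T.smul_mem _ (hT _ ?_)
        rw [← wordTgt_eq_of_graphSum_ne_zero' hm h0]
        refine (Adm.wordTgt_eq ?_ hk hg).symm
        rw [hkg]
        exact (h z (by simp)).2
  · rcases r with _ | ⟨q, _ | ⟨c, r⟩⟩
    · exact T.zero_mem
    · exact hT _ (wordSrc_append ha _)
    · exact T.zero_mem
  · exact T.zero_mem

/-- The values of the operations end where the last word ends. -/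
theorem muWord_mem_right (T : Submodule (Coef m) N) {z : List (Letter m)}
    {r : List (List (Letter m))} (h : ∀ b ∈ r ++ [z], b ≠ [] ∧ Adm b)
    (hT : ∀ w, wordTgt w = wordTgt z → W w ∈ T) (he : ∀ k, wordTgt z = some k → e k ∈ T) :
    muWord hm e W (r ++ [z]) ∈ T := by
  have hz := (h z (by simp)).1
  refine T.add_mem ?_ (T.add_mem (T.add_mem (T.add_mem ?_ ?_) ?_) ?_)
  · by_cases h0 : graphSum hm (r ++ [z]) = 0
    · rw [h0, zero_smul]
      exact T.zero_mem
    rcases r with _ | ⟨a, r⟩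
    · exact absurd (graphSum_of_odd hm (by simp)) h0
    have h1 := List.head?_eq_some_head (h a (by simp)).1
    rw [List.cons_append, startM_cons_of_head? h1]
    refine T.smul_mem _ (he _ ?_)
    rw [wordTgt_eq_of_graphSum_ne_zero' hm h0, wordSrc, h1]
    rfl
  · rcases r with _ | ⟨a, r⟩
    · rw [List.nil_append, CutSystem.lamI_cons]
      refine icuts_mem T fun k g _ _ _ => ?_
      rw [show (graphSystem hm).C [g] = 0 from graphSum_of_odd hm (by simp), zero_smul]
      exact T.zero_mem
    · rw [List.cons_append, CutSystem.lamI_cons]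
      refine icuts_mem T fun g k hg hk hgk => ?_
      by_cases h0 : graphSum hm (k :: r ++ [z]) = 0
      · rw [show (graphSystem hm).C (k :: (r ++ [z])) = 0 from h0, zero_smul]
        exact T.zero_mem
      · refine T.smul_mem _ (hT _ ?_)
        rw [wordTgt_eq_of_graphSum_ne_zero' hm h0]
        refine Adm.wordTgt_eq ?_ hg hk
        rw [hgk]
        exact (h a (by simp)).2
  · rw [CutSystem.rhoI_concat]
    exact icuts_mem T fun k g _ hg hkg => T.smul_mem _ (hT _ (by rw [← hkg, wordTgt_append _ hg]))
  · rcases r with _ | ⟨q, _ | ⟨c, r⟩⟩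
    · exact T.zero_mem
    · exact hT _ (wordTgt_append _ hz)
    · rcases r with _ | ⟨d, r⟩ <;> exact T.zero_mem
  · rw [CutSystem.unitI_concat]
    exact T.zero_mem

end Words

/-! #### Paths -/

theorem Path.wordSrc_eq (p : Path m) (hp : p.letters ≠ []) : wordSrc p.letters = some p.start := by
  have := List.head?_eq_some_head hp
  rw [wordSrc, this, p.start_eq_src this]
  rfl

theorem Path.wordTgt_eq (p : Path m) (hp : p.letters ≠ []) : wordTgt p.letters = some p.finish := by
  have := List.getLast?_eq_some_getLast hp
  rw [wordTgt, this, p.finish_eq_tgt this]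
  rfl

theorem Path.eq_const {p : Path m} (hp : p.letters = []) : p = Path.const p.start := by
  ext1
  · rfl
  · exact hp

theorem toM_single (p : Path m) (c : ℤ[X]) :
    toM (Finsupp.single p c) = Finsupp.single p (MvPolynomial.C c) :=
  Finsupp.mapRange_single (hf := map_zero _)

theorem toM_single_one (p : Path m) : toM (Finsupp.single p 1) = Finsupp.single p 1 := by
  rw [toM_single, map_one]

theorem toM_ofWord_mem (hm : 3 ≤ m) (P : Path m → Prop) (w : List (Letter m))
    (h : ∀ p : Path m, p.letters ≠ [] → p.letters = w → P p) :
    toM (ofWord w) ∈ Finsupp.supported (Coef m) (Coef m) {p | P p} := by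
  by_cases hw : Adm w ∧ w ≠ []
  · obtain ⟨p, hp, h1⟩ := exists_path hm hw.1 hw.2
    rw [h1, toM_single]
    exact Finsupp.single_mem_supported _ _ (h p (hp ▸ hw.2) hp)
  · have : ofWord w = 0 := by
      by_cases h1 : Adm w
      · rw [not_not.1 fun h2 => hw ⟨h1, h2⟩]
        rfl
      · exact ofWord_of_not_adm hm h1
    rw [this, map_zero]
    exact Submodule.zero_mem _

theorem toM_idem_mem (P : Path m → Prop) (k : Node m) (h : P (Path.const k)) :
    toM (idem k) ∈ Finsupp.supported (Coef m) (Coef m) {p | P p} := by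
  rw [idem, toM_single]
  exact Finsupp.single_mem_supported _ _ h

theorem toM_mulPath_mem (hm : 3 ≤ m) (p q : Path m) :
    toM (mulPath p q) ∈ Finsupp.supported (Coef m) (Coef m)
      {r | r.start = p.start ∧ r.finish = q.finish} := by
  by_cases hp : p.letters = []
  · rw [Path.eq_const hp, mulPath_const_left]
    split_ifs with h
    · rw [toM_single]
      exact Finsupp.single_mem_supported _ _ ⟨h.symm, rfl⟩
    · rw [map_zero]
      exact Submodule.zero_mem _
  by_cases hq : q.letters = []
  · rw [Path.eq_const hq, mulPath_const_right]
    split_ifs with h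
    · rw [toM_single]
      exact Finsupp.single_mem_supported _ _ ⟨rfl, h⟩
    · rw [map_zero]
      exact Submodule.zero_mem _
  rw [mulPath_eq_ofWord hm hp hq]
  refine toM_ofWord_mem hm _ _ fun r hr h => ?_
  constructor
  · have := r.wordSrc_eq hr
    rw [h, wordSrc_append hp, p.wordSrc_eq hp] at this
    exact (Option.some_injective _ this).symm
  · have := r.wordTgt_eq hr
    rw [h, wordTgt_append _ hq, q.wordTgt_eq hq] at this
    exact (Option.some_injective _ this).symm

theorem mulPath_eq_zero {p q : Path m} (h : p.finish ≠ q.start) : mulPath p q = 0 := if_neg h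

theorem muHat_eq_zero (hm : 3 ≤ m) {x z : List (Path m)} {p q : Path m} (h : p.finish ≠ q.start) :
    muHat hm (x ++ p :: q :: z) = 0 := by
  by_cases hc : ∃ r ∈ x ++ p :: q :: z, r.letters = []
  · rw [muHat_of_const hm hc]
    have : prodPaths (x ++ p :: q :: z) = 0 := by
      rcases x with _ | ⟨a, _ | ⟨b, x⟩⟩
      · rcases z with _ | ⟨c, z⟩
        · exact mulPath_eq_zero h
        · rfl
      · rfl
      · rcases x with _ | ⟨c, x⟩ <;> rfl
    rw [this, map_zero]
  · rw [muHat_of_ne hm hc, List.map_append, List.map_cons, List.map_cons]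
    have hp : p.letters ≠ [] := fun h0 => hc ⟨p, by simp, h0⟩
    have hq : q.letters ≠ [] := fun h0 => hc ⟨q, by simp, h0⟩
    refine muWord_eq_zero hm (fun w hw => by rw [ofWord_of_not_adm hm hw, map_zero]) hp hq ?_
    rw [p.wordTgt_eq hp, q.wordSrc_eq hq]
    exact fun h0 => h (Option.some_injective _ h0)

theorem good_of_not_const (hm : 3 ≤ m) {l : List (Path m)} (hc : ¬ ∃ r ∈ l, r.letters = []) :
    ∀ b ∈ l.map Path.letters, b ≠ [] ∧ Adm b := by
  intro b hb
  obtain ⟨p, hp, rfl⟩ := List.mem_map.1 hb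
  exact ⟨fun h0 => hc ⟨p, hp, h0⟩, p.adm hm⟩

theorem muHat_mem_left (hm : 3 ≤ m) (p : Path m) (l : List (Path m)) :
    muHat hm (p :: l) ∈ Finsupp.supported (Coef m) (Coef m) {r | r.start = p.start} := by
  by_cases hc : ∃ r ∈ p :: l, r.letters = []
  · rw [muHat_of_const hm hc]
    rcases l with _ | ⟨q, _ | ⟨r, l⟩⟩
    · rw [prodPaths, map_zero]
      · exact Submodule.zero_mem _
      · simp
    · exact Finsupp.supported_mono (fun r hr => hr.1) (toM_mulPath_mem hm p q)
    · rw [prodPaths, map_zero]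
      · exact Submodule.zero_mem _
      · simp
  · have hg := good_of_not_const hm hc
    rw [muHat_of_ne hm hc, List.map_cons]
    have hp : p.letters ≠ [] := fun h0 => hc ⟨p, by simp, h0⟩
    refine muWord_mem_left (N := Path m →₀ Coef m) hm (Finsupp.supported (Coef m) (Coef m) 
      {r : Path m | r.start = p.start}) hg (fun w hw => ?_) fun k hk => ?_
    · refine toM_ofWord_mem hm _ _ fun r hr h => ?_
      rw [← h, r.wordSrc_eq hr, p.wordSrc_eq hp] at hw
      exact Option.some_injective _ hw
    · rw [p.wordSrc_eq hp] at hk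
      refine toM_idem_mem _ _ ?_
      exact (Option.some_injective _ hk).symm

theorem muHat_mem_right (hm : 3 ≤ m) (l : List (Path m)) (p : Path m) :
    muHat hm (l ++ [p]) ∈ Finsupp.supported (Coef m) (Coef m) {r | r.finish = p.finish} := by
  by_cases hc : ∃ r ∈ l ++ [p], r.letters = []
  · rw [muHat_of_const hm hc]
    rcases l with _ | ⟨q, _ | ⟨r, l⟩⟩
    · exact (map_zero (toM (m := m))).symm ▸ Submodule.zero_mem _
    · exact Finsupp.supported_mono (fun r hr => hr.2) (toM_mulPath_mem hm q p)
    · rcases l with _ | ⟨s, l⟩ <;> exact (map_zero (toM (m := m))).symm ▸ Submodule.zero_mem _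
  · have hg := good_of_not_const hm hc
    rw [List.map_append] at hg
    rw [muHat_of_ne hm hc, List.map_append]
    have hp : p.letters ≠ [] := fun h0 => hc ⟨p, by simp, h0⟩
    refine muWord_mem_right (N := Path m →₀ Coef m) hm (Finsupp.supported (Coef m) (Coef m) 
      {r : Path m | r.finish = p.finish}) hg (fun w hw => ?_) fun k hk => ?_
    · refine toM_ofWord_mem hm _ _ fun r hr h => ?_
      rw [← h, r.wordTgt_eq hr, p.wordTgt_eq hp] at hw
      exact Option.some_injective _ hw
    · rw [p.wordTgt_eq hp] at hk
      refine toM_idem_mem _ _ ?_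
      exact (Option.some_injective _ hk).symm

theorem muHat_nil_mem (hm : 3 ≤ m) :
    muHat hm [] ∈ Finsupp.supported (Coef m) (Coef m) {r : Path m | r.start = r.finish} := by
  rw [muHat_of_ne hm (by simp)]
  have h1 : muWord hm (fun k => toM (idem k)) (fun w => toM (ofWord w))
      (([] : List (Path m)).map Path.letters) =
      ∑ i : Port m, (MvPolynomial.X (typ i) : Coef m) • toM (ofWord (innerWord i)) := by
    rw [muWord, CutSystem.inner]
    simp only [List.map_nil, startM, CutSystem.prodI, CutSystem.lamI_nil, CutSystem.rhoI_nil,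
      smul_zero, zero_add]
    rfl
  rw [h1]
  refine Submodule.sum_mem _ fun i _ => Submodule.smul_mem _ _ ?_
  refine toM_ofWord_mem hm _ _ fun r hr h => ?_
  have h2 := r.wordSrc_eq hr
  have h3 := r.wordTgt_eq hr
  rw [h] at h2 h3
  rw [wordTgt, getLast?_innerWord, Option.map_some, tgt_getLast_innerWord] at h3
  exact Option.some_injective _ (h2.symm.trans h3)

end Bordered

/-! ### The structure relation for paths -/

namespace Bordered

variable {m : ℕ}

theorem prodPaths_of_length {l : List (Path m)} (h : l.length ≠ 2) : prodPaths l = 0 := by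
  rcases l with _ | ⟨p, _ | ⟨q, _ | ⟨r, l⟩⟩⟩
  · rfl
  · rfl
  · exact absurd rfl h
  · rfl

theorem muHat_of_odd (hm : 3 ≤ m) {l : List (Path m)} (h : Odd l.length) : muHat hm l = 0 := by
  by_cases hc : ∃ p ∈ l, p.letters = []
  · rw [muHat_of_const hm hc, prodPaths_of_length, map_zero]
    intro h0
    rw [h0] at h
    exact absurd h (by decide)
  · have h' : Odd (l.map Path.letters).length := by rwa [List.length_map]
    rw [muHat_of_ne hm hc, muWord, graphSum_of_odd hm h', zero_smul, zero_add,
      CutSystem.inner_of_odd _ _ h']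

section Signed

variable {N : Type*} [AddCommGroup N]

/-- The element `(-1)ⁿ a`. -/
def signed (n : ℕ) (a : N) : N := (-1 : ℤ) ^ n • a

@[simp] theorem signed_zero (n : ℕ) : signed n (0 : N) = 0 := smul_zero _

theorem signed_of_even {n : ℕ} (h : Even n) (a : N) : signed n a = a := by
  rw [signed, h.neg_one_pow, one_smul]

theorem signed_of_odd {n : ℕ} (h : Odd n) (a : N) : signed n a = -a := by
  rw [signed, h.neg_one_pow, neg_one_smul]

theorem signed_add_mul {x y : ℕ} (z : ℕ) (h : Even y) (a : N) :
    signed (x + y * z) a = signed x a := by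
  rw [signed, pow_add, (h.mul_right z).neg_one_pow, mul_one, signed]

theorem signed_add_signed_succ (n : ℕ) (a : N) : signed n a + signed (n + 1) a = 0 := by
  rw [signed, signed, pow_succ, mul_neg_one, neg_smul, add_neg_cancel]

/-- The form of `word_relation` in terms of `signed`. -/
theorem word_relation_signed {hm : 3 ≤ m} [Module (Coef m) N] (e : Node m → N)
    {W : List (Letter m) → N} (hW : ∀ w, ¬ Adm w → W w = 0) {s : List (List (Letter m))}
    (h : (graphSystem hm).Good s) (hs : Odd s.length) :
    trip (fun x y z => signed x.length (graphSum hm y • insStart W x y z +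
      (graphSystem hm).inner (fun w => open Classical in
        if Adm w then muWord hm e W (x ++ w :: z) else 0) y)) s = 0 :=
  word_relation hW h hs

end Signed

/-- The linear map that inserts its argument between the sequences `x` and `z`, as an input of the
operations. -/
noncomputable def outerOp (hm : 3 ≤ m) (x z : List (Path m)) :
    (Path m →₀ Coef m) →ₗ[Coef m] (Path m →₀ Coef m) :=
  Finsupp.linearCombination (Coef m) fun p => muHat hm (x ++ p :: z)

theorem outerOp_single (hm : 3 ≤ m) (x z : List (Path m)) (p : Path m) :
    outerOp hm x z (toM (Finsupp.single p 1)) = muHat hm (x ++ p :: z) := by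
  rw [toM_single_one, outerOp, Finsupp.linearCombination_single, one_smul]

theorem outerOp_eq_zero (hm : 3 ≤ m) {x z : List (Path m)} (h : ∀ p, muHat hm (x ++ p :: z) = 0) :
    outerOp hm x z = 0 := by
  refine Finsupp.lhom_ext fun p c => ?_
  rw [outerOp, Finsupp.linearCombination_single, h, smul_zero]
  rfl

/-- The term of the structure relation with the inner inputs `y`. -/
noncomputable def relTerm (hm : 3 ≤ m) (x y z : List (Path m)) : Path m →₀ Coef m :=
  signed (x.length + y.length * z.length) (outerOp hm x z (muHat hm y))

theorem relTerm_of_odd (hm : 3 ≤ m) {x y z : List (Path m)} (h : Odd y.length) :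
    relTerm hm x y z = 0 := by
  rw [relTerm, muHat_of_odd hm h, map_zero, signed_zero]

theorem relTerm_of_even (hm : 3 ≤ m) {x y z : List (Path m)} (h : Even y.length) :
    relTerm hm x y z = signed x.length (outerOp hm x z (muHat hm y)) :=
  signed_add_mul _ h _

theorem relTerm_eq_zero (hm : 3 ≤ m) {x y z : List (Path m)} (h : outerOp hm x z = 0) :
    relTerm hm x y z = 0 := by
  rw [relTerm, h, LinearMap.zero_apply, signed_zero]

theorem trip_relTerm_of_even (hm : 3 ≤ m) {l : List (Path m)} (h : Even l.length) :
    trip (relTerm hm) l = 0 := by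
  have e0 : trip (fun _ _ _ => (0 : Path m →₀ Coef m)) l = 0 := by simp [trip]
  refine (trip_congr fun x y z hxyz => ?_).trans e0
  rcases Nat.even_or_odd y.length with hy | hy
  · refine relTerm_eq_zero hm (outerOp_eq_zero hm fun p => muHat_of_odd hm ?_)
    rw [← hxyz] at h
    simp only [List.length_append, List.length_cons] at h ⊢
    rw [Nat.odd_iff]
    rw [Nat.even_iff] at h hy
    omega
  · exact relTerm_of_odd hm hy

/-! #### Sequences of nonconstant paths -/

theorem outerOp_toM_ofWord (hm : 3 ≤ m) {x z : List (Path m)}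
    (hc : ¬ ∃ r ∈ x ++ z, r.letters = []) {w : List (Letter m)} (hw : w ≠ []) [Decidable (Adm w)] :
    outerOp hm x z (toM (ofWord w)) =
      if Adm w then muWord hm (fun k => toM (idem k)) (fun w => toM (ofWord w))
        (x.map Path.letters ++ w :: z.map Path.letters) else 0 := by
  split_ifs with h
  · obtain ⟨p, rfl, hp⟩ := exists_path hm h hw
    rw [hp, outerOp_single, muHat_of_ne hm, List.map_append, List.map_cons]
    rintro ⟨r, hr, hr'⟩
    simp only [List.mem_append, List.mem_cons] at hr
    rcases hr with hr | rfl | hr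
    · exact hc ⟨r, by simp [hr], hr'⟩
    · exact hw hr'
    · exact hc ⟨r, by simp [hr], hr'⟩
  · rw [ofWord_of_not_adm hm h, map_zero, map_zero]

theorem outerOp_idem (hm : 3 ≤ m) (x z : List (Path m)) (k : Node m) :
    outerOp hm x z (toM (idem k)) = toM (prodPaths (x ++ Path.const k :: z)) := by
  rw [idem, outerOp_single, muHat_of_const hm ⟨Path.const k, by simp, rfl⟩]

theorem outerOp_startM (hm : 3 ≤ m) {x z : List (Path m)} (hc : ¬ ∃ r ∈ x ++ z, r.letters = [])
    (s : List (List (Letter m))) :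
    outerOp hm x z (startM (fun k => toM (idem k)) s) =
      insStart (fun w => toM (ofWord w)) (x.map Path.letters) s (z.map Path.letters) := by
  have hcases : (∃ a, x = [a] ∧ z = []) ∨ (∃ b, x = [] ∧ z = [b]) ∨
      (x.length + z.length ≠ 1) := by
    rcases x with _ | ⟨a, _ | ⟨b, x⟩⟩ <;> rcases z with _ | ⟨c, _ | ⟨d, z⟩⟩ <;> simp
    omega
  rcases hcases with ⟨a, rfl, rfl⟩ | ⟨b, rfl, rfl⟩ | h
  · have ha : a.letters ≠ [] := fun h0 => hc ⟨a, by simp, h0⟩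
    simp only [List.map_cons, List.map_nil, insStart]
    rcases s with _ | ⟨_ | ⟨c, d⟩, s⟩
    · exact map_zero _
    · exact map_zero _
    · rw [startM, outerOp_idem, startM]
      change toM (mulPath a (Path.const c.src)) = _
      have h1 : a.letters.getLast?.map Letter.tgt = some a.finish := a.wordTgt_eq ha
      rw [mulPath_const_right, h1, a.ofWord_letters ha]
      simp only [Option.some.injEq]
      split_ifs
      · rfl
      · exact map_zero _
  · have hb : b.letters ≠ [] := fun h0 => hc ⟨b, by simp, h0⟩
    simp only [List.map_cons, List.map_nil, insStart]
    rcases s with _ | ⟨_ | ⟨c, d⟩, s⟩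
    · exact map_zero _
    · exact map_zero _
    · rw [startM, outerOp_idem, startM]
      change toM (mulPath (Path.const c.src) b) = _
      have h1 : b.letters.head?.map Letter.src = some b.start := b.wordSrc_eq hb
      rw [mulPath_const_left, h1, b.ofWord_letters hb]
      simp only [Option.some.injEq, eq_comm (a := b.start)]
      split_ifs
      · rfl
      · exact map_zero _
  · have h1 : insStart (fun w => toM (m := m) (ofWord w)) (x.map Path.letters) s
        (z.map Path.letters) = 0 := by
      rcases x with _ | ⟨a, _ | ⟨b, x⟩⟩
      · rcases z with _ | ⟨b, _ | ⟨c, z⟩⟩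
        · rfl
        · simp at h
        · rfl
      · rcases z with _ | ⟨b, z⟩
        · simp at h
        · rfl
      · rfl
    rw [h1]
    rcases s with _ | ⟨_ | ⟨c, d⟩, s⟩
    · exact map_zero _
    · exact map_zero _
    · rw [startM, outerOp_idem, prodPaths_of_length, map_zero]
      simp only [List.length_append, List.length_cons]
      omega

theorem trip_relTerm_of_not_const (hm : 3 ≤ m) {l : List (Path m)} (h : Odd l.length)
    (hc : ¬ ∃ r ∈ l, r.letters = []) : trip (relTerm hm) l = 0 := by
  classical
  have hg : (graphSystem hm).Good (l.map Path.letters) := good_of_not_const hm hc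
  have key := word_relation_signed (hm := hm) (N := Path m →₀ Coef m) (fun k => toM (idem k))
    (W := fun w => toM (ofWord w)) (fun w hw => by rw [ofWord_of_not_adm hm hw, map_zero]) hg
    (by rwa [List.length_map])
  rw [trip_map] at key
  refine Eq.trans (trip_congr fun x y z hxyz => ?_) key
  have hcy : ¬ ∃ r ∈ y, r.letters = [] := fun ⟨r, hr, h0⟩ => hc ⟨r, by rw [← hxyz]; simp [hr], h0⟩
  have hcxz : ¬ ∃ r ∈ x ++ z, r.letters = [] := by
    rintro ⟨r, hr, h0⟩
    refine hc ⟨r, ?_, h0⟩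
    rw [← hxyz]
    simp only [List.mem_append] at hr ⊢
    tauto
  rcases Nat.even_or_odd y.length with hy | hy
  · have h1 : outerOp hm x z ((graphSystem hm).inner (fun w => toM (ofWord w))
        (y.map Path.letters)) = (graphSystem hm).inner (fun w => outerOp hm x z (toM (ofWord w)))
        (y.map Path.letters) := (graphSystem hm).map_inner (N := Path m →₀ Coef m)
        (N' := Path m →₀ Coef m) (outerOp hm x z) _ _
    rw [relTerm_of_even hm hy, List.length_map, muHat_of_ne hm hcy, muWord, map_add, map_smul,
      outerOp_startM hm hcxz, h1]
    refine congrArg (signed x.length) (congrArg (HAdd.hAdd (γ := Path m →₀ Coef m) _) ?_)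
    exact (graphSystem hm).inner_congr (fun w hw => outerOp_toM_ofWord hm hcxz hw)
      fun b hb => (good_of_not_const hm hcy b hb).1
  · have hy' : Odd (y.map Path.letters).length := by rwa [List.length_map]
    rw [relTerm_of_odd hm hy, graphSum_of_odd hm hy', CutSystem.inner_of_odd _ _ hy', zero_smul,
      add_zero, signed_zero]

/-! #### Sequences with a constant path -/

theorem outerOp_const_left (hm : 3 ≤ m) (k : Node m) (v : Path m →₀ Coef m) :
    outerOp hm [Path.const k] [] v = v.filter fun p => k = p.start := by
  induction v using Finsupp.induction_linear with
  | zero => rw [map_zero, Finsupp.filter_zero]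
  | add f g hf hg => rw [map_add, Finsupp.filter_add, hf, hg]
  | single p c =>
    rw [outerOp, Finsupp.linearCombination_single, muHat_of_const hm ⟨Path.const k, by simp, rfl⟩]
    change c • toM (mulPath (Path.const k) p) = _
    rw [mulPath_const_left]
    split_ifs with h
    · rw [Finsupp.filter_single_of_pos (fun p : Path m => k = p.start) h, toM_single_one,
        Finsupp.smul_single, smul_eq_mul, mul_one]
    · rw [Finsupp.filter_single_of_neg (fun p : Path m => k = p.start) h, map_zero, smul_zero]

theorem outerOp_const_right (hm : 3 ≤ m) (k : Node m) (v : Path m →₀ Coef m) :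
    outerOp hm [] [Path.const k] v = v.filter fun p => p.finish = k := by
  induction v using Finsupp.induction_linear with
  | zero => rw [map_zero, Finsupp.filter_zero]
  | add f g hf hg => rw [map_add, Finsupp.filter_add, hf, hg]
  | single p c =>
    rw [outerOp, Finsupp.linearCombination_single, muHat_of_const hm ⟨Path.const k, by simp, rfl⟩]
    change c • toM (mulPath p (Path.const k)) = _
    rw [mulPath_const_right]
    split_ifs with h
    · rw [Finsupp.filter_single_of_pos (fun p : Path m => p.finish = k) h, toM_single_one,
        Finsupp.smul_single, smul_eq_mul, mul_one]
    · rw [Finsupp.filter_single_of_neg (fun p : Path m => p.finish = k) h, map_zero, smul_zero]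

theorem filter_of_mem_supported {v : Path m →₀ Coef m} {S : Set (Path m)}
    (hv : v ∈ Finsupp.supported (Coef m) (Coef m) S) {P : Path m → Prop} [DecidablePred P] {c : Prop}
    [Decidable c] (h : ∀ p ∈ S, P p ↔ c) : v.filter P = if c then v else 0 := by
  rw [Finsupp.mem_supported] at hv
  ext1 p
  by_cases hp : p ∈ v.support
  · have := h p (hv hp)
    by_cases hP : P p
    · rw [Finsupp.filter_apply_pos _ _ hP, if_pos (this.1 hP)]
    · rw [Finsupp.filter_apply_neg _ _ hP, if_neg fun h0 => hP (this.2 h0)]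
      rfl
  · have h0 : v p = 0 := Finsupp.notMem_support_iff.1 hp
    rw [Finsupp.filter_apply, h0, ite_self]
    split_ifs
    · exact h0.symm
    · rfl

theorem outerOp_const_left_muHat (hm : 3 ≤ m) (k : Node m) (q : Path m) (z : List (Path m)) :
    outerOp hm [Path.const k] [] (muHat hm (q :: z)) =
      if k = q.start then muHat hm (q :: z) else 0 := by
  rw [outerOp_const_left]
  refine filter_of_mem_supported (muHat_mem_left hm q z) fun r hr => ?_
  rw [show r.start = q.start from hr]

theorem outerOp_const_right_muHat (hm : 3 ≤ m) (k : Node m) (z : List (Path m)) (q : Path m) :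
    outerOp hm [] [Path.const k] (muHat hm (z ++ [q])) =
      if q.finish = k then muHat hm (z ++ [q]) else 0 := by
  rw [outerOp_const_right]
  refine filter_of_mem_supported (muHat_mem_right hm z q) fun r hr => ?_
  rw [show r.finish = q.finish from hr]

theorem outerOp_mulPath_const_right (hm : 3 ≤ m) (x z : List (Path m)) (p : Path m) (k : Node m) :
    outerOp hm x z (toM (mulPath p (Path.const k))) =
      if p.finish = k then muHat hm (x ++ p :: z) else 0 := by
  rw [mulPath_const_right]
  split_ifs
  · exact outerOp_single _ _ _ _
  · rw [map_zero, map_zero]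

theorem outerOp_mulPath_const_left (hm : 3 ≤ m) (x z : List (Path m)) (p : Path m) (k : Node m) :
    outerOp hm x z (toM (mulPath (Path.const k) p)) =
      if k = p.start then muHat hm (x ++ p :: z) else 0 := by
  rw [mulPath_const_left]
  split_ifs
  · exact outerOp_single _ _ _ _
  · rw [map_zero, map_zero]

theorem outerOp_of_const (hm : 3 ≤ m) {x z : List (Path m)} {k : Node m}
    (h : Path.const k ∈ x ++ z) (hl : x.length + z.length ≠ 1) : outerOp hm x z = 0 := by
  refine outerOp_eq_zero hm fun p => ?_
  rw [muHat_of_const hm ⟨Path.const k, ?_, rfl⟩, prodPaths_of_length, map_zero]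
  · simp only [List.length_append, List.length_cons]
    omega
  · simp only [List.mem_append, List.mem_cons] at h ⊢
    tauto

theorem muHat_of_const_of_length (hm : 3 ≤ m) {y : List (Path m)} {k : Node m}
    (h : Path.const k ∈ y) (hl : y.length ≠ 2) : muHat hm y = 0 := by
  rw [muHat_of_const hm ⟨_, h, rfl⟩, prodPaths_of_length hl, map_zero]

/-- The decompositions of a sequence, sorted by the position of one of its elements. -/
theorem trip_append_cons {α M : Type*} [AddCommMonoid M] (f : List α → List α → List α → M)
    (l₁ : List α) (a : α) (l₂ : List α) :
    trip f (l₁ ++ a :: l₂) =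
      trip (fun x y z => f x y (z ++ a :: l₂)) l₁ +
      cuts (fun x u => cuts (fun v z => f x (u ++ a :: v) z) l₂) l₁ +
      trip (fun x y z => f (l₁ ++ a :: x) y z) l₂ := by
  rw [trip, cuts_append_cons]
  simp only [cuts_append_cons, cuts_add]
  rfl

theorem trip_eq_middle {α M : Type*} [AddCommMonoid M] {f : List α → List α → List α → M}
    {l : List α} (h : ∀ x y z, x.length + z.length ≠ 0 → f x y z = 0) : trip f l = f [] l [] := by
  rw [trip, cuts_eq_left, pts_eq_zero, add_zero, cuts_eq_right, pts_eq_zero, zero_add]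
  · exact fun x b y _ => h _ _ _ (by simp)
  · exact fun x b y _ => cuts_eq_zero fun u v _ => h _ _ _ (by simp)

theorem trip_eq_zero {α M : Type*} [AddCommMonoid M] {f : List α → List α → List α → M}
    {l : List α} (h : ∀ x y z, f x y z = 0) : trip f l = 0 :=
  cuts_eq_zero fun _ _ _ => cuts_eq_zero fun _ _ _ => h _ _ _

theorem cuts_nil {α M : Type*} [AddCommMonoid M] (f : List α → List α → M) :
    cuts f [] = f [] [] := rfl

theorem cuts_nil_left {α M : Type*} [AddCommMonoid M] {f : List α → List α → M} {l : List α}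
    (h : ∀ x y, x ≠ [] → f x y = 0) : cuts f l = f [] l := by
  rw [cuts_eq_left, pts_eq_zero, add_zero]
  exact fun x b y _ => h _ _ (by simp)

theorem cuts_nil_right {α M : Type*} [AddCommMonoid M] {f : List α → List α → M} {l : List α}
    (h : ∀ x y, y ≠ [] → f x y = 0) : cuts f l = f l [] := by
  rw [cuts_eq_right, pts_eq_zero, zero_add]
  exact fun x b y _ => h _ _ (by simp)

theorem cuts_singleton_left {α M : Type*} [AddCommMonoid M] {f : List α → List α → M} {a : α}
    {l : List α} (h : ∀ x y, x.length ≠ 1 → f x y = 0) : cuts f (a :: l) = f [a] l := by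
  rw [cuts, h [] _ (by simp), zero_add, cuts_nil_left]
  exact fun x y hx => h _ _ (by simpa using hx)

theorem relTerm_of_inner (hm : 3 ≤ m) {x u v z : List (Path m)} {k : Node m}
    (h : u.length + v.length ≠ 1) : relTerm hm x (u ++ Path.const k :: v) z = 0 := by
  rw [relTerm, muHat_of_const_of_length hm (k := k), map_zero, signed_zero]
  · simp
  · simp only [List.length_append, List.length_cons]
    omega

theorem relTerm_const_pair_right (hm : 3 ≤ m) (x z : List (Path m)) (p : Path m) (k : Node m) :
    relTerm hm x [p, Path.const k] z =
      signed x.length (if p.finish = k then muHat hm (x ++ p :: z) else 0) := by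
  rw [relTerm_of_even hm even_two, muHat_of_const hm ⟨Path.const k, by simp, rfl⟩]
  exact congrArg _ (outerOp_mulPath_const_right hm x z p k)

theorem relTerm_const_pair_left (hm : 3 ≤ m) (x z : List (Path m)) (p : Path m) (k : Node m) :
    relTerm hm x [Path.const k, p] z =
      signed x.length (if k = p.start then muHat hm (x ++ p :: z) else 0) := by
  rw [relTerm_of_even hm even_two, muHat_of_const hm ⟨Path.const k, by simp, rfl⟩]
  exact congrArg _ (outerOp_mulPath_const_left hm x z p k)

/-- If an input is constant, only the products with its neighbours survive: as an inner operation with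
the two neighbours of the constant path, with opposite signs, or, if the constant path is the first
or the last input, as an outer operation. -/
theorem trip_relTerm_of_const (hm : 3 ≤ m) {l₁ l₂ : List (Path m)} {k : Node m}
    (h : Odd (l₁ ++ Path.const k :: l₂).length) :
    trip (relTerm hm) (l₁ ++ Path.const k :: l₂) = 0 := by
  have hpar : Even (l₁.length + l₂.length) := by
    simp only [List.length_append, List.length_cons] at h
    rw [Nat.odd_iff] at h
    rw [Nat.even_iff]
    omega
  rw [trip_append_cons]
  have hA : l₂ ≠ [] → trip (fun x y z => relTerm hm x y (z ++ Path.const k :: l₂)) l₁ = 0 := by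
    intro h2
    refine trip_eq_zero fun x y z => relTerm_eq_zero hm (outerOp_of_const hm (k := k) (by simp) ?_)
    have := List.length_pos_of_ne_nil h2
    simp only [List.length_append, List.length_cons]
    omega
  have hA' : trip (fun x y z => relTerm hm x y (z ++ [Path.const k])) l₁ =
      relTerm hm [] l₁ [Path.const k] := by
    refine trip_eq_middle fun x y z hxz => relTerm_eq_zero hm
      (outerOp_of_const hm (k := k) (by simp) ?_)
    simp only [List.length_append, List.length_cons, List.length_nil]
    omega
  have hC : l₁ ≠ [] → trip (fun x y z => relTerm hm (l₁ ++ Path.const k :: x) y z) l₂ = 0 := by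
    intro h2
    refine trip_eq_zero fun x y z => relTerm_eq_zero hm (outerOp_of_const hm (k := k) (by simp) ?_)
    have := List.length_pos_of_ne_nil h2
    simp only [List.length_append, List.length_cons]
    omega
  have hC' : trip (fun x y z => relTerm hm ([] ++ Path.const k :: x) y z) l₂ =
      relTerm hm [Path.const k] l₂ [] := by
    refine trip_eq_middle fun x y z hxz => relTerm_eq_zero hm
      (outerOp_of_const hm (k := k) (by simp) ?_)
    simp only [List.length_append, List.length_cons, List.length_nil]
    omega
  -- The part of the middle sum in which the constant path is multiplied by the next input.
  have hB₂ : ∀ q z, cuts (fun v z => relTerm hm l₁ ([] ++ Path.const k :: v) z) (q :: z) =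
      relTerm hm l₁ [Path.const k, q] z := fun q z =>
    cuts_singleton_left fun v z hv => relTerm_of_inner hm (by simpa using hv)
  have hB₁ : ∀ x p, cuts (fun v z => relTerm hm x ([p] ++ Path.const k :: v) z) l₂ =
      relTerm hm x [p, Path.const k] l₂ := fun x p =>
    cuts_nil_left fun v z hv => relTerm_of_inner hm (by
      have := List.length_pos_of_ne_nil hv
      simp only [List.length_cons, List.length_nil]
      omega)
  have hB : ∀ x p, l₁ = x ++ [p] →
      cuts (fun x u => cuts (fun v z => relTerm hm x (u ++ Path.const k :: v) z) l₂) l₁ =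
        relTerm hm x [p, Path.const k] l₂ +
          cuts (fun v z => relTerm hm l₁ ([] ++ Path.const k :: v) z) l₂ := by
    rintro x p rfl
    rw [cuts_append_cons, cuts_nil_right, ← hB₁]
    · rfl
    · intro x y hy
      refine cuts_eq_zero fun v z _ => relTerm_of_inner hm ?_
      have := List.length_pos_of_ne_nil hy
      simp only [List.length_append, List.length_cons]
      omega
  rcases List.eq_nil_or_concat l₁ with rfl | ⟨x, p, rfl⟩
  · rw [hC']
    rcases l₂ with _ | ⟨q, z⟩
    · rw [hA']
      have h1 : cuts (fun x u => cuts (fun v z => relTerm hm x (u ++ Path.const k :: v) z)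
          ([] : List (Path m))) ([] : List (Path m)) = 0 := relTerm_of_inner hm (by simp)
      rw [h1, relTerm_of_even hm Even.zero, relTerm_of_even hm Even.zero, outerOp_const_left,
        outerOp_const_right]
      have h2 : (muHat hm ([] : List (Path m))).filter (fun p => k = p.start) =
          (muHat hm []).filter fun p => p.finish = k := by
        ext1 p
        rw [Finsupp.filter_apply, Finsupp.filter_apply]
        by_cases hp : p ∈ (muHat hm ([] : List (Path m))).support
        · have h3 := (Finsupp.mem_supported _ _).1 (muHat_nil_mem hm) hp
          rw [Set.mem_ofPred_eq] at h3
          rw [h3]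
          simp only [eq_comm]
        · rw [Finsupp.notMem_support_iff.1 hp, ite_self, ite_self]
      rw [h2, add_zero]
      exact signed_add_signed_succ 0 _
    · rw [hA (by simp)]
      have h1 : Even (q :: z).length := by
        rwa [List.length_nil, zero_add] at hpar
      rw [cuts_nil, hB₂, relTerm_const_pair_left, relTerm_of_even hm h1,
        outerOp_const_left_muHat, zero_add]
      exact signed_add_signed_succ 0 _
  · rw [List.concat_eq_append] at *
    rw [hC (by simp), hB x p rfl, relTerm_const_pair_right]
    rcases l₂ with _ | ⟨q, z⟩
    · have h1 : Even (x ++ [p]).length := by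
        rwa [List.length_nil, add_zero] at hpar
      rw [hA', show cuts (fun v z => relTerm hm (x ++ [p]) ([] ++ Path.const k :: v) z) [] = 0 from
        relTerm_of_inner hm (by simp), relTerm_of_even hm h1,
        outerOp_const_right_muHat]
      have hx : Odd x.length := by
        simp only [List.length_append, List.length_cons, List.length_nil] at hpar
        rw [Nat.even_iff] at hpar
        rw [Nat.odd_iff]
        omega
      rw [add_zero, add_zero, signed_of_odd hx]
      refine Eq.trans (congrArg (· + _) (signed_of_even (n := 0) Even.zero _)) (add_neg_cancel _)
    · rw [hA (by simp), hB₂, relTerm_const_pair_left, List.append_assoc, List.length_append,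
        List.length_singleton, zero_add, add_zero]
      by_cases h1 : p.finish = q.start
      · rw [h1, if_congr (eq_comm (a := q.start)) rfl rfl]
        exact signed_add_signed_succ _ _
      · rw [show x ++ ([p] ++ q :: z) = x ++ p :: q :: z from rfl, muHat_eq_zero hm h1, ite_self,
          ite_self, signed_zero, signed_zero, add_zero]

/-- The structure relation on basis elements, for the generating functions. -/
theorem trip_relTerm (hm : 3 ≤ m) (l : List (Path m)) : trip (relTerm hm) l = 0 := by
  rcases Nat.even_or_odd l.length with h | h
  · exact trip_relTerm_of_even hm h
  by_cases hc : ∃ r ∈ l, r.letters = []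
  · obtain ⟨r, hr, hr'⟩ := hc
    obtain ⟨l₁, l₂, rfl⟩ := List.append_of_mem hr
    rw [Path.eq_const hr'] at h ⊢
    exact trip_relTerm_of_const hm h
  · exact trip_relTerm_of_not_const hm h hc

end Bordered

/-! ### Multilinear extension -/

namespace Bordered

variable {m : ℕ}

/-- The coefficients of a product of generating functions. -/
theorem coeffAt_mul (w : Fin m → ℕ) (c d : Coef m) :
    coeffAt w (c * d) = ∑ v ∈ Finset.Icc 0 w, coeffAt v c * coeffAt (w - v) d := by
  classical
  change MvPolynomial.coeff _ (c * d) = _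
  rw [MvPolynomial.coeff_mul]
  refine Finset.sum_nbij' (fun x => ⇑x.1)
    (fun v => (Finsupp.equivFunOnFinite.symm v, Finsupp.equivFunOnFinite.symm (w - v))) ?_ ?_ ?_ ?_ ?_
  · intro x hx
    rw [Finset.HasAntidiagonal.mem_antidiagonal] at hx
    rw [Finset.mem_Icc]
    refine ⟨fun i => Nat.zero_le _, fun i => ?_⟩
    have := DFunLike.congr_fun hx i
    rw [Finsupp.add_apply, Finsupp.equivFunOnFinite_symm_apply_apply] at this
    change x.1 i ≤ w i
    omega
  · intro v hv
    rw [Finset.mem_Icc] at hv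
    rw [Finset.HasAntidiagonal.mem_antidiagonal]
    ext i
    exact Nat.add_sub_cancel' (hv.2 i)
  · intro x hx
    rw [Finset.HasAntidiagonal.mem_antidiagonal] at hx
    refine Prod.ext (Finsupp.ext fun i => rfl) (Finsupp.ext fun i => ?_)
    have := DFunLike.congr_fun hx i
    rw [Finsupp.add_apply, Finsupp.equivFunOnFinite_symm_apply_apply] at this
    change w i - x.1 i = x.2 i
    omega
  · intro v hv
    rfl
  · intro x hx
    rw [Finset.HasAntidiagonal.mem_antidiagonal] at hx
    refine congrArg₂ (· * ·) (congrArg (fun s => MvPolynomial.coeff s c) (Finsupp.ext fun i => rfl))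
      (congrArg (fun s => MvPolynomial.coeff s d) (Finsupp.ext fun i => ?_))
    have := DFunLike.congr_fun hx i
    rw [Finsupp.add_apply, Finsupp.equivFunOnFinite_symm_apply_apply] at this
    change x.2 i = w i - x.1 i
    omega

theorem weightPart_smul_eq_sum (w : Fin m → ℕ) (c : Coef m) (a : Path m →₀ Coef m) :
    weightPart w (c • a) = ∑ v ∈ Finset.Icc 0 w, coeffAt v c • weightPart (w - v) a := by
  ext1 p
  rw [Finsupp.finsetSum_apply]
  exact coeffAt_mul w c (a p)

theorem weightPart_outerOp (hm : 3 ≤ m) (w : Fin m → ℕ) (x z : List (Path m))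
    (b : Path m →₀ Coef m) :
    weightPart w (outerOp hm x z b) = ∑ v ∈ Finset.Icc 0 w,
      Finsupp.linearCombination ℤ[X] (fun p => muPaths (w - v) (x ++ p :: z)) (weightPart v b) := by
  induction b using Finsupp.induction_linear with
  | zero => simp
  | add b c hb hc => simp only [map_add, Finset.sum_add_distrib, hb, hc]
  | single p c =>
    rw [outerOp, Finsupp.linearCombination_single, weightPart_smul_eq_sum]
    refine Finset.sum_congr rfl fun v _ => ?_
    rw [show weightPart v (Finsupp.single p c) = Finsupp.single p (coeffAt v c) from
      Finsupp.mapRange_single (hf := map_zero (coeffAt v)), Finsupp.linearCombination_single, muPaths_eq hm]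

/-- The structure relation on basis elements, as the coefficient of `trip_relTerm` at a weight. -/
theorem trip_muPaths (hm : 3 ≤ m) (w : Fin m → ℕ) (l : List (Path m)) :
    trip (fun x y z => signed (x.length + y.length * z.length) (∑ v ∈ Finset.Icc 0 w,
      Finsupp.linearCombination ℤ[X] (fun p => muPaths (w - v) (x ++ p :: z)) (muPaths v y))) l = 0 := by
  have h := congrArg (weightPart w) (trip_relTerm hm l)
  rw [map_zero, map_trip] at h
  refine (trip_congr fun x y z _ => ?_).trans h
  rw [relTerm, signed, signed, map_zsmul, weightPart_outerOp]
  simp only [muPaths_eq hm]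

section Ext

variable {P R N N' : Type*} [CommRing R] [AddCommGroup N] [Module R N] [AddCommGroup N'] [Module R N']

/-- The multilinear extension of a function on sequences of basis elements. -/
noncomputable def multiExt (R : Type*) [CommRing R] [Module R N] :
    (List P → N) → List (P →₀ R) → N
  | F, [] => F []
  | F, a :: l => a.sum fun p c => c • multiExt R (fun ps => F (p :: ps)) l

theorem multiExt_cons (F : List P → N) (a : P →₀ R) (l : List (P →₀ R)) :
    multiExt R F (a :: l) =
      Finsupp.linearCombination R (fun p => multiExt R (fun ps => F (p :: ps)) l) a := rfl

theorem multiExt_congr {F G : List P → N} {l : List (P →₀ R)}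
    (h : ∀ ps : List P, ps.length = l.length → F ps = G ps) : multiExt R F l = multiExt R G l := by
  induction l generalizing F G with
  | nil => exact h [] rfl
  | cons a l ih =>
    refine Finsupp.sum_congr fun p _ => ?_
    rw [ih fun ps hps => h _ (by rw [List.length_cons, List.length_cons, hps])]

theorem map_multiExt (φ : N →ₗ[R] N') (F : List P → N) (l : List (P →₀ R)) :
    φ (multiExt R F l) = multiExt R (fun ps => φ (F ps)) l := by
  induction l generalizing F with
  | nil => rfl
  | cons a l ih =>
    rw [multiExt, map_finsuppSum]
    exact Finsupp.sum_congr fun p _ => by rw [map_smul, ih]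

theorem multiExt_add (F G : List P → N) (l : List (P →₀ R)) :
    multiExt R (fun ps => F ps + G ps) l = multiExt R F l + multiExt R G l := by
  induction l generalizing F G with
  | nil => rfl
  | cons a l ih => simp only [multiExt, ih, smul_add, Finsupp.sum_add]

theorem multiExt_zero (l : List (P →₀ R)) : multiExt R (fun _ => (0 : N)) l = 0 := by
  induction l with
  | nil => rfl
  | cons a l ih => simp only [multiExt, ih, smul_zero, Finsupp.sum, Finset.sum_const_zero]

theorem multiExt_sum {ι : Type*} (s : Finset ι) (F : ι → List P → N) (l : List (P →₀ R)) :
    multiExt R (fun ps => ∑ i ∈ s, F i ps) l = ∑ i ∈ s, multiExt R (F i) l := by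
  classical
  induction s using Finset.induction_on with
  | empty => simp only [Finset.sum_empty, multiExt_zero]
  | insert i s hi ih => simp only [Finset.sum_insert hi, multiExt_add, ih]

theorem multiExt_append (F : List P → N) (x y : List (P →₀ R)) :
    multiExt R F (x ++ y) = multiExt R (fun px => multiExt R (fun py => F (px ++ py)) y) x := by
  induction x generalizing F with
  | nil => rfl
  | cons a x ih => exact Finsupp.sum_congr fun p _ => congrArg _ (ih _)

theorem cuts_sum {α ι : Type*} (s : Finset ι) (f : ι → List α → List α → N) (l : List α) :
    cuts (fun x y => ∑ i ∈ s, f i x y) l = ∑ i ∈ s, cuts (f i) l := by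
  simp only [cuts_eq_sum]
  exact Finset.sum_comm

theorem multiExt_cuts (f : List P → List P → N) (l : List (P →₀ R)) :
    multiExt R (cuts f) l = cuts (fun x y => multiExt R (fun px => multiExt R (f px) y) x) l := by
  induction l generalizing f with
  | nil => rfl
  | cons a l ih =>
    simp only [multiExt, cuts, multiExt_add, smul_add, Finsupp.sum_add, ih]
    refine congrArg _ ?_
    simp only [Finsupp.sum, cuts_sum, cuts_smul]

theorem multiExt_trip (f : List P → List P → List P → N) (l : List (P →₀ R)) :
    multiExt R (trip f) l = trip (fun x y z =>
      multiExt R (fun px => multiExt R (fun py => multiExt R (f px py) z) y) x) l := by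
  refine (multiExt_cuts _ l).trans (cuts_congr fun x r _ => ?_)
  simp only [multiExt_cuts]
  simp only [cuts_eq_sum, multiExt_sum]

/-- The composition of multilinear extensions is the multilinear extension of the composition on
basis elements. -/
theorem multiExt_insert (F : List P → N) (G : List P → P →₀ R) (x y z : List (P →₀ R)) :
    multiExt R F (x ++ multiExt R G y :: z) = multiExt R (fun px => multiExt R (fun py =>
      multiExt R (fun pz => Finsupp.linearCombination R (fun p => F (px ++ p :: pz)) (G py)) z) y) x := by
  rw [multiExt_append]
  refine multiExt_congr fun px _ => ?_
  rw [multiExt_cons, map_multiExt]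
  refine multiExt_congr fun py _ => ?_
  rw [Finsupp.linearCombination_apply, Finsupp.sum]
  simp only [Finsupp.linearCombination_apply, Finsupp.sum, multiExt_sum]
  exact Finset.sum_congr rfl fun p _ => map_multiExt (LinearMap.lsmul R N (G py p)) _ z

end Ext

end Bordered

/-! ### The structure relation -/

namespace Bordered

open WeightedAInfty

variable {m : ℕ}

/-- The expansion of a multilinear map over all sequences of basis elements, as an iterated sum. -/
theorem sum_piFinset_eq_multiExt {P R N : Type*} [CommRing R] [AddCommGroup N] [Module R N]
    (F : List P → N) {n : ℕ} (a : Fin n → P →₀ R) :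
    ∑ ps ∈ Fintype.piFinset (fun i => (a i).support), (∏ i, a i (ps i)) • F (List.ofFn ps) =
      multiExt R F (List.ofFn a) := by
  classical
  induction n generalizing F with
  | zero =>
    rw [Fintype.piFinset_of_isEmpty]
    simp [multiExt]
  | succ n ih =>
    rw [List.ofFn_succ, multiExt, Finsupp.sum]
    simp only [← ih, Finset.smul_sum]
    rw [← Finset.sum_product']
    refine Finset.sum_nbij' (fun ps => (ps 0, Fin.tail ps)) (fun q => Fin.cons q.1 q.2) ?_ ?_ ?_ ?_ ?_
    · intro ps hps
      rw [Fintype.mem_piFinset] at hps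
      exact Finset.mem_product.2 ⟨hps 0, Fintype.mem_piFinset.2 fun i => hps i.succ⟩
    · intro q hq
      rw [Finset.mem_product, Fintype.mem_piFinset] at hq
      exact Fintype.mem_piFinset.2 fun i => Fin.cases hq.1 hq.2 i
    · intro ps _
      exact Fin.cons_self_tail ps
    · intro q _
      rfl
    · intro ps _
      rw [Fin.prod_univ_succ, List.ofFn_succ, mul_smul]
      rfl

theorem mu_eq_multiExt (w : Fin m → ℕ) {n : ℕ} (a : Fin n → Alg m) :
    mu m w n a = multiExt ℤ[X] (muPaths w) (List.ofFn a) :=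
  sum_piFinset_eq_multiExt _ a

theorem ofFn_splice {A : Type*} (a : ℕ → A) (r s t : ℕ) (y : A) :
    (List.ofFn fun j : Fin (r + 1 + t) => splice a r s y j) =
      (List.ofFn fun i : Fin r => a i) ++ y :: List.ofFn fun i : Fin t => a (r + (s + i)) := by
  refine List.ext_getElem ?_ fun i h1 h2 => ?_
  · simp only [List.length_append, List.length_cons, List.length_ofFn]
    omega
  · rw [List.length_ofFn] at h1
    rw [List.getElem_ofFn, List.getElem_append]
    simp only [List.length_ofFn, List.getElem_ofFn, List.getElem_cons, splice]
    split_ifs with h3 h4 h5 h6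
    · rfl
    · rfl
    · omega
    · omega
    · congr 1
      omega

theorem trip_eq_sum {α M : Type*} [AddCommMonoid M] (f : List α → List α → List α → M)
    (a : ℕ → α) (n : ℕ) :
    trip f (List.ofFn fun i : Fin n => a i) =
      ∑ p ∈ Finset.HasAntidiagonal.antidiagonal n,
        ∑ q ∈ Finset.HasAntidiagonal.antidiagonal p.2,
          f (List.ofFn fun i : Fin p.1 => a i) (List.ofFn fun i : Fin q.1 => a (p.1 + i))
            (List.ofFn fun i : Fin q.2 => a (p.1 + (q.1 + i))) := by
  have h : ∀ (g : List α → List α → M) (a : ℕ → α) (n : ℕ),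
      cuts g (List.ofFn fun i : Fin n => a i) = ∑ p ∈ Finset.HasAntidiagonal.antidiagonal n,
        g (List.ofFn fun i : Fin p.1 => a i) (List.ofFn fun i : Fin p.2 => a (p.1 + i)) := by
    intro g a n
    induction n generalizing g a with
    | zero => simp [cuts]
    | succ n ih =>
      rw [List.ofFn_succ, Finset.Nat.sum_antidiagonal_succ, cuts]
      refine congrArg₂ (· + ·) ?_ ?_
      · simp [List.ofFn_succ]
      · refine (ih _ fun i => a (i + 1)).trans (Finset.sum_congr rfl fun p _ => ?_)
        simp [List.ofFn_succ, add_right_comm]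
  rw [trip, h]
  exact Finset.sum_congr rfl fun p _ => h _ (fun i => a (p.1 + i)) _

theorem multiExt_signed {P R N : Type*} [CommRing R] [AddCommGroup N] [Module R N] (k : ℕ)
    (F : List P → N) (l : List (P →₀ R)) :
    multiExt R (fun ps => signed k (F ps)) l = signed k (multiExt R F l) := by
  rcases Nat.even_or_odd k with h | h
  · simp only [signed_of_even h]
  · simp only [signed_of_odd h]
    exact (map_multiExt (-LinearMap.id : N →ₗ[R] N) F l).symm

theorem mu_relation (hm : 3 ≤ m) (w : Fin m → ℕ) (n : ℕ) (a : ℕ → Alg m) :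
    ∑ p ∈ Finset.HasAntidiagonal.antidiagonal n, ∑ q ∈ Finset.HasAntidiagonal.antidiagonal p.2,
      ∑ v ∈ Finset.Icc 0 w,
      (-1 : ℤ) ^ (p.1 + q.1 * q.2) •
        mu m (w - v) (p.1 + 1 + q.2)
          (fun j => splice a p.1 q.1 (mu m v q.1 (fun i => a (p.1 + i))) j) = 0 := by
  have h := multiExt_trip (R := ℤ[X]) (fun x y z : List (Path m) =>
    signed (x.length + y.length * z.length) (∑ v ∈ Finset.Icc 0 w,
      Finsupp.linearCombination ℤ[X] (fun p => muPaths (w - v) (x ++ p :: z)) (muPaths v y)))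
    (List.ofFn fun i : Fin n => a i)
  rw [multiExt_congr (G := fun _ => 0) fun ps _ => trip_muPaths hm w ps, multiExt_zero,
    trip_eq_sum] at h
  rw [h]
  refine Finset.sum_congr rfl fun p _ => Finset.sum_congr rfl fun q _ => ?_
  rw [← Finset.smul_sum]
  simp only [mu_eq_multiExt, ofFn_splice, multiExt_insert]
  simp only [← multiExt_sum]
  refine Eq.trans (multiExt_signed _ _ _).symm (multiExt_congr fun x hx => ?_)
  refine Eq.trans (multiExt_signed _ _ _).symm (multiExt_congr fun y hy => ?_)
  refine Eq.trans (multiExt_signed _ _ _).symm (multiExt_congr fun z hz => ?_)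
  rw [hx, hy, hz, List.length_ofFn, List.length_ofFn, List.length_ofFn]

end Bordered

/-! ### Bimodule structure, multilinearity and grading -/

namespace Bordered

open WeightedAInfty

variable {m : ℕ}

theorem mu_eq_sum (w : Fin m → ℕ) {n : ℕ} {a : Fin n → Alg m} {S : Finset (Path m)}
    (h : ∀ i, (a i).support ⊆ S) :
    mu m w n a = ∑ ps ∈ Fintype.piFinset (fun _ => S), (∏ i, a i (ps i)) • muPaths w (List.ofFn ps) := by
  refine Finset.sum_subset (Fintype.piFinset_subset _ _ h) fun ps _ hps => ?_
  rw [Fintype.mem_piFinset, not_forall] at hps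
  obtain ⟨i, hi⟩ := hps
  have h0 : ∏ i, a i (ps i) = 0 :=
    Finset.prod_eq_zero (Finset.mem_univ i) (Finsupp.notMem_support_iff.1 hi)
  rw [h0, zero_smul]

theorem exists_support_subset {ι : Type*} [Fintype ι] (a : ι → Alg m) (s : Finset (Path m)) :
    ∃ S : Finset (Path m), (∀ i, (a i).support ⊆ S) ∧ s ⊆ S := by
  classical
  exact ⟨Finset.univ.biUnion (fun i => (a i).support) ∪ s, fun i => Finset.Subset.trans
    (Finset.subset_biUnion_of_mem (fun i => (a i).support) (Finset.mem_univ i))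
    Finset.subset_union_left, Finset.subset_union_right⟩

theorem support_update_subset {n : ℕ} {a : Fin n → Alg m} {S : Finset (Path m)}
    (h : ∀ i, (a i).support ⊆ S) (i : Fin n) {x : Alg m} (hx : x.support ⊆ S) (j : Fin n) :
    (Function.update a i x j).support ⊆ S := by
  rcases eq_or_ne j i with rfl | hj
  · rwa [Function.update_self]
  · rw [Function.update_of_ne hj]
    exact h j

theorem prod_update_apply {n : ℕ} (a : Fin n → Alg m) (i : Fin n) (x : Alg m) (ps : Fin n → Path m) :
    ∏ j, Function.update a i x j (ps j) = x (ps i) * ∏ j ∈ Finset.univ \ {i}, a j (ps j) := by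
  have h : (fun j => Function.update a i x j (ps j)) =
      Function.update (fun j => a j (ps j)) i (x (ps i)) := by
    funext j
    rcases eq_or_ne j i with rfl | hj
    · rw [Function.update_self, Function.update_self]
    · rw [Function.update_of_ne hj, Function.update_of_ne hj]
  rw [h, Finset.prod_update_of_mem (Finset.mem_univ i)]

theorem mu_update_add (w : Fin m → ℕ) (n : ℕ) (a : Fin n → Alg m) (i : Fin n) (x y : Alg m) :
    mu m w n (Function.update a i (x + y)) =
      mu m w n (Function.update a i x) + mu m w n (Function.update a i y) := by
  classical
  obtain ⟨S, hS, hxy⟩ := exists_support_subset a (x.support ∪ y.support)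
  rw [mu_eq_sum w (support_update_subset hS i (Finsupp.support_add.trans hxy)),
    mu_eq_sum w (support_update_subset hS i (Finset.subset_union_left.trans hxy)),
    mu_eq_sum w (support_update_subset hS i (Finset.subset_union_right.trans hxy)),
    ← Finset.sum_add_distrib]
  refine Finset.sum_congr rfl fun ps _ => ?_
  rw [prod_update_apply, prod_update_apply, prod_update_apply, Finsupp.add_apply, add_mul, add_smul]

theorem mu_update_smul (w : Fin m → ℕ) (n : ℕ) (a : Fin n → Alg m) (i : Fin n) (c : ℤ[X]) (x : Alg m) :
    mu m w n (Function.update a i (c • x)) = c • mu m w n (Function.update a i x) := by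
  obtain ⟨S, hS, hx⟩ := exists_support_subset a x.support
  rw [mu_eq_sum w (support_update_subset hS i (Finsupp.support_smul.trans hx)),
    mu_eq_sum w (support_update_subset hS i hx), Finset.smul_sum]
  refine Finset.sum_congr rfl fun ps _ => ?_
  rw [prod_update_apply, prod_update_apply, Finsupp.smul_apply, smul_eq_mul, mul_assoc, mul_smul]

/-- Multiplying the coefficients of one input, path by path, by integers multiplies the terms of
the operation. -/
theorem mu_update_of_apply (w : Fin m → ℕ) {n : ℕ} {a : Fin n → Alg m} {S : Finset (Path m)}
    (hS : ∀ i, (a i).support ⊆ S) (i : Fin n) {x : Alg m} {c : Path m → ℤ}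
    (hx : ∀ p, x p = c p • a i p) :
    mu m w n (Function.update a i x) = ∑ ps ∈ Fintype.piFinset (fun _ => S),
      c (ps i) • (∏ i, a i (ps i)) • muPaths w (List.ofFn ps) := by
  have hxS : x.support ⊆ S := fun p hp => hS i (Finsupp.mem_support_iff.2 fun h0 =>
    Finsupp.mem_support_iff.1 hp (by rw [hx, h0, smul_zero]))
  rw [mu_eq_sum w (support_update_subset hS i hxS)]
  refine Finset.sum_congr rfl fun ps _ => ?_
  have h := prod_update_apply a i (a i) ps
  rw [Function.update_eq_self] at h
  rw [prod_update_apply, hx, h, smul_mul_assoc, smul_assoc]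

theorem muPaths_apply_eq_zero (hm : 3 ≤ m) (w : Fin m → ℕ) {l : List (Path m)} {P : Path m → Prop}
    (h : muHat hm l ∈ Finsupp.supported (Coef m) (Coef m) {r | P r}) {r : Path m} (hr : ¬ P r) :
    muPaths w l r = 0 := by
  rw [muPaths_eq hm, show weightPart w (muHat hm l) r = coeffAt w (muHat hm l r) from rfl,
    (Finsupp.mem_supported' _ _).1 h r hr, map_zero]

theorem muPaths_balanced (hm : 3 ≤ m) (w : Fin m → ℕ) {n : ℕ} (ps : Fin n → Path m) {i j : Fin n}
    (hij : i.val + 1 = j.val) (h : (ps i).finish ≠ (ps j).start) : muPaths w (List.ofFn ps) = 0 := by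
  have hl : List.ofFn ps = (List.ofFn ps).take i ++ ps i :: ps j :: (List.ofFn ps).drop (j + 1) := by
    have h1 : i.val < (List.ofFn ps).length := by simp
    have h2 : j.val < (List.ofFn ps).length := by simp
    conv_lhs => rw [← List.take_append_drop i (List.ofFn ps), List.drop_eq_getElem_cons h1]
    simp only [hij]
    rw [List.drop_eq_getElem_cons h2, List.getElem_ofFn, List.getElem_ofFn]
  rw [hl, muPaths_eq hm, muHat_eq_zero hm h, map_zero]

theorem mu_balanced (hm : 3 ≤ m) (w : Fin m → ℕ) (n : ℕ) (a : Fin n → Alg m) (i j : Fin n)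
    (hij : i.val + 1 = j.val) (c : Idem m) :
    mu m w n (Function.update a i (MulOpposite.op c • a i)) =
      mu m w n (Function.update a j (c • a j)) := by
  obtain ⟨S, hS, -⟩ := exists_support_subset a ∅
  rw [mu_update_of_apply w hS i (c := fun p => c p.finish) fun p => rfl,
    mu_update_of_apply w hS j (c := fun p => c p.start) fun p => rfl]
  refine Finset.sum_congr rfl fun ps _ => ?_
  by_cases h : (ps i).finish = (ps j).start
  · rw [h]
  · rw [muPaths_balanced hm w ps hij h, smul_zero, smul_zero, smul_zero]

theorem mu_left_smul (hm : 3 ≤ m) (w : Fin m → ℕ) (n : ℕ) (a : Fin (n + 1) → Alg m) (c : Idem m) :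
    mu m w (n + 1) (Function.update a 0 (c • a 0)) = c • mu m w (n + 1) a := by
  obtain ⟨S, hS, -⟩ := exists_support_subset a ∅
  rw [mu_update_of_apply w hS 0 (c := fun p => c p.start) fun p => rfl, mu_eq_sum w hS,
    Finset.smul_sum]
  refine Finset.sum_congr rfl fun ps _ => Finsupp.ext fun r => ?_
  change c (ps 0).start • (_ * muPaths w (List.ofFn ps) r) =
    c r.start • (_ * muPaths w (List.ofFn ps) r)
  by_cases h : r.start = (ps 0).start
  · rw [h]
  · rw [muPaths_apply_eq_zero hm w (P := fun r => r.start = (ps 0).start) _ h, mul_zero, smul_zero,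
      smul_zero]
    rw [List.ofFn_succ]
    exact muHat_mem_left hm _ _

theorem mu_right_smul (hm : 3 ≤ m) (w : Fin m → ℕ) (n : ℕ) (a : Fin (n + 1) → Alg m) (c : Idem m) :
    mu m w (n + 1) (Function.update a (Fin.last n) (MulOpposite.op c • a (Fin.last n))) =
      MulOpposite.op c • mu m w (n + 1) a := by
  obtain ⟨S, hS, -⟩ := exists_support_subset a ∅
  rw [mu_update_of_apply w hS _ (c := fun p => c p.finish) fun p => rfl, mu_eq_sum w hS,
    Finset.smul_sum]
  refine Finset.sum_congr rfl fun ps _ => Finsupp.ext fun r => ?_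
  change c (ps (Fin.last n)).finish • (_ * muPaths w (List.ofFn ps) r) =
    c r.finish • (_ * muPaths w (List.ofFn ps) r)
  by_cases h : r.finish = (ps (Fin.last n)).finish
  · rw [h]
  · rw [muPaths_apply_eq_zero hm w (P := fun r => r.finish = (ps (Fin.last n)).finish) _ h, mul_zero,
      smul_zero, smul_zero]
    rw [List.ofFn_succ_last]
    exact muHat_mem_right hm _ _

theorem mu_zero (w : Fin m → ℕ) (a : Fin 0 → Alg m) : mu m w 0 a = muPaths w [] := by
  rw [mu_eq_multiExt]
  rfl

theorem mu_zero_smul (hm : 3 ≤ m) (w : Fin m → ℕ) (a : Fin 0 → Alg m) (c : Idem m) :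
    c • mu m w 0 a = MulOpposite.op c • mu m w 0 a := by
  rw [mu_zero]
  refine Finsupp.ext fun r => ?_
  change c r.start • muPaths w [] r = c r.finish • muPaths w [] r
  by_cases h : r.start = r.finish
  · rw [h]
  · rw [muPaths_apply_eq_zero hm w (P := fun r => r.start = r.finish) (muHat_nil_mem hm) h,
      smul_zero, smul_zero]

theorem mu_zero_zero (a : Fin 0 → Alg m) : mu m 0 0 a = 0 := by
  rw [mu_zero]
  refine Finset.sum_eq_zero fun i _ => if_neg fun h => ?_
  simpa using congrFun h i

/-! ### The unit -/

theorem unit_apply_eq_zero {p : Path m} (h : p.letters ≠ []) : unit m p = 0 := by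
  rw [unit, Finsupp.finsetSum_apply]
  refine Finset.sum_eq_zero fun k _ => Finsupp.single_eq_of_ne ?_
  rintro rfl
  exact h rfl

theorem mu_vanish (w : Fin m → ℕ) (n : ℕ) (a : Fin n → Alg m) (h : (n, w) ≠ (2, 0))
    (ha : ∃ i, a i = unit m) : mu m w n a = 0 := by
  obtain ⟨i, hi⟩ := ha
  refine Finset.sum_eq_zero fun ps _ => ?_
  by_cases hp : (ps i).letters = []
  · have h1 : muGraph w (List.ofFn ps) = 0 := if_pos ⟨ps i, List.mem_ofFn.2 ⟨i, rfl⟩, hp⟩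
    have h2 : muPaths w (List.ofFn ps) = 0 := by
      rcases hl : List.ofFn ps with _ | ⟨p, _ | ⟨q, _ | ⟨r, l⟩⟩⟩
      · have := congrArg List.length hl
        rw [List.length_ofFn] at this
        exact absurd i.2 (by simp [this])
      · rw [hl] at h1
        exact h1
      · have := congrArg List.length hl
        rw [List.length_ofFn] at this
        rw [hl] at h1
        have hw : w ≠ 0 := fun hw => h (Prod.ext this hw)
        exact (if_neg hw).trans h1
      · rw [hl] at h1
        exact h1
    rw [h2, smul_zero]
  · rw [Finset.prod_eq_zero (Finset.mem_univ i) (by rw [hi, unit_apply_eq_zero hp]), zero_smul]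

theorem mu_two (a b : Alg m) : mu m 0 2 ![a, b] =
    a.sum fun p x => x • b.sum fun q y => y • mulPath p q := by
  rw [mu_eq_multiExt]
  refine Finsupp.sum_congr fun p _ => congrArg _ (Finsupp.sum_congr fun q _ => congrArg _ ?_)
  exact if_pos rfl

theorem sum_unit {N : Type*} [AddCommMonoid N] [Module ℤ[X] N] (f : Path m → N) :
    ((unit m).sum fun p c => c • f p) = ∑ k : Node m, f (Path.const k) := by
  change Finsupp.linearCombination ℤ[X] f (unit m) = _
  rw [unit, map_sum]
  refine Finset.sum_congr rfl fun k _ => ?_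
  rw [idem, Finsupp.linearCombination_single, one_smul]

theorem mu_unit_right (a : Alg m) : mu m 0 2 ![a, unit m] = a := by
  rw [mu_two]
  refine Eq.trans (Finsupp.sum_congr fun p _ => ?_) a.sum_single
  rw [sum_unit]
  simp only [mulPath_const_right, Finset.sum_ite_eq, Finset.mem_univ, if_true]
  rw [Finsupp.smul_single_one]

theorem mu_unit_left (a : Alg m) : mu m 0 2 ![unit m, a] = a := by
  rw [mu_two, sum_unit]
  refine Eq.trans Finset.sum_comm (Eq.trans (Finset.sum_congr rfl fun p _ => ?_) a.sum_single)
  simp only [mulPath_const_left, smul_ite, smul_zero, Finset.sum_ite_eq', Finset.mem_univ, if_true]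
  rw [Finsupp.smul_single_one]

/-! ### The grading -/

/-- A polynomial in `t` is homogeneous of degree `g`, where `t` has degree `2m - 4`. -/
def IsHomog (m : ℕ) (g : ℤ) (f : ℤ[X]) : Prop := ∀ j, f.coeff j ≠ 0 → (2 * (m : ℤ) - 4) * j = g

theorem IsHomog.mul {g g' : ℤ} {f f' : ℤ[X]} (h : IsHomog m g f) (h' : IsHomog m g' f') :
    IsHomog m (g + g') (f * f') := by
  intro j hj
  rw [Polynomial.coeff_mul] at hj
  obtain ⟨x, hx, h0⟩ := Finset.exists_ne_zero_of_sum_ne_zero hj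
  rw [Finset.HasAntidiagonal.mem_antidiagonal] at hx
  rw [← hx, ← h _ (left_ne_zero_of_mul h0), ← h' _ (right_ne_zero_of_mul h0)]
  push_cast
  ring

theorem isHomog_one : IsHomog m 0 1 := by
  intro j hj
  rw [Polynomial.coeff_one] at hj
  have : j = 0 := by by_contra h; simp [h] at hj
  rw [this, Nat.cast_zero, mul_zero]

theorem IsHomog.prod {ι : Type*} {s : Finset ι} {g : ι → ℤ} {f : ι → ℤ[X]}
    (h : ∀ i ∈ s, IsHomog m (g i) (f i)) : IsHomog m (∑ i ∈ s, g i) (∏ i ∈ s, f i) := by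
  classical
  induction s using Finset.induction_on with
  | empty => exact isHomog_one
  | insert i s hi ih =>
    rw [Finset.sum_insert hi, Finset.prod_insert hi]
    exact (h i (Finset.mem_insert_self i s)).mul (ih fun j hj => h j (Finset.mem_insert_of_mem hj))

theorem smul_mem_grading {g g' : ℤ} {f : ℤ[X]} {a : Alg m} (hf : IsHomog m g f)
    (ha : a ∈ grading m g') : f • a ∈ grading m (g + g') :=
  fun p => hf.mul (ha p)

theorem single_mem_grading (p : Path m) : Finsupp.single p 1 ∈ grading m 0 := by
  classical
  intro q
  rw [Finsupp.single_apply]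
  split_ifs
  · exact isHomog_one
  · intro j hj
    exact absurd (Polynomial.coeff_zero j) hj

theorem ofWord_mem_grading (w : List (Letter m)) : ofWord w ∈ grading m 0 := by
  rcases w with _ | ⟨a, w⟩
  · exact zero_mem _
  · rw [ofWord]
    split_ifs
    · exact single_mem_grading _
    · exact zero_mem _

theorem mulPath_mem_grading (p q : Path m) : mulPath p q ∈ grading m 0 := by
  rw [mulPath]
  split_ifs
  · exact single_mem_grading _
  · exact single_mem_grading _
  · exact ofWord_mem_grading _
  · exact zero_mem _

theorem U_mem_grading (i : ℕ) : U m i ∈ grading m 0 := by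
  unfold U
  split_ifs
  · exact ofWord_mem_grading _
  · exact ofWord_mem_grading _
  · exact add_mem (ofWord_mem_grading _) (ofWord_mem_grading _)
  · exact zero_mem _
  · exact zero_mem _

theorem mul_mem_grading {g g' : ℤ} {a b : Alg m} (ha : a ∈ grading m g) (hb : b ∈ grading m g') :
    mul a b ∈ grading m (g + g') := by
  refine sum_mem fun p _ => sum_mem fun q _ => ?_
  rw [← add_zero (g + g')]
  exact smul_mem_grading (IsHomog.mul (ha p) (hb q)) (mulPath_mem_grading p q)

theorem centered_mem_grading (hm : 3 ≤ m) (w : Fin m → ℕ) (a : List (List (Letter m))) :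
    centered w a ∈ grading m (a.length - 2 + 2 * ∑ i, (w i : ℤ)) := by
  rw [centered_eq hm, ← add_zero (_ + _)]
  refine smul_mem_grading (fun j hj => ?_) ?_
  · have h := congrArg (Nat.cast : ℕ → ℤ) (coeff_coeffAt_graphSum hm w a j hj).2
    rw [Nat.cast_add, Nat.cast_mul, Nat.cast_sub (by omega)] at h
    push_cast at h
    linarith
  · rcases a with _ | ⟨_ | ⟨c, b⟩, s⟩
    · exact zero_mem _
    · exact zero_mem _
    · exact single_mem_grading _

theorem muGraph_mem_grading (hm : 3 ≤ m) (w : Fin m → ℕ) {l : List (Path m)} (hl : l ≠ []) :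
    muGraph w l ∈ grading m (l.length - 2 + 2 * ∑ i, (w i : ℤ)) := by
  rw [muGraph]
  split_ifs
  · exact zero_mem _
  have hl' : l.length - 1 + 1 = l.length := Nat.sub_add_cancel (List.length_pos_of_ne_nil hl)
  refine add_mem (add_mem ?_ (sum_mem fun j _ => ?_)) (sum_mem fun j _ => ?_)
  · simpa using centered_mem_grading hm w (l.map Path.letters)
  · rw [← zero_add (_ + _)]
    refine mul_mem_grading (ofWord_mem_grading _) ?_
    convert centered_mem_grading hm w _ using 4
    simp [hl']
  · rw [← add_zero (_ + _)]
    refine mul_mem_grading ?_ (ofWord_mem_grading _)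
    convert centered_mem_grading hm w _ using 4
    simp [hl']

theorem muPaths_mem_grading (hm : 3 ≤ m) (w : Fin m → ℕ) (l : List (Path m)) :
    muPaths w l ∈ grading m (l.length - 2 + 2 * ∑ i, (w i : ℤ)) := by
  rcases l with _ | ⟨p, _ | ⟨q, _ | ⟨r, l⟩⟩⟩
  · refine sum_mem fun i _ => ?_
    split_ifs with h
    · rw [h]
      convert U_mem_grading (m := m) (i.1 + 1)
      simp [Pi.single_apply, apply_ite]
    · exact zero_mem _
  · exact muGraph_mem_grading hm w (by simp)
  · rw [muPaths]
    split_ifs with h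
    · rw [h]
      convert mulPath_mem_grading p q
      simp
    · exact muGraph_mem_grading hm w (by simp)
  · exact muGraph_mem_grading hm w (by simp)

theorem mu_mem_grading (hm : 3 ≤ m) (w : Fin m → ℕ) (n : ℕ) (a : Fin n → Alg m) (g : Fin n → ℤ)
    (h : ∀ i, a i ∈ grading m (g i)) :
    mu m w n a ∈ grading m ((∑ i, g i) + n - 2 + 2 * ∑ i, (w i : ℤ)) := by
  refine sum_mem fun ps _ => ?_
  have h1 := smul_mem_grading (IsHomog.prod (s := Finset.univ) fun i _ => h i (ps i))
    (muPaths_mem_grading hm w (List.ofFn ps))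
  rw [List.length_ofFn] at h1
  rwa [add_sub_assoc, add_assoc]

theorem left_smul_mem_grading (c : Idem m) {g : ℤ} {a : Alg m} (ha : a ∈ grading m g) :
    c • a ∈ grading m g := fun p j hj => ha p j fun h0 => hj (by
  change (c p.start • a p).coeff j = 0
  rw [Polynomial.coeff_smul, h0, smul_zero])

theorem right_smul_mem_grading (c : Idem m) {g : ℤ} {a : Alg m} (ha : a ∈ grading m g) :
    MulOpposite.op c • a ∈ grading m g := fun p j hj => ha p j fun h0 => hj (by
  change (c p.finish • a p).coeff j = 0
  rw [Polynomial.coeff_smul, h0, smul_zero])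

/-- The coefficient of `t^j` of a sum of homogeneous elements comes from the part whose degree is
that of `t^j`. -/
theorem coeff_coeAddMonoidHom (x : DirectSum ℤ fun g => grading m g) (p : Path m) (j : ℕ) :
    (DirectSum.coeAddMonoidHom (grading m) x p).coeff j =
      ((x ((2 * (m : ℤ) - 4) * j)).1 p).coeff j := by
  induction x using DirectSum.induction_on with
  | zero => simp
  | add x y hx hy =>
    rw [map_add, Finsupp.add_apply, Polynomial.coeff_add, hx, hy, DirectSum.add_apply]
    rfl
  | of g a =>
    rw [DirectSum.coeAddMonoidHom_of]
    rcases eq_or_ne ((2 * (m : ℤ) - 4) * j) g with rfl | h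
    · rw [DirectSum.of_eq_same]
    · rw [DirectSum.of_eq_of_ne _ _ _ h]
      by_contra h0
      exact h (a.2 p j h0)

theorem isInternal_grading : DirectSum.IsInternal (grading m) := by
  constructor
  · intro x y h
    refine DFinsupp.ext fun g => Subtype.ext (Finsupp.ext fun p => Polynomial.ext fun j => ?_)
    by_cases hg : (2 * (m : ℤ) - 4) * j = g
    · subst hg
      rw [← coeff_coeAddMonoidHom, h, coeff_coeAddMonoidHom]
    · rw [not_imp_comm.1 ((x g).2 p j) hg, not_imp_comm.1 ((y g).2 p j) hg]
  · intro a
    change a ∈ AddMonoidHom.mrange (DirectSum.coeAddMonoidHom (grading m))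
    induction a using Finsupp.induction_linear with
    | zero => exact zero_mem _
    | add a b ha hb => exact add_mem ha hb
    | single p f =>
      induction f using Polynomial.induction_on' with
      | add f g hf hg =>
        rw [Finsupp.single_add]
        exact add_mem hf hg
      | monomial j c =>
        classical
        refine ⟨DirectSum.of (fun g => grading m g) ((2 * (m : ℤ) - 4) * j)
          ⟨Finsupp.single p (Polynomial.monomial j c), fun q k hk => ?_⟩,
          DirectSum.coeAddMonoidHom_of _ _ _⟩
        rw [Finsupp.single_apply] at hk
        split_ifs at hk
        · rw [Polynomial.coeff_monomial] at hk
          rw [(ite_ne_right_iff.1 hk).1]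
        · exact absurd (Polynomial.coeff_zero k) hk

end Bordered

theorem mainTheorem2 (m : ℕ) (hm : 3 ≤ m) :
    WeightedAInfty.IsWeightedAInfty ℤ[X] (Bordered.Idem m) (Bordered.grading m) (Bordered.mu m) ∧
      WeightedAInfty.IsStrictUnit (Bordered.mu m) (Bordered.unit m) := by
  refine ⟨?_, Bordered.mu_unit_right, Bordered.mu_unit_left, Bordered.mu_vanish⟩
  exact
    { isInternal := Bordered.isInternal_grading
      left_smul_mem := fun c _ _ ha => Bordered.left_smul_mem_grading c ha
      right_smul_mem := fun c _ _ ha => Bordered.right_smul_mem_grading c ha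
      map_update_add := Bordered.mu_update_add
      map_update_smul := Bordered.mu_update_smul
      balanced := Bordered.mu_balanced hm
      map_left_smul := Bordered.mu_left_smul hm
      map_right_smul := Bordered.mu_right_smul hm
      smul_zero_ary := Bordered.mu_zero_smul hm
      degree := Bordered.mu_mem_grading hm
      zero_weight_zero_ary := Bordered.mu_zero_zero
      relation := Bordered.mu_relation hm }
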